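/- Let $k$ be a field and $A$ a Hopf algebra over $k$ with counit $\varepsilon$, antipode $S$, and $\mathrm{ad}_L(a)=a^{(-1)}\otimes a^{(0)}=a_{(1)}S(a_{(3)})\otimes a_{(2)}$. A co-quasitriangular structure is a bilinear form $\mathbf r$ on $A$ with $\mathbf r(ab,c)=\mathbf r(a,c_{(1)})\mathbf r(b,c_{(2)})$, $\mathbf r(a,bc)=\mathbf r(a_{(1)},c)\mathbf r(a_{(2)},b)$, $\mathbf r(1,a)=\mathbf r(a,1)=\varepsilon(a)$ and $b_{(1)}a_{(1)}\mathbf r(a_{(2)},b_{(2)})=\mathbf r(a_{(1)},b_{(1)})a_{(2)}b_{(2)}$. Let $\mathbf r,\mathbf s$ be two such structures, $\mathbf q(a,b)=\mathbf s(b_{(1)},a_{(1)})\,\mathbf r(a_{(2)},b_{(2)})$ (that is, $\mathbf q=\mathbf s_{21}*\mathbf r$), and $\mathbf q_1(a)=\mathbf q(a,-)$, $\mathbf q_2(a)=\mathbf q(-,a)$. Let $A^\circ\subset A^*$ be the Hopf dual, with unit $1_{A^\circ}=\varepsilon$. For $X,Y\in A^*$ put $[X,Y](a)=X(a_{(1)}S(a_{(3)}))\,Y(a_{(2)})$;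 for $X\in A^\circ$ this is $[X,Y]=X_{(1)}YS(X_{(2)})$. A bicovariant first order differential calculus (FODC) $(\Gamma,d)$ over $A$ is a Hopf bimodule $\Gamma$ with a bicomodule derivation $d:A\to\Gamma$ such that $a\otimes b\mapsto a\,db$ is surjective onto $\Gamma$. Its left ideal is $\mathcal I_\Gamma=\ker\omega_R\cap\ker\varepsilon$, where $\omega_R(a)=d(a_{(1)})S(a_{(2)})$. Its extended tangent space is $\tilde{\mathfrak g}_\Gamma=\{X\in A^*: X(\mathcal I_\Gamma)=0\}$, and its tangent space is $\mathfrak g_\Gamma=\{x\in\tilde{\mathfrak g}_\Gamma: x(1)=0\}$. It is inner if there is $\theta\in\Gamma$ with $da=a\theta-\theta a$ for all $a$. A subspace $T\subset A^*$ for which the following maps exist is given the right coaction of $A$ dual to $\mathrm{ad}_L$, $\langle X^{(0)},a\rangle X^{(1)}=X(a^{(0)})\,a^{(-1)}$; the coproduct dual to the product $a\cdot b=a_{(1)}b^{(0)}\,\mathbf r(b^{(-1)},S(a_{(2)}))$ on $A$; the counit $X\mapsto X(1)$; and the bracket $[\,,]$. "Braided" refers to the category $\mathcal M^A$ of right $A$-comodules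 with the braiding $\Psi(v\otimes w)=\mathbf r(v^{(1)},w^{(1)})\,w^{(0)}\otimes v^{(0)}$. A braided Lie algebra is a coalgebra $L$ in $\mathcal M^A$ whose bracket is a morphism of coalgebras $L\underline\otimes L\to L$ in $\mathcal M^A$ and satisfies the braided Jacobi identity $[\,,[\,,]]=[[\,,],[\,,]](\mathrm{id}\otimes\Psi\otimes\mathrm{id})(\Delta\otimes\mathrm{id}\otimes\mathrm{id})$ and $\Psi\Upsilon=(\mathrm{id}\otimes[\,,])(\Delta\otimes\mathrm{id})$, where $\Upsilon=([\,,]\otimes\mathrm{id})(\mathrm{id}\otimes\Psi)(\Delta\otimes\mathrm{id})$. Its enveloping algebra is the quadratic algebra $B(L)=T(L)/\langle\mathrm{im}(\mathrm{id}-\Upsilon)\rangle$, whose coaction, coproduct and counit extend those of $L$. For $T$ as above with $1_{A^\circ}\in T$ and $\mathfrak g=\{x\in T:x(1)=0\}$, set $U(\mathfrak g)=T(\mathfrak g)/\langle\mathrm{im}(\mathrm{id}-\sigma-[\,,])\rangle$, where $\sigma(x\otimes y)=[x_{(1)},y]\otimes x_{(2)}-[x,y]\otimes1_{A^\circ}$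 ($x_{(1)}\otimes x_{(2)}$ is the coproduct of $A^\circ$ here), with $\Delta(x)=x\otimes1+1\otimes x+\delta(x)$ and $\varepsilon(x)=0$ for $x\in\mathfrak g$; here $x\otimes1_{A^\circ}+1_{A^\circ}\otimes x+\delta(x)$ is the coproduct of $x$ in $T$. (i) Let $C_1$ be a subcoalgebra of $A$ containing $1_A$. Then $\mathbf q_1(C_1)$ is a subspace of $A^\circ$ that contains $1_{A^\circ}$, is a left coideal, and is stable under the left adjoint action of $A^\circ$. There is a bicovariant FODC $\Gamma$ over $A$ with left ideal $$\mathcal I(C_1,\mathbf q)=\{a\in A:\ \mathbf q(c,a)=0\text{ for all }c\in C_1\}\supset\ker\mathbf q_2 ,$$ that is, $\mathcal I_\Gamma$ is the annihilator of $\mathbf q_1(C_1)$ in $A$. One has $\mathbf q_1(C_1)\subset\tilde{\mathfrak g}_\Gamma$, with equality if $\mathbf q_1(C_1)$ is finite-dimensional. (ii) Let $(\Gamma,d)$ be a bicovariant FODC over $A$. If $\mathbf q_1$ is injective, then $C_1=\{a\in A:\mathbf q(a,\mathcal I_\Gamma)=0\}$ is a subcoalgebra of $A$ containing $1_A$. If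 moreover $\tilde{\mathfrak g}_\Gamma\subset\mathrm{im}\,\mathbf q_1$, then $\tilde{\mathfrak g}_\Gamma=\mathbf q_1(C_1)$. (iii) Let $C_1=k1_A\oplus C$ for a subcoalgebra $C$ of $A$, and assume that $\mathbf q_1$ is injective on $C_1$. Put $\mathcal L=\mathbf q_1(C)$, $\tilde{\mathfrak g}=\mathbf q_1(C_1)$ and $\mathfrak g=\{x\in\tilde{\mathfrak g}:x(1)=0\}$. Then $\tilde{\mathfrak g}=k1_{A^\circ}\oplus\mathcal L$ and $\mathfrak g=\{x-x(1)1_{A^\circ}:x\in\mathcal L\}$. With the structures above, $\tilde{\mathfrak g}$ is a braided Lie algebra in $\mathcal M^A$ with braided Lie subalgebra $\mathcal L$; $U(\mathfrak g)$ and $B(\mathcal L)$ are bialgebras in $\mathcal M^A$; and there is an isomorphism of bialgebras in $\mathcal M^A$, $U(\mathfrak g)\simeq B(\mathcal L)$, which sends $X-X(1)1_{A^\circ}\in\mathfrak g$ to $X-X(1)1$ for $X\in\mathcal L$ (so that $U(\mathfrak g)$ is quadratic). If $C$ is finite-dimensional, then every bicovariant FODC $\Gamma$ over $A$ with left ideal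 $\mathcal I(C_1,\mathbf q)$ has $\tilde{\mathfrak g}_\Gamma=\tilde{\mathfrak g}$ and $\mathfrak g_\Gamma=\mathfrak g$, and is inner. -/

import Mathlib

open scoped TensorProduct

universe u v w

noncomputable section

namespace QLie

/-! ### Hopf algebra preliminaries -/

section Hopf

variable {k : Type u} {A : Type v} [Field k] [Ring A] [HopfAlgebra k A]

/-- The left adjoint coaction `a ↦ a₍₁₎ S(a₍₃₎) ⊗ a₍₂₎`. -/
def adL (k : Type u) (A : Type v) [Field k] [Ring A] [HopfAlgebra k A] :
    A →ₗ[k] A ⊗[k] A :=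
  (LinearMap.mul' k A ∘ₗ (HopfAlgebra.antipode k (A := A)).lTensor A).rTensor A ∘ₗ
    (TensorProduct.assoc k A A A).symm.toLinearMap ∘ₗ
    (TensorProduct.comm k A A).toLinearMap.lTensor A ∘ₗ
    (Coalgebra.comul (R := k) (A := A)).lTensor A ∘ₗ Coalgebra.comul

/-- The convolution product of linear maps from a coalgebra to an algebra. -/
def conv {C : Type*} {R : Type*} [AddCommGroup C] [Module k C] [Coalgebra k C]
    [Ring R] [Algebra k R] (f g : C →ₗ[k] R) : C →ₗ[k] R :=
  LinearMap.mul' k R ∘ₗ TensorProduct.map f g ∘ₗ Coalgebra.comul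

/-- A bilinear form on `A`, as a linear map on `A ⊗ A`, with values in `k ⊆ A`. -/
def formInA (r : A →ₗ[k] A →ₗ[k] k) : A ⊗[k] A →ₗ[k] A :=
  Algebra.linearMap k A ∘ₗ TensorProduct.lift r

/-- Co-quasitriangular structures on the Hopf algebra `A`, in the form: `r ↦ r₁ = r(a, -)` is a
unital algebra map to `A*`, `r₂ = r(-, a)` is a unital anti-algebra map, and
`m^op * r = r * m`. (Then `r` is convolution invertible with inverse `r(S a, b)`.) -/
structure IsCoquasitriangular (r : A →ₗ[k] A →ₗ[k] k) : Prop where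
  /-- `b₍₁₎ a₍₁₎ r(a₍₂₎, b₍₂₎) = r(a₍₁₎, b₍₁₎) a₍₂₎ b₍₂₎`. -/
  quasi_comm :
    conv (LinearMap.mul' k A ∘ₗ (TensorProduct.comm k A A).toLinearMap) (formInA r) =
      conv (formInA r) (LinearMap.mul' k A)
  /-- `r(ab, c) = r(a, c₍₁₎) r(b, c₍₂₎)`. -/
  mul_left : ∀ a b c : A,
    r (a * b) c = LinearMap.mul' k k (TensorProduct.map (r a) (r b) (Coalgebra.comul (R := k) c))
  /-- `r(a, bc) = r(a₍₁₎, c) r(a₍₂₎, b)`. -/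
  mul_right : ∀ a b c : A,
    r a (b * c) =
      LinearMap.mul' k k (TensorProduct.map (r.flip c) (r.flip b) (Coalgebra.comul (R := k) a))
  one_left : ∀ a : A, r 1 a = Coalgebra.counit (R := k) a
  one_right : ∀ a : A, r a 1 = Coalgebra.counit (R := k) a

/-- The form `q = s₂₁ * r`, that is `q(a, b) = s(b₍₁₎, a₍₁₎) r(a₍₂₎, b₍₂₎)`. As a linear map
`A → A*` it is `q₁`, and its flip is `q₂`. -/
def quantumKilling (r s : A →ₗ[k] A →ₗ[k] k) : A →ₗ[k] Module.Dual k A :=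
  TensorProduct.curry (conv (TensorProduct.lift s.flip) (TensorProduct.lift r))

/-- `C` is a subcoalgebra: `Δ(C) ⊆ C ⊗ C`. -/
def IsSubcoalgebra (C : Submodule k A) : Prop :=
  ∀ c ∈ C, Coalgebra.comul (R := k) c ∈
    LinearMap.range (TensorProduct.map C.subtype C.subtype)

/-- The action `a ▹ b = r(b⁽⁻¹⁾, a) b⁽⁰⁾` where `b⁽⁻¹⁾ ⊗ b⁽⁰⁾ = ad_L(b)`. -/
def adAct (r : A →ₗ[k] A →ₗ[k] k) (a : A) : A →ₗ[k] A :=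
  (TensorProduct.lid k A).toLinearMap ∘ₗ (r.flip a).rTensor A ∘ₗ adL k A

/-- The covariantised (transmuted) product `a ⬝ b = a₍₁₎ (S(a₍₂₎) ▹ b)` on `A`. -/
def covMul (r : A →ₗ[k] A →ₗ[k] k) (a b : A) : A :=
  TensorProduct.lift
    (LinearMap.mk₂ k (fun a₁ a₂ : A => a₁ * adAct r (HopfAlgebra.antipode k a₂) b)
      (fun _ _ _ => add_mul _ _ _) (fun _ _ _ => smul_mul_assoc _ _ _)
      (fun _ _ _ => by
        simp [adAct, LinearMap.rTensor_add, mul_add])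
      (fun _ _ _ => by
        simp [adAct, LinearMap.rTensor_smul]))
    (Coalgebra.comul (R := k) a)

/-- The pairing of `T ⊗ T'` (`T, T'` subspaces of `A*`) with `A ⊗ A`:
`⟨a ⊗ b, x ⊗ y⟩ = x(a) y(b)`. -/
def pairing (T T' : Submodule k (Module.Dual k A)) :
    T ⊗[k] T' →ₗ[k] Module.Dual k (A ⊗[k] A) :=
  TensorProduct.dualDistrib k A A ∘ₗ TensorProduct.map T.subtype T'.subtype

/-- The Hopf dual `A°`: the functionals `f` for which `a ⊗ b ↦ f(ab)` lies in `A* ⊗ A*`. -/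
def hopfDual (k : Type u) (A : Type v) [Field k] [Ring A] [HopfAlgebra k A] :
    Submodule k (Module.Dual k A) :=
  (LinearMap.range (TensorProduct.dualDistrib k A A)).comap (LinearMap.mul' k A).dualMap

/-- The unit `1_{A°}`, which is the counit of `A`. -/
def dualOne (k : Type u) (A : Type v) [Field k] [Ring A] [HopfAlgebra k A] : Module.Dual k A :=
  Coalgebra.counit

/-- The bracket `[X, Y] = X₍₁₎ Y S(X₍₂₎)`, evaluated as
`⟨a, [X, Y]⟩ = X(a₍₁₎ S(a₍₃₎)) Y(a₍₂₎)`, which makes sense for all `X, Y` in `A*`. -/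
def adBracket (X Y : Module.Dual k A) : Module.Dual k A :=
  TensorProduct.dualDistrib k A A (X ⊗ₜ[k] Y) ∘ₗ adL k A

/-- The three properties of an extended tangent space (besides the link with a calculus): a
subspace of `A°` that contains `1`, is a left coideal (`Δ(T) ⊆ A° ⊗ T`), and is stable under the
left adjoint action (`[A°, T] ⊆ T`). -/
structure IsTangentSubspace (T : Submodule k (Module.Dual k A)) : Prop where
  le_hopfDual : T ≤ hopfDual k A
  one_mem : dualOne k A ∈ T
  comul_mem : ∀ X ∈ T, X ∘ₗ LinearMap.mul' k A ∈ LinearMap.range (pairing (hopfDual k A) T)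
  ad_mem : ∀ h ∈ hopfDual k A, ∀ X ∈ T, adBracket h X ∈ T

/-- The part of a subspace `T` of `A*` that vanishes at `1`. -/
def augPart (T : Submodule k (Module.Dual k A)) : Submodule k (Module.Dual k A) :=
  T ⊓ LinearMap.ker (Module.Dual.eval k A 1)

/-- The subspace `{a | q(c, a) = 0 for all c ∈ C₁}` of `A`. -/
def killingIdeal (q : A →ₗ[k] Module.Dual k A) (C₁ : Submodule k A) : Submodule k A :=
  (C₁.map q).dualCoannihilator

/-- The subspace `{a | q(a, I) = 0}` of `A`. -/
def killingPerp (q : A →ₗ[k] Module.Dual k A) (I : Submodule k A) : Submodule k A :=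
  I.dualAnnihilator.comap q

end Hopf

/-! ### Bicovariant first order differential calculi -/

/-- A Hopf bimodule over `A`: a bimodule and bicomodule, both coactions being compatible with
both actions. -/
structure HopfBimodule (k : Type u) (A : Type v) [Field k] [Ring A] [HopfAlgebra k A]
    (Γ : Type w) [AddCommGroup Γ] [Module k Γ] where
  lmul : A ⊗[k] Γ →ₗ[k] Γ
  rmul : Γ ⊗[k] A →ₗ[k] Γ
  one_lmul : ∀ η, lmul (1 ⊗ₜ η) = η
  mul_lmul : ∀ a b η, lmul ((a * b) ⊗ₜ η) = lmul (a ⊗ₜ lmul (b ⊗ₜ η))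
  rmul_one : ∀ η, rmul (η ⊗ₜ 1) = η
  rmul_mul : ∀ η a b, rmul (η ⊗ₜ (a * b)) = rmul (rmul (η ⊗ₜ a) ⊗ₜ b)
  lmul_rmul : ∀ a η b, rmul (lmul (a ⊗ₜ η) ⊗ₜ b) = lmul (a ⊗ₜ rmul (η ⊗ₜ b))
  coactL : Γ →ₗ[k] A ⊗[k] Γ
  coactR : Γ →ₗ[k] Γ ⊗[k] A
  coactL_coassoc : (TensorProduct.assoc k A A Γ).toLinearMap ∘ₗ
    (Coalgebra.comul (R := k) (A := A)).rTensor Γ ∘ₗ coactL = coactL.lTensor A ∘ₗ coactL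
  coactL_counit : (TensorProduct.lid k Γ).toLinearMap ∘ₗ
    (Coalgebra.counit (R := k) (A := A)).rTensor Γ ∘ₗ coactL = LinearMap.id
  coactR_coassoc : (TensorProduct.assoc k Γ A A).toLinearMap ∘ₗ coactR.rTensor A ∘ₗ coactR =
    (Coalgebra.comul (R := k) (A := A)).lTensor Γ ∘ₗ coactR
  coactR_counit : (TensorProduct.rid k Γ).toLinearMap ∘ₗ
    (Coalgebra.counit (R := k) (A := A)).lTensor Γ ∘ₗ coactR = LinearMap.id
  coact_comm : (TensorProduct.assoc k A Γ A).toLinearMap ∘ₗ coactL.rTensor A ∘ₗ coactR =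
    coactR.lTensor A ∘ₗ coactL
  coactL_lmul : coactL ∘ₗ lmul = TensorProduct.map (LinearMap.mul' k A) lmul ∘ₗ
    (TensorProduct.tensorTensorTensorComm k A A A Γ).toLinearMap ∘ₗ
    TensorProduct.map Coalgebra.comul coactL
  coactL_rmul : coactL ∘ₗ rmul = TensorProduct.map (LinearMap.mul' k A) rmul ∘ₗ
    (TensorProduct.tensorTensorTensorComm k A Γ A A).toLinearMap ∘ₗ
    TensorProduct.map coactL Coalgebra.comul
  coactR_lmul : coactR ∘ₗ lmul = TensorProduct.map lmul (LinearMap.mul' k A) ∘ₗ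
    (TensorProduct.tensorTensorTensorComm k A A Γ A).toLinearMap ∘ₗ
    TensorProduct.map Coalgebra.comul coactR
  coactR_rmul : coactR ∘ₗ rmul = TensorProduct.map rmul (LinearMap.mul' k A) ∘ₗ
    (TensorProduct.tensorTensorTensorComm k Γ A A A).toLinearMap ∘ₗ
    TensorProduct.map coactR Coalgebra.comul

/-- A bicovariant first order differential calculus `(Γ, d)` over the Hopf algebra `A`. -/
structure BicovariantFODC (k : Type u) (A : Type v) [Field k] [Ring A] [HopfAlgebra k A] where
  carrier : Type w
  [addCommGroup : AddCommGroup carrier]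
  [module : Module k carrier]
  hopf : HopfBimodule k A carrier
  d : A →ₗ[k] carrier
  leibniz : ∀ a b, d (a * b) = hopf.rmul (d a ⊗ₜ b) + hopf.lmul (a ⊗ₜ d b)
  coactL_d : hopf.coactL ∘ₗ d = d.lTensor A ∘ₗ Coalgebra.comul
  coactR_d : hopf.coactR ∘ₗ d = d.rTensor A ∘ₗ Coalgebra.comul
  /-- `a ⊗ b ↦ a d(b)` is surjective. -/
  surj : Function.Surjective (hopf.lmul ∘ₗ d.lTensor A)

attribute [instance] BicovariantFODC.addCommGroup BicovariantFODC.module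

namespace BicovariantFODC

variable {k : Type u} {A : Type v} [Field k] [Ring A] [HopfAlgebra k A]
  (Γ : BicovariantFODC.{u, v, w} k A)

/-- The right-handed Maurer-Cartan map `ω_R(a) = d(a₍₁₎) S(a₍₂₎)`. -/
def omegaR : A →ₗ[k] Γ.carrier :=
  Γ.hopf.rmul ∘ₗ TensorProduct.map Γ.d (HopfAlgebra.antipode k) ∘ₗ Coalgebra.comul

/-- The left ideal `I_Γ = ker ω_R ∩ ker ε` associated to the calculus. -/
def ideal : Submodule k A :=
  LinearMap.ker Γ.omegaR ⊓ LinearMap.ker (Coalgebra.counit (R := k) (A := A))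

/-- The extended tangent space `{X ∈ A* | X(I_Γ) = 0}`. -/
def extTangent : Submodule k (Module.Dual k A) := Γ.ideal.dualAnnihilator

/-- The tangent space `{x ∈ A* | x(I_Γ) = 0, x(1) = 0}`. -/
def tangent : Submodule k (Module.Dual k A) := augPart Γ.extTangent

/-- The calculus is inner: `d a = a θ - θ a` for some `θ`. -/
def IsInner : Prop :=
  ∃ θ : Γ.carrier, ∀ a, Γ.d a = Γ.hopf.lmul (a ⊗ₜ θ) - Γ.hopf.rmul (θ ⊗ₜ a)

end BicovariantFODC

/-! ### Right comodules over a co-quasitriangular Hopf algebra -/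

section Braided

variable (k : Type u) (A : Type v) [Field k] [Ring A] [HopfAlgebra k A]

/-- Right `A`-comodules. -/
structure RightComodule (V : Type*) [AddCommMonoid V] [Module k V] where
  coact : V →ₗ[k] V ⊗[k] A
  coact_coassoc : (TensorProduct.assoc k V A A).toLinearMap ∘ₗ coact.rTensor A ∘ₗ coact =
    (Coalgebra.comul (R := k) (A := A)).lTensor V ∘ₗ coact
  coact_counit : (TensorProduct.rid k V).toLinearMap ∘ₗ
    (Coalgebra.counit (R := k) (A := A)).lTensor V ∘ₗ coact = LinearMap.id

variable {k A}
variable {V W V' W' : Type*} [AddCommMonoid V] [Module k V] [AddCommMonoid W] [Module k W]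
  [AddCommMonoid V'] [Module k V'] [AddCommMonoid W'] [Module k W']

/-- The coaction `v ⊗ w ↦ v⁽⁰⁾ ⊗ w⁽⁰⁾ ⊗ v⁽¹⁾ w⁽¹⁾` on a tensor product. -/
def coactTensor (ρ : V →ₗ[k] V ⊗[k] A) (ρ' : W →ₗ[k] W ⊗[k] A) :
    V ⊗[k] W →ₗ[k] (V ⊗[k] W) ⊗[k] A :=
  (LinearMap.mul' k A).lTensor (V ⊗[k] W) ∘ₗ
    (TensorProduct.tensorTensorTensorComm k V A W A).toLinearMap ∘ₗ TensorProduct.map ρ ρ'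

/-- The braiding `v ⊗ w ↦ r(v⁽¹⁾, w⁽¹⁾) w⁽⁰⁾ ⊗ v⁽⁰⁾` of right comodules. -/
def braiding (r : A →ₗ[k] A →ₗ[k] k) (ρ : V →ₗ[k] V ⊗[k] A) (ρ' : W →ₗ[k] W ⊗[k] A) :
    V ⊗[k] W →ₗ[k] W ⊗[k] V :=
  (TensorProduct.rid k (W ⊗[k] V)).toLinearMap ∘ₗ
    TensorProduct.map (TensorProduct.comm k V W).toLinearMap (TensorProduct.lift r) ∘ₗ
    (TensorProduct.tensorTensorTensorComm k V A W A).toLinearMap ∘ₗ TensorProduct.map ρ ρ'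

/-- `id ⊗ Ψ ⊗ id : (V ⊗ V') ⊗ (W ⊗ W') → (V ⊗ W) ⊗ (V' ⊗ W')`. -/
def midMap (Ψ : V' ⊗[k] W →ₗ[k] W ⊗[k] V') :
    (V ⊗[k] V') ⊗[k] (W ⊗[k] W') →ₗ[k] (V ⊗[k] W) ⊗[k] (V' ⊗[k] W') :=
  (TensorProduct.assoc k V W (V' ⊗[k] W')).symm.toLinearMap ∘ₗ
    ((TensorProduct.assoc k W V' W').toLinearMap ∘ₗ Ψ.rTensor W' ∘ₗ
      (TensorProduct.assoc k V' W W').symm.toLinearMap).lTensor V ∘ₗ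
    (TensorProduct.assoc k V V' (W ⊗[k] W')).toLinearMap

variable (k A)

/-- Left braided Lie algebras in the category of right `A`-comodules with the braiding `Ψ`
given by `r`. -/
structure BraidedLieAlgebra (r : A →ₗ[k] A →ₗ[k] k) (V : Type*) [AddCommMonoid V] [Module k V]
    extends RightComodule k A V where
  comul : V →ₗ[k] V ⊗[k] V
  counit : V →ₗ[k] k
  bracket : V ⊗[k] V →ₗ[k] V
  coassoc : (TensorProduct.assoc k V V V).toLinearMap ∘ₗ comul.rTensor V ∘ₗ comul =
    comul.lTensor V ∘ₗ comul
  counit_left : (TensorProduct.lid k V).toLinearMap ∘ₗ counit.rTensor V ∘ₗ comul = LinearMap.id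
  counit_right : (TensorProduct.rid k V).toLinearMap ∘ₗ counit.lTensor V ∘ₗ comul = LinearMap.id
  comul_comodule : coactTensor coact coact ∘ₗ comul = comul.rTensor A ∘ₗ coact
  counit_comodule : (TensorProduct.lid k A).toLinearMap ∘ₗ counit.rTensor A ∘ₗ coact =
    LinearMap.toSpanSingleton k A 1 ∘ₗ counit
  bracket_comodule : coact ∘ₗ bracket = bracket.rTensor A ∘ₗ coactTensor coact coact
  /-- Braided Jacobi identity:
  `[ , [ , ]] = [[ , ], [ , ]] (id ⊗ Ψ ⊗ id) (Δ ⊗ id ⊗ id)`. -/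
  jacobi : bracket ∘ₗ bracket.lTensor V =
    bracket ∘ₗ TensorProduct.map bracket bracket ∘ₗ midMap (braiding r coact coact) ∘ₗ
      comul.rTensor (V ⊗[k] V)
  /-- Weak braided cocommutativity:
  `Ψ ([ , ] ⊗ id) (id ⊗ Ψ) (Δ ⊗ id) = (id ⊗ [ , ]) (Δ ⊗ id)`. -/
  weak_cocomm : braiding r coact coact ∘ₗ bracket.rTensor V ∘ₗ
      (TensorProduct.assoc k V V V).symm.toLinearMap ∘ₗ (braiding r coact coact).lTensor V ∘ₗ
      (TensorProduct.assoc k V V V).toLinearMap ∘ₗ comul.rTensor V =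
    bracket.lTensor V ∘ₗ (TensorProduct.assoc k V V V).toLinearMap ∘ₗ comul.rTensor V
  /-- The bracket is a morphism of coalgebras, `V ⊗ V` being the braided tensor product. -/
  comul_bracket : comul ∘ₗ bracket =
    TensorProduct.map bracket bracket ∘ₗ midMap (braiding r coact coact) ∘ₗ
      TensorProduct.map comul comul
  counit_bracket : counit ∘ₗ bracket =
    LinearMap.mul' k k ∘ₗ TensorProduct.map counit counit

/-- The structure of a bialgebra in the category of right `A`-comodules (braided by `r`) on an
algebra `B`. -/
structure BraidedBialgebra (r : A →ₗ[k] A →ₗ[k] k) (B : Type*) [Ring B] [Algebra k B]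
    extends RightComodule k A B where
  comul : B →ₗ[k] B ⊗[k] B
  counit : B →ₐ[k] k
  coact_one : coact 1 = 1 ⊗ₜ 1
  coact_mul : ∀ x y, coact (x * y) = coact x * coact y
  coassoc : (TensorProduct.assoc k B B B).toLinearMap ∘ₗ comul.rTensor B ∘ₗ comul =
    comul.lTensor B ∘ₗ comul
  counit_left : (TensorProduct.lid k B).toLinearMap ∘ₗ counit.toLinearMap.rTensor B ∘ₗ comul =
    LinearMap.id
  counit_right : (TensorProduct.rid k B).toLinearMap ∘ₗ counit.toLinearMap.lTensor B ∘ₗ comul =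
    LinearMap.id
  comul_comodule : coactTensor coact coact ∘ₗ comul = comul.rTensor A ∘ₗ coact
  counit_comodule : (TensorProduct.lid k A).toLinearMap ∘ₗ
    counit.toLinearMap.rTensor A ∘ₗ coact = LinearMap.toSpanSingleton k A 1 ∘ₗ counit.toLinearMap
  comul_one : comul 1 = 1 ⊗ₜ 1
  /-- `Δ` is multiplicative for the braided tensor product algebra `B ⊗ B`. -/
  comul_mul : comul ∘ₗ LinearMap.mul' k B =
    TensorProduct.map (LinearMap.mul' k B) (LinearMap.mul' k B) ∘ₗ
      midMap (braiding r coact coact) ∘ₗ TensorProduct.map comul comul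

end Braided

section Envelopes

variable {k : Type u} {A : Type v} [Field k] [Ring A] [HopfAlgebra k A]

/-- An isomorphism of bialgebras in the category of right `A`-comodules: an algebra isomorphism
that respects coactions, coproducts and counits. -/
structure IsBialgebraIso {r : A →ₗ[k] A →ₗ[k] k} {B B' : Type*} [Ring B] [Algebra k B]
    [Ring B'] [Algebra k B'] (S : BraidedBialgebra k A r B) (S' : BraidedBialgebra k A r B')
    (φ : B ≃ₐ[k] B') : Prop where
  coact : ∀ x, S'.coact (φ x) = φ.toLinearMap.rTensor A (S.coact x)
  comul : ∀ x, S'.comul (φ x) = TensorProduct.map φ.toLinearMap φ.toLinearMap (S.comul x)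
  counit : ∀ x, S'.counit (φ x) = S.counit x

variable {V : Type w} [AddCommMonoid V] [Module k V]

/-- The inclusion of `V ⊗ V` as the degree two part of the tensor algebra. -/
def degTwo (k : Type u) (V : Type w) [Field k] [AddCommMonoid V] [Module k V] :
    V ⊗[k] V →ₗ[k] TensorAlgebra k V :=
  LinearMap.mul' k (TensorAlgebra k V) ∘ₗ
    TensorProduct.map (TensorAlgebra.ι k) (TensorAlgebra.ι k)

/-- The quotient of `T(V)` by the two-sided ideal generated by all `t - σ(t) - β(t)`,
`t ∈ V ⊗ V`, where `σ(t)` has degree two and `β(t)` has degree one. -/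
abbrev Envelope (σ : V ⊗[k] V →ₗ[k] V ⊗[k] V) (β : V ⊗[k] V →ₗ[k] V) : Type (max u w) :=
  RingQuot (fun x y : TensorAlgebra k V =>
    ∃ t : V ⊗[k] V, x = degTwo k V t ∧ y = degTwo k V (σ t) + TensorAlgebra.ι k (β t))

/-- The canonical map `V → T(V) / ⟨t - σ(t) - β(t)⟩`. -/
def Envelope.gen (σ : V ⊗[k] V →ₗ[k] V ⊗[k] V) (β : V ⊗[k] V →ₗ[k] V) :
    V →ₗ[k] Envelope σ β :=
  (RingQuot.mkAlgHom k (fun x y : TensorAlgebra k V =>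
    ∃ t : V ⊗[k] V, x = degTwo k V t ∧
      y = degTwo k V (σ t) + TensorAlgebra.ι k (β t))).toLinearMap ∘ₗ TensorAlgebra.ι k

namespace BraidedLieAlgebra

variable {r : A →ₗ[k] A →ₗ[k] k} (L : BraidedLieAlgebra k A r V)

/-- The canonical braiding `Υ = ([ , ] ⊗ id) (id ⊗ Ψ) (Δ ⊗ id)`. -/
def canonicalBraiding : V ⊗[k] V →ₗ[k] V ⊗[k] V :=
  L.bracket.rTensor V ∘ₗ (TensorProduct.assoc k V V V).symm.toLinearMap ∘ₗ
    (braiding r L.coact L.coact).lTensor V ∘ₗ (TensorProduct.assoc k V V V).toLinearMap ∘ₗ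
    L.comul.rTensor V

/-- The braided enveloping algebra `B(L) = T(L) / ⟨im (id - Υ)⟩`, a quadratic algebra. -/
abbrev BraidedEnvelope : Type (max u w) := Envelope L.canonicalBraiding 0

/-- The canonical map `L → B(L)`. -/
def gen : V →ₗ[k] L.BraidedEnvelope := Envelope.gen L.canonicalBraiding 0

/-- `M` is a braided Lie subalgebra: a subcomodule and subcoalgebra with `[M, M] ⊆ M`. -/
structure IsSubalgebra (M : Submodule k V) : Prop where
  coact_mem : ∀ x ∈ M, L.coact x ∈ LinearMap.range (M.subtype.rTensor A)
  comul_mem : ∀ x ∈ M, L.comul x ∈ LinearMap.range (TensorProduct.map M.subtype M.subtype)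
  bracket_mem : ∀ x ∈ M, ∀ y ∈ M, L.bracket (x ⊗ₜ y) ∈ M

/-- A bialgebra structure on `B(L)` extends the coaction, coproduct and counit of `L`.
(Since `L` generates `B(L)`, there is at most one such structure.) -/
structure Extends (S : BraidedBialgebra k A r L.BraidedEnvelope) : Prop where
  coact : ∀ x, S.coact (L.gen x) = L.gen.rTensor A (L.coact x)
  comul : ∀ x, S.comul (L.gen x) = TensorProduct.map L.gen L.gen (L.comul x)
  counit : ∀ x, S.counit (L.gen x) = L.counit x

end BraidedLieAlgebra

/-! ### The structures carried by (extended) tangent spaces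

A subspace `T` of `A*` is in duality with `A`, and a tensor in `T ⊗ T` or `T ⊗ A` is determined
by its values on `A`. So each structure map below is uniquely determined by its values. -/

/-- `⟨X⁽⁰⁾, a⟩ X⁽¹⁾ = ⟨a⁽⁰⁾, X⟩ a⁽⁻¹⁾` for all `a`, where `a⁽⁻¹⁾ ⊗ a⁽⁰⁾ = ad_L(a)`: the right
coaction on `T` dual to the left adjoint coaction. -/
def IsDualCoaction (T : Submodule k (Module.Dual k A)) (ρ : T →ₗ[k] T ⊗[k] A) : Prop :=
  ∀ (X : T) (a : A),
    TensorProduct.lid k A ((Module.Dual.eval k A a ∘ₗ T.subtype).rTensor A (ρ X)) =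
      TensorProduct.rid k A ((X : Module.Dual k A).lTensor A (adL k A a))

/-- The braided Lie algebra structure on a subspace `T` of `A*`: coaction dual to `ad_L`,
coproduct dual to the covariantised product of `A`, counit `X ↦ X(1)` and bracket
`[X, Y] = X₍₁₎ Y S(X₍₂₎)`. -/
structure TangentBraidedLie (r : A →ₗ[k] A →ₗ[k] k) (T : Submodule k (Module.Dual k A))
    extends BraidedLieAlgebra k A r T where
  coact_spec : IsDualCoaction T coact
  comul_spec : ∀ (X : T) (a b : A),
    pairing T T (comul X) (a ⊗ₜ b) = (X : Module.Dual k A) (covMul r a b)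
  counit_spec : ∀ X : T, counit X = (X : Module.Dual k A) 1
  bracket_spec : ∀ X Y : T, (bracket (X ⊗ₜ Y) : Module.Dual k A) = adBracket X Y

/-- The data of the quantum Lie algebra on a tangent space `g ⊆ A*`: its coaction, the braiding
`σ(x ⊗ y) = [x₍₁₎, y] ⊗ x₍₂₎ - [x, y] ⊗ 1`, the bracket `[x, y] = x₍₁₎ y S(x₍₂₎)`, and the map
`δ` with `Δ(x) = x ⊗ 1 + 1 ⊗ x + δ(x)` for the coproduct `Δ` dual to the covariantised product. -/
structure TangentQuantumLie (r : A →ₗ[k] A →ₗ[k] k) (g : Submodule k (Module.Dual k A))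
    extends RightComodule k A g where
  sigma : g ⊗[k] g →ₗ[k] g ⊗[k] g
  bracket : g ⊗[k] g →ₗ[k] g
  delta : g →ₗ[k] g ⊗[k] g
  coact_spec : IsDualCoaction g coact
  /-- `⟨a ⊗ b, σ(x ⊗ y)⟩ = x(a⁽⁻¹⁾ b) y(a⁽⁰⁾) - [x, y](a) ε(b)`. -/
  sigma_spec : ∀ (x y : g) (a b : A),
    pairing g g (sigma (x ⊗ₜ y)) (a ⊗ₜ b) =
      TensorProduct.dualDistrib k A A
          (((x : Module.Dual k A) ∘ₗ LinearMap.mulRight k b) ⊗ₜ[k] (y : Module.Dual k A))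
          (adL k A a) -
        adBracket (x : Module.Dual k A) y a * dualOne k A b
  bracket_spec : ∀ x y : g, (bracket (x ⊗ₜ y) : Module.Dual k A) = adBracket x y
  delta_spec : ∀ (x : g) (a b : A),
    pairing g g (delta x) (a ⊗ₜ b) = (x : Module.Dual k A) (covMul r a b) -
      (x : Module.Dual k A) a * dualOne k A b - dualOne k A a * (x : Module.Dual k A) b

namespace TangentQuantumLie

variable {r : A →ₗ[k] A →ₗ[k] k} {g : Submodule k (Module.Dual k A)}
  (Q : TangentQuantumLie r g)

/-- The universal enveloping algebra `U(g) = T(g) / ⟨im (id - σ - [ , ])⟩`. -/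
abbrev UniversalEnvelope : Type (max u v) := Envelope Q.sigma Q.bracket

/-- The canonical map `g → U(g)`. -/
def gen : g →ₗ[k] Q.UniversalEnvelope := Envelope.gen Q.sigma Q.bracket

/-- A bialgebra structure on `U(g)` is the one with `Δ(x) = x ⊗ 1 + 1 ⊗ x + δ(x)` and `ε(x) = 0`
for `x ∈ g`. (Since `g` generates `U(g)`, there is at most one such structure.) -/
structure Extends (S : BraidedBialgebra k A r Q.UniversalEnvelope) : Prop where
  coact : ∀ x, S.coact (Q.gen x) = Q.gen.rTensor A (Q.coact x)
  comul : ∀ x, S.comul (Q.gen x) =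
    Q.gen x ⊗ₜ 1 + 1 ⊗ₜ Q.gen x + TensorProduct.map Q.gen Q.gen (Q.delta x)
  counit : ∀ x, S.counit (Q.gen x) = 0

end TangentQuantumLie

end Envelopes

end QLie

end

/-! Everything rests on a few properties of `q = s₂₁ * r`. In the convolution algebra of maps `A ⊗ A
→ A`, quasi-commutativity lets `r` and `s₂₁` each exchange the product with the opposite product, in
opposite directions; hence `q` commutes with the product (`quantumKilling_central`). Cancelling one
leg against the antipode turns this into ad-invariance: the left adjoint coaction in the second
argument of `q` corresponds to the right adjoint coaction `adR` in the first
(`quantumKilling_invariant`). Multiplicativity of `r` and `s` gives `q(c, ab) = s(a₍₁₎, c₍₁₎)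
q(c₍₂₎, b) r(c₍₃₎, a₍₂₎)`, so left multiplication in the second argument is a right action `gam` on
the first (`quantumKilling_gam`, `quantumKilling_flip_mul`). Together these yield `q(c, a ⬝ b) =
q(c₍₁₎, a) q(c₍₂₎, b)`: the coproduct of `A` is dual, under `q`, to the covariantised product
(`quantumKilling_covMul`).

Parts (i) and (ii) combine this with Woronowicz's correspondence between bicovariant calculi and
left ideals of `A` inside `ker ε` that are stable under `ad_L` (`BicovariantFODC.isAdIdeal`,
`IsAdIdeal.ideal_calculus`). The annihilator of a subcoalgebra containing `1` is such an ideal.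
Conversely such an ideal is two-sided for `⬝`, so its orthogonal is a subcoalgebra when `q₁` is
injective. Equality of the tangent spaces is a double annihilator.

For (iii), `A` itself carries the coaction `adR`, its own coproduct and the bracket `[c, d] = d⁽⁰⁾
q(c, d⁽¹⁾)`, with canonical braiding `Υ(c ⊗ d) = d⁽⁰⁾ ⊗ γ(c, d⁽¹⁾)`. The axioms of a braided Lie
algebra hold there, weak cocommutativity only after applying `q` to one leg; on the image under `q₁`
of a subcoalgebra where `q₁` is injective they all hold (`KillingSection.braidedLie`). For every
braided Lie algebra `L`, `Υ` is a coalgebra endomorphism of the braided `L ⊗ L`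
(`comulTensor_canonicalBraiding`), so the relations of `B(L)` are compatible with the coproduct and
`B(L)` is a braided bialgebra.

In the extended tangent space the unit `e` satisfies `Υ(e ⊗ v) = v ⊗ e` and `Υ(v ⊗ e) = e ⊗ v`. Once
`e` is set equal to `1`, the quadratic relations of the whole space are therefore those of any
complement of `e`. On the complement `ℒ` they are the relations of `B(ℒ)`. On the complement `g =
ker ε` one has `Υ = σ + [ , ] ⊗ e`, and they are the relations of `U(g)`. Hence `U(g) ≃ B(ℒ)`
(`UnitalSplitting.Augmentation.equivB`). Finally, if `C` is finite-dimensional, some `a₀` has `ε(a₀)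
= 0` and `q(c, a₀) = ε(c)` on `C`, and then `θ = ω_R(a₀)` shows that the calculus is inner.

Sweedler computations are done on matrix coefficients: every vector of a comodule lies in the span
of a finite family with coefficient matrix `u`, `Δ(u i j) = ∑ u i l ⊗ u l j`, and identities of
linear maps become reindexings of finite sums. -/

noncomputable section

namespace QLie

section

/-! ### Matrix coefficients and local finiteness of comodules. -/

section MatrixCoalgebra

variable {k : Type u} {A : Type v} [Field k] [Ring A] [HopfAlgebra k A]

/-- A square matrix of elements of `A` with `Δ(u i j) = ∑ u i l ⊗ u l j` and `ε(u i j) = δ i j`. -/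
structure IsCorep {ι : Type*} [Fintype ι] [DecidableEq ι] (u : ι → ι → A) : Prop where
  comul : ∀ i j, Coalgebra.comul (R := k) (u i j) = ∑ l, u i l ⊗ₜ[k] u l j
  counit : ∀ i j, Coalgebra.counit (R := k) (u i j) = if i = j then 1 else 0

/-- Coefficient functionals dual to a linearly independent finite family. -/
theorem exists_dual_family {V : Type*} [AddCommGroup V] [Module k V] {ι : Type*} [Fintype ι]
    [DecidableEq ι] {e : ι → V} (he : LinearIndependent k e) :
    ∃ φ : ι → V →ₗ[k] k, ∀ i j, φ i (e j) = if i = j then 1 else 0 := by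
  have hinj : LinearMap.ker (Fintype.linearCombination k e) = ⊥ := by
    rw [LinearMap.ker_eq_bot]
    exact linearIndependent_iff_injective_fintypeLinearCombination.mp he
  obtain ⟨g, hg⟩ := LinearMap.exists_leftInverse_of_injective _ hinj
  refine ⟨fun i => LinearMap.proj i ∘ₗ g, fun i j => ?_⟩
  have h := LinearMap.congr_fun hg (Pi.single j 1)
  rw [LinearMap.comp_apply, Fintype.linearCombination_apply_single, one_smul] at h
  simp [h, Pi.single_apply]

namespace RightComodule

variable {V : Type*} [AddCommGroup V] [Module k V] (M : RightComodule k A V)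

/-- A finite family in a comodule, spanning a subcomodule with coefficient matrix `u`. -/
structure IsFamily {ι : Type*} [Fintype ι] [DecidableEq ι] (e : ι → V) (u : ι → ι → A) : Prop
    extends IsCorep (k := k) u where
  coact : ∀ j, M.coact (e j) = ∑ i, e i ⊗ₜ u i j

/-- The first legs of `coact v`, expanded in a basis of `A`, span a finite-dimensional subspace. The
counit axiom puts `v` in it, coassociativity makes it a subcomodule, and a basis of it gives the
family and the matrix. -/
theorem exists_family (v : V) : ∃ (m : ℕ) (e : Fin m → V) (u : Fin m → Fin m → A),
    M.IsFamily e u ∧ v ∈ Submodule.span k (Set.range e) := by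
  classical
  let B := Module.Basis.ofVectorSpace k A
  let c : _ → V := fun i => TensorProduct.rid k V ((B.coord i).lTensor V (M.coact v))
  obtain ⟨s, hs⟩ : ∃ s : Finset _, M.coact v = ∑ i ∈ s, c i ⊗ₜ B i := by
    obtain ⟨b, hb⟩ := TensorProduct.eq_repr_basis_right B (M.coact v)
    refine ⟨b.support, ?_⟩
    have hc : ∀ i, c i = b i := by
      intro i
      simp only [c, ← hb, Finsupp.sum, map_sum, LinearMap.lTensor_tmul, TensorProduct.rid_tmul,
        Module.Basis.coord_apply, Module.Basis.repr_self]
      rw [Finset.sum_eq_single i]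
      · simp
      · intro j _ hj
        rw [Finsupp.single_eq_of_ne hj.symm, zero_smul]
      · intro hi
        simpa using hi
    simp only [hc]
    exact hb.symm
  let W := Submodule.span k (c '' (s : Set _))
  have hfin : FiniteDimensional k W := FiniteDimensional.span_of_finite k (s.finite_toSet.image c)
  have hvW : v ∈ W := by
    have h := LinearMap.congr_fun M.coact_counit v
    simp only [LinearMap.comp_apply, hs, map_sum, LinearMap.lTensor_tmul, LinearMap.id_apply,
      LinearEquiv.coe_coe, TensorProduct.rid_tmul] at h
    rw [← h]
    exact Submodule.sum_mem _ fun i hi => Submodule.smul_mem _ _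
      (Submodule.subset_span ⟨i, hi, rfl⟩)
  -- The functional `B.coord i` on the last leg of coassociativity isolates `coact (c i)` on one
  -- side; the other side visibly has its first leg in `W`.
  have hcW : ∀ i, M.coact (c i) ∈ LinearMap.range (W.subtype.rTensor A) := by
    intro i
    have h := LinearMap.congr_fun M.coact_coassoc v
    have h2 := congrArg ((((TensorProduct.rid k A).toLinearMap ∘ₗ
      (B.coord i).lTensor A).lTensor V)) h
    have h3 : ∀ t : V ⊗[k] A, (((TensorProduct.rid k A).toLinearMap ∘ₗ
        (B.coord i).lTensor A).lTensor V) (TensorProduct.assoc k V A A (M.coact.rTensor A t)) =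
        M.coact (TensorProduct.rid k V ((B.coord i).lTensor V t)) := by
      intro t
      induction t with
      | zero => simp
      | add x y hx hy => simp only [map_add, hx, hy]
      | tmul x y =>
        simp only [LinearMap.rTensor_tmul, LinearMap.lTensor_tmul, TensorProduct.rid_tmul,
          map_smul]
        generalize M.coact x = z
        induction z with
        | zero => simp
        | add x y hx hy => simp only [map_add, hx, hy, TensorProduct.add_tmul, smul_add]
        | tmul x z => simp
    simp only [LinearMap.comp_apply, LinearEquiv.coe_coe, h3] at h2
    rw [show M.coact (c i) = _ from h2, hs]
    simp only [map_sum, LinearMap.lTensor_tmul]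
    refine Submodule.sum_mem _ fun l hl => ?_
    exact ⟨(⟨c l, Submodule.subset_span ⟨l, hl, rfl⟩⟩ : W) ⊗ₜ _, rfl⟩
  have hW : ∀ w ∈ W, M.coact w ∈ LinearMap.range (W.subtype.rTensor A) := by
    intro w hw
    induction hw using Submodule.span_induction with
    | mem x hx => obtain ⟨i, _, rfl⟩ := hx; exact hcW i
    | zero => simp
    | add x y _ _ hx hy => rw [map_add]; exact Submodule.add_mem _ hx hy
    | smul a x _ hx => rw [map_smul]; exact Submodule.smul_mem _ _ hx
  let b := Module.finBasis k W
  let e : Fin (Module.finrank k W) → V := fun i => b i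
  have he : LinearIndependent k e := by
    have := b.linearIndependent.map' W.subtype (Submodule.ker_subtype W)
    exact this
  -- The coordinates are functionals on all of `V`, so the matrix can be read off without lifting
  -- `coact` to `W ⊗ A`.
  obtain ⟨φ, hφ⟩ := exists_dual_family he
  let u : Fin (Module.finrank k W) → Fin (Module.finrank k W) → A := fun i j =>
    TensorProduct.lid k A ((φ i).rTensor A (M.coact (e j)))
  have hcoact : ∀ j, M.coact (e j) = ∑ i, e i ⊗ₜ u i j := by
    intro j
    obtain ⟨t, ht⟩ := hW (e j) (b j).2
    have key : ∀ t : W ⊗[k] A, W.subtype.rTensor A t = ∑ i, e i ⊗ₜ[k]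
        TensorProduct.lid k A ((φ i).rTensor A (W.subtype.rTensor A t)) := by
      intro t
      induction t with
      | zero => simp
      | add x y hx hy =>
        simp only [map_add, TensorProduct.tmul_add, Finset.sum_add_distrib, ← hx, ← hy]
      | tmul x a =>
        have hx : (x : V) = ∑ i, φ i x • e i := by
          have : ∀ i, φ i x = b.repr x i := by
            intro i
            conv_lhs => rw [← b.sum_repr x]
            simp only [Submodule.coe_sum, Submodule.coe_smul, map_sum, map_smul]
            have := hφ i
            simp only [e] at this
            simp [this]
          simp only [this, e]
          have h := congrArg W.subtype (b.sum_repr x)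
          simpa only [map_sum, map_smul, Submodule.subtype_apply] using h.symm
        simp only [LinearMap.rTensor_tmul, Submodule.subtype_apply, TensorProduct.lid_tmul,
          TensorProduct.tmul_smul]
        conv_lhs => rw [hx]
        simp [TensorProduct.sum_tmul, TensorProduct.smul_tmul']
    simp only [u, ← ht]
    exact key t
  have huu : ∀ i j, Coalgebra.comul (R := k) (u i j) = ∑ l, u i l ⊗ₜ[k] u l j := by
    intro i j
    have h := LinearMap.congr_fun M.coact_coassoc (e j)
    simp only [LinearMap.comp_apply, hcoact, map_sum, LinearMap.rTensor_tmul,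
      TensorProduct.sum_tmul, LinearEquiv.coe_coe, TensorProduct.assoc_tmul,
      LinearMap.lTensor_tmul] at h
    have h2 := congrArg (fun t => TensorProduct.lid k _ ((φ i).rTensor (A ⊗[k] A) t)) h
    simp only [map_sum, LinearMap.rTensor_tmul, TensorProduct.lid_tmul, hφ] at h2
    simp only [ite_smul, one_smul, zero_smul, Finset.sum_ite_eq, Finset.mem_univ, if_true] at h2
    exact h2.symm
  refine ⟨_, e, u, ⟨⟨huu, fun i j => ?_⟩, hcoact⟩, ?_⟩
  · have h := LinearMap.congr_fun M.coact_counit (e j)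
    simp only [LinearMap.comp_apply, hcoact, map_sum, LinearMap.lTensor_tmul, LinearMap.id_apply,
      LinearEquiv.coe_coe, TensorProduct.rid_tmul] at h
    have h2 := congrArg (φ i) h
    simpa [hφ] using h2
  · have h1 : Submodule.span k (Set.range e) = W := by
      have : Set.range e = W.subtype '' Set.range b := by
        rw [← Set.range_comp]; rfl
      rw [this, Submodule.span_image, b.span_eq]
      simp
    rw [h1]
    exact hvW

/-- Linear maps out of a comodule are determined by their values on finite families. -/
theorem hom_ext {W : Type*} [AddCommMonoid W] [Module k W] {F G : V →ₗ[k] W}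
    (h : ∀ (m : ℕ) (e : Fin m → V) (u : Fin m → Fin m → A), M.IsFamily e u →
      ∀ j, F (e j) = G (e j)) : F = G := by
  ext v
  obtain ⟨m, e, u, he, hv⟩ := M.exists_family v
  exact LinearMap.eqOn_span (f := F) (g := G) (by rintro _ ⟨j, rfl⟩; exact h m e u he j) hv

end RightComodule

/-- The regular right comodule. -/
def regularComodule (k : Type u) (A : Type v) [Field k] [Ring A] [HopfAlgebra k A] :
    RightComodule k A A where
  coact := Coalgebra.comul
  coact_coassoc := Coalgebra.coassoc
  coact_counit := by
    ext a
    simp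

/-- Linear maps on `A` are determined by their values on matrix coefficients. -/
theorem hom_ext_corep {W : Type*} [AddCommMonoid W] [Module k W] {F G : A →ₗ[k] W}
    (h : ∀ (m : ℕ) (u : Fin m → Fin m → A), IsCorep (k := k) u → ∀ i j, F (u i j) = G (u i j)) :
    F = G := by
  refine (regularComodule k A).hom_ext fun m e u he j => ?_
  -- By the counit axiom the elements of a family in the regular comodule are combinations of its
  -- matrix entries.
  have h1 : e j = ∑ i, Coalgebra.counit (R := k) (e i) • u i j := by
    have h2 := congrArg (fun t => TensorProduct.lid k A
      ((Coalgebra.counit (R := k) (A := A)).rTensor A t)) (he.coact j)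
    simpa [regularComodule] using h2
  rw [h1, map_sum, map_sum]
  exact Finset.sum_congr rfl fun i _ => by rw [map_smul, map_smul, h m u he.toIsCorep]

end MatrixCoalgebra

end

section

/-! ### The convolution algebra of maps out of `A ⊗ A`, and centrality of the Killing form. -/

section ConvolutionWords

open WithConv

variable {k : Type u} {A : Type v} [Field k] [Ring A] [HopfAlgebra k A]

namespace IsCorep

variable {ι κ : Type*} [Fintype ι] [DecidableEq ι] [Fintype κ] [DecidableEq κ]
  {u : ι → ι → A} {x : κ → κ → A}

theorem sum_antipode_mul (hu : IsCorep (k := k) u) (i j : ι) :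
    ∑ l, HopfAlgebra.antipode k (u i l) * u l j = if i = j then 1 else 0 := by
  have h := HopfAlgebra.mul_antipode_rTensor_comul_apply (R := k) (u i j)
  simp only [hu.comul, hu.counit, map_sum, LinearMap.rTensor_tmul, LinearMap.mul'_apply] at h
  rw [h]
  split_ifs <;> simp

theorem sum_mul_antipode (hu : IsCorep (k := k) u) (i j : ι) :
    ∑ l, u i l * HopfAlgebra.antipode k (u l j) = if i = j then 1 else 0 := by
  have h := HopfAlgebra.mul_antipode_lTensor_comul_apply (R := k) (u i j)
  simp only [hu.comul, hu.counit, map_sum, LinearMap.lTensor_tmul, LinearMap.mul'_apply] at h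
  rw [h]
  split_ifs <;> simp

theorem conv_apply (hu : IsCorep (k := k) u) {R : Type*} [Ring R] [Algebra k R]
    (f g : WithConv (A →ₗ[k] R)) (i j : ι) : (f * g) (u i j) = ∑ l, f (u i l) * g (u l j) := by
  simp [LinearMap.convMul_apply, hu.comul]

theorem conv_tmul (hu : IsCorep (k := k) u) (hx : IsCorep (k := k) x) {R : Type*} [Ring R]
    [Algebra k R] (f g : WithConv (A ⊗[k] A →ₗ[k] R)) (i j : ι) (p q : κ) :
    (f * g) (u i j ⊗ₜ x p q) = ∑ l, ∑ m, f (u i l ⊗ₜ x p m) * g (u l j ⊗ₜ x m q) := by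
  simp only [LinearMap.convMul_apply, TensorProduct.comul_tmul, hu.comul, hx.comul,
    TensorProduct.sum_tmul, TensorProduct.tmul_sum, map_sum,
    TensorProduct.AlgebraTensorModule.tensorTensorTensorComm_tmul, TensorProduct.map_tmul,
    LinearMap.mul'_apply]
  rw [Finset.sum_comm]

end IsCorep

/-- Linear maps on `A ⊗ A` are determined by their values on matrix coefficients. -/
theorem hom_ext_corep₂ {W : Type*} [AddCommMonoid W] [Module k W] {F G : A ⊗[k] A →ₗ[k] W}
    (h : ∀ (m n : ℕ) (u : Fin m → Fin m → A) (x : Fin n → Fin n → A), IsCorep (k := k) u →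
      IsCorep (k := k) x → ∀ i j p q, F (u i j ⊗ₜ x p q) = G (u i j ⊗ₜ x p q)) : F = G := by
  refine TensorProduct.ext (hom_ext_corep fun m u hu i j => hom_ext_corep fun n x hx p q => ?_)
  exact h m n u x hu hx i j p q

theorem conv_ext₂ {R : Type*} [Ring R] [Algebra k R] {F G : WithConv (A ⊗[k] A →ₗ[k] R)}
    (h : ∀ (m n : ℕ) (u : Fin m → Fin m → A) (x : Fin n → Fin n → A), IsCorep (k := k) u →
      IsCorep (k := k) x → ∀ i j p q, F (u i j ⊗ₜ x p q) = G (u i j ⊗ₜ x p q)) : F = G :=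
  WithConv.ext (hom_ext_corep₂ h)

section Words

variable {R : Type*} [Ring R] [Algebra k R]

/-- `a ⊗ b ↦ ε(b) f(a)`. -/
def wordL (f : A →ₗ[k] R) : WithConv (A ⊗[k] A →ₗ[k] R) :=
  toConv (f ∘ₗ (TensorProduct.rid k A).toLinearMap ∘ₗ (Coalgebra.counit (R := k)).lTensor A)

/-- `a ⊗ b ↦ ε(a) f(b)`. -/
def wordR (f : A →ₗ[k] R) : WithConv (A ⊗[k] A →ₗ[k] R) :=
  toConv (f ∘ₗ (TensorProduct.lid k A).toLinearMap ∘ₗ (Coalgebra.counit (R := k)).rTensor A)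

/-- A bilinear form as an element of the convolution algebra. -/
def wordF (R : Type*) [Ring R] [Algebra k R] (f : A →ₗ[k] A →ₗ[k] k) :
    WithConv (A ⊗[k] A →ₗ[k] R) :=
  toConv (Algebra.linearMap k R ∘ₗ TensorProduct.lift f)

@[simp] theorem wordL_tmul (f : A →ₗ[k] R) (a b : A) :
    wordL f (a ⊗ₜ b) = Coalgebra.counit (R := k) b • f a := by
  simp [wordL]

@[simp] theorem wordR_tmul (f : A →ₗ[k] R) (a b : A) :
    wordR f (a ⊗ₜ b) = Coalgebra.counit (R := k) a • f b := by
  simp [wordR]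

@[simp] theorem wordF_tmul (f : A →ₗ[k] A →ₗ[k] k) (a b : A) :
    wordF R f (a ⊗ₜ b) = algebraMap k R (f a b) := by
  simp [wordF]

theorem wordL_mul (f g : WithConv (A →ₗ[k] R)) :
    wordL f.ofConv * wordL g.ofConv = wordL (f * g).ofConv := by
  refine conv_ext₂ fun m n u x hu hx i j p q => ?_
  rw [hu.conv_tmul hx, wordL_tmul, hu.conv_apply]
  simp [hx.counit, Finset.smul_sum]

theorem wordR_mul (f g : WithConv (A →ₗ[k] R)) :
    wordR f.ofConv * wordR g.ofConv = wordR (f * g).ofConv := by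
  refine conv_ext₂ fun m n u x hu hx i j p q => ?_
  rw [hu.conv_tmul hx, wordR_tmul, hx.conv_apply]
  simp [hu.counit, Finset.smul_sum]

theorem wordL_one : wordL (1 : WithConv (A →ₗ[k] R)).ofConv = 1 := by
  refine conv_ext₂ fun m n u x hu hx i j p q => ?_
  simp [Algebra.smul_def]

theorem wordR_one : wordR (1 : WithConv (A →ₗ[k] R)).ofConv = 1 := by
  refine conv_ext₂ fun m n u x hu hx i j p q => ?_
  simp only [wordR_tmul, LinearMap.convOne_apply, TensorProduct.counit_tmul, smul_eq_mul, map_mul,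
    Algebra.smul_def]
  exact Algebra.commutes _ _

theorem wordL_antipode_mul : wordL (HopfAlgebra.antipode k (A := A)) *
    wordL (LinearMap.id : A →ₗ[k] A) = 1 := by
  have := wordL_mul (toConv (HopfAlgebra.antipode k (A := A))) (toConv (LinearMap.id))
  rw [LinearMap.antipode_mul_id, wordL_one] at this
  exact this

theorem wordR_mul_antipode : wordR (LinearMap.id : A →ₗ[k] A) *
    wordR (HopfAlgebra.antipode k (A := A)) = 1 := by
  have := wordR_mul (toConv (LinearMap.id)) (toConv (HopfAlgebra.antipode k (A := A)))
  rw [LinearMap.id_mul_antipode, wordR_one] at this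
  exact this

/-- The identity placed in the two legs gives the product in this order and the opposite product in
the other order. Quasi-commutativity thereby becomes an identity between words in an associative
algebra. -/
theorem wordL_mul_wordR_tmul (a b : A) :
    (wordL (LinearMap.id : A →ₗ[k] A) * wordR (LinearMap.id : A →ₗ[k] A)) (a ⊗ₜ b) = a * b := by
  have : (wordL (LinearMap.id : A →ₗ[k] A) * wordR (LinearMap.id : A →ₗ[k] A)) =
      toConv (LinearMap.mul' k A) := by
    refine conv_ext₂ fun m n u x hu hx i j p q => ?_
    rw [hu.conv_tmul hx]
    simp [hx.counit, hu.counit]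
  rw [this]
  simp

theorem wordR_mul_wordL_tmul (a b : A) :
    (wordR (LinearMap.id : A →ₗ[k] A) * wordL (LinearMap.id : A →ₗ[k] A)) (a ⊗ₜ b) = b * a := by
  have : (wordR (LinearMap.id : A →ₗ[k] A) * wordL (LinearMap.id : A →ₗ[k] A)) =
      toConv (LinearMap.mul' k A ∘ₗ (TensorProduct.comm k A A).toLinearMap) := by
    refine conv_ext₂ fun m n u x hu hx i j p q => ?_
    rw [hu.conv_tmul hx]
    simp [hx.counit, hu.counit]
  rw [this]
  simp

end Words

namespace IsCoquasitriangular

variable {r s : A →ₗ[k] A →ₗ[k] k} (hr : IsCoquasitriangular r) (hs : IsCoquasitriangular s)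
  {ι : Type*} [Fintype ι] [DecidableEq ι] {u : ι → ι → A}

include hr

theorem mul_left_corep (hu : IsCorep (k := k) u) (a b : A) (i j : ι) :
    r (a * b) (u i j) = ∑ l, r a (u i l) * r b (u l j) := by
  simp [hr.mul_left, hu.comul]

theorem mul_right_corep (hu : IsCorep (k := k) u) (b c : A) (i j : ι) :
    r (u i j) (b * c) = ∑ l, r (u i l) c * r (u l j) b := by
  simp [hr.mul_right, hu.comul]

variable (R : Type*) [Ring R] [Algebra k R]

/-- Multiplicativity in the first argument merges the factors into `r(a₍₁₎ S(a₍₂₎), b)`. -/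
theorem mul_inv : wordF R r * wordF R (r ∘ₗ HopfAlgebra.antipode k (A := A)) = 1 := by
  refine conv_ext₂ fun m n u x hu hx i j p q => ?_
  rw [hu.conv_tmul hx]
  simp only [wordF_tmul, LinearMap.comp_apply, ← map_mul, ← map_sum, ← hr.mul_left_corep hx]
  rw [← LinearMap.sum_apply, ← map_sum, hu.sum_mul_antipode]
  by_cases h : i = j <;> simp [h, hr.one_left, hu.counit]

theorem quasi_comm_word : wordR (LinearMap.id : A →ₗ[k] A) * wordL (LinearMap.id : A →ₗ[k] A) *
    wordF A r = wordF A r * (wordL (LinearMap.id : A →ₗ[k] A) *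
      wordR (LinearMap.id : A →ₗ[k] A)) := by
  have h : toConv (LinearMap.mul' k A ∘ₗ (TensorProduct.comm k A A).toLinearMap) * wordF A r =
      wordF A r * toConv (LinearMap.mul' k A) := congrArg toConv hr.quasi_comm
  have h1 : toConv (LinearMap.mul' k A ∘ₗ (TensorProduct.comm k A A).toLinearMap) =
      wordR (LinearMap.id : A →ₗ[k] A) * wordL (LinearMap.id : A →ₗ[k] A) :=
    WithConv.ext (TensorProduct.ext' fun a b => by rw [wordR_mul_wordL_tmul]; simp)
  have h2 : toConv (LinearMap.mul' k A) =
      wordL (LinearMap.id : A →ₗ[k] A) * wordR (LinearMap.id : A →ₗ[k] A) :=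
    WithConv.ext (TensorProduct.ext' fun a b => by rw [wordL_mul_wordR_tmul]; simp)
  rw [← h1, ← h2, h]

theorem quasi_comm_corep {κ : Type*} [Fintype κ] [DecidableEq κ] {x : κ → κ → A}
    (hu : IsCorep (k := k) u) (hx : IsCorep (k := k) x) (i j : ι) (p q : κ) :
    ∑ l, ∑ m, r (u l j) (x m q) • (x p m * u i l) =
      ∑ l, ∑ m, r (u i l) (x p m) • (u l j * x m q) := by
  have h := congrArg (fun f => f (u i j ⊗ₜ x p q)) hr.quasi_comm_word
  simp only [hu.conv_tmul hx _ (wordF A r), hu.conv_tmul hx (wordF A r), wordR_mul_wordL_tmul,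
    wordL_mul_wordR_tmul, wordF_tmul] at h
  simpa only [Algebra.smul_def, Algebra.commutes] using h

/-- Exchanging the arguments swaps the two legs, so `r₂₁` passes the product in the direction
opposite to `r`. -/
theorem quasi_comm_word_flip : wordL (LinearMap.id : A →ₗ[k] A) *
    wordR (LinearMap.id : A →ₗ[k] A) * wordF A r.flip = wordF A r.flip *
      (wordR (LinearMap.id : A →ₗ[k] A) * wordL (LinearMap.id : A →ₗ[k] A)) := by
  refine conv_ext₂ fun m n u x hu hx i j p q => ?_
  have h := hr.quasi_comm_corep hx hu p q i j
  rw [Finset.sum_comm] at h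
  rw [Finset.sum_comm (s := Finset.univ (α := Fin n))] at h
  simp only [hu.conv_tmul hx _ (wordF A _), hu.conv_tmul hx (wordF A _), wordR_mul_wordL_tmul,
    wordL_mul_wordR_tmul, wordF_tmul]
  simpa only [Algebra.smul_def, Algebra.commutes, LinearMap.flip_apply] using h

omit hr in
theorem _root_.QLie.wordF_quantumKilling (r s : A →ₗ[k] A →ₗ[k] k) :
    wordF R (quantumKilling r s) = wordF R s.flip * wordF R r := by
  refine conv_ext₂ fun m n u x hu hx i j p q => ?_
  rw [hu.conv_tmul hx]
  have h : quantumKilling r s (u i j) (x p q) =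
      (toConv (TensorProduct.lift s.flip) * toConv (TensorProduct.lift r)) (u i j ⊗ₜ x p q) := rfl
  rw [wordF_tmul, h, hu.conv_tmul hx]
  simp

include hs

/-- The Killing form is central: `q(a₍₁₎, b₍₁₎) a₍₂₎ b₍₂₎ = a₍₁₎ b₍₁₎ q(a₍₂₎, b₍₂₎)`. -/
theorem quantumKilling_central : wordF A (quantumKilling r s) *
    (wordL (LinearMap.id : A →ₗ[k] A) * wordR (LinearMap.id : A →ₗ[k] A)) =
    wordL (LinearMap.id : A →ₗ[k] A) * wordR (LinearMap.id : A →ₗ[k] A) *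
      wordF A (quantumKilling r s) := by
  -- With `X`, `Y` the identity in the two legs: `s₂₁ r X Y = s₂₁ Y X r = X Y s₂₁ r`.
  rw [wordF_quantumKilling, mul_assoc, ← hr.quasi_comm_word, ← mul_assoc, ← mul_assoc,
    mul_assoc (wordF A s.flip), ← hs.quasi_comm_word_flip, mul_assoc _ (wordF A s.flip)]

end IsCoquasitriangular

end ConvolutionWords

end

section

/-- Once a Sweedler identity is expanded in matrix entries, its two sides typically differ by a
permutation of summation indices; `e` and `e'` translate between the two orders. -/
theorem sum_reindex {α β M : Type*} [Fintype α] [Fintype β] [AddCommMonoid M] {f : α → M}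
    {g : β → M} (e : α → β) (e' : β → α) (h₁ : ∀ x, e' (e x) = x) (h₂ : ∀ y, e (e' y) = y)
    (h : ∀ x, f x = g (e x)) : ∑ x, f x = ∑ y, g y :=
  Fintype.sum_equiv ⟨e, e', h₁, h₂⟩ f g h

theorem ite_tmul' {R M N : Type*} [CommSemiring R] [AddCommMonoid M] [AddCommMonoid N] [Module R M]
    [Module R N] (p : Prop) [Decidable p] (x : M) (y : N) :
    (if p then x else 0) ⊗ₜ[R] y = if p then x ⊗ₜ y else 0 := by
  split_ifs <;> simp

/-! ### The right adjoint coaction, and the action `γ` adjoint to left multiplication. -/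

section Coactions

open WithConv

variable {k : Type u} {A : Type v} [Field k] [Ring A] [HopfAlgebra k A]

/-- The right adjoint coaction `c ↦ c₍₂₎ ⊗ S(c₍₁₎) c₍₃₎`. -/
def adR (k : Type u) (A : Type v) [Field k] [Ring A] [HopfAlgebra k A] : A →ₗ[k] A ⊗[k] A :=
  (LinearMap.mul' k A ∘ₗ (HopfAlgebra.antipode k (A := A)).rTensor A).lTensor A ∘ₗ
    (TensorProduct.leftComm k A A A).toLinearMap ∘ₗ
    (Coalgebra.comul (R := k) (A := A)).lTensor A ∘ₗ Coalgebra.comul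

/-- The action of `A*` on a right `A`-comodule: `v ↦ v⁽⁰⁾ f(v⁽¹⁾)`. -/
def coactBy {V : Type*} [AddCommMonoid V] [Module k V] (ρ : V →ₗ[k] V ⊗[k] A) :
    Module.Dual k A →ₗ[k] V →ₗ[k] V :=
  LinearMap.lcomp k V ρ ∘ₗ LinearMap.llcomp k (V ⊗[k] A) (V ⊗[k] k) V
    (TensorProduct.rid k V).toLinearMap ∘ₗ LinearMap.lTensorHom V

theorem coactBy_apply {V : Type*} [AddCommMonoid V] [Module k V] (ρ : V →ₗ[k] V ⊗[k] A)
    (f : Module.Dual k A) (v : V) :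
    coactBy ρ f v = TensorProduct.rid k V (f.lTensor V (ρ v)) := rfl

theorem RightComodule.IsFamily.coactBy {V : Type*} [AddCommGroup V] [Module k V]
    {M : RightComodule k A V} {ι : Type*} [Fintype ι] [DecidableEq ι] {e : ι → V} {u : ι → ι → A}
    (h : M.IsFamily e u) (f : Module.Dual k A) (j : ι) :
    coactBy M.coact f (e j) = ∑ i, f (u i j) • e i := by
  simp [coactBy_apply, h.coact]

theorem bilin_ext_corep {W : Type*} [AddCommMonoid W] [Module k W] {F G : A →ₗ[k] A →ₗ[k] W}
    (h : ∀ (m n : ℕ) (u : Fin m → Fin m → A) (x : Fin n → Fin n → A), IsCorep (k := k) u →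
      IsCorep (k := k) x → ∀ i j p q, F (u i j) (x p q) = G (u i j) (x p q)) : F = G :=
  hom_ext_corep fun m u hu i j => hom_ext_corep fun n x hx p q => h m n u x hu hx i j p q

namespace IsCorep

variable {ι κ : Type*} [Fintype ι] [DecidableEq ι] [Fintype κ] [DecidableEq κ]
  {u : ι → ι → A} {x : κ → κ → A}

theorem mul (hu : IsCorep (k := k) u) (hx : IsCorep (k := k) x) :
    IsCorep (k := k) (fun a b : ι × κ => u a.1 b.1 * x a.2 b.2) where
  comul i j := by
    simp only [Bialgebra.comul_mul, hu.comul, hx.comul, Finset.sum_mul_sum,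
      Algebra.TensorProduct.tmul_mul_tmul, Fintype.sum_prod_type]
  counit i j := by
    simp only [Bialgebra.counit_mul, hu.counit, hx.counit, Prod.ext_iff]
    split_ifs <;> simp_all

theorem adL_apply (hx : IsCorep (k := k) x) (p q : κ) :
    adL k A (x p q) = ∑ l, ∑ m, (x p l * HopfAlgebra.antipode k (x m q)) ⊗ₜ x l m := by
  simp only [adL, LinearMap.comp_apply, hx.comul, map_sum, LinearMap.lTensor_tmul,
    TensorProduct.tmul_sum, LinearEquiv.coe_coe, TensorProduct.comm_tmul,
    TensorProduct.assoc_symm_tmul, LinearMap.rTensor_tmul, LinearMap.mul'_apply]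

theorem adR_apply (hx : IsCorep (k := k) x) (p q : κ) :
    adR k A (x p q) = ∑ l, ∑ m, x l m ⊗ₜ (HopfAlgebra.antipode k (x p l) * x m q) := by
  simp only [adR, LinearMap.comp_apply, hx.comul, map_sum, LinearMap.lTensor_tmul,
    TensorProduct.tmul_sum, LinearEquiv.coe_coe, TensorProduct.leftComm_tmul,
    LinearMap.rTensor_tmul, LinearMap.mul'_apply]

theorem quantumKilling_apply (r s : A →ₗ[k] A →ₗ[k] k) (hu : IsCorep (k := k) u)
    (hx : IsCorep (k := k) x) (i j : ι) (p q : κ) :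
    quantumKilling r s (u i j) (x p q) =
      ∑ l, ∑ m, s (x p m) (u i l) * r (u l j) (x m q) := by
  have h := congrArg (fun f => f (u i j ⊗ₜ x p q)) (wordF_quantumKilling k r s)
  simpa [hu.conv_tmul hx] using h

end IsCorep

/-- The antipode reverses the coproduct because both maps are convolution inverses of `Δ` among the
maps `A → A ⊗ A`, one on the left and one on the right. -/
theorem comul_antipode_word :
    toConv (TensorProduct.map (HopfAlgebra.antipode k) (HopfAlgebra.antipode k) ∘ₗ
      (TensorProduct.comm k A A).toLinearMap ∘ₗ Coalgebra.comul) =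
    toConv (Coalgebra.comul (R := k) ∘ₗ HopfAlgebra.antipode k (A := A)) := by
  refine left_inv_eq_right_inv (a := toConv (Coalgebra.comul (R := k) (A := A))) ?_
    LinearMap.comul_right_inv
  refine WithConv.ext (hom_ext_corep fun m u hu i j => ?_)
  change (_ * _ : WithConv (A →ₗ[k] A ⊗[k] A)) (u i j) = _
  rw [hu.conv_apply]
  simp only [LinearMap.comp_apply, hu.comul, map_sum, LinearEquiv.coe_coe,
    TensorProduct.comm_tmul, TensorProduct.map_tmul, Finset.sum_mul_sum,
    Algebra.TensorProduct.tmul_mul_tmul, LinearMap.convOne_apply, hu.counit]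
  have h : ∀ a b : Fin m, ∑ l, (HopfAlgebra.antipode k (u a l) * u l b) ⊗ₜ[k]
      (HopfAlgebra.antipode k (u i a) * u b j) = (if a = b then 1 else 0) ⊗ₜ[k]
      (HopfAlgebra.antipode k (u i a) * u b j) := fun a b => by
    rw [← TensorProduct.sum_tmul, hu.sum_antipode_mul]
  have h2 : ∑ l, ∑ a, ∑ b, (HopfAlgebra.antipode k (u a l) * u l b) ⊗ₜ[k]
      (HopfAlgebra.antipode k (u i a) * u b j) = (1 : A) ⊗ₜ[k] (if i = j then 1 else 0 : A) := by
    calc _ = ∑ a, ∑ b, ∑ l, (HopfAlgebra.antipode k (u a l) * u l b) ⊗ₜ[k]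
          (HopfAlgebra.antipode k (u i a) * u b j) := by
          simp only [← Fintype.sum_prod_type']
          exact sum_reindex (fun x => ⟨x.2.1, x.2.2, x.1⟩) (fun x => ⟨x.2.2, x.1, x.2.1⟩)
            (fun _ => rfl) (fun _ => rfl) fun _ => rfl
      _ = _ := by
          simp only [h, ite_tmul', Finset.sum_ite_eq, Finset.mem_univ, if_true,
            ← TensorProduct.tmul_sum, hu.sum_antipode_mul]
  rw [h2]
  split_ifs <;> simp

theorem IsCorep.comul_antipode {ι : Type*} [Fintype ι] [DecidableEq ι] {u : ι → ι → A}
    (hu : IsCorep (k := k) u) (i j : ι) :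
    Coalgebra.comul (R := k) (HopfAlgebra.antipode k (u i j)) =
      ∑ l, HopfAlgebra.antipode k (u l j) ⊗ₜ HopfAlgebra.antipode k (u i l) := by
  have h := congrArg (fun f => f (u i j)) (comul_antipode_word (k := k) (A := A))
  simpa [hu.comul] using h.symm

/-- The right adjoint comodule. -/
def adRComodule (k : Type u) (A : Type v) [Field k] [Ring A] [HopfAlgebra k A] :
    RightComodule k A A where
  coact := adR k A
  coact_coassoc := by
    refine hom_ext_corep fun m u hu i j => ?_
    simp only [LinearMap.comp_apply, hu.adR_apply, map_sum, LinearMap.rTensor_tmul,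
      LinearMap.lTensor_tmul, TensorProduct.sum_tmul, LinearEquiv.coe_coe,
      TensorProduct.assoc_tmul, Bialgebra.comul_mul, hu.comul, hu.comul_antipode,
      Finset.sum_mul_sum, Algebra.TensorProduct.tmul_mul_tmul, TensorProduct.tmul_sum]
    simp only [← Fintype.sum_prod_type']
    exact sum_reindex (fun x => ⟨x.2.2.1, x.2.2.2, x.1, x.2.1⟩)
      (fun x => ⟨x.2.2.1, x.2.2.2, x.1, x.2.1⟩) (fun _ => rfl) (fun _ => rfl) fun _ => rfl
  coact_counit := by
    refine hom_ext_corep fun m u hu i j => ?_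
    simp [hu.adR_apply, hu.counit]

variable {r s : A →ₗ[k] A →ₗ[k] k}

/-- The right action `γ(c, x) = s(x₍₁₎, c₍₁₎) c₍₂₎ r(c₍₃₎, x₍₂₎)` of `A` on itself. -/
def gam (r s : A →ₗ[k] A →ₗ[k] k) : A →ₗ[k] A →ₗ[k] A :=
  TensorProduct.curry (wordF A s.flip * wordL (LinearMap.id : A →ₗ[k] A) * wordF A r).ofConv

section

variable {ι κ : Type*} [Fintype ι] [DecidableEq ι] [Fintype κ] [DecidableEq κ]
  {u : ι → ι → A} {x : κ → κ → A}

theorem IsCorep.word_apply {R : Type*} [Ring R] [Algebra k R] (f h : A →ₗ[k] A →ₗ[k] k)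
    (g : A →ₗ[k] R) (hu : IsCorep (k := k) u) (hx : IsCorep (k := k) x) (i j : ι) (p q : κ) :
    (wordF R f * wordL g * wordF R h) (u i j ⊗ₜ x p q) =
      ∑ t, ∑ l, ∑ m, (f (u i l) (x p t) * h (u m j) (x t q)) • g (u l m) := by
  rw [hu.conv_tmul hx]
  simp only [hu.conv_tmul hx (wordF R f)]
  simp only [wordF_tmul, wordL_tmul, hx.counit, ite_smul, zero_smul, one_smul, mul_ite, mul_zero,
    Finset.sum_ite_eq', Finset.mem_univ, if_true, ← Algebra.smul_def, ← Algebra.commutes,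
    Finset.smul_sum, smul_smul]
  simp only [← Fintype.sum_prod_type']
  exact sum_reindex (fun x => ⟨x.2.1, x.2.2, x.1⟩) (fun x => ⟨x.2.2, x.1, x.2.1⟩)
    (fun _ => rfl) (fun _ => rfl) fun _ => by simp [mul_comm]

theorem IsCorep.gam_apply (r s : A →ₗ[k] A →ₗ[k] k) (hu : IsCorep (k := k) u)
    (hx : IsCorep (k := k) x) (i j : ι) (p q : κ) : gam r s (u i j) (x p q) =
      ∑ t, ∑ l, ∑ m, (s (x p t) (u i l) * r (u m j) (x t q)) • u l m :=
  hu.word_apply _ _ _ hx i j p q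

theorem gam_word (c y : A) : gam r s c y =
    (wordF A s.flip * wordL (LinearMap.id : A →ₗ[k] A) * wordF A r) (c ⊗ₜ y) := rfl

variable (hr : IsCoquasitriangular r)
include hr

/-- Splitting `r(S(c₍₁₎) c₍₃₎, y)` by multiplicativity exhibits the adjoint action through `r` as
conjugation by `r` in the convolution algebra. -/
theorem coactBy_adR_word (c y : A) : coactBy (adR k A) (r.flip y) c =
    (wordF A (r ∘ₗ HopfAlgebra.antipode k (A := A)) * wordL (LinearMap.id : A →ₗ[k] A) *
      wordF A r) (c ⊗ₜ y) := by
  have h : (coactBy (adR k A) ∘ₗ r.flip).flip = TensorProduct.curry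
      (wordF A (r ∘ₗ HopfAlgebra.antipode k (A := A)) *
      wordL (LinearMap.id : A →ₗ[k] A) * wordF A r).ofConv := by
    refine bilin_ext_corep fun m n u x hu hx i j p q => ?_
    rw [TensorProduct.curry_apply, hu.word_apply _ _ _ hx, LinearMap.flip_apply,
      LinearMap.comp_apply, coactBy_apply, hu.adR_apply]
    simp only [map_sum, LinearMap.lTensor_tmul, TensorProduct.rid_tmul, LinearMap.flip_apply,
      hr.mul_left_corep hx, LinearMap.comp_apply, LinearMap.id_apply, Finset.sum_smul]
    simp only [← Fintype.sum_prod_type']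
    exact sum_reindex (fun x => ⟨x.2.2, x.1, x.2.1⟩) (fun x => ⟨x.2.1, x.2.2, x.1⟩)
      (fun _ => rfl) (fun _ => rfl) fun _ => rfl
  exact LinearMap.congr_fun (LinearMap.congr_fun h c) y

/-- `γ(c, x) = q(c₍₁₎, x₍₁₎) λ_{x₍₂₎}(c₍₂₎)` with `λ_x(c) = c⁽⁰⁾ r(c⁽¹⁾, x)`. -/
theorem gam_eq_sum (hu : IsCorep (k := k) u) (hx : IsCorep (k := k) x) (i j : ι) (p q : κ) :
    gam r s (u i j) (x p q) = ∑ l, ∑ m, quantumKilling r s (u i l) (x p m) •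
      coactBy (adR k A) (r.flip (x m q)) (u l j) := by
  -- Inserting `r * r⁻¹ = 1` gives `s₂₁ * id * r = (s₂₁ * r) * (r⁻¹ * id * r)`, and the last bracket
  -- is the adjoint action.
  have h : wordF A s.flip * wordL (LinearMap.id : A →ₗ[k] A) * wordF A r =
      wordF A (quantumKilling r s) * (wordF A (r ∘ₗ HopfAlgebra.antipode k (A := A)) *
        wordL (LinearMap.id : A →ₗ[k] A) * wordF A r) := by
    rw [wordF_quantumKilling, mul_assoc (wordF A s.flip), mul_assoc, ← mul_assoc (wordF A r),
      ← mul_assoc (wordF A r), hr.mul_inv, one_mul]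
  rw [gam_word, h, hu.conv_tmul hx]
  simp only [wordF_tmul, coactBy_adR_word hr, ← Algebra.smul_def]

variable (hs : IsCoquasitriangular s)
include hs

/-- `q(γ(c, x), b) = q(c, x b)`. -/
theorem quantumKilling_gam (c y b : A) :
    quantumKilling r s (gam r s c y) b = quantumKilling r s c (y * b) := by
  have h : LinearMap.compr₂ (gam r s) (quantumKilling r s) =
      (LinearMap.llcomp k A A k ∘ₗ quantumKilling r s).compl₂ (LinearMap.mul k A) := by
    refine bilin_ext_corep fun m n u x hu hx i j p q => ?_
    refine hom_ext_corep fun n' y hy a b => ?_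
    -- Products of entries of `x` and `y` are entries of the product matrix, where `q` is expressed
    -- by `r` and `s`; their multiplicativity in the relevant arguments does the rest.
    have e := hu.quantumKilling_apply r s (hx.mul hy) i j (p, a) (q, b)
    simp only [LinearMap.compr₂_apply, LinearMap.compl₂_apply, LinearMap.comp_apply,
      LinearMap.llcomp_apply, LinearMap.mul_apply', e, hu.gam_apply r s hx, map_sum, map_smul,
      LinearMap.sum_apply, LinearMap.smul_apply, hu.quantumKilling_apply r s hy, smul_eq_mul,
      hr.mul_right_corep hu, hs.mul_left_corep hu, Finset.mul_sum, Finset.sum_mul]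
    simp only [← Fintype.sum_prod_type']
    exact sum_reindex (fun x => ⟨x.2.2.2.1, ⟨x.1, x.2.2.2.2⟩, x.2.2.1, x.2.1⟩)
      (fun x => ⟨x.2.1.1, x.2.2.2, x.2.2.1, x.1, x.2.1.2⟩)
      (fun _ => rfl) (fun _ => rfl) fun _ => by dsimp only; ring
  exact LinearMap.congr_fun (LinearMap.congr_fun (LinearMap.congr_fun h c) y) b

end

end Coactions

end

section

/-! ### Ad-invariance of the Killing form, and its behaviour on the covariantised product. -/

section Invariance

open WithConv

variable {k : Type u} {A : Type v} [Field k] [Ring A] [HopfAlgebra k A]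

theorem RightComodule.coactBy_coactBy {V : Type*} [AddCommGroup V] [Module k V]
    (M : RightComodule k A V) (f g : Module.Dual k A) (v : V) :
    coactBy M.coact f (coactBy M.coact g v) = coactBy M.coact (conv f g) v := by
  have h : coactBy M.coact f ∘ₗ coactBy M.coact g = coactBy M.coact (conv f g) := by
    refine M.hom_ext fun m e u he j => ?_
    have hc : ∀ i j, conv f g (u i j) = ∑ l, f (u i l) * g (u l j) := fun i j =>
      he.conv_apply (toConv f) (toConv g) i j
    simp only [LinearMap.comp_apply, he.coactBy, map_sum, map_smul, Finset.smul_sum, smul_smul, hc,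
      Finset.sum_smul]
    rw [Finset.sum_comm]
    simp only [mul_comm]
  exact LinearMap.congr_fun h v

theorem RightComodule.coactBy_counit {V : Type*} [AddCommGroup V] [Module k V]
    (M : RightComodule k A V) (v : V) : coactBy M.coact (Coalgebra.counit (R := k)) v = v :=
  LinearMap.congr_fun M.coact_counit v

/-- `d ↦ f(d⁽⁰⁾) d⁽¹⁾` for the right adjoint coaction. -/
def adCoeff (f : Module.Dual k A) : A →ₗ[k] A :=
  (TensorProduct.lid k A).toLinearMap ∘ₗ f.rTensor A ∘ₗ adR k A

theorem adCoeff_apply (f : Module.Dual k A) (d : A) :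
    adCoeff f d = TensorProduct.lid k A (f.rTensor A (adR k A d)) := rfl

theorem apply_adCoeff (f g : Module.Dual k A) (d : A) :
    g (adCoeff f d) = f (coactBy (adR k A) g d) := by
  rw [adCoeff_apply, coactBy_apply]
  generalize adR k A d = t
  induction t with
  | zero => simp
  | add x y hx hy => simp only [map_add, hx, hy]
  | tmul x y => simp [mul_comm]

variable {ι κ : Type*} [Fintype ι] [DecidableEq ι] [Fintype κ] [DecidableEq κ]
  {u : ι → ι → A} {x : κ → κ → A}

theorem IsCorep.adAct_apply (hx : IsCorep (k := k) x) (r : A →ₗ[k] A →ₗ[k] k) (a : A) (p q : κ) :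
    adAct r a (x p q) =
      ∑ l, ∑ m, r (x p l * HopfAlgebra.antipode k (x m q)) a • x l m := by
  simp [adAct, hx.adL_apply]

theorem IsCorep.covMul_apply (hx : IsCorep (k := k) x) (r : A →ₗ[k] A →ₗ[k] k) (b : A) (p q : κ) :
    covMul r (x p q) b = ∑ l, x p l * adAct r (HopfAlgebra.antipode k (x l q)) b := by
  simp only [covMul, hx.comul, map_sum, TensorProduct.lift.tmul]
  rfl

variable {r s : A →ₗ[k] A →ₗ[k] k} (hr : IsCoquasitriangular r)
include hr

theorem conv_flip_flip (b c : A) : conv (r.flip c) (r.flip b) = r.flip (b * c) := by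
  ext a
  rw [LinearMap.flip_apply, hr.mul_right]
  rfl

theorem coactBy_mul {V : Type*} [AddCommGroup V] [Module k V] (M : RightComodule k A V)
    (b c : A) (v : V) : coactBy M.coact (r.flip c) (coactBy M.coact (r.flip b) v) =
      coactBy M.coact (r.flip (b * c)) v := by
  rw [M.coactBy_coactBy, conv_flip_flip hr]

theorem conv_apply_apply (a b : A) : conv (r a) (r b) = r (a * b) := by
  ext c
  rw [hr.mul_left]
  rfl

theorem flip_one : r.flip 1 = Coalgebra.counit (R := k) := by
  ext a
  rw [LinearMap.flip_apply, hr.one_right]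

theorem apply_one : r 1 = Coalgebra.counit (R := k) := by
  ext a
  rw [hr.one_left]

/-- Both `r` and `r ∘ (S ⊗ S)` are inverse to `r ∘ (S ⊗ id)`, on the left and on the right. For the
second one, `S` reverses the coproduct and `r` reverses products in its second argument. -/
theorem antipode_antipode (a b : A) :
    r (HopfAlgebra.antipode k a) (HopfAlgebra.antipode k b) = r a b := by
  have h : wordF k r = wordF k ((r ∘ₗ HopfAlgebra.antipode k (A := A)).compl₂
      (HopfAlgebra.antipode k (A := A))) := by
    refine left_inv_eq_right_inv (hr.mul_inv k) ?_
    refine conv_ext₂ fun m n u x hu hx i j p q => ?_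
    rw [hu.conv_tmul hx, Finset.sum_comm]
    have e : ∀ b c : A, r (HopfAlgebra.antipode k (u i j)) (b * c) =
        ∑ l, r (HopfAlgebra.antipode k (u i l)) b * r (HopfAlgebra.antipode k (u l j)) c := by
      intro b c
      simp only [hr.mul_right, hu.comul_antipode, map_sum, TensorProduct.map_tmul,
        LinearMap.mul'_apply, LinearMap.flip_apply]
      simp only [mul_comm]
    simp only [wordF_tmul, LinearMap.comp_apply, LinearMap.compl₂_apply, Algebra.algebraMap_self,
      RingHom.id_apply, ← e, ← map_sum, hx.sum_mul_antipode]
    by_cases h : p = q <;> simp [h, hr.one_right, hx.counit]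
  have h2 := congrArg (fun f => f (a ⊗ₜ b)) h
  simpa using h2.symm

/-- The covariantised product in its second form `a ⬝ b = r(b₍₁₎, a⁽⁻¹⁾) b₍₂₎ a⁽⁰⁾`. -/
theorem covMul_corep (hu : IsCorep (k := k) u) (a : A) (i j : ι) :
    covMul r a (u i j) = ∑ c, u c j * (TensorProduct.lid k A ((r (u i c)).rTensor A (adL k A a)))
      := by
  -- The left side is `covMul` as a linear map of its first argument, so that this argument too may
  -- be a matrix entry.
  have h : TensorProduct.lift (LinearMap.mk₂ k (fun a₁ a₂ : A =>
        a₁ * adAct r (HopfAlgebra.antipode k a₂) (u i j))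
      (fun _ _ _ => add_mul _ _ _) (fun _ _ _ => smul_mul_assoc _ _ _)
      (fun _ _ _ => by simp [adAct, LinearMap.rTensor_add, mul_add])
      (fun _ _ _ => by simp [adAct, LinearMap.rTensor_smul])) ∘ₗ Coalgebra.comul =
      ∑ c, LinearMap.mulLeft k (u c j) ∘ₗ (TensorProduct.lid k A).toLinearMap ∘ₗ
        (r (u i c)).rTensor A ∘ₗ adL k A := by
    refine hom_ext_corep fun n x hx p q => ?_
    refine Eq.trans (hx.covMul_apply r (u i j) p q) ?_
    have e : ∀ (a b : A) l, r (a * b) (HopfAlgebra.antipode k (x l q)) =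
        ∑ m, r a (HopfAlgebra.antipode k (x m q)) * r b (HopfAlgebra.antipode k (x l m)) := by
      intro a b l
      simp only [hr.mul_left, hx.comul_antipode, map_sum, TensorProduct.map_tmul,
        LinearMap.mul'_apply]
    simp only [hu.adAct_apply, e, antipode_antipode hr, Finset.mul_sum, Finset.sum_smul,
      mul_smul_comm, LinearMap.sum_apply, LinearMap.comp_apply, hx.adL_apply, map_sum,
      LinearMap.rTensor_tmul, LinearEquiv.coe_coe, TensorProduct.lid_tmul,
      LinearMap.mulLeft_apply, hr.mul_right_corep hu]
    -- The inner double sum is one side of quasi-commutativity for `u` and `x`; the exchange moves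
    -- `u` to the left of `x`.
    calc _ = ∑ m, ∑ d, r (u i d) (HopfAlgebra.antipode k (x m q)) •
          ∑ c, ∑ l, r (u c j) (x l m) • (x p l * u d c) := by
          simp only [Finset.smul_sum, smul_smul]
          simp only [← Fintype.sum_prod_type']
          exact sum_reindex (fun z => ⟨z.2.2.2, z.2.1, z.2.2.1, z.1⟩)
            (fun z => ⟨z.2.2.2, z.2.1, z.2.2.1, z.1⟩) (fun _ => rfl) (fun _ => rfl) fun _ => rfl
      _ = ∑ m, ∑ d, r (u i d) (HopfAlgebra.antipode k (x m q)) •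
          ∑ c, ∑ l, r (u d c) (x p l) • (u c j * x l m) := by
          simp only [hr.quasi_comm_corep hu hx]
      _ = _ := by
          simp only [Finset.smul_sum, smul_smul]
          simp only [← Fintype.sum_prod_type']
          exact sum_reindex (fun z => ⟨z.2.2.1, z.2.2.2, z.1, z.2.1⟩)
            (fun z => ⟨z.2.2.1, z.2.2.2, z.1, z.2.1⟩) (fun _ => rfl) (fun _ => rfl) fun _ => rfl
  have h2 := LinearMap.congr_fun h a
  simp only [LinearMap.sum_apply] at h2
  exact h2

variable (hs : IsCoquasitriangular s)
include hs

/-- Invariance of the Killing form: `q(c, a⁽⁰⁾) a⁽⁻¹⁾ = q(c⁽⁰⁾, a) c⁽¹⁾`. -/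
theorem quantumKilling_invariant (c a : A) :
    TensorProduct.rid k A ((quantumKilling r s c).lTensor A (adL k A a)) =
      adCoeff ((quantumKilling r s).flip a) c := by
  have hL : ∀ (m n : ℕ) (u : Fin m → Fin m → A) (x : Fin n → Fin n → A), IsCorep (k := k) u →
      IsCorep (k := k) x → ∀ i j p q,
      TensorProduct.rid k A ((quantumKilling r s (u i j)).lTensor A (adL k A (x p q))) =
        adCoeff ((quantumKilling r s).flip (x p q)) (u i j) := by
    intro m n u x hu hx i j p q
    let Q := wordF A (quantumKilling r s)
    let X : WithConv (A ⊗[k] A →ₗ[k] A) := wordL LinearMap.id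
    let Y : WithConv (A ⊗[k] A →ₗ[k] A) := wordR LinearMap.id
    -- Centrality `Q X Y = X Y Q`, multiplied by `X⁻¹` on the left and `Y⁻¹` on the right, says `Y Q
    -- Y⁻¹ = X⁻¹ Q X`. The two conjugations are the left adjoint coaction in the second leg and the
    -- right adjoint coaction in the first.
    have h : Y * (Q * wordR (HopfAlgebra.antipode k (A := A))) =
        wordL (HopfAlgebra.antipode k (A := A)) * (Q * X) := by
      have h1 : Q * (X * Y) = X * Y * Q := hr.quantumKilling_central hs
      calc _ = wordL (HopfAlgebra.antipode k (A := A)) * X * Y *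
            (Q * wordR (HopfAlgebra.antipode k (A := A))) := by rw [wordL_antipode_mul, one_mul]
        _ = wordL (HopfAlgebra.antipode k (A := A)) * (X * Y * Q) *
            wordR (HopfAlgebra.antipode k (A := A)) := by
            simp only [mul_assoc]
        _ = wordL (HopfAlgebra.antipode k (A := A)) * (Q * X) *
            (Y * wordR (HopfAlgebra.antipode k (A := A))) := by
            rw [← h1]; simp only [mul_assoc]
        _ = _ := by rw [wordR_mul_antipode, mul_one]
    have h2 := congrArg (fun f => f (u i j ⊗ₜ x p q)) h
    simp only [hu.conv_tmul hx] at h2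
    simp only [Q, X, Y, wordF_tmul, wordL_tmul, wordR_tmul, hx.counit, hu.counit,
      LinearMap.id_apply, ite_smul, zero_smul, one_smul, mul_ite, ite_mul, zero_mul, mul_zero,
      smul_ite, smul_zero, Finset.sum_ite_eq', Finset.sum_ite_eq, Finset.mem_univ, if_true, ← Algebra.smul_def,
      Finset.mul_sum, mul_smul_comm, Finset.sum_ite_irrel, Finset.sum_const_zero] at h2
    simp only [adCoeff_apply, hx.adL_apply, hu.adR_apply, map_sum, LinearMap.lTensor_tmul,
      LinearMap.rTensor_tmul, TensorProduct.lid_tmul, TensorProduct.rid_tmul,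
      LinearMap.flip_apply]
    exact h2
  have h : (LinearMap.llcomp k (A ⊗[k] A) (A ⊗[k] k) A (TensorProduct.rid k A).toLinearMap ∘ₗ
      LinearMap.lTensorHom A ∘ₗ quantumKilling r s).compl₂ (adL k A) =
      ((LinearMap.llcomp k (A ⊗[k] A) (k ⊗[k] A) A (TensorProduct.lid k A).toLinearMap ∘ₗ
      LinearMap.rTensorHom A ∘ₗ (quantumKilling r s).flip).compl₂ (adR k A)).flip :=
    bilin_ext_corep hL
  exact LinearMap.congr_fun (LinearMap.congr_fun h c) a

/-- `q(d⁽⁰⁾, y₍₁₎) d⁽¹⁾ y₍₂₎ = y₍₁₎ q(d, y₍₂₎)`. -/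
theorem sum_adCoeff_mul (hx : IsCorep (k := k) x) (d : A) (p q : κ) :
    ∑ t, adCoeff ((quantumKilling r s).flip (x p t)) d * x t q =
      ∑ t, quantumKilling r s d (x t q) • x p t := by
  simp only [← quantumKilling_invariant hr hs, hx.adL_apply, map_sum, LinearMap.lTensor_tmul,
    TensorProduct.rid_tmul, Finset.sum_mul, smul_mul_assoc, mul_assoc]
  calc _ = ∑ l, ∑ m, quantumKilling r s d (x l m) • (x p l *
        ∑ t, HopfAlgebra.antipode k (x m t) * x t q) := by
        simp only [Finset.mul_sum, Finset.smul_sum]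
        simp only [← Fintype.sum_prod_type']
        exact sum_reindex (fun z => ⟨z.2.1, z.2.2, z.1⟩) (fun z => ⟨z.2.2, z.1, z.2.1⟩)
          (fun _ => rfl) (fun _ => rfl) fun _ => rfl
    _ = _ := by simp [hx.sum_antipode_mul]

/-- This is invariance evaluated under `r(-, y)`: the action on the second argument is adjoint to
the action of `r(-, y)` on the first through `adR`. -/
theorem quantumKilling_adAct (c y b : A) : quantumKilling r s c (adAct r y b) =
    quantumKilling r s (coactBy (adR k A) (r.flip y) c) b := by
  have h : r.flip y (adCoeff ((quantumKilling r s).flip b) c) =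
      quantumKilling r s (coactBy (adR k A) (r.flip y) c) b := apply_adCoeff _ _ c
  rw [← h, ← quantumKilling_invariant hr hs]
  simp only [adAct, LinearMap.comp_apply]
  generalize adL k A b = t
  induction t with
  | zero => simp
  | add x y hx hy => simp only [map_add, hx, hy]
  | tmul x y => simp [mul_comm]

/-- `q(c, a ⬝ b) = q(c₍₁₎, a) q(c₍₂₎, b)`. -/
theorem quantumKilling_covMul_corep (hu : IsCorep (k := k) u) (a b : A) (i j : ι) :
    quantumKilling r s (u i j) (covMul r a b) =
      ∑ l, quantumKilling r s (u i l) a * quantumKilling r s (u l j) b := by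
  have h : quantumKilling r s (u i j) ∘ₗ TensorProduct.lift (LinearMap.mk₂ k (fun a₁ a₂ : A =>
        a₁ * adAct r (HopfAlgebra.antipode k a₂) b)
      (fun _ _ _ => add_mul _ _ _) (fun _ _ _ => smul_mul_assoc _ _ _)
      (fun _ _ _ => by simp [adAct, LinearMap.rTensor_add, mul_add])
      (fun _ _ _ => by simp [adAct, LinearMap.rTensor_smul])) ∘ₗ Coalgebra.comul =
      ∑ l, quantumKilling r s (u l j) b • quantumKilling r s (u i l) := by
    refine hom_ext_corep fun n x hx p q => ?_
    refine Eq.trans (congrArg (quantumKilling r s (u i j)) (hx.covMul_apply r b p q)) ?_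
    simp only [map_sum, ← quantumKilling_gam hr hs, quantumKilling_adAct hr hs,
      gam_eq_sum hr hu hx, map_smul, LinearMap.sum_apply, LinearMap.smul_apply, smul_eq_mul]
    have e : ∀ y z c : A, coactBy (adR k A) (r.flip y) (coactBy (adR k A) (r.flip z) c) =
        coactBy (adR k A) (r.flip (z * y)) c := fun y z c => coactBy_mul hr (adRComodule k A) z y c
    simp only [e]
    -- The two successive actions combine into that of `x m l * S(x l q)`; the sum over `l`
    -- collapses to the unit or zero.
    calc _ = ∑ h, ∑ m, quantumKilling r s (u i h) (x p m) *
          quantumKilling r s (coactBy (adR k A) (r.flip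
            (∑ l, x m l * HopfAlgebra.antipode k (x l q))) (u h j)) b := by
          simp only [map_sum, LinearMap.sum_apply, Finset.mul_sum]
          simp only [← Fintype.sum_prod_type']
          exact sum_reindex (fun z => ⟨z.2.1, z.2.2, z.1⟩) (fun z => ⟨z.2.2, z.1, z.2.1⟩)
            (fun _ => rfl) (fun _ => rfl) fun _ => rfl
      _ = _ := by
          have e1 : ∀ c : A, coactBy (adR k A) (r.flip 1) c = c := fun c => by
            rw [flip_one hr]
            exact (adRComodule k A).coactBy_counit c
          have e2 : ∀ (p : Prop) [Decidable p] (c : A), quantumKilling r s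
              (coactBy (adR k A) (r.flip (if p then 1 else 0)) c) b =
              if p then quantumKilling r s c b else 0 := by
            intro p _ c
            split_ifs <;> simp [e1]
          simp only [hx.sum_mul_antipode, e2, mul_ite, mul_zero, Finset.sum_ite_eq',
            Finset.mem_univ, if_true]
          exact Finset.sum_congr rfl fun _ _ => mul_comm _ _
  have h2 := LinearMap.congr_fun h a
  simp only [LinearMap.sum_apply, LinearMap.smul_apply, smul_eq_mul] at h2
  refine Eq.trans h2 ?_
  simp only [mul_comm]

theorem quantumKilling_covMul (c a b : A) :
    quantumKilling r s c (covMul r a b) = LinearMap.mul' k k (TensorProduct.map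
      ((quantumKilling r s).flip a) ((quantumKilling r s).flip b) (Coalgebra.comul c)) := by
  have h : (quantumKilling r s).flip (covMul r a b) = LinearMap.mul' k k ∘ₗ TensorProduct.map
      ((quantumKilling r s).flip a) ((quantumKilling r s).flip b) ∘ₗ Coalgebra.comul := by
    refine hom_ext_corep fun m u hu i j => ?_
    rw [LinearMap.flip_apply, quantumKilling_covMul_corep hr hs hu]
    simp [hu.comul]
  exact LinearMap.congr_fun h c

end Invariance

end

section

/-! ### Tensor products of comodules and their braiding. -/

section TensorComodule

variable {k : Type u} {A : Type v} [Field k] [Ring A] [HopfAlgebra k A]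
  {V W : Type*} [AddCommGroup V] [Module k V] [AddCommGroup W] [Module k W]
  {M : RightComodule k A V} {N : RightComodule k A W}
  {ι κ : Type*} [Fintype ι] [DecidableEq ι] [Fintype κ] [DecidableEq κ]
  {e : ι → V} {u : ι → ι → A} {f : κ → W} {x : κ → κ → A}

/-- Linear maps out of a tensor product of comodules are determined on tensors of families. -/
theorem RightComodule.hom_ext₂ (M : RightComodule k A V) (N : RightComodule k A W) {Z : Type*}
    [AddCommMonoid Z] [Module k Z] {F G : V ⊗[k] W →ₗ[k] Z}
    (h : ∀ (m n : ℕ) (e : Fin m → V) (u : Fin m → Fin m → A) (f : Fin n → W)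
      (x : Fin n → Fin n → A), M.IsFamily e u → N.IsFamily f x →
      ∀ i p, F (e i ⊗ₜ f p) = G (e i ⊗ₜ f p)) : F = G := by
  refine TensorProduct.ext (M.hom_ext fun m e u he i => N.hom_ext fun n f x hf p => ?_)
  exact h m n e u f x he hf i p

theorem RightComodule.IsFamily.coactTensor_apply (he : M.IsFamily e u) (hf : N.IsFamily f x) (i : ι)
    (p : κ) : coactTensor M.coact N.coact (e i ⊗ₜ f p) =
      ∑ j, ∑ q, (e j ⊗ₜ f q) ⊗ₜ (u j i * x q p) := by
  simp only [QLie.coactTensor, LinearMap.comp_apply, TensorProduct.map_tmul, he.coact, hf.coact,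
    TensorProduct.sum_tmul, TensorProduct.tmul_sum, map_sum, LinearEquiv.coe_coe,
    TensorProduct.tensorTensorTensorComm_tmul, LinearMap.lTensor_tmul, LinearMap.mul'_apply]
  exact Finset.sum_comm

/-- The tensor product of two right comodules. -/
def RightComodule.tensor (M : RightComodule k A V) (N : RightComodule k A W) :
    RightComodule k A (V ⊗[k] W) where
  coact := coactTensor M.coact N.coact
  coact_coassoc := by
    refine M.hom_ext₂ N fun m n e u f x he hf i p => ?_
    simp only [LinearMap.comp_apply, he.coactTensor_apply hf, map_sum, LinearMap.rTensor_tmul,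
      LinearMap.lTensor_tmul, TensorProduct.sum_tmul, LinearEquiv.coe_coe,
      TensorProduct.assoc_tmul, Bialgebra.comul_mul, he.comul, hf.comul, Finset.sum_mul_sum,
      Algebra.TensorProduct.tmul_mul_tmul, TensorProduct.tmul_sum]
    simp only [← Fintype.sum_prod_type']
    exact sum_reindex (fun x => ⟨x.2.2.1, x.2.2.2, x.1, x.2.1⟩)
      (fun x => ⟨x.2.2.1, x.2.2.2, x.1, x.2.1⟩) (fun _ => rfl) (fun _ => rfl) fun _ => rfl
  coact_counit := by
    refine M.hom_ext₂ N fun m n e u f x he hf i p => ?_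
    simp [he.coactTensor_apply hf, he.counit, hf.counit]

theorem RightComodule.IsFamily.tensor (he : M.IsFamily e u) (hf : N.IsFamily f x) :
    (M.tensor N).IsFamily (fun a : ι × κ => e a.1 ⊗ₜ[k] f a.2)
      (fun a b : ι × κ => u a.1 b.1 * x a.2 b.2) where
  toIsCorep := he.toIsCorep.mul hf.toIsCorep
  coact a := by
    rw [Fintype.sum_prod_type]
    exact he.coactTensor_apply hf a.1 a.2

theorem RightComodule.IsFamily.coactBy_tensor (he : M.IsFamily e u) (hf : N.IsFamily f x)
    (φ : Module.Dual k A) (i : ι) (p : κ) :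
    QLie.coactBy (coactTensor M.coact N.coact) φ (e i ⊗ₜ f p) =
      ∑ j, ∑ q, φ (u j i * x q p) • e j ⊗ₜ f q := by
  have h := (he.tensor hf).coactBy φ (i, p)
  rw [Fintype.sum_prod_type] at h
  exact h

variable (r : A →ₗ[k] A →ₗ[k] k)

theorem RightComodule.IsFamily.braiding_right (ρ : V →ₗ[k] V ⊗[k] A) (hf : N.IsFamily f x) (v : V)
    (p : κ) : braiding r ρ N.coact (v ⊗ₜ f p) = ∑ q, f q ⊗ₜ QLie.coactBy ρ (r.flip (x q p)) v := by
  simp only [QLie.braiding, LinearMap.comp_apply, TensorProduct.map_tmul, hf.coact, coactBy_apply]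
  generalize ρ v = t
  induction t with
  | zero => simp
  | add a b ha hb =>
    simp only [TensorProduct.add_tmul, map_add, ha, hb, TensorProduct.tmul_add,
      Finset.sum_add_distrib]
  | tmul a b => simp [TensorProduct.tmul_sum]

theorem RightComodule.IsFamily.braiding_left (ρ : W →ₗ[k] W ⊗[k] A) (he : M.IsFamily e u) (w : W)
    (i : ι) : braiding r M.coact ρ (e i ⊗ₜ w) = ∑ j, QLie.coactBy ρ (r (u j i)) w ⊗ₜ e j := by
  simp only [QLie.braiding, LinearMap.comp_apply, TensorProduct.map_tmul, he.coact, coactBy_apply]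
  generalize ρ w = t
  induction t with
  | zero => simp
  | add a b ha hb =>
    simp only [TensorProduct.add_tmul, map_add, ha, hb, TensorProduct.tmul_add,
      Finset.sum_add_distrib]
  | tmul a b => simp [TensorProduct.sum_tmul, TensorProduct.smul_tmul']

theorem RightComodule.IsFamily.braiding_apply (he : M.IsFamily e u) (hf : N.IsFamily f x) (i : ι)
    (p : κ) : braiding r M.coact N.coact (e i ⊗ₜ f p) =
      ∑ j, ∑ q, r (u j i) (x q p) • f q ⊗ₜ e j := by
  rw [he.braiding_left]
  simp only [hf.coactBy, TensorProduct.sum_tmul, TensorProduct.smul_tmul']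

omit [Ring A] [HopfAlgebra k A] in
theorem midMap_tmul {V V' W W' : Type*} [AddCommMonoid V] [Module k V] [AddCommMonoid W]
    [Module k W] [AddCommMonoid V'] [Module k V'] [AddCommMonoid W'] [Module k W']
    (Ψ : V' ⊗[k] W →ₗ[k] W ⊗[k] V') (a : V) (b : V') (c : W) (d : W') :
    midMap Ψ ((a ⊗ₜ b) ⊗ₜ (c ⊗ₜ d) : (V ⊗[k] V') ⊗[k] (W ⊗[k] W')) =
      (TensorProduct.assoc k V W (V' ⊗[k] W')).symm
        (a ⊗ₜ TensorProduct.assoc k W V' W' (Ψ (b ⊗ₜ c) ⊗ₜ d)) := rfl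

/-- A linear map commuting with the coactions. -/
def IsComoduleMap (ρ : V →ₗ[k] V ⊗[k] A) (ρ' : W →ₗ[k] W ⊗[k] A) (F : V →ₗ[k] W) : Prop :=
  ρ' ∘ₗ F = F.rTensor A ∘ₗ ρ

theorem IsComoduleMap.coactBy {ρ : V →ₗ[k] V ⊗[k] A} {ρ' : W →ₗ[k] W ⊗[k] A} {F : V →ₗ[k] W}
    (h : IsComoduleMap ρ ρ' F) (φ : Module.Dual k A) (v : V) :
    F (coactBy ρ φ v) = coactBy ρ' φ (F v) := by
  have h2 : ρ' (F v) = F.rTensor A (ρ v) := LinearMap.congr_fun h v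
  rw [coactBy_apply, coactBy_apply, h2]
  generalize ρ v = t
  induction t with
  | zero => simp
  | add x y hx hy => simp only [map_add, hx, hy]
  | tmul x y => simp

/-- On matrix entries this is exactly quasi-commutativity of `r`. -/
theorem isComoduleMap_braiding {r : A →ₗ[k] A →ₗ[k] k} (hr : IsCoquasitriangular r)
    (M : RightComodule k A V) (N : RightComodule k A W) :
    IsComoduleMap (coactTensor M.coact N.coact) (coactTensor N.coact M.coact)
      (QLie.braiding r M.coact N.coact) := by
  refine M.hom_ext₂ N fun m n e u f x he hf i p => ?_
  simp only [LinearMap.comp_apply, he.braiding_apply r hf, hf.coactTensor_apply he, he.coactTensor_apply hf, map_sum,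
    map_smul, LinearMap.rTensor_tmul, TensorProduct.sum_tmul, ← TensorProduct.smul_tmul',
    Finset.smul_sum]
  have h := fun j q => congrArg (fun t => (f q ⊗ₜ[k] e j) ⊗ₜ[k] t)
    (hr.quasi_comm_corep he.toIsCorep hf.toIsCorep j i q p)
  simp only [TensorProduct.tmul_sum, TensorProduct.tmul_smul] at h
  calc _ = ∑ j, ∑ q, ∑ l, ∑ m, r (u l i) (x m p) • (f q ⊗ₜ[k] e j) ⊗ₜ[k] (x q m * u j l) := by
        simp only [← Fintype.sum_prod_type']
        exact sum_reindex (fun z => ⟨z.2.2.2, z.2.2.1, z.1, z.2.1⟩)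
          (fun z => ⟨z.2.2.1, z.2.2.2, z.2.1, z.1⟩) (fun _ => rfl) (fun _ => rfl) fun _ => rfl
    _ = ∑ j, ∑ q, ∑ l, ∑ m, r (u j l) (x q m) • (f q ⊗ₜ[k] e j) ⊗ₜ[k] (u l i * x m p) :=
        Finset.sum_congr rfl fun j _ => Finset.sum_congr rfl fun q _ => h j q
    _ = _ := by
        simp only [← Fintype.sum_prod_type']
        exact sum_reindex (fun z => ⟨z.2.2.1, z.2.2.2, z.1, z.2.1⟩)
          (fun z => ⟨z.2.2.1, z.2.2.2, z.1, z.2.1⟩) (fun _ => rfl) (fun _ => rfl) fun _ => rfl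

end TensorComodule

section Upsilon

variable {k : Type u} {A : Type v} [Field k] [Ring A] [HopfAlgebra k A]
  {V : Type*} [AddCommGroup V] [Module k V]

/-- The map `([ , ] ⊗ id) (id ⊗ Ψ) (Δ ⊗ id)`. -/
def upsilon (Ψ : V ⊗[k] V →ₗ[k] V ⊗[k] V) (Δ : V →ₗ[k] V ⊗[k] V) (br : V ⊗[k] V →ₗ[k] V) :
    V ⊗[k] V →ₗ[k] V ⊗[k] V :=
  br.rTensor V ∘ₗ (TensorProduct.assoc k V V V).symm.toLinearMap ∘ₗ Ψ.lTensor V ∘ₗ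
    (TensorProduct.assoc k V V V).toLinearMap ∘ₗ Δ.rTensor V

-- Moving `c₍₂₎` past `f` and bracketing `c₍₁₎` with the result is already `Υ(c ⊗ f)`; one bracket
-- with `g` remains. This reduces the right sides of the Jacobi identity and of the coalgebra axiom
-- for the bracket to `Υ`.
omit [Ring A] [HopfAlgebra k A] in
theorem map_bracket_midMap (Ψ : V ⊗[k] V →ₗ[k] V ⊗[k] V) (Δ : V →ₗ[k] V ⊗[k] V)
    (br : V ⊗[k] V →ₗ[k] V) (c f g : V) :
    TensorProduct.map br br (midMap Ψ (Δ c ⊗ₜ (f ⊗ₜ g))) =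
      br.lTensor V (TensorProduct.assoc k V V V (upsilon Ψ Δ br (c ⊗ₜ f) ⊗ₜ g)) := by
  simp only [upsilon, LinearMap.comp_apply, LinearMap.rTensor_tmul, LinearEquiv.coe_coe]
  generalize Δ c = t
  induction t with
  | zero => simp
  | add a b ha hb => simp only [TensorProduct.add_tmul, map_add, ha, hb]
  | tmul a b =>
    simp only [midMap_tmul, TensorProduct.assoc_tmul, LinearMap.lTensor_tmul]
    generalize Ψ (b ⊗ₜ f) = t
    induction t with
    | zero => simp
    | add a b ha hb => simp only [TensorProduct.add_tmul, TensorProduct.tmul_add, map_add, ha, hb]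
    | tmul a b => simp

end Upsilon

/-! ### The braided Lie structure of `A`, up to the kernel of the Killing form. -/

section AdjointBraidedLie

variable {k : Type u} {A : Type v} [Field k] [Ring A] [HopfAlgebra k A]

/-- The bracket `[c, d] = d⁽⁰⁾ q(c, d⁽¹⁾)` on `A`. -/
def brA (q : A →ₗ[k] Module.Dual k A) : A ⊗[k] A →ₗ[k] A :=
  TensorProduct.lift (coactBy (adR k A) ∘ₗ q)

@[simp] theorem brA_tmul (q : A →ₗ[k] Module.Dual k A) (c d : A) :
    brA q (c ⊗ₜ d) = coactBy (adR k A) (q c) d := rfl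

theorem adR_comul : coactTensor (adR k A) (adR k A) ∘ₗ Coalgebra.comul =
    (Coalgebra.comul (R := k)).rTensor A ∘ₗ adR k A := by
  refine hom_ext_corep fun m u hu i j => ?_
  simp only [coactTensor, LinearMap.comp_apply, hu.comul, hu.adR_apply, map_sum,
    TensorProduct.map_tmul, TensorProduct.sum_tmul, TensorProduct.tmul_sum, LinearEquiv.coe_coe,
    TensorProduct.tensorTensorTensorComm_tmul, LinearMap.lTensor_tmul, LinearMap.mul'_apply,
    LinearMap.rTensor_tmul]
  calc _ = ∑ l, ∑ b, ∑ m', ∑ a, (u l m' ⊗ₜ[k] u a b) ⊗ₜ[k] (HopfAlgebra.antipode k (u i l) *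
        (∑ h, u m' h * HopfAlgebra.antipode k (u h a)) * u b j) := by
        simp only [Finset.mul_sum, Finset.sum_mul, TensorProduct.tmul_sum, mul_assoc]
        simp only [← Fintype.sum_prod_type']
        exact sum_reindex (fun z => ⟨z.2.2.2.1, z.2.2.1, z.2.2.2.2, z.2.1, z.1⟩)
          (fun z => ⟨z.2.2.2.2, z.2.2.2.1, z.2.1, z.1, z.2.2.1⟩)
          (fun _ => rfl) (fun _ => rfl) fun _ => rfl
    _ = _ := by
        simp only [hu.sum_mul_antipode, mul_ite, mul_zero, mul_one, ite_mul, zero_mul]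
        refine Finset.sum_congr rfl fun l _ => Finset.sum_congr rfl fun b _ =>
          Finset.sum_congr rfl fun m' _ => ?_
        rw [Finset.sum_eq_single m']
        · simp
        · intro a _ ha
          simp [ha.symm]
        · simp

theorem adR_counit : (TensorProduct.lid k A).toLinearMap ∘ₗ
    (Coalgebra.counit (R := k)).rTensor A ∘ₗ adR k A =
      LinearMap.toSpanSingleton k A 1 ∘ₗ Coalgebra.counit := by
  refine hom_ext_corep fun m u hu i j => ?_
  simp [hu.adR_apply, hu.counit, hu.sum_antipode_mul]

variable {ι κ : Type*} [Fintype ι] [DecidableEq ι] [Fintype κ] [DecidableEq κ]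
  {e : ι → A} {u : ι → ι → A} {f : κ → A} {x : κ → κ → A}

theorem RightComodule.IsFamily.adCoeff_apply (he : (adRComodule k A).IsFamily e u)
    (φ : Module.Dual k A) (i : ι) : adCoeff φ (e i) = ∑ j, φ (e j) • u j i := by
  have h : adR k A (e i) = _ := he.coact i
  simp [QLie.adCoeff, h]

theorem RightComodule.IsFamily.brA_apply (he : (adRComodule k A).IsFamily e u)
    (q : A →ₗ[k] Module.Dual k A) (c : A) (i : ι) :
    brA q (c ⊗ₜ e i) = ∑ j, q c (u j i) • e j :=
  he.coactBy (q c) i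

/-- The braiding of the right adjoint comodule. -/
abbrev psiA (r : A →ₗ[k] A →ₗ[k] k) : A ⊗[k] A →ₗ[k] A ⊗[k] A :=
  braiding r (adR k A) (adR k A)

variable (r s : A →ₗ[k] A →ₗ[k] k)

/-- The canonical braiding of `A`. -/
abbrev upsA : A ⊗[k] A →ₗ[k] A ⊗[k] A :=
  upsilon (psiA r) Coalgebra.comul (brA (quantumKilling r s))

theorem RightComodule.IsFamily.psiA_right (he : (adRComodule k A).IsFamily e u) (c : A) (i : ι) :
    psiA r (c ⊗ₜ e i) = ∑ j, e j ⊗ₜ QLie.coactBy (adR k A) (r.flip (u j i)) c :=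
  he.braiding_right r (adR k A) c i

theorem RightComodule.IsFamily.psiA_left (he : (adRComodule k A).IsFamily e u) (c : A) (i : ι) :
    psiA r (e i ⊗ₜ c) = ∑ j, QLie.coactBy (adR k A) (r (u j i)) c ⊗ₜ e j :=
  he.braiding_left r (adR k A) c i

variable {r s} (hr : IsCoquasitriangular r)
include hr

/-- The bracket contributes a factor `q` and the braiding the adjoint action through `r`; by
`gam_eq_sum` their convolution is `γ`. In this form `Υ` combines directly with `q(γ(c, x), b) = q(c,
xb)`. -/
theorem RightComodule.IsFamily.upsA_apply (he : (adRComodule k A).IsFamily e u) (c : A) (i : ι) :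
    upsA r s (c ⊗ₜ e i) = ∑ j, e j ⊗ₜ gam r s c (u j i) := by
  have h : upsA r s ∘ₗ (TensorProduct.mk k A A).flip (e i) =
      ∑ j, TensorProduct.mk k A A (e j) ∘ₗ (gam r s).flip (u j i) := by
    refine hom_ext_corep fun n x hx p q => ?_
    simp only [QLie.upsA, upsilon, LinearMap.comp_apply, LinearMap.flip_apply,
      TensorProduct.mk_apply, LinearMap.rTensor_tmul, hx.comul, TensorProduct.sum_tmul, map_sum,
      LinearEquiv.coe_coe, TensorProduct.assoc_tmul, LinearMap.lTensor_tmul, he.psiA_right,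
      TensorProduct.tmul_sum, TensorProduct.assoc_symm_tmul, he.brA_apply, LinearMap.sum_apply,
      gam_eq_sum hr hx he.toIsCorep, TensorProduct.smul_tmul]
    simp only [← Fintype.sum_prod_type']
    exact sum_reindex (fun z => ⟨z.2.2, z.1, z.2.1⟩) (fun z => ⟨z.2.1, z.2.2, z.1⟩)
      (fun _ => rfl) (fun _ => rfl) fun _ => rfl
  have h2 := LinearMap.congr_fun h c
  simpa using h2

variable (hs : IsCoquasitriangular s)
include hs

/-- On a family, colinearity of the bracket is the form of invariance given by `sum_adCoeff_mul`. -/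
theorem isComoduleMap_brA : IsComoduleMap (coactTensor (adR k A) (adR k A)) (adR k A)
    (brA (quantumKilling r s)) := by
  refine TensorProduct.ext (LinearMap.ext fun c => (adRComodule k A).hom_ext
    fun m e u he i => ?_)
  have hc : ∀ i, adR k A (e i) = _ := he.coact
  have h1 : (coactTensor (adR k A) (adR k A) (c ⊗ₜ e i)) = ∑ j, (LinearMap.lTensor (A ⊗[k] A)
      (LinearMap.mulRight k (u j i))) ((TensorProduct.comm k A A).toLinearMap.rTensor A
        ((TensorProduct.assoc k A A A).symm (e j ⊗ₜ adR k A c))) := by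
    simp only [coactTensor, LinearMap.comp_apply, TensorProduct.map_tmul, hc]
    generalize adR k A c = t
    induction t with
    | zero => simp
    | add a b ha hb =>
      simp only [TensorProduct.add_tmul, TensorProduct.tmul_add, map_add, ha, hb,
        Finset.sum_add_distrib]
    | tmul a b => simp [TensorProduct.tmul_sum]
  have h2 : ∀ j, (brA (quantumKilling r s)).rTensor A ((LinearMap.lTensor (A ⊗[k] A)
      (LinearMap.mulRight k (u j i))) ((TensorProduct.comm k A A).toLinearMap.rTensor A
        ((TensorProduct.assoc k A A A).symm (e j ⊗ₜ adR k A c)))) =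
      ∑ l, e l ⊗ₜ (adCoeff ((quantumKilling r s).flip (u l j)) c * u j i) := by
    intro j
    simp only [adCoeff_apply]
    generalize adR k A c = t
    induction t with
    | zero => simp
    | add a b ha hb =>
      simp only [TensorProduct.tmul_add, map_add, ha, hb, Finset.sum_add_distrib, add_mul]
    | tmul a b =>
      simp [-brA_tmul, he.brA_apply, TensorProduct.sum_tmul, TensorProduct.smul_tmul]
  simp only [LinearMap.compr₂ₛₗ_apply, TensorProduct.mk_apply, LinearMap.comp_apply, h1, map_sum,
    h2, he.brA_apply, map_smul, hc]
  rw [Finset.sum_comm]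
  simp only [← TensorProduct.tmul_sum, sum_adCoeff_mul hr hs he.toIsCorep]
  simp only [Finset.smul_sum, TensorProduct.tmul_sum, TensorProduct.tmul_smul]
  rw [Finset.sum_comm]

/-- The braided Jacobi identity on `A`. -/
theorem jacobi_brA : brA (quantumKilling r s) ∘ₗ (brA (quantumKilling r s)).lTensor A =
    brA (quantumKilling r s) ∘ₗ TensorProduct.map (brA (quantumKilling r s))
      (brA (quantumKilling r s)) ∘ₗ midMap (psiA r) ∘ₗ
        (Coalgebra.comul (R := k)).rTensor (A ⊗[k] A) := by
  refine TensorProduct.ext (LinearMap.ext fun c => (adRComodule k A).hom_ext₂ (adRComodule k A)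
    fun m n e u f x he hf i p => ?_)
  simp only [LinearMap.compr₂ₛₗ_apply, TensorProduct.mk_apply, LinearMap.comp_apply,
    LinearMap.rTensor_tmul, LinearMap.lTensor_tmul, map_bracket_midMap, he.upsA_apply hr]
  simp only [TensorProduct.sum_tmul, map_sum, TensorProduct.assoc_tmul, LinearMap.lTensor_tmul,
    hf.brA_apply, TensorProduct.tmul_sum, TensorProduct.tmul_smul, map_smul,
    quantumKilling_gam hr hs]
  -- Invariance in the form `sum_adCoeff_mul`, evaluated under `q(c, -)`, is the Jacobi identity in
  -- coordinates.
  have h := fun l => congrArg (fun t => quantumKilling r s c t • f l)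
    (sum_adCoeff_mul hr hs hf.toIsCorep (e i) l p)
  simp only [he.adCoeff_apply, Finset.sum_mul, map_sum, map_smul, smul_mul_assoc, Finset.sum_smul,
    LinearMap.flip_apply, smul_eq_mul] at h
  simp only [Finset.smul_sum, smul_smul]
  calc _ = ∑ l, ∑ t, (quantumKilling r s (e i) (x t p) * quantumKilling r s c (x l t)) • f l :=
        Finset.sum_comm
    _ = _ := by
        simp only [← h]
        simp only [← Fintype.sum_prod_type']
        exact sum_reindex (fun z => ⟨z.2.2, z.2.1, z.1⟩) (fun z => ⟨z.2.2, z.2.1, z.1⟩)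
          (fun _ => rfl) (fun _ => rfl) fun _ => by dsimp only; rw [mul_comm]

/-- The bracket of `A` is a morphism of coalgebras. -/
theorem comul_brA : Coalgebra.comul (R := k) ∘ₗ brA (quantumKilling r s) =
    TensorProduct.map (brA (quantumKilling r s)) (brA (quantumKilling r s)) ∘ₗ
      midMap (psiA r) ∘ₗ TensorProduct.map (Coalgebra.comul (R := k)) Coalgebra.comul := by
  refine TensorProduct.ext' fun c d => ?_
  -- For an arbitrary tensor in place of `Δ d`, the right side is the action of `q c` on the
  -- comodule `A ⊗ A`, because `q(γ(c, u), x) = q(c, ux)`. Colinearity of `Δ` then finishes.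
  have h : ∀ t : A ⊗[k] A, coactBy (coactTensor (adR k A) (adR k A)) (quantumKilling r s c) t =
      TensorProduct.map (brA (quantumKilling r s)) (brA (quantumKilling r s))
        (midMap (psiA r) (Coalgebra.comul (R := k) c ⊗ₜ t)) := by
    refine LinearMap.congr_fun (f := coactBy (coactTensor (adR k A) (adR k A))
      (quantumKilling r s c)) (g := TensorProduct.map (brA (quantumKilling r s))
      (brA (quantumKilling r s)) ∘ₗ midMap (psiA r) ∘ₗ TensorProduct.mk k _ _
        (Coalgebra.comul (R := k) c)) ((adRComodule k A).hom_ext₂ (adRComodule k A)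
          fun m n e u f x he hf i p => ?_)
    refine (he.coactBy_tensor hf _ i p).trans ?_
    simp only [LinearMap.comp_apply, TensorProduct.mk_apply, map_bracket_midMap, he.upsA_apply hr,
      TensorProduct.sum_tmul, map_sum, TensorProduct.assoc_tmul, LinearMap.lTensor_tmul,
      hf.brA_apply, TensorProduct.tmul_sum, TensorProduct.tmul_smul, quantumKilling_gam hr hs]
  have h2 : IsComoduleMap (adR k A) (coactTensor (adR k A) (adR k A))
    (Coalgebra.comul (R := k)) := adR_comul
  simp only [LinearMap.comp_apply, brA_tmul, h2.coactBy, h, TensorProduct.map_tmul]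

omit hr hs in
theorem isCorep_one : IsCorep (k := k) (fun _ _ : Unit => (1 : A)) where
  comul _ _ := by simp [Algebra.TensorProduct.one_def]
  counit _ _ := by simp

omit hr hs in
theorem quantumKilling_one_right (hr : IsCoquasitriangular r) (hs : IsCoquasitriangular s)
    (c : A) : quantumKilling r s c 1 = Coalgebra.counit c := by
  have h : (quantumKilling r s).flip 1 = Coalgebra.counit := by
    refine hom_ext_corep fun m u hu i j => ?_
    have h2 := hu.quantumKilling_apply r s isCorep_one i j () ()
    simp [h2, hr.one_right, hs.one_left, hu.counit]
  exact LinearMap.congr_fun h c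

omit hr hs in
theorem quantumKilling_one_left (hr : IsCoquasitriangular r) (hs : IsCoquasitriangular s)
    (c : A) : quantumKilling r s 1 c = Coalgebra.counit c := by
  have h : quantumKilling r s 1 = Coalgebra.counit := by
    refine hom_ext_corep fun m u hu i j => ?_
    have h2 := isCorep_one.quantumKilling_apply r s hu () () i j
    simp [h2, hr.one_left, hs.one_right, hu.counit]
  exact LinearMap.congr_fun h c

omit hr hs in
theorem counit_brA (hr : IsCoquasitriangular r) (hs : IsCoquasitriangular s) :
    Coalgebra.counit (R := k) ∘ₗ brA (quantumKilling r s) =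
      LinearMap.mul' k k ∘ₗ TensorProduct.map (Coalgebra.counit (R := k)) Coalgebra.counit := by
  refine TensorProduct.ext' fun c d => ?_
  have h : ∀ t : A ⊗[k] A, Coalgebra.counit (R := k) (TensorProduct.rid k A
      ((quantumKilling r s c).lTensor A t)) = quantumKilling r s c
        (TensorProduct.lid k A ((Coalgebra.counit (R := k)).rTensor A t)) := by
    intro t
    induction t with
    | zero => simp
    | add x y hx hy => simp only [map_add, hx, hy]
    | tmul x y => simp [mul_comm]
  have h2 := LinearMap.congr_fun (adR_counit (k := k) (A := A)) d
  simp only [LinearMap.comp_apply, LinearEquiv.coe_coe, LinearMap.toSpanSingleton_apply] at h2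
  simp only [LinearMap.comp_apply, brA_tmul, coactBy_apply, h, h2, map_smul,
    TensorProduct.map_tmul, LinearMap.mul'_apply, smul_eq_mul, quantumKilling_one_right hr hs]
  rw [mul_comm]

/-- Weak braided cocommutativity of `A`, up to the kernel of the Killing form. -/
theorem weak_cocomm_brA (b : A) : (TensorProduct.lid k A).toLinearMap ∘ₗ
      ((quantumKilling r s).flip b).rTensor A ∘ₗ psiA r ∘ₗ upsA r s =
    (TensorProduct.lid k A).toLinearMap ∘ₗ ((quantumKilling r s).flip b).rTensor A ∘ₗ
      (brA (quantumKilling r s)).lTensor A ∘ₗ (TensorProduct.assoc k A A A).toLinearMap ∘ₗ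
        (Coalgebra.comul (R := k)).rTensor A := by
  refine TensorProduct.ext (LinearMap.ext fun c => (adRComodule k A).hom_ext
    fun m e u he i => ?_)
  -- Invariance moves the action of `r (u g j)` from `γ(c, u j i)` onto `b`, after which `γ` becomes
  -- left multiplication by `u j i`.
  have h1 : ∀ g j, (quantumKilling r s).flip b (coactBy (adR k A) (r (u g j)) (gam r s c (u j i)))
      = r (u g j) (TensorProduct.rid k A ((quantumKilling r s c).lTensor A
        ((LinearMap.lTensor A (LinearMap.mulLeft k (u j i)) (adL k A b))))) := by
    intro g j
    rw [← apply_adCoeff, ← quantumKilling_invariant hr hs]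
    congr 1
    generalize adL k A b = t
    induction t with
    | zero => simp
    | add x y hx hy => simp only [map_add, hx, hy]
    | tmul x y => simp [quantumKilling_gam hr hs]
  -- The sum over `j` is the second form `covMul_corep` of the covariantised product of `b` and `u g
  -- i`; `q` then splits it along the coproduct of `c`.
  have h2 : ∀ g, ∑ j, r (u g j) (TensorProduct.rid k A ((quantumKilling r s c).lTensor A
        ((LinearMap.lTensor A (LinearMap.mulLeft k (u j i)) (adL k A b))))) =
      quantumKilling r s c (covMul r b (u g i)) := by
    intro g
    rw [covMul_corep hr he.toIsCorep, map_sum]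
    refine Finset.sum_congr rfl fun j _ => ?_
    generalize adL k A b = t
    induction t with
    | zero => simp
    | add x y hx hy => simp only [map_add, hx, hy, mul_add]
    | tmul x y => simp [mul_comm]
  simp only [LinearMap.compr₂ₛₗ_apply, TensorProduct.mk_apply, LinearMap.comp_apply,
    he.upsA_apply hr, map_sum, he.psiA_left, LinearMap.rTensor_tmul, LinearEquiv.coe_coe,
    TensorProduct.lid_tmul, h1]
  rw [Finset.sum_comm]
  simp only [← Finset.sum_smul, h2, quantumKilling_covMul hr hs]
  generalize Coalgebra.comul (R := k) c = t
  induction t with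
  | zero => simp
  | add x y hx hy =>
    simp only [map_add, hx, hy, add_smul, Finset.sum_add_distrib, TensorProduct.add_tmul]
  | tmul x y => simp [-brA_tmul, he.brA_apply, Finset.smul_sum, smul_smul]

end AdjointBraidedLie

end

/-! ### Operator identities on tensor products, and morphisms of comodules. -/

section

theorem map_sum_left {R M N P Q ι : Type*} [CommSemiring R] [AddCommMonoid M] [Module R M]
    [AddCommMonoid N] [Module R N] [AddCommMonoid P] [Module R P] [AddCommMonoid Q] [Module R Q]
    (s : Finset ι) (f : ι → M →ₗ[R] P) (g : N →ₗ[R] Q) :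
    TensorProduct.map (∑ i ∈ s, f i) g = ∑ i ∈ s, TensorProduct.map (f i) g :=
  (map_sum (TensorProduct.mapBilinear (RingHom.id R) M N P Q |>.flip g) f s)

theorem map_sum_right {R M N P Q ι : Type*} [CommSemiring R] [AddCommMonoid M] [Module R M]
    [AddCommMonoid N] [Module R N] [AddCommMonoid P] [Module R P] [AddCommMonoid Q] [Module R Q]
    (s : Finset ι) (f : M →ₗ[R] P) (g : ι → N →ₗ[R] Q) :
    TensorProduct.map f (∑ i ∈ s, g i) = ∑ i ∈ s, TensorProduct.map f (g i) :=
  (map_sum (TensorProduct.mapBilinear (RingHom.id R) M N P Q f) g s)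

theorem lTensor_sum {R M N Q ι : Type*} [CommSemiring R] [AddCommMonoid M] [Module R M]
    [AddCommMonoid N] [Module R N] [AddCommMonoid Q] [Module R Q] (s : Finset ι)
    (g : ι → N →ₗ[R] Q) : (∑ i ∈ s, g i).lTensor M = ∑ i ∈ s, (g i).lTensor M :=
  map_sum_right s _ g

theorem linearMap_comp_sum {R M N P ι : Type*} [CommSemiring R] [AddCommMonoid M] [Module R M]
    [AddCommMonoid N] [Module R N] [AddCommMonoid P] [Module R P] (s : Finset ι) (F : N →ₗ[R] P)
    (g : ι → M →ₗ[R] N) : F ∘ₗ ∑ i ∈ s, g i = ∑ i ∈ s, F ∘ₗ g i :=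
  LinearMap.ext fun x => by simp

theorem linearMap_sum_comp {R M N P ι : Type*} [CommSemiring R] [AddCommMonoid M] [Module R M]
    [AddCommMonoid N] [Module R N] [AddCommMonoid P] [Module R P] (s : Finset ι)
    (F : ι → N →ₗ[R] P) (g : M →ₗ[R] N) : (∑ i ∈ s, F i) ∘ₗ g = ∑ i ∈ s, F i ∘ₗ g :=
  LinearMap.ext fun x => by simp

theorem map_comp_map_comp {R M N P Q M' N' Z : Type*} [CommSemiring R] [AddCommMonoid M]
    [Module R M] [AddCommMonoid N] [Module R N] [AddCommMonoid P] [Module R P] [AddCommMonoid Q]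
    [Module R Q] [AddCommMonoid M'] [Module R M'] [AddCommMonoid N'] [Module R N']
    [AddCommMonoid Z] [Module R Z] (F : N →ₗ[R] P) (G : N' →ₗ[R] Q) (F' : M →ₗ[R] N)
    (G' : M' →ₗ[R] N') (D : Z →ₗ[R] M ⊗[R] M') :
    TensorProduct.map F G ∘ₗ TensorProduct.map F' G' ∘ₗ D =
      TensorProduct.map (F ∘ₗ F') (G ∘ₗ G') ∘ₗ D := by
  rw [TensorProduct.map_comp, LinearMap.comp_assoc]

theorem lTensor_assoc_tmul {R M N P Q : Type*} [CommSemiring R] [AddCommMonoid M] [Module R M]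
    [AddCommMonoid N] [Module R N] [AddCommMonoid P] [Module R P] [AddCommMonoid Q] [Module R Q]
    (F : N ⊗[R] P →ₗ[R] Q) (s : M ⊗[R] N) (h : P) :
    F.lTensor M (TensorProduct.assoc R M N P (s ⊗ₜ h)) =
      (F ∘ₗ (TensorProduct.mk R N P).flip h).lTensor M s := by
  induction s with
  | zero => simp
  | add a b ha hb => simp only [TensorProduct.add_tmul, map_add, ha, hb]
  | tmul a b => simp

section ComoduleMaps

variable {k : Type u} {A : Type v} [Field k] [Ring A] [HopfAlgebra k A]
  {V W Z Z' : Type*} [AddCommGroup V] [Module k V] [AddCommGroup W] [Module k W]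
  [AddCommGroup Z] [Module k Z] [AddCommGroup Z'] [Module k Z']

namespace IsComoduleMap

theorem id (ρ : V →ₗ[k] V ⊗[k] A) : IsComoduleMap ρ ρ LinearMap.id := by
  simp [IsComoduleMap]

theorem comp {ρ : V →ₗ[k] V ⊗[k] A} {ρ' : W →ₗ[k] W ⊗[k] A} {ρ'' : Z →ₗ[k] Z ⊗[k] A}
    {F : V →ₗ[k] W} {G : W →ₗ[k] Z} (hG : IsComoduleMap ρ' ρ'' G) (hF : IsComoduleMap ρ ρ' F) :
    IsComoduleMap ρ ρ'' (G ∘ₗ F) := by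
  unfold IsComoduleMap at *
  rw [← LinearMap.comp_assoc, hG, LinearMap.comp_assoc, hF, LinearMap.rTensor_comp,
    LinearMap.comp_assoc]

/-- The hypotheses concern single vectors because `coact_comul_mul` knows colinearity only at the
two vectors being multiplied. -/
theorem _root_.QLie.coactTensor_tmul_map {ρ₁ : V →ₗ[k] V ⊗[k] A} {ρ₁' : W →ₗ[k] W ⊗[k] A}
    {ρ₂ : Z →ₗ[k] Z ⊗[k] A} {ρ₂' : Z' →ₗ[k] Z' ⊗[k] A} {F : V →ₗ[k] W} {G : Z →ₗ[k] Z'} {v : V}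
    {z : Z} (hF : ρ₁' (F v) = F.rTensor A (ρ₁ v)) (hG : ρ₂' (G z) = G.rTensor A (ρ₂ z)) :
    coactTensor ρ₁' ρ₂' (F v ⊗ₜ G z) =
      (TensorProduct.map F G).rTensor A (coactTensor ρ₁ ρ₂ (v ⊗ₜ z)) := by
  simp only [coactTensor, LinearMap.comp_apply, TensorProduct.map_tmul, hF, hG]
  generalize ρ₁ v = s
  generalize ρ₂ z = t
  induction s with
  | zero => simp
  | add a b ha hb => simp only [TensorProduct.add_tmul, map_add, ha, hb]
  | tmul a b =>
    induction t with
    | zero => simp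
    | add a b ha hb => simp only [TensorProduct.tmul_add, map_add, ha, hb]
    | tmul c d => simp

theorem map {ρ₁ : V →ₗ[k] V ⊗[k] A} {ρ₁' : W →ₗ[k] W ⊗[k] A} {ρ₂ : Z →ₗ[k] Z ⊗[k] A}
    {ρ₂' : Z' →ₗ[k] Z' ⊗[k] A} {F : V →ₗ[k] W} {G : Z →ₗ[k] Z'} (hF : IsComoduleMap ρ₁ ρ₁' F)
    (hG : IsComoduleMap ρ₂ ρ₂' G) :
    IsComoduleMap (coactTensor ρ₁ ρ₂) (coactTensor ρ₁' ρ₂') (TensorProduct.map F G) :=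
  TensorProduct.ext' fun v z => coactTensor_tmul_map (LinearMap.congr_fun hF v)
    (LinearMap.congr_fun hG z)

theorem rTensor {ρ₁ : V →ₗ[k] V ⊗[k] A} {ρ₁' : W →ₗ[k] W ⊗[k] A} (ρ₂ : Z →ₗ[k] Z ⊗[k] A)
    {F : V →ₗ[k] W} (hF : IsComoduleMap ρ₁ ρ₁' F) :
    IsComoduleMap (coactTensor ρ₁ ρ₂) (coactTensor ρ₁' ρ₂) (F.rTensor Z) :=
  hF.map (id ρ₂)

theorem lTensor {ρ₁ : V →ₗ[k] V ⊗[k] A} {ρ₁' : W →ₗ[k] W ⊗[k] A} (ρ₂ : Z →ₗ[k] Z ⊗[k] A)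
    {F : V →ₗ[k] W} (hF : IsComoduleMap ρ₁ ρ₁' F) :
    IsComoduleMap (coactTensor ρ₂ ρ₁) (coactTensor ρ₂ ρ₁') (F.lTensor Z) :=
  (id ρ₂).map hF

theorem assoc (ρ₁ : V →ₗ[k] V ⊗[k] A) (ρ₂ : W →ₗ[k] W ⊗[k] A) (ρ₃ : Z →ₗ[k] Z ⊗[k] A) :
    IsComoduleMap (coactTensor (coactTensor ρ₁ ρ₂) ρ₃) (coactTensor ρ₁ (coactTensor ρ₂ ρ₃))
      (TensorProduct.assoc k V W Z).toLinearMap := by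
  refine TensorProduct.ext_threefold fun v w z => ?_
  simp only [coactTensor, LinearMap.comp_apply, TensorProduct.map_tmul, LinearEquiv.coe_coe,
    TensorProduct.assoc_tmul]
  generalize ρ₁ v = s
  generalize ρ₂ w = t
  generalize ρ₃ z = x
  induction s with
  | zero => simp
  | add a b ha hb => simp only [TensorProduct.add_tmul, map_add, ha, hb]
  | tmul a b =>
    induction t with
    | zero => simp
    | add a b ha hb => simp only [TensorProduct.tmul_add, TensorProduct.add_tmul, map_add, ha, hb]
    | tmul c d =>
      induction x with
      | zero => simp
      | add a b ha hb => simp only [TensorProduct.tmul_add, map_add, ha, hb]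
      | tmul e f => simp [mul_assoc]

theorem symm {ρ : V →ₗ[k] V ⊗[k] A} {ρ' : W →ₗ[k] W ⊗[k] A} {F : V ≃ₗ[k] W}
    (hF : IsComoduleMap ρ ρ' F.toLinearMap) : IsComoduleMap ρ' ρ F.symm.toLinearMap := by
  refine LinearMap.ext fun w => ?_
  have h : ρ' (F (F.symm w)) = F.toLinearMap.rTensor A (ρ (F.symm w)) :=
    LinearMap.congr_fun hF (F.symm w)
  rw [F.apply_symm_apply] at h
  rw [LinearMap.comp_apply, LinearMap.comp_apply, LinearEquiv.coe_coe, h,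
    ← LinearMap.rTensor_comp_apply]
  simp

theorem braiding_right {ρ : V →ₗ[k] V ⊗[k] A} {ρ' : W →ₗ[k] W ⊗[k] A} {F : V →ₗ[k] W}
    (hF : IsComoduleMap ρ ρ' F) (r : A →ₗ[k] A →ₗ[k] k) (ρ₂ : Z →ₗ[k] Z ⊗[k] A) (z : Z) (v : V) :
    braiding r ρ₂ ρ' (z ⊗ₜ F v) = F.rTensor Z (braiding r ρ₂ ρ (z ⊗ₜ v)) := by
  have hF' : ρ' (F v) = F.rTensor A (ρ v) := LinearMap.congr_fun hF v
  simp only [braiding, LinearMap.comp_apply, TensorProduct.map_tmul, hF']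
  generalize ρ₂ z = s
  generalize ρ v = t
  induction s with
  | zero => simp
  | add a b ha hb => simp only [TensorProduct.add_tmul, map_add, ha, hb]
  | tmul a b =>
    induction t with
    | zero => simp
    | add a b ha hb => simp only [TensorProduct.tmul_add, map_add, ha, hb]
    | tmul c d => simp

theorem braiding_left {ρ : V →ₗ[k] V ⊗[k] A} {ρ' : W →ₗ[k] W ⊗[k] A} {F : V →ₗ[k] W}
    (hF : IsComoduleMap ρ ρ' F) (r : A →ₗ[k] A →ₗ[k] k) (ρ₂ : Z →ₗ[k] Z ⊗[k] A) (z : Z) (v : V) :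
    braiding r ρ' ρ₂ (F v ⊗ₜ z) = F.lTensor Z (braiding r ρ ρ₂ (v ⊗ₜ z)) := by
  have hF' : ρ' (F v) = F.rTensor A (ρ v) := LinearMap.congr_fun hF v
  simp only [braiding, LinearMap.comp_apply, TensorProduct.map_tmul, hF']
  generalize ρ₂ z = s
  generalize ρ v = t
  induction s with
  | zero => simp
  | add a b ha hb => simp only [TensorProduct.tmul_add, map_add, ha, hb]
  | tmul a b =>
    induction t with
    | zero => simp
    | add a b ha hb => simp only [TensorProduct.add_tmul, map_add, ha, hb]
    | tmul c d => simp

theorem braiding_map {ρ : V →ₗ[k] V ⊗[k] A} {ρ' : W →ₗ[k] W ⊗[k] A} {F : V →ₗ[k] W}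
    (hF : IsComoduleMap ρ ρ' F) {ρ₂ : Z →ₗ[k] Z ⊗[k] A} {ρ₂' : Z' →ₗ[k] Z' ⊗[k] A} {G : Z →ₗ[k] Z'}
    (hG : IsComoduleMap ρ₂ ρ₂' G) (r : A →ₗ[k] A →ₗ[k] k) (v : V) (z : Z) :
    braiding r ρ' ρ₂' (F v ⊗ₜ G z) = TensorProduct.map G F (braiding r ρ ρ₂ (v ⊗ₜ z)) := by
  rw [hF.braiding_left, hG.braiding_right, ← LinearMap.comp_apply, LinearMap.lTensor_comp_rTensor]

theorem midMap {ρ₁ : V →ₗ[k] V ⊗[k] A} {ρ₂ : W →ₗ[k] W ⊗[k] A} {ρ₃ : Z →ₗ[k] Z ⊗[k] A}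
    {ρ₄ : Z' →ₗ[k] Z' ⊗[k] A} {Ψ : W ⊗[k] Z →ₗ[k] Z ⊗[k] W}
    (h : IsComoduleMap (coactTensor ρ₂ ρ₃) (coactTensor ρ₃ ρ₂) Ψ) :
    IsComoduleMap (coactTensor (coactTensor ρ₁ ρ₂) (coactTensor ρ₃ ρ₄))
      (coactTensor (coactTensor ρ₁ ρ₃) (coactTensor ρ₂ ρ₄)) (midMap Ψ) :=
  (symm (assoc _ _ _)).comp <| (lTensor ρ₁ ((assoc _ _ _).comp <| (h.rTensor ρ₄).comp <|
    symm (assoc _ _ _))).comp (assoc _ _ _)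

end IsComoduleMap

variable {r : A →ₗ[k] A →ₗ[k] k} (hr : IsCoquasitriangular r)
include hr

/-- One of the two hexagon identities: multiplicativity of `r` in its first argument makes `r(-, x)`
act on a tensor product through `Δ x`. -/
theorem coactBy_flip_tensor (M : RightComodule k A V) (N : RightComodule k A W) {ι : Type*}
    [Fintype ι] [DecidableEq ι] {u : ι → ι → A} (hu : IsCorep (k := k) u) (i j : ι)
    (t : V ⊗[k] W) : coactBy (coactTensor M.coact N.coact) (r.flip (u i j)) t =
      ∑ l, TensorProduct.map (coactBy M.coact (r.flip (u i l))) (coactBy N.coact (r.flip (u l j)))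
        t := by
  have h : coactBy (coactTensor M.coact N.coact) (r.flip (u i j)) =
      ∑ l, TensorProduct.map (coactBy M.coact (r.flip (u i l)))
        (coactBy N.coact (r.flip (u l j))) := by
    refine M.hom_ext₂ N fun m n e u f x he hf p q => ?_
    rw [he.coactBy_tensor hf]
    simp only [LinearMap.flip_apply, hr.mul_left_corep hu, LinearMap.sum_apply,
      TensorProduct.map_tmul, he.coactBy, hf.coactBy, TensorProduct.sum_tmul,
      TensorProduct.tmul_sum, TensorProduct.smul_tmul_smul, Finset.sum_smul]
    simp only [← Fintype.sum_prod_type']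
    exact sum_reindex (fun z => ⟨z.2.2, z.2.1, z.1⟩) (fun z => ⟨z.2.2, z.2.1, z.1⟩)
      (fun _ => rfl) (fun _ => rfl) fun _ => rfl
  rw [h, LinearMap.sum_apply]

theorem coactBy_flip_mul (M : RightComodule k A V) (a b : A) (v : V) :
    coactBy M.coact (r.flip (a * b)) v =
      coactBy M.coact (r.flip b) (coactBy M.coact (r.flip a) v) := by
  rw [coactBy_mul hr]

end ComoduleMaps

/-! ### The canonical braiding is a morphism of braided coalgebras. -/

namespace BraidedLieAlgebra

variable {k : Type u} {A : Type v} [Field k] [Ring A] [HopfAlgebra k A]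
  {V : Type*} [AddCommGroup V] [Module k V] {r : A →ₗ[k] A →ₗ[k] k}
  (L : BraidedLieAlgebra k A r V)

/-- The operator `[ , v]`. -/
def brBy (v : V) : V →ₗ[k] V := L.bracket ∘ₗ (TensorProduct.mk k V V).flip v

/-- The operator `c ↦ r(c⁽¹⁾, a) c⁽⁰⁾`. -/
def lam (a : A) : V →ₗ[k] V := coactBy L.coact (r.flip a)

variable {ι κ : Type*} [Fintype ι] [DecidableEq ι] [Fintype κ] [DecidableEq κ]
  {e : ι → V} {u : ι → ι → A} {f : κ → V} {x : κ → κ → A}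

/-- With the second argument in a family, `Υ` becomes a sum of operators applied to `Δ c`;
identities involving `Υ` turn into uses of coassociativity on `c` alone. -/
theorem canonicalBraiding_family (he : L.toRightComodule.IsFamily e u) (c : V) (i : ι) :
    L.canonicalBraiding (c ⊗ₜ e i) =
      ∑ l, TensorProduct.map (L.brBy (e l)) (L.lam (u l i)) (L.comul c) := by
  simp only [canonicalBraiding, LinearMap.comp_apply, LinearMap.rTensor_tmul]
  generalize L.comul c = t
  induction t with
  | zero => simp
  | add a b ha hb => simp only [TensorProduct.add_tmul, map_add, ha, hb, Finset.sum_add_distrib]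
  | tmul a b =>
    simp [he.braiding_right, TensorProduct.tmul_sum, brBy, lam]

theorem canonicalBraiding_linear (he : L.toRightComodule.IsFamily e u) (F : V →ₗ[k] V) (i : ι) :
    L.canonicalBraiding ∘ₗ (TensorProduct.mk k V V).flip (e i) ∘ₗ F =
      ∑ l, TensorProduct.map (L.brBy (e l)) (L.lam (u l i)) ∘ₗ L.comul ∘ₗ F := by
  refine LinearMap.ext fun c => ?_
  simp [L.canonicalBraiding_family he]

theorem map_comul_comul {W₁ W₂ W₃ : Type*} [AddCommMonoid W₁] [Module k W₁] [AddCommMonoid W₂]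
    [Module k W₂] [AddCommMonoid W₃] [Module k W₃] (F : V →ₗ[k] W₁) (G : V →ₗ[k] W₂)
    (H : V →ₗ[k] W₃) (c : V) :
    TensorProduct.map F (TensorProduct.map G H ∘ₗ L.comul) (L.comul c) =
      TensorProduct.assoc k W₁ W₂ W₃ (TensorProduct.map (TensorProduct.map F G ∘ₗ L.comul) H
        (L.comul c)) := by
  have h := LinearMap.congr_fun L.coassoc c
  simp only [LinearMap.comp_apply, LinearEquiv.coe_coe] at h
  have h1 : TensorProduct.map F (TensorProduct.map G H ∘ₗ L.comul) (L.comul c) =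
      TensorProduct.map F (TensorProduct.map G H) (L.comul.lTensor V (L.comul c)) := by
    simp only [LinearMap.lTensor, TensorProduct.map_map, LinearMap.comp_id]
  have h2 : TensorProduct.map (TensorProduct.map F G ∘ₗ L.comul) H (L.comul c) =
      TensorProduct.map (TensorProduct.map F G) H (L.comul.rTensor V (L.comul c)) := by
    simp only [LinearMap.rTensor, TensorProduct.map_map, LinearMap.comp_id]
  rw [h1, h2, ← h, ← TensorProduct.map_map_assoc]

theorem counit_lam (hr : IsCoquasitriangular r) (a : A) (c : V) :
    L.counit (L.lam a c) = Coalgebra.counit (R := k) a * L.counit c := by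
  have h := LinearMap.congr_fun L.counit_comodule c
  simp only [LinearMap.comp_apply, LinearEquiv.coe_coe, LinearMap.toSpanSingleton_apply] at h
  have h2 : L.counit (L.lam a c) = r.flip a (TensorProduct.lid k A (L.counit.rTensor A
      (L.coact c))) := by
    rw [lam, coactBy_apply]
    generalize L.coact c = t
    induction t with
    | zero => simp
    | add a b ha hb => simp only [map_add, ha, hb]
    | tmul a b => simp [mul_comm]
  rw [h2, h]
  simp [hr.one_left, mul_comm]

/-- The braided coproduct of `L ⊗ L`. -/
def comulTensor : V ⊗[k] V →ₗ[k] (V ⊗[k] V) ⊗[k] (V ⊗[k] V) :=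
  midMap (braiding r L.coact L.coact) ∘ₗ TensorProduct.map L.comul L.comul

variable (hr : IsCoquasitriangular r)
include hr

theorem comul_lam (hu : IsCorep (k := k) u) (i j : ι) :
    L.comul ∘ₗ L.lam (u i j) =
      ∑ l, TensorProduct.map (L.lam (u i l)) (L.lam (u l j)) ∘ₗ L.comul := by
  have h : IsComoduleMap L.coact (coactTensor L.coact L.coact) L.comul := L.comul_comodule
  refine LinearMap.ext fun c => ?_
  simp only [lam, LinearMap.comp_apply, h.coactBy,
    coactBy_flip_tensor hr L.toRightComodule L.toRightComodule hu, LinearMap.sum_apply]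

theorem lam_mul (a b : A) : L.lam (a * b) = L.lam b ∘ₗ L.lam a :=
  LinearMap.ext fun c => coactBy_flip_mul hr L.toRightComodule a b c

theorem isComoduleMap_canonicalBraiding : IsComoduleMap (coactTensor L.coact L.coact)
    (coactTensor L.coact L.coact) L.canonicalBraiding := by
  have h : IsComoduleMap L.coact (coactTensor L.coact L.coact) L.comul := L.comul_comodule
  have h2 : IsComoduleMap (coactTensor L.coact L.coact) L.coact L.bracket := L.bracket_comodule
  exact (h2.rTensor L.coact).comp <| (IsComoduleMap.symm (IsComoduleMap.assoc _ _ _)).comp <|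
    (IsComoduleMap.lTensor L.coact (isComoduleMap_braiding hr L.toRightComodule
      L.toRightComodule)).comp <| (IsComoduleMap.assoc _ _ _).comp (h.rTensor L.coact)

theorem counit_canonicalBraiding (t : V ⊗[k] V) :
    TensorProduct.map L.counit L.counit (L.canonicalBraiding t) =
      TensorProduct.map L.counit L.counit t := by
  have h : TensorProduct.map L.counit L.counit ∘ₗ L.canonicalBraiding =
      TensorProduct.map L.counit L.counit := by
    refine TensorProduct.ext (LinearMap.ext fun c => L.toRightComodule.hom_ext
      fun m e u he i => ?_)
    have h1 : ∀ v, L.counit ∘ₗ L.brBy v = L.counit v • L.counit := by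
      intro v
      refine LinearMap.ext fun w => ?_
      have := LinearMap.congr_fun L.counit_bracket (w ⊗ₜ v)
      simpa [brBy, mul_comm] using this
    have h2 : ∀ a, L.counit ∘ₗ L.lam a = Coalgebra.counit (R := k) a • L.counit := fun a =>
      LinearMap.ext fun w => L.counit_lam hr a w
    simp only [LinearMap.compr₂ₛₗ_apply, TensorProduct.mk_apply, LinearMap.comp_apply,
      L.canonicalBraiding_family he, map_sum, TensorProduct.map_map, h1, h2, he.counit]
    rw [Finset.sum_eq_single i (fun l _ hl => by simp [hl]) (by simp)]
    have h3 := LinearMap.congr_fun L.counit_left c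
    have h4 : TensorProduct.map L.counit L.counit (L.comul c) =
        L.counit.lTensor k (L.counit.rTensor V (L.comul c)) := by
      rw [← LinearMap.comp_apply (L.counit.lTensor k), LinearMap.lTensor_comp_rTensor]
    have h5 : L.counit.rTensor V (L.comul c) = 1 ⊗ₜ c := by
      rw [← (TensorProduct.lid k V).injective.eq_iff]
      simpa using h3
    simp [TensorProduct.map_smul_left, h4, h5, ← (TensorProduct.lid k k).injective.eq_iff,
      mul_comm]
  exact LinearMap.congr_fun h t

/-- As the bracket is a coalgebra morphism and the braiding is natural for `Δ`, splitting the left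
output of `Υ` amounts to passing `c` past the two parts of `Δ d` one after the other. -/
theorem rTensor_comul_canonicalBraiding (c d : V) :
    L.comul.rTensor V (L.canonicalBraiding (c ⊗ₜ d)) =
      (TensorProduct.assoc k V V V).symm (L.canonicalBraiding.lTensor V
        (TensorProduct.assoc k V V V (L.canonicalBraiding.rTensor V
          ((TensorProduct.assoc k V V V).symm (c ⊗ₜ L.comul d))))) := by
  have h1 : L.comul.rTensor V (L.canonicalBraiding (c ⊗ₜ d)) =
      (TensorProduct.map L.bracket L.bracket ∘ₗ midMap (braiding r L.coact L.coact) ∘ₗ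
        L.comul.rTensor (V ⊗[k] V)).rTensor V ((TensorProduct.assoc k V (V ⊗[k] V) V).symm
          ((braiding r L.coact (coactTensor L.coact L.coact)).lTensor V
            (TensorProduct.assoc k V V (V ⊗[k] V) (L.comul c ⊗ₜ L.comul d)))) := by
    have hΔ : IsComoduleMap L.coact (coactTensor L.coact L.coact) L.comul := L.comul_comodule
    simp only [canonicalBraiding, LinearMap.comp_apply, LinearMap.rTensor_tmul]
    generalize L.comul c = t
    induction t with
    | zero => simp
    | add a b ha hb => simp only [TensorProduct.add_tmul, map_add, ha, hb]
    | tmul a b =>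
      simp only [TensorProduct.assoc_tmul, LinearMap.lTensor_tmul, LinearEquiv.coe_coe,
        hΔ.braiding_right]
      generalize braiding r L.coact L.coact (b ⊗ₜ d) = z
      induction z with
      | zero => simp
      | add a b ha hb => simp only [TensorProduct.tmul_add, map_add, ha, hb]
      | tmul y b =>
        have h := LinearMap.congr_fun L.comul_bracket (a ⊗ₜ y)
        simp only [LinearMap.comp_apply, TensorProduct.map_tmul] at h
        simp [h]
  rw [h1]
  -- Both sides are linear in `Δ d`, which may be replaced by a tensor of members of two families.
  refine LinearMap.congr_fun (f := (TensorProduct.map L.bracket L.bracket ∘ₗ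
    midMap (braiding r L.coact L.coact) ∘ₗ L.comul.rTensor (V ⊗[k] V)).rTensor V ∘ₗ
      (TensorProduct.assoc k V (V ⊗[k] V) V).symm.toLinearMap ∘ₗ
        (braiding r L.coact (coactTensor L.coact L.coact)).lTensor V ∘ₗ
          (TensorProduct.assoc k V V (V ⊗[k] V)).toLinearMap ∘ₗ
            TensorProduct.mk k (V ⊗[k] V) (V ⊗[k] V) (L.comul c))
    (g := (TensorProduct.assoc k V V V).symm.toLinearMap ∘ₗ L.canonicalBraiding.lTensor V ∘ₗ
      (TensorProduct.assoc k V V V).toLinearMap ∘ₗ L.canonicalBraiding.rTensor V ∘ₗ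
        (TensorProduct.assoc k V V V).symm.toLinearMap ∘ₗ TensorProduct.mk k V (V ⊗[k] V) c)
    (L.toRightComodule.hom_ext₂ L.toRightComodule fun m n e u f x he hf i p => ?_) (L.comul d)
  have h2 : (braiding r L.coact (coactTensor L.coact L.coact)) ∘ₗ
      (TensorProduct.mk k V (V ⊗[k] V)).flip (e i ⊗ₜ f p) = ∑ a : Fin m × Fin n,
        TensorProduct.mk k (V ⊗[k] V) V (e a.1 ⊗ₜ f a.2) ∘ₗ L.lam (x a.2 p) ∘ₗ L.lam (u a.1 i) := by
    refine LinearMap.ext fun b => ?_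
    have h := (he.tensor hf).braiding_right r L.coact b (i, p)
    simp only [LinearMap.comp_apply, LinearMap.flip_apply, TensorProduct.mk_apply,
      LinearMap.sum_apply]
    refine h.trans (Finset.sum_congr rfl fun a _ => ?_)
    exact congrArg (fun z => (e a.1 ⊗ₜ f a.2) ⊗ₜ z) (LinearMap.congr_fun (L.lam_mul hr _ _) b)
  have h3 : ∀ (j : Fin m) (q : Fin n), (TensorProduct.map L.bracket L.bracket ∘ₗ
      midMap (braiding r L.coact L.coact) ∘ₗ L.comul.rTensor (V ⊗[k] V)) ∘ₗ
        (TensorProduct.mk k V (V ⊗[k] V)).flip (e j ⊗ₜ f q) =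
      ∑ l, TensorProduct.map (L.brBy (e l)) (L.brBy (f q) ∘ₗ L.lam (u l j)) ∘ₗ L.comul := by
    intro j q
    refine LinearMap.ext fun a => ?_
    simp only [LinearMap.comp_apply, LinearMap.flip_apply, TensorProduct.mk_apply,
      LinearMap.rTensor_tmul]
    rw [map_bracket_midMap]
    have h := L.canonicalBraiding_family he a j
    rw [lTensor_assoc_tmul]
    refine (congrArg _ h).trans ?_
    simp only [map_sum, LinearMap.lTensor_map, LinearMap.sum_apply, LinearMap.comp_apply]
    rfl
  have h4 : ∀ (a : Fin m × Fin n) (G : V →ₗ[k] V) (t : V ⊗[k] V),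
      (TensorProduct.map L.bracket L.bracket ∘ₗ midMap (braiding r L.coact L.coact) ∘ₗ
        L.comul.rTensor (V ⊗[k] V)).rTensor V ((TensorProduct.assoc k V (V ⊗[k] V) V).symm
          ((TensorProduct.mk k (V ⊗[k] V) V (e a.1 ⊗ₜ f a.2) ∘ₗ G).lTensor V t)) =
      ∑ l, TensorProduct.map (TensorProduct.map (L.brBy (e l)) (L.brBy (f a.2) ∘ₗ
        L.lam (u l a.1)) ∘ₗ L.comul) G t := by
    intro a G t
    induction t with
    | zero => simp
    | add a b ha hb => simp only [map_add, ha, hb, Finset.sum_add_distrib]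
    | tmul b c =>
      have h := LinearMap.congr_fun (h3 a.1 a.2) b
      simp only [LinearMap.comp_apply, LinearMap.flip_apply, TensorProduct.mk_apply,
        LinearMap.sum_apply, LinearMap.rTensor_tmul] at h
      simp only [LinearMap.lTensor_tmul, LinearMap.comp_apply, TensorProduct.mk_apply,
        TensorProduct.assoc_symm_tmul, LinearMap.rTensor_tmul, TensorProduct.map_tmul, h,
        TensorProduct.sum_tmul]
  simp only [LinearMap.comp_apply, TensorProduct.mk_apply, LinearEquiv.coe_coe,
    lTensor_assoc_tmul, h2, lTensor_sum, LinearMap.sum_apply, map_sum, h4,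
    TensorProduct.assoc_symm_tmul, LinearMap.rTensor_tmul, L.canonicalBraiding_family he,
    TensorProduct.sum_tmul, LinearMap.lTensor_map]
  simp only [LinearMap.comp_assoc, L.canonicalBraiding_linear hf, L.comul_lam hr he.toIsCorep,
    linearMap_comp_sum, map_comp_map_comp, map_sum_right, LinearMap.sum_apply, map_sum,
    L.map_comul_comul, LinearEquiv.symm_apply_apply]
  simp only [← Fintype.sum_prod_type']
  exact sum_reindex (fun z => ⟨z.2, z.1.2, z.1.1⟩) (fun z => ⟨⟨z.2.2, z.2.1⟩, z.1⟩)
    (fun _ => rfl) (fun _ => rfl) fun _ => rfl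

theorem lTensor_comul_canonicalBraiding (he : L.toRightComodule.IsFamily e u) (c : V) (i : ι) :
    L.comul.lTensor V (L.canonicalBraiding (c ⊗ₜ e i)) =
      ∑ l, ∑ j, TensorProduct.map (L.brBy (e l))
        (TensorProduct.map (L.lam (u l j)) (L.lam (u j i)) ∘ₗ L.comul) (L.comul c) := by
  simp only [L.canonicalBraiding_family he, map_sum, LinearMap.lTensor_map,
    L.comul_lam hr he.toIsCorep, map_sum_right, LinearMap.sum_apply]

/-- Splitting the right output gives terms `[w₍₁₎, e l] ⊗ λ(w₍₂₎) ⊗ λ(w₍₃₎)`. Weak cocommutativity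
turns the braided first two legs into `w₍₁₎ ⊗ [w₍₂₎, e j]`, and what follows `w₍₁₎` is again `Υ`. -/
theorem canonicalBraiding_cocomm (w h : V) :
    TensorProduct.assoc k V V V ((braiding r L.coact L.coact).rTensor V
      ((TensorProduct.assoc k V V V).symm (L.comul.lTensor V (L.canonicalBraiding (w ⊗ₜ h))))) =
      L.canonicalBraiding.lTensor V (TensorProduct.assoc k V V V (L.comul w ⊗ₜ h)) := by
  refine LinearMap.congr_fun (f := (TensorProduct.assoc k V V V).toLinearMap ∘ₗ
    (braiding r L.coact L.coact).rTensor V ∘ₗ (TensorProduct.assoc k V V V).symm.toLinearMap ∘ₗ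
      L.comul.lTensor V ∘ₗ L.canonicalBraiding ∘ₗ TensorProduct.mk k V V w)
    (g := L.canonicalBraiding.lTensor V ∘ₗ (TensorProduct.assoc k V V V).toLinearMap ∘ₗ
      TensorProduct.mk k (V ⊗[k] V) V (L.comul w))
    (L.toRightComodule.hom_ext fun m e u he i => ?_) h
  have hw : ∀ j, ∑ l, braiding r L.coact L.coact ∘ₗ TensorProduct.map (L.brBy (e l))
      (L.lam (u l j)) ∘ₗ L.comul = TensorProduct.map LinearMap.id (L.brBy (e j)) ∘ₗ L.comul := by
    intro j
    refine LinearMap.ext fun v => ?_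
    have h := LinearMap.congr_fun L.weak_cocomm (v ⊗ₜ e j)
    have h2 : braiding r L.coact L.coact (L.canonicalBraiding (v ⊗ₜ e j)) =
      L.bracket.lTensor V (TensorProduct.assoc k V V V (L.comul v ⊗ₜ e j)) := h
    rw [L.canonicalBraiding_family he, lTensor_assoc_tmul] at h2
    simpa [brBy, LinearMap.lTensor] using h2
  simp only [LinearMap.comp_apply, TensorProduct.mk_apply, LinearEquiv.coe_coe,
    L.lTensor_comul_canonicalBraiding hr he, map_sum, L.map_comul_comul,
    LinearEquiv.symm_apply_apply, LinearMap.rTensor_map, lTensor_assoc_tmul]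
  have h5 := L.canonicalBraiding_linear he LinearMap.id i
  simp only [LinearMap.comp_id] at h5
  rw [h5, Finset.sum_comm]
  simp only [← LinearMap.sum_apply, ← map_sum, ← map_sum_left, hw]
  simp only [LinearMap.lTensor, LinearMap.sum_apply, map_sum_right, L.map_comul_comul, map_sum]

/-- This is what lets `Δ` descend to `B(L)`: the relations are compatible with the coproduct. The
left output of `Υ` is split by `rTensor_comul_canonicalBraiding`, the right one by
`canonicalBraiding_cocomm`, and the result consists of two copies of `Υ`. -/
theorem comulTensor_canonicalBraiding : L.comulTensor ∘ₗ L.canonicalBraiding =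
    TensorProduct.map L.canonicalBraiding L.canonicalBraiding ∘ₗ L.comulTensor := by
  refine TensorProduct.ext' fun c d => ?_
  have h1 : ∀ t, L.comulTensor t = midMap (braiding r L.coact L.coact)
      (L.comul.lTensor (V ⊗[k] V) (L.comul.rTensor V t)) := by
    intro t
    rw [← LinearMap.comp_apply (LinearMap.lTensor _ _), LinearMap.lTensor_comp_rTensor]
    rfl
  rw [LinearMap.comp_apply, h1, L.rTensor_comul_canonicalBraiding hr]
  refine LinearMap.congr_fun (f := midMap (braiding r L.coact L.coact) ∘ₗ
    L.comul.lTensor (V ⊗[k] V) ∘ₗ (TensorProduct.assoc k V V V).symm.toLinearMap ∘ₗ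
      L.canonicalBraiding.lTensor V ∘ₗ (TensorProduct.assoc k V V V).toLinearMap ∘ₗ
        L.canonicalBraiding.rTensor V ∘ₗ (TensorProduct.assoc k V V V).symm.toLinearMap ∘ₗ
          TensorProduct.mk k V (V ⊗[k] V) c)
    (g := TensorProduct.map L.canonicalBraiding L.canonicalBraiding ∘ₗ
      midMap (braiding r L.coact L.coact) ∘ₗ TensorProduct.mk k _ _ (L.comul c))
    (L.toRightComodule.hom_ext₂ L.toRightComodule fun m n e u f x he hf i p => ?_) (L.comul d)
  have h2 : ∀ t : V ⊗[k] (V ⊗[k] V), midMap (braiding r L.coact L.coact)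
      (L.comul.lTensor (V ⊗[k] V) ((TensorProduct.assoc k V V V).symm t)) =
        (TensorProduct.assoc k V V (V ⊗[k] V)).symm
          (((TensorProduct.assoc k V V V).toLinearMap ∘ₗ (braiding r L.coact L.coact).rTensor V ∘ₗ
            (TensorProduct.assoc k V V V).symm.toLinearMap ∘ₗ L.comul.lTensor V).lTensor V t) := by
    intro t
    induction t with
    | zero => simp
    | add a b ha hb => simp only [map_add, ha, hb]
    | tmul a z =>
      induction z with
      | zero => simp
      | add a b ha hb => simp only [TensorProduct.tmul_add, map_add, ha, hb]
      | tmul b c =>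
        simp only [TensorProduct.assoc_symm_tmul, LinearMap.lTensor_tmul, LinearMap.comp_apply,
          LinearEquiv.coe_coe]
        generalize L.comul c = z
        induction z with
        | zero => simp
        | add a b ha hb => simp only [TensorProduct.tmul_add, map_add, ha, hb]
        | tmul c d => simp [midMap_tmul]
  have h3 : ((TensorProduct.assoc k V V V).toLinearMap ∘ₗ
      (braiding r L.coact L.coact).rTensor V ∘ₗ (TensorProduct.assoc k V V V).symm.toLinearMap ∘ₗ
        L.comul.lTensor V) ∘ₗ (L.canonicalBraiding ∘ₗ (TensorProduct.mk k V V).flip (f p)) =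
      (L.canonicalBraiding ∘ₗ (TensorProduct.mk k V V).flip (f p)).lTensor V ∘ₗ L.comul := by
    refine LinearMap.ext fun w => ?_
    have h := L.canonicalBraiding_cocomm hr w (f p)
    rw [lTensor_assoc_tmul] at h
    exact h
  have h4 : ∀ t : V ⊗[k] V, TensorProduct.map L.canonicalBraiding L.canonicalBraiding
      (midMap (braiding r L.coact L.coact) (t ⊗ₜ (e i ⊗ₜ f p))) =
      ∑ j, TensorProduct.map (L.canonicalBraiding ∘ₗ (TensorProduct.mk k V V).flip (e j))
        (L.canonicalBraiding ∘ₗ (TensorProduct.mk k V V).flip (f p) ∘ₗ L.lam (u j i)) t := by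
    intro t
    induction t with
    | zero => simp
    | add a b ha hb => simp only [TensorProduct.add_tmul, map_add, ha, hb, Finset.sum_add_distrib]
    | tmul a b =>
      simp [midMap_tmul, he.braiding_right, TensorProduct.sum_tmul, TensorProduct.tmul_sum, lam]
  simp only [LinearMap.comp_apply, TensorProduct.mk_apply, LinearEquiv.coe_coe, h2, h4,
    TensorProduct.assoc_symm_tmul, LinearMap.rTensor_tmul, L.canonicalBraiding_family he,
    TensorProduct.sum_tmul, map_sum, lTensor_assoc_tmul, LinearMap.lTensor_map]
  have h5 : ∀ l, TensorProduct.map (L.brBy (e l)) (((TensorProduct.assoc k V V V).toLinearMap ∘ₗ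
      (braiding r L.coact L.coact).rTensor V ∘ₗ (TensorProduct.assoc k V V V).symm.toLinearMap ∘ₗ
        L.comul.lTensor V) ∘ₗ (L.canonicalBraiding ∘ₗ (TensorProduct.mk k V V).flip (f p)) ∘ₗ
          L.lam (u l i)) (L.comul c) =
      ∑ j, TensorProduct.assoc k V V (V ⊗[k] V) (TensorProduct.map (TensorProduct.map
        (L.brBy (e l)) (L.lam (u l j)) ∘ₗ L.comul) (L.canonicalBraiding ∘ₗ
          (TensorProduct.mk k V V).flip (f p) ∘ₗ L.lam (u j i)) (L.comul c)) := by
    intro l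
    rw [← LinearMap.comp_assoc, h3, LinearMap.comp_assoc, L.comul_lam hr he.toIsCorep]
    simp only [LinearMap.lTensor, linearMap_comp_sum, map_comp_map_comp, map_sum_right,
      LinearMap.sum_apply, L.map_comul_comul, LinearMap.id_comp, LinearMap.comp_assoc]
  have h6 : ∀ j, L.canonicalBraiding ∘ₗ (TensorProduct.mk k V V).flip (e j) =
      ∑ l, TensorProduct.map (L.brBy (e l)) (L.lam (u l j)) ∘ₗ L.comul := fun j => by
    simpa using L.canonicalBraiding_linear he LinearMap.id j
  have h7 : ∀ l, (TensorProduct.assoc k V V (V ⊗[k] V)).symm _ = _ := fun l =>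
    congrArg (TensorProduct.assoc k V V (V ⊗[k] V)).symm (h5 l)
  simp only [map_sum, LinearEquiv.symm_apply_apply] at h7
  simp only [h6, map_sum_left, LinearMap.sum_apply]
  rw [Finset.sum_comm]
  exact Finset.sum_congr rfl fun l _ => h7 l

end BraidedLieAlgebra

end

section

/-! ### Quadratic-linear quotients of the tensor algebra. -/

namespace Envelope

variable {k : Type u} [Field k] {V : Type w} [AddCommMonoid V] [Module k V]
  {σ : V ⊗[k] V →ₗ[k] V ⊗[k] V} {β : V ⊗[k] V →ₗ[k] V}

/-- The quotient map from the tensor algebra. -/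
def mk (σ : V ⊗[k] V →ₗ[k] V ⊗[k] V) (β : V ⊗[k] V →ₗ[k] V) :
    TensorAlgebra k V →ₐ[k] Envelope σ β :=
  RingQuot.mkAlgHom k _

theorem mk_surjective : Function.Surjective (mk σ β) := RingQuot.mkAlgHom_surjective k _

theorem mk_ι (v : V) : mk σ β (TensorAlgebra.ι k v) = gen σ β v := rfl

theorem mk_degTwo (t : V ⊗[k] V) : mk σ β (degTwo k V t) =
    LinearMap.mul' k _ (TensorProduct.map (gen σ β) (gen σ β) t) := by
  induction t with
  | zero => simp
  | add x y hx hy => simp only [map_add, hx, hy]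
  | tmul x y => simp [degTwo, mk_ι]

theorem mul_gen (t : V ⊗[k] V) :
    LinearMap.mul' k _ (TensorProduct.map (gen σ β) (gen σ β) t) =
      LinearMap.mul' k _ (TensorProduct.map (gen σ β) (gen σ β) (σ t)) + gen σ β (β t) := by
  rw [← mk_degTwo, ← mk_degTwo, ← mk_ι, ← map_add]
  exact RingQuot.mkAlgHom_rel k ⟨t, rfl, rfl⟩

variable {R : Type*} [Semiring R] [Algebra k R]

/-- The universal property of the envelope. -/
def lift (F : V →ₗ[k] R) (h : ∀ t, LinearMap.mul' k R (TensorProduct.map F F t) =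
    LinearMap.mul' k R (TensorProduct.map F F (σ t)) + F (β t)) : Envelope σ β →ₐ[k] R :=
  RingQuot.liftAlgHom k ⟨TensorAlgebra.lift k F, by
    have h2 : ∀ t, TensorAlgebra.lift k F (degTwo k V t) =
        LinearMap.mul' k R (TensorProduct.map F F t) := fun t => by
      induction t with
      | zero => simp
      | add x y hx hy => simp only [map_add, hx, hy]
      | tmul x y => simp [degTwo]
    rintro x y ⟨t, rfl, rfl⟩
    rw [map_add, h2, h2, TensorAlgebra.lift_ι_apply, h]⟩

@[simp] theorem lift_gen (F : V →ₗ[k] R) (h) (v : V) : lift (σ := σ) (β := β) F h (gen σ β v) =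
    F v := by
  rw [← mk_ι, lift, mk, RingQuot.liftAlgHom_mkAlgHom_apply]
  simp

/-- Only left multiplication by a generator is asked for, which is the operation under which the
coproduct of `B(L)` is computed. -/
theorem induction {p : Envelope σ β → Prop} (one : p 1) (add : ∀ x y, p x → p y → p (x + y))
    (smul : ∀ (c : k) x, p x → p (c • x)) (gen_mul : ∀ v x, p x → p (gen σ β v * x))
    (b : Envelope σ β) : p b := by
  obtain ⟨t, rfl⟩ := mk_surjective b
  -- Strengthened to all right factors, so that the product case of induction on the tensor algebra
  -- closes.
  suffices ∀ x, p x → p (mk σ β t * x) by simpa using this 1 one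
  induction t using TensorAlgebra.induction with
  | algebraMap c =>
    intro x hx
    rw [AlgHom.commutes, ← Algebra.smul_def]
    exact smul c x hx
  | ι v => exact fun x hx => gen_mul v x hx
  | mul a b ha hb =>
    intro x hx
    rw [map_mul, mul_assoc]
    exact ha _ (hb _ hx)
  | add a b ha hb =>
    intro x hx
    rw [map_add, add_mul]
    exact add _ _ (ha _ hx) (hb _ hx)

theorem linear_ext {W : Type*} [AddCommMonoid W] [Module k W] {F G : Envelope σ β →ₗ[k] W}
    (one : F 1 = G 1) (gen_mul : ∀ v x, F x = G x → F (gen σ β v * x) = G (gen σ β v * x)) :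
    F = G :=
  LinearMap.ext <| induction one (fun x y hx hy => by rw [map_add, map_add, hx, hy])
    (fun c x hx => by rw [map_smul, map_smul, hx]) gen_mul

theorem algHom_ext {F G : Envelope σ β →ₐ[k] R} (h : ∀ v, F (gen σ β v) = G (gen σ β v)) :
    F = G :=
  AlgHom.toLinearMap_injective <| linear_ext (by simp) fun v x hx => by
    simp only [AlgHom.toLinearMap_apply] at hx ⊢
    rw [map_mul, map_mul, hx, h]

end Envelope

/-! ### Moving an action past a comodule with the braiding. -/

section BraidOp

variable {k : Type u} {A : Type v} [Field k] [Ring A] [HopfAlgebra k A]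
  {N Z W : Type*} [AddCommGroup N] [Module k N] [AddCommGroup Z] [Module k Z] [AddCommGroup W]
  [Module k W]

/-- Given an action `H` of `Z` on `W`, the action of `Z` on `N ⊗ W` obtained by moving `Z` past
`N` with the braiding: `z ⊗ n ⊗ w ↦ r(z⁽¹⁾, n⁽¹⁾) n⁽⁰⁾ ⊗ H(z⁽⁰⁾) w`. -/
def braidOp (r : A →ₗ[k] A →ₗ[k] k) (ρN : N →ₗ[k] N ⊗[k] A) (ρ : Z →ₗ[k] Z ⊗[k] A)
    (H : Z →ₗ[k] W →ₗ[k] W) : Z →ₗ[k] N ⊗[k] W →ₗ[k] N ⊗[k] W :=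
  TensorProduct.lift (((TensorProduct.mapBilinear (RingHom.id k) N W N W).flip ∘ₗ H).compl₂
    (coactBy ρN ∘ₗ r)) ∘ₗ ρ

theorem braidOp_of_coact (r : A →ₗ[k] A →ₗ[k] k) (ρN : N →ₗ[k] N ⊗[k] A) (ρ : Z →ₗ[k] Z ⊗[k] A)
    (H : Z →ₗ[k] W →ₗ[k] W) {ι : Type*} [Fintype ι] {z : Z} {e : ι → Z} {a : ι → A}
    (h : ρ z = ∑ i, e i ⊗ₜ a i) :
    braidOp r ρN ρ H z = ∑ i, TensorProduct.map (coactBy ρN (r (a i))) (H (e i)) := by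
  simp [braidOp, h]

theorem braidOp_family {M : RightComodule k A Z} {ι : Type*} [Fintype ι] [DecidableEq ι]
    {e : ι → Z} {u : ι → ι → A} (he : M.IsFamily e u) (r : A →ₗ[k] A →ₗ[k] k)
    (ρN : N →ₗ[k] N ⊗[k] A) (H : Z →ₗ[k] W →ₗ[k] W) (i : ι) :
    braidOp r ρN M.coact H (e i) =
      ∑ j, TensorProduct.map (coactBy ρN (r (u j i))) (H (e j)) :=
  braidOp_of_coact r ρN M.coact H (he.coact i)

theorem IsComoduleMap.braidOp {Z' : Type*} [AddCommGroup Z'] [Module k Z']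
    {ρ : Z →ₗ[k] Z ⊗[k] A} {ρ' : Z' →ₗ[k] Z' ⊗[k] A} {F : Z' →ₗ[k] Z} (hF : IsComoduleMap ρ' ρ F)
    (r : A →ₗ[k] A →ₗ[k] k) (ρN : N →ₗ[k] N ⊗[k] A) (H : Z →ₗ[k] W →ₗ[k] W) (z : Z') :
    braidOp r ρN ρ H (F z) = braidOp r ρN ρ' (H ∘ₗ F) z := by
  have hF' : ρ (F z) = F.rTensor A (ρ' z) := LinearMap.congr_fun hF z
  simp only [QLie.braidOp, LinearMap.comp_apply, hF']
  generalize ρ' z = t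
  induction t with
  | zero => simp
  | add a b ha hb => simp only [map_add, ha, hb]
  | tmul a b => simp

/-- The other hexagon identity. Since `r` reverses products in its second argument, the two legs of
`Δ(u i j)` act in exchanged order. -/
theorem coactBy_apply_tensor {r : A →ₗ[k] A →ₗ[k] k} (hr : IsCoquasitriangular r)
    (M : RightComodule k A Z) (N : RightComodule k A W) {ι : Type*}
    [Fintype ι] [DecidableEq ι] {u : ι → ι → A} (hu : IsCorep (k := k) u) (i j : ι) :
    coactBy (coactTensor M.coact N.coact) (r (u i j)) =
      ∑ l, TensorProduct.map (coactBy M.coact (r (u l j))) (coactBy N.coact (r (u i l))) := by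
  refine M.hom_ext₂ N fun m n e u f x he hf p q => ?_
  rw [he.coactBy_tensor hf]
  simp only [hr.mul_right_corep hu, LinearMap.sum_apply,
    TensorProduct.map_tmul, he.coactBy, hf.coactBy, TensorProduct.sum_tmul,
    TensorProduct.tmul_sum, TensorProduct.smul_tmul_smul, Finset.sum_smul]
  simp only [← Fintype.sum_prod_type']
  exact sum_reindex (fun z => ⟨z.2.2, z.2.1, z.1⟩) (fun z => ⟨z.2.2, z.2.1, z.1⟩)
    (fun _ => rfl) (fun _ => rfl) fun _ => by dsimp only; rw [mul_comm]

end BraidOp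

/-! ### `B(L)` as a comodule algebra with counit. -/

namespace BraidedLieAlgebra

variable {k : Type u} {A : Type v} [Field k] [Ring A] [HopfAlgebra k A]
  {V : Type w} [AddCommGroup V] [Module k V] {r : A →ₗ[k] A →ₗ[k] k}
  (L : BraidedLieAlgebra k A r V)

theorem mul_gen (t : V ⊗[k] V) : LinearMap.mul' k _ (TensorProduct.map L.gen L.gen
    (L.canonicalBraiding t)) = LinearMap.mul' k _ (TensorProduct.map L.gen L.gen t) := by
  have h := Envelope.mul_gen (σ := L.canonicalBraiding) (β := 0) t
  rw [LinearMap.zero_apply, map_zero, add_zero] at h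
  exact h.symm

section Lift

variable {R : Type*} [Semiring R] [Algebra k R]

/-- The universal property of `B(L)`. -/
def liftB (F : V →ₗ[k] R) (h : ∀ t, LinearMap.mul' k R (TensorProduct.map F F
    (L.canonicalBraiding t)) = LinearMap.mul' k R (TensorProduct.map F F t)) :
    L.BraidedEnvelope →ₐ[k] R :=
  Envelope.lift F fun t => by simp [h]

@[simp] theorem liftB_gen (F : V →ₗ[k] R) (h) (v : V) : L.liftB F h (L.gen v) = F v :=
  Envelope.lift_gen F _ v

end Lift

theorem mul_coact (t : V ⊗[k] V) :
    LinearMap.mul' k (L.BraidedEnvelope ⊗[k] A) (TensorProduct.map (L.gen.rTensor A ∘ₗ L.coact)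
      (L.gen.rTensor A ∘ₗ L.coact) t) =
      (LinearMap.mul' k _ ∘ₗ TensorProduct.map L.gen L.gen).rTensor A
        (coactTensor L.coact L.coact t) := by
  induction t with
  | zero => simp
  | add a b ha hb => simp only [map_add, ha, hb]
  | tmul a b =>
    simp only [TensorProduct.map_tmul, LinearMap.comp_apply, coactTensor]
    generalize L.coact a = s
    generalize L.coact b = t
    induction s with
    | zero => simp
    | add a b ha hb => simp only [TensorProduct.add_tmul, map_add, ha, hb]
    | tmul a b =>
      induction t with
      | zero => simp
      | add a b ha hb => simp only [TensorProduct.tmul_add, map_add, ha, hb]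
      | tmul c d => simp

variable (hr : IsCoquasitriangular r)

/-- The coaction on `B(L)`. -/
def coactB : L.BraidedEnvelope →ₐ[k] L.BraidedEnvelope ⊗[k] A :=
  L.liftB (L.gen.rTensor A ∘ₗ L.coact) fun t => by
    have h := LinearMap.congr_fun (L.isComoduleMap_canonicalBraiding hr) t
    simp only [LinearMap.comp_apply] at h
    rw [mul_coact, mul_coact, h, ← LinearMap.rTensor_comp_apply]
    congr 2
    exact LinearMap.ext fun t => L.mul_gen t

@[simp] theorem coactB_gen (v : V) : L.coactB hr (L.gen v) = L.gen.rTensor A (L.coact v) :=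
  L.liftB_gen _ _ v

/-- `B(L)` as a comodule. -/
def comoduleB : RightComodule k A L.BraidedEnvelope where
  coact := (L.coactB hr).toLinearMap
  coact_coassoc := by
    have h : (Algebra.TensorProduct.assoc k k k L.BraidedEnvelope A A).toAlgHom.comp
        ((Algebra.TensorProduct.map (L.coactB hr) (AlgHom.id k A)).comp (L.coactB hr)) =
        (Algebra.TensorProduct.map (AlgHom.id k _) (Bialgebra.comulAlgHom k A)).comp
          (L.coactB hr) := by
      refine Envelope.algHom_ext fun v => ?_
      have h1 := congrArg (L.gen.rTensor (A ⊗[k] A)) (LinearMap.congr_fun L.coact_coassoc v)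
      change TensorProduct.assoc k _ A A ((L.coactB hr).toLinearMap.rTensor A
        (L.coactB hr (L.gen v))) = (Coalgebra.comul (R := k)).lTensor _ (L.coactB hr (L.gen v))
      rw [coactB_gen]
      simp only [LinearMap.comp_apply, LinearEquiv.coe_coe] at h1
      have h2 : ∀ t : V ⊗[k] A, (Coalgebra.comul (R := k)).lTensor L.BraidedEnvelope
          (L.gen.rTensor A t) = L.gen.rTensor (A ⊗[k] A)
            ((Coalgebra.comul (R := k)).lTensor V t) := fun t => by
        rw [← LinearMap.comp_apply, ← LinearMap.comp_apply, LinearMap.lTensor_comp_rTensor,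
          LinearMap.rTensor_comp_lTensor]
      rw [h2, ← h1]
      generalize L.coact v = t
      induction t with
      | zero => simp
      | add a b ha hb => simp only [map_add, ha, hb]
      | tmul a b =>
        simp only [LinearMap.rTensor_tmul, AlgHom.toLinearMap_apply, coactB_gen]
        generalize L.coact a = t
        induction t with
        | zero => simp
        | add a b ha hb => simp only [map_add, TensorProduct.add_tmul, ha, hb]
        | tmul a b => simp
    exact congrArg AlgHom.toLinearMap h
  coact_counit := by
    have h : (Algebra.TensorProduct.rid k k L.BraidedEnvelope).toAlgHom.comp
        ((Algebra.TensorProduct.map (AlgHom.id k _) (Bialgebra.counitAlgHom k A)).comp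
          (L.coactB hr)) = AlgHom.id k _ := by
      refine Envelope.algHom_ext fun v => ?_
      have h1 := congrArg L.gen (LinearMap.congr_fun L.coact_counit v)
      change TensorProduct.rid k _ ((Coalgebra.counit (R := k)).lTensor _
        (L.coactB hr (L.gen v))) = L.gen v
      rw [coactB_gen]
      refine Eq.trans ?_ h1
      simp only [LinearMap.comp_apply]
      generalize L.coact v = t
      induction t with
      | zero => simp
      | add a b ha hb => simp only [map_add, ha, hb]
      | tmul a b => simp
    exact congrArg AlgHom.toLinearMap h

theorem comoduleB_coact (b : L.BraidedEnvelope) : (L.comoduleB hr).coact b = L.coactB hr b := rfl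

theorem isComoduleMap_gen : IsComoduleMap L.coact (L.comoduleB hr).coact L.gen :=
  LinearMap.ext fun v => L.coactB_gen hr v

theorem isComoduleMap_mul : IsComoduleMap (V := L.BraidedEnvelope ⊗[k] L.BraidedEnvelope)
    (coactTensor (L.comoduleB hr).coact
    (L.comoduleB hr).coact) (L.comoduleB hr).coact (LinearMap.mul' k L.BraidedEnvelope) := by
  refine TensorProduct.ext' fun a b => ?_
  simp only [LinearMap.comp_apply, LinearMap.mul'_apply, comoduleB_coact, map_mul, coactTensor,
    TensorProduct.map_tmul]
  generalize L.coactB hr a = s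
  generalize L.coactB hr b = t
  induction s with
  | zero => simp
  | add a b ha hb => simp only [TensorProduct.add_tmul, map_add, ha, hb, add_mul]
  | tmul a b =>
    induction t with
    | zero => simp
    | add a b ha hb => simp only [TensorProduct.tmul_add, map_add, ha, hb, mul_add]
    | tmul c d => simp

/-- The counit of `B(L)`. -/
def counitB : L.BraidedEnvelope →ₐ[k] k :=
  L.liftB L.counit fun t => by rw [L.counit_canonicalBraiding hr]

@[simp] theorem counitB_gen (v : V) : L.counitB hr (L.gen v) = L.counit v := L.liftB_gen _ _ v

end BraidedLieAlgebra

end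

section

/-! ### The braided tensor product algebra, described by its left multiplications. -/

section ComoduleAlgebra

variable {k : Type u} {A : Type v} [Field k] [Ring A] [HopfAlgebra k A]
  {B : Type*} [Ring B] [Algebra k B] (r : A →ₗ[k] A →ₗ[k] k) (M : RightComodule k A B)

/-- Left multiplication by `b ⊗ 1` on `B ⊗ B`. -/
def opP (k : Type u) (B : Type*) [Field k] [Ring B] [Algebra k B] :
    B →ₗ[k] B ⊗[k] B →ₗ[k] B ⊗[k] B :=
  LinearMap.rTensorHom B ∘ₗ LinearMap.mul k B

/-- Left multiplication by `1 ⊗ b` on the braided tensor product `B ⊗ B`. -/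
def opQ : B →ₗ[k] B ⊗[k] B →ₗ[k] B ⊗[k] B := braidOp r M.coact M.coact (LinearMap.mul k B)

/-- Left multiplication on the braided tensor product `B ⊗ B`. -/
def opS : B ⊗[k] B →ₗ[k] B ⊗[k] B →ₗ[k] B ⊗[k] B :=
  TensorProduct.lift ((LinearMap.mul k (Module.End k (B ⊗[k] B))).compl₁₂ (opP k B) (opQ r M))

theorem opP_def (b : B) : opP k B b = (LinearMap.mul k B b).rTensor B := rfl

theorem opS_tmul (a b : B) : opS r M (a ⊗ₜ b) = opP k B a ∘ₗ opQ r M b := rfl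

variable {ι : Type*} [Fintype ι] [DecidableEq ι] {e : ι → B} {u : ι → ι → A}

theorem opQ_family (he : M.IsFamily e u) (i : ι) : opQ r M (e i) =
    ∑ j, TensorProduct.map (coactBy M.coact (r (u j i))) (LinearMap.mul k B (e j)) :=
  braidOp_family he r _ _ i

variable {r M} (hr : IsCoquasitriangular r)

theorem opP_mul (a b : B) : opP k B (a * b) = opP k B a ∘ₗ opP k B b :=
  TensorProduct.ext' fun x y => by simp [opP_def, mul_assoc]

theorem opP_one : opP k B 1 = LinearMap.id :=
  TensorProduct.ext' fun x y => by simp [opP_def]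

theorem opS_opP (x : B) (s : B ⊗[k] B) : opS r M (opP k B x s) = opP k B x ∘ₗ opS r M s := by
  induction s with
  | zero => simp
  | add a b ha hb => simp only [map_add, ha, hb, LinearMap.comp_add]
  | tmul a b =>
    have h : opP k B x (a ⊗ₜ b) = (x * a) ⊗ₜ b := rfl
    rw [h, opS_tmul, opS_tmul, opP_mul, LinearMap.comp_assoc]

include hr

theorem coactBy_mul_apply (M : RightComodule k A B) (a b : A) :
    coactBy M.coact (r (a * b)) = coactBy M.coact (r a) ∘ₗ coactBy M.coact (r b) :=
  LinearMap.ext fun v => by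
    rw [LinearMap.comp_apply, M.coactBy_coactBy, conv_apply_apply hr]

variable (h1 : M.coact 1 = 1 ⊗ₜ 1)
  (hm : IsComoduleMap (V := B ⊗[k] B) (coactTensor M.coact M.coact) M.coact (LinearMap.mul' k B))

omit hr in
include h1 in
theorem coactBy_one (φ : Module.Dual k A) : coactBy M.coact φ 1 = φ 1 • 1 := by
  simp [coactBy_apply, h1]

include h1 in
theorem opQ_one : opQ r M 1 = LinearMap.id := by
  have h : M.coact 1 = ∑ _i : Unit, (1 : B) ⊗ₜ (1 : A) := by simp [h1]
  rw [opQ, braidOp_of_coact r _ _ _ h]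
  refine TensorProduct.ext' fun x y => ?_
  simp [apply_one hr, M.coactBy_counit]

include h1 in
theorem opQ_apply_one (a : B) : opQ r M a (1 ⊗ₜ 1) = 1 ⊗ₜ a := by
  have h : (opQ r M).flip (1 ⊗ₜ 1) = TensorProduct.mk k B B 1 := by
    refine M.hom_ext fun m e u he i => ?_
    simp [opQ_family r M he, coactBy_one h1, hr.one_right, he.counit, ite_tmul']
  exact LinearMap.congr_fun h a

include h1 in
theorem opS_one : opS r M (1 ⊗ₜ 1) = LinearMap.id := by
  rw [opS_tmul, opP_one, opQ_one hr h1, LinearMap.id_comp]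

include h1 in
theorem opS_apply_one (s : B ⊗[k] B) : opS r M s (1 ⊗ₜ 1) = s := by
  induction s with
  | zero => simp
  | add a b ha hb => simp only [map_add, LinearMap.add_apply, ha, hb]
  | tmul a b => simp [opS_tmul, opQ_apply_one hr h1, opP_def]

omit hr in
include hm in
theorem coact_mul_family {κ : Type*} [Fintype κ] [DecidableEq κ] {f : κ → B} {x : κ → κ → A}
    (he : M.IsFamily e u) (hf : M.IsFamily f x) (i : ι) (p : κ) :
    M.coact (e i * f p) = ∑ a : ι × κ, (e a.1 * f a.2) ⊗ₜ (u a.1 i * x a.2 p) := by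
  have h := LinearMap.congr_fun hm (e i ⊗ₜ f p)
  simp only [LinearMap.comp_apply, LinearMap.mul'_apply, he.coactTensor_apply hf, map_sum,
    LinearMap.rTensor_tmul] at h
  rw [h, Fintype.sum_prod_type]

include hm in
theorem opQ_mul (a b : B) : opQ r M (a * b) = opQ r M a ∘ₗ opQ r M b := by
  have h : opQ r M ∘ₗ LinearMap.mul' k B =
      TensorProduct.lift ((LinearMap.mul k (Module.End k (B ⊗[k] B))).compl₁₂ (opQ r M)
        (opQ r M)) := by
    refine M.hom_ext₂ M fun m n e u f x he hf i p => ?_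
    simp only [LinearMap.comp_apply, LinearMap.mul'_apply, TensorProduct.lift.tmul,
      LinearMap.compl₁₂_apply, LinearMap.mul_apply', opQ_family r M he, opQ_family r M hf,
      Finset.sum_mul_sum]
    rw [opQ, braidOp_of_coact r _ _ _ (coact_mul_family hm he hf i p), Fintype.sum_prod_type]
    refine Finset.sum_congr rfl fun j _ => Finset.sum_congr rfl fun q _ => ?_
    rw [Module.End.mul_eq_comp, ← TensorProduct.map_comp, coactBy_mul_apply hr]
    congr 1
    exact LinearMap.ext fun y => mul_assoc _ _ _
  exact LinearMap.congr_fun h (a ⊗ₜ b)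

include hm in
theorem coactBy_comp_mul {u : ι → ι → A} (hu : IsCorep (k := k) u) (i j : ι) (b : B) :
    coactBy M.coact (r (u i j)) ∘ₗ LinearMap.mul k B b =
      ∑ l, LinearMap.mul k B (coactBy M.coact (r (u l j)) b) ∘ₗ coactBy M.coact (r (u i l)) := by
  refine LinearMap.ext fun c => ?_
  have h := hm.coactBy (r (u i j)) (b ⊗ₜ c)
  rw [coactBy_apply_tensor hr M M hu] at h
  simp only [LinearMap.sum_apply, TensorProduct.map_tmul, map_sum, LinearMap.mul'_apply] at h
  simp [h]

-- The exchange relation of the braided tensor product. It holds because the product is colinear, so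
-- that `r(u, -)` acts on a product factor by factor (`coactBy_comp_mul`).
include hm in
theorem opQ_opP (a b : B) : opQ r M a ∘ₗ opP k B b =
    opS r M (braiding r M.coact M.coact (a ⊗ₜ b)) := by
  have h : (LinearMap.mul k (Module.End k (B ⊗[k] B))).flip (opP k B b) ∘ₗ opQ r M =
      opS r M ∘ₗ braiding r M.coact M.coact ∘ₗ (TensorProduct.mk k B B).flip b := by
    refine M.hom_ext fun m e u he i => ?_
    simp only [LinearMap.comp_apply, LinearMap.flip_apply, TensorProduct.mk_apply,
      LinearMap.mul_apply', opQ_family r M he, he.braiding_left, map_sum, opS_tmul,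
      Module.End.mul_eq_comp, opP_def, linearMap_comp_sum, LinearMap.map_comp_rTensor,
      LinearMap.rTensor_comp_map, coactBy_comp_mul hr hm he.toIsCorep, map_sum_left]
    exact Finset.sum_comm
  exact LinearMap.congr_fun h a

include hm in
theorem opS_opQ (x : B) (s : B ⊗[k] B) : opS r M (opQ r M x s) = opQ r M x ∘ₗ opS r M s := by
  induction s with
  | zero => simp
  | add a b ha hb => simp only [map_add, ha, hb, LinearMap.comp_add]
  | tmul a b =>
    rw [opS_tmul, ← LinearMap.comp_assoc, opQ_opP hr hm]
    have h : opS r M ∘ₗ (opQ r M).flip (a ⊗ₜ b) =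
        (LinearMap.mul k (Module.End k (B ⊗[k] B))).flip (opQ r M b) ∘ₗ
          opS r M ∘ₗ braiding r M.coact M.coact ∘ₗ (TensorProduct.mk k B B).flip a := by
      refine M.hom_ext fun m e u he i => ?_
      simp only [LinearMap.comp_apply, LinearMap.flip_apply, TensorProduct.mk_apply,
        opQ_family r M he, LinearMap.sum_apply, TensorProduct.map_tmul, map_sum, opS_tmul,
        he.braiding_left, LinearMap.mul_apply', Module.End.mul_eq_comp, opQ_mul hr hm,
        LinearMap.comp_assoc]
    exact LinearMap.congr_fun h x

-- Associativity of the braided tensor product in terms of operators; it follows from the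
-- multiplicativity of `opP` and `opQ` and from the exchange relation. The coproduct of `B(L)` can
-- thus be built as an algebra map into `Module.End`, without a second ring structure on `B ⊗ B`.
include hm in
theorem opS_opS (s t : B ⊗[k] B) : opS r M (opS r M s t) = opS r M s ∘ₗ opS r M t := by
  induction s with
  | zero => simp
  | add a b ha hb => simp only [map_add, LinearMap.add_apply, ha, hb, LinearMap.add_comp]
  | tmul a b => rw [opS_tmul, LinearMap.comp_apply, opS_opP, opS_opQ hr hm, LinearMap.comp_assoc]

omit hr in
theorem opS_apply (s t : B ⊗[k] B) : opS r M s t = TensorProduct.map (LinearMap.mul' k B)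
    (LinearMap.mul' k B) (midMap (braiding r M.coact M.coact) (s ⊗ₜ t)) := by
  induction s with
  | zero => simp
  | add a b ha hb => simp only [map_add, LinearMap.add_apply, ha, hb, TensorProduct.add_tmul]
  | tmul a b =>
    induction t with
    | zero => simp
    | add a b ha hb => simp only [map_add, ha, hb, TensorProduct.tmul_add]
    | tmul c d =>
      have h : (opP k B a ∘ₗ (opQ r M).flip (c ⊗ₜ d)) = TensorProduct.map (LinearMap.mul' k B)
          (LinearMap.mul' k B) ∘ₗ midMap (braiding r M.coact M.coact) ∘ₗ
            (TensorProduct.mk k _ _).flip (c ⊗ₜ d) ∘ₗ TensorProduct.mk k B B a := by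
        refine M.hom_ext fun m e u he i => ?_
        simp [opQ_family r M he, midMap_tmul, he.braiding_left, opP_def, TensorProduct.sum_tmul,
          TensorProduct.tmul_sum]
      exact LinearMap.congr_fun h b

end ComoduleAlgebra

namespace BraidedLieAlgebra

variable {k : Type u} {A : Type v} [Field k] [Ring A] [HopfAlgebra k A]
  {V : Type w} [AddCommGroup V] [Module k V] {r : A →ₗ[k] A →ₗ[k] k}
  (L : BraidedLieAlgebra k A r V) (hr : IsCoquasitriangular r)

theorem comoduleB_one : (L.comoduleB hr).coact 1 = 1 ⊗ₜ 1 := by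
  rw [comoduleB_coact, map_one, Algebra.TensorProduct.one_def]

section Relations

variable {B : Type*} [Ring B] [Algebra k B] (M : RightComodule k A B) (g : V →ₗ[k] B)

/-- The action of `V ⊗ V` on `B ⊗ B` by left multiplication in the braided tensor product. -/
def opX (r : A →ₗ[k] A →ₗ[k] k) : V ⊗[k] V →ₗ[k] B ⊗[k] B →ₗ[k] B ⊗[k] B :=
  opS r M ∘ₗ TensorProduct.map g g

/-- Products `P(ab) Q(cd)`. -/
def opPQ (r : A →ₗ[k] A →ₗ[k] k) :
    (V ⊗[k] V) ⊗[k] (V ⊗[k] V) →ₗ[k] B ⊗[k] B →ₗ[k] B ⊗[k] B :=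
  TensorProduct.lift ((LinearMap.mul k (Module.End k (B ⊗[k] B))).compl₁₂
    (opP k B ∘ₗ LinearMap.mul' k B ∘ₗ TensorProduct.map g g)
    (opQ r M ∘ₗ LinearMap.mul' k B ∘ₗ TensorProduct.map g g))

theorem opPQ_tmul (s t : V ⊗[k] V) : opPQ M g r (s ⊗ₜ t) =
    opP k B (LinearMap.mul' k B (TensorProduct.map g g s)) ∘ₗ
      opQ r M (LinearMap.mul' k B (TensorProduct.map g g t)) := rfl

variable {M g} (hg : IsComoduleMap L.coact M.coact g)
  (hm : IsComoduleMap (V := B ⊗[k] B) (coactTensor M.coact M.coact) M.coact (LinearMap.mul' k B))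
include hr hg hm

/-- In `(a ⊗ b)(c ⊗ d)` only the middle factors `b` and `c` have to be exchanged; colinearity of `g`
carries the braiding of `V` to that of `B`. -/
theorem opX_comp_opX (s t : V ⊗[k] V) : opX M g r s ∘ₗ opX M g r t =
    opPQ M g r (midMap (braiding r L.coact L.coact) (s ⊗ₜ t)) := by
  induction s with
  | zero => simp
  | add a b ha hb => simp only [map_add, LinearMap.add_comp, ha, hb, TensorProduct.add_tmul]
  | tmul a b =>
    induction t with
    | zero => simp
    | add c d hc hd => simp only [map_add, LinearMap.comp_add, hc, hd, TensorProduct.tmul_add]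
    | tmul c d =>
      have h := opQ_opP hr hm (g b) (g c)
      rw [hg.braiding_map hg] at h
      simp only [opX, LinearMap.comp_apply, TensorProduct.map_tmul, opS_tmul, midMap_tmul]
      rw [LinearMap.comp_assoc, ← LinearMap.comp_assoc _ (opP k _ (g c)), h]
      generalize braiding r L.coact L.coact (b ⊗ₜ c) = z
      induction z with
      | zero => simp
      | add a b ha hb =>
        simp only [map_add, LinearMap.comp_add, LinearMap.add_comp, ha, hb,
          TensorProduct.add_tmul, TensorProduct.tmul_add]
      | tmul x y =>
        simp only [TensorProduct.map_tmul, opS_tmul, TensorProduct.assoc_tmul,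
          TensorProduct.assoc_symm_tmul, opPQ_tmul, LinearMap.mul'_apply, opP_mul,
          opQ_mul hr hm, LinearMap.comp_assoc]

/-- A product of two coproducts is `opPQ` of the braided coproduct of `V ⊗ V`. There `Υ` becomes `Υ
⊗ Υ`, and each copy is absorbed by the quadratic relation in its own leg. -/
theorem mul_opX (hΥ : ∀ t, LinearMap.mul' k B (TensorProduct.map g g (L.canonicalBraiding t)) =
      LinearMap.mul' k B (TensorProduct.map g g t)) (t : V ⊗[k] V) :
    LinearMap.mul' k (Module.End k (B ⊗[k] B)) (TensorProduct.map (opX M g r ∘ₗ L.comul)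
      (opX M g r ∘ₗ L.comul) (L.canonicalBraiding t)) =
      LinearMap.mul' k (Module.End k (B ⊗[k] B)) (TensorProduct.map (opX M g r ∘ₗ L.comul)
        (opX M g r ∘ₗ L.comul) t) := by
  have h : ∀ t, LinearMap.mul' k (Module.End k (B ⊗[k] B)) (TensorProduct.map
      (opX M g r ∘ₗ L.comul) (opX M g r ∘ₗ L.comul) t) = opPQ M g r (L.comulTensor t) := by
    intro t
    induction t with
    | zero => simp
    | add a b ha hb => simp only [map_add, ha, hb]
    | tmul a b => exact L.opX_comp_opX hr hg hm (L.comul a) (L.comul b)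
  have h2 := LinearMap.congr_fun (L.comulTensor_canonicalBraiding hr) t
  simp only [LinearMap.comp_apply] at h2
  rw [h, h, h2]
  generalize L.comulTensor t = s
  induction s with
  | zero => simp
  | add a b ha hb => simp only [map_add, ha, hb]
  | tmul a b => simp only [TensorProduct.map_tmul, opPQ_tmul, hΥ]

end Relations

/-- `B(L)` acting on `B(L) ⊗ B(L)` by left multiplication with the coproduct. -/
def deltaHom : L.BraidedEnvelope →ₐ[k]
    Module.End k (L.BraidedEnvelope ⊗[k] L.BraidedEnvelope) :=
  L.liftB (opX (L.comoduleB hr) L.gen r ∘ₗ L.comul)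
    (L.mul_opX hr (L.isComoduleMap_gen hr) (L.isComoduleMap_mul hr) L.mul_gen)

theorem deltaHom_gen (v : V) : L.deltaHom hr (L.gen v) = opX (L.comoduleB hr) L.gen r (L.comul v) :=
  L.liftB_gen _ _ v

/-- The coproduct of `B(L)`. -/
def comulB : L.BraidedEnvelope →ₗ[k] L.BraidedEnvelope ⊗[k] L.BraidedEnvelope :=
  LinearMap.applyₗ (1 ⊗ₜ 1) ∘ₗ (L.deltaHom hr).toLinearMap

/-- The operators in the image commute with right multiplication in the braided tensor product, so
each is left multiplication by its value at `1 ⊗ 1`. -/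
theorem opS_comulB (b : L.BraidedEnvelope) :
    opS r (L.comoduleB hr) (L.comulB hr b) = L.deltaHom hr b := by
  have h : ∀ t, opS r (L.comoduleB hr) (L.deltaHom hr b t) =
      L.deltaHom hr b ∘ₗ opS r (L.comoduleB hr) t := by
    induction b using Envelope.induction with
    | one => simp [Module.End.one_eq_id]
    | add x y hx hy => intro t; simp only [map_add, LinearMap.add_apply, hx, hy, LinearMap.add_comp]
    | smul c x hx => intro t; simp only [map_smul, LinearMap.smul_apply, hx, LinearMap.smul_comp]
    | gen_mul v x hx =>
      intro t
      have h : L.deltaHom hr (Envelope.gen L.canonicalBraiding 0 v) = _ := L.deltaHom_gen hr v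
      rw [map_mul, Module.End.mul_apply, h, opX, LinearMap.comp_apply,
        opS_opS hr (L.isComoduleMap_mul hr), hx, Module.End.mul_eq_comp, LinearMap.comp_assoc]
  refine (h _).trans ?_
  rw [opS_one hr (L.comoduleB_one hr), LinearMap.comp_id]

theorem comulB_one : L.comulB hr 1 = 1 ⊗ₜ 1 := by
  simp [comulB]

theorem comulB_mul (a b : L.BraidedEnvelope) :
    L.comulB hr (a * b) = opS r (L.comoduleB hr) (L.comulB hr a) (L.comulB hr b) := by
  rw [opS_comulB]
  simp [comulB]

theorem comulB_gen_mul (v : V) (b : L.BraidedEnvelope) :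
    L.comulB hr (L.gen v * b) = opX (L.comoduleB hr) L.gen r (L.comul v) (L.comulB hr b) := by
  rw [comulB_mul, opS_comulB, deltaHom_gen]

theorem comulB_gen (v : V) : L.comulB hr (L.gen v) = TensorProduct.map L.gen L.gen (L.comul v) := by
  have h : L.comulB hr (L.gen v) = opX (L.comoduleB hr) L.gen r (L.comul v) (1 ⊗ₜ 1) := by
    rw [← deltaHom_gen]
    rfl
  rw [h, opX, LinearMap.comp_apply, opS_apply_one hr (L.comoduleB_one hr)]

end BraidedLieAlgebra

end

section

/-! ### The coalgebra axioms of `B(L)`. -/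

namespace BraidedLieAlgebra

variable {k : Type u} {A : Type v} [Field k] [Ring A] [HopfAlgebra k A]
  {V : Type w} [AddCommGroup V] [Module k V] {r : A →ₗ[k] A →ₗ[k] k}
  (L : BraidedLieAlgebra k A r V) (hr : IsCoquasitriangular r)

section Coalgebra

variable {B : Type*} [Ring B] [Algebra k B] {M : RightComodule k A B} {g : V →ₗ[k] B}
  (hg : IsComoduleMap L.coact M.coact g)

include hg

theorem opX_family {ι : Type*} [Fintype ι] [DecidableEq ι] {e : ι → V} {u : ι → ι → A}
    (he : L.toRightComodule.IsFamily e u) (w : V) (i : ι) : opX M g r (w ⊗ₜ e i) =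
      ∑ j, TensorProduct.map (LinearMap.mul k B (g w) ∘ₗ coactBy M.coact (r (u j i)))
        (LinearMap.mul k B (g (e j))) := by
  have h : opQ r M (g (e i)) = ∑ j, TensorProduct.map (coactBy M.coact (r (u j i)))
      (LinearMap.mul k B (g (e j))) := by
    rw [opQ, hg.braidOp]
    exact braidOp_family he r _ _ i
  simp only [opX, LinearMap.comp_apply, TensorProduct.map_tmul, opS_tmul, h, linearMap_comp_sum,
    opP_def, LinearMap.rTensor_comp_map]

variable {D : B →ₗ[k] B ⊗[k] B} {ε : B →ₗ[k] k}

/-- Induction step for the left counit axiom. Here `ε` falls on the factor moved by the braiding,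
and colinearity of `ε` on `B` makes the braiding trivial. -/
theorem counit_left_opX (hε : ∀ v b, ε (g v * b) = L.counit v * ε b)
    (hc : (TensorProduct.lid k A).toLinearMap ∘ₗ ε.rTensor A ∘ₗ M.coact =
      LinearMap.toSpanSingleton k A 1 ∘ₗ ε) (hr : IsCoquasitriangular r) (y : V ⊗[k] V)
    (s : B ⊗[k] B) :
    TensorProduct.lid k B (ε.rTensor B (opX M g r y s)) =
      g (TensorProduct.lid k V (L.counit.rTensor V y)) *
        TensorProduct.lid k B (ε.rTensor B s) := by
  have h1 : ∀ a, ε ∘ₗ coactBy M.coact (r a) = Coalgebra.counit (R := k) a • ε := by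
    intro a
    refine LinearMap.ext fun c => ?_
    have h := LinearMap.congr_fun hc c
    simp only [LinearMap.comp_apply, LinearEquiv.coe_coe, LinearMap.toSpanSingleton_apply] at h
    have h2 : ε (coactBy M.coact (r a) c) = r a (TensorProduct.lid k A (ε.rTensor A
        (M.coact c))) := by
      rw [coactBy_apply]
      generalize M.coact c = t
      induction t with
      | zero => simp
      | add a b ha hb => simp only [map_add, ha, hb]
      | tmul a b => simp [mul_comm]
    simp [h2, h, hr.one_right, mul_comm]
  have h2 : ∀ w, ε ∘ₗ LinearMap.mul k B (g w) = L.counit w • ε := fun w =>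
    LinearMap.ext fun b => hε w b
  have h : (TensorProduct.lid k B).toLinearMap ∘ₗ ε.rTensor B ∘ₗ (opX M g r).flip s =
      LinearMap.mulRight k (TensorProduct.lid k B (ε.rTensor B s)) ∘ₗ g ∘ₗ
        (TensorProduct.lid k V).toLinearMap ∘ₗ L.counit.rTensor V := by
    refine TensorProduct.ext (LinearMap.ext fun w => L.toRightComodule.hom_ext
      fun m e u he i => ?_)
    have h3 : ∀ j, ε.rTensor B ∘ₗ TensorProduct.map (LinearMap.mul k B (g w) ∘ₗ
        coactBy M.coact (r (u j i))) (LinearMap.mul k B (g (e j))) =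
        (L.counit w * if j = i then 1 else 0) • TensorProduct.map ε (LinearMap.mul k B (g (e j)))
        := by
      intro j
      rw [LinearMap.rTensor_comp_map, ← LinearMap.comp_assoc, h2, LinearMap.smul_comp, h1,
        he.counit, smul_smul, TensorProduct.map_smul_left]
    simp only [LinearMap.compr₂ₛₗ_apply, TensorProduct.mk_apply, LinearMap.comp_apply,
      LinearMap.flip_apply, L.opX_family hg he, LinearMap.sum_apply, map_sum]
    simp only [← LinearMap.comp_apply (ε.rTensor B), h3]
    rw [Finset.sum_eq_single i (fun l _ hl => by simp [hl]) (by simp)]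
    simp only [if_true, mul_one, LinearMap.smul_apply, map_smul, LinearMap.rTensor_tmul,
      LinearEquiv.coe_coe, TensorProduct.lid_tmul, LinearMap.mulRight_apply]
    congr 1
    induction s with
    | zero => simp
    | add a b ha hb => simp only [map_add, ha, hb, mul_add]
    | tmul a b => simp
  exact LinearMap.congr_fun h y

/-- Induction step for the right counit axiom. Now the counit falls on the braided generators, and
its colinearity on `V` trivialises the braiding. -/
theorem counit_right_opX (hε : ∀ v b, ε (g v * b) = L.counit v * ε b)
    (hr : IsCoquasitriangular r) (y : V ⊗[k] V) (s : B ⊗[k] B) :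
    TensorProduct.rid k B (ε.lTensor B (opX M g r y s)) =
      g (TensorProduct.rid k V (L.counit.lTensor V y)) *
        TensorProduct.rid k B (ε.lTensor B s) := by
  have h2 : ∀ w, ε ∘ₗ LinearMap.mul k B (g w) = L.counit w • ε := fun w =>
    LinearMap.ext fun b => hε w b
  have h : (TensorProduct.rid k B).toLinearMap ∘ₗ ε.lTensor B ∘ₗ (opX M g r).flip s =
      LinearMap.mulRight k (TensorProduct.rid k B (ε.lTensor B s)) ∘ₗ g ∘ₗ
        (TensorProduct.rid k V).toLinearMap ∘ₗ L.counit.lTensor V := by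
    refine TensorProduct.ext (LinearMap.ext fun w => L.toRightComodule.hom_ext
      fun m e u he i => ?_)
    have h0 := LinearMap.congr_fun L.counit_comodule (e i)
    have h00 : L.coact (e i) = _ := he.coact i
    simp only [LinearMap.comp_apply, LinearEquiv.coe_coe, LinearMap.toSpanSingleton_apply, h00,
      map_sum, LinearMap.rTensor_tmul, TensorProduct.lid_tmul] at h0
    have h3 : ∑ j, ε.lTensor B ∘ₗ TensorProduct.map (LinearMap.mul k B (g w) ∘ₗ
        coactBy M.coact (r (u j i))) (LinearMap.mul k B (g (e j))) =
        L.counit (e i) • TensorProduct.map (LinearMap.mul k B (g w)) ε := by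
      have h4 : ∀ j, ε.lTensor B ∘ₗ TensorProduct.map (LinearMap.mul k B (g w) ∘ₗ
          coactBy M.coact (r (u j i))) (LinearMap.mul k B (g (e j))) =
          TensorProduct.map (LinearMap.mul k B (g w) ∘ₗ
            coactBy M.coact (r (L.counit (e j) • u j i))) ε := by
        intro j
        rw [LinearMap.lTensor_comp_map, h2, map_smul, map_smul, LinearMap.comp_smul,
          TensorProduct.map_smul_right, TensorProduct.map_smul_left]
      have h5 : coactBy M.coact (Coalgebra.counit (R := k)) = LinearMap.id :=
        LinearMap.ext M.coactBy_counit
      simp only [h4]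
      rw [← map_sum_left, ← linearMap_comp_sum, ← map_sum, ← map_sum, h0, map_smul, map_smul,
        apply_one hr, h5, LinearMap.comp_smul, LinearMap.comp_id, TensorProduct.map_smul_left]
    simp only [LinearMap.compr₂ₛₗ_apply, TensorProduct.mk_apply, LinearMap.comp_apply,
      LinearMap.flip_apply, L.opX_family hg he, LinearMap.sum_apply, map_sum]
    simp only [← LinearMap.comp_apply (ε.lTensor B), ← map_sum, ← LinearMap.sum_apply, h3]
    simp only [LinearMap.smul_apply, map_smul, LinearMap.lTensor_tmul,
      LinearEquiv.coe_coe, TensorProduct.rid_tmul, LinearMap.mulRight_apply]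
    congr 1
    induction s with
    | zero => simp
    | add a b ha hb => simp only [map_add, ha, hb, mul_add]
    | tmul a b => simp
  exact LinearMap.congr_fun h y

omit hg in
/-- The action of `(V ⊗ V) ⊗ V` on `(B ⊗ B) ⊗ B` by left multiplication. -/
def opL (M : RightComodule k A B) (g : V →ₗ[k] B) :
    (V ⊗[k] V) ⊗[k] V →ₗ[k] (B ⊗[k] B) ⊗[k] B →ₗ[k] (B ⊗[k] B) ⊗[k] B :=
  TensorProduct.lift ((LinearMap.mul k (Module.End k ((B ⊗[k] B) ⊗[k] B))).compl₁₂
    (LinearMap.rTensorHom B ∘ₗ opX M g r)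
    (braidOp r (coactTensor M.coact M.coact) L.coact (LinearMap.mul k B ∘ₗ g)))

omit hg in
/-- The action of `V ⊗ (V ⊗ V)` on `B ⊗ (B ⊗ B)` by left multiplication. -/
def opR (M : RightComodule k A B) (g : V →ₗ[k] B) :
    V ⊗[k] (V ⊗[k] V) →ₗ[k] B ⊗[k] (B ⊗[k] B) →ₗ[k] B ⊗[k] (B ⊗[k] B) :=
  TensorProduct.lift ((LinearMap.mul k (Module.End k (B ⊗[k] (B ⊗[k] B)))).compl₁₂
    (LinearMap.rTensorHom (B ⊗[k] B) ∘ₗ LinearMap.mul k B ∘ₗ g)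
    (braidOp r M.coact (coactTensor L.coact L.coact) (opX M g r)))

omit hg in
theorem opL_tmul (y : V ⊗[k] V) (v : V) : L.opL M g (y ⊗ₜ v) = (opX M g r y).rTensor B ∘ₗ
    braidOp r (coactTensor M.coact M.coact) L.coact (LinearMap.mul k B ∘ₗ g) v := rfl

omit hg in
theorem opR_tmul (w : V) (z : V ⊗[k] V) : L.opR M g (w ⊗ₜ z) =
    (LinearMap.mul k B (g w)).rTensor (B ⊗[k] B) ∘ₗ
      braidOp r M.coact (coactTensor L.coact L.coact) (opX M g r) z := rfl

/-- Associativity of left multiplication on the threefold braided product. A generator passes two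
factors at once or one after the other, and two generators pass a factor together or successively;
the hexagon identities, that is multiplicativity of `r` in both arguments, make these agree. -/
theorem assoc_opL (hr : IsCoquasitriangular r) (t : (V ⊗[k] V) ⊗[k] V) :
    (TensorProduct.assoc k B B B).toLinearMap ∘ₗ L.opL M g t =
      L.opR M g (TensorProduct.assoc k V V V t) ∘ₗ
        (TensorProduct.assoc k B B B).toLinearMap := by
  have h : LinearMap.llcomp k _ _ _ (TensorProduct.assoc k B B B).toLinearMap ∘ₗ L.opL M g =
      LinearMap.lcomp k _ (TensorProduct.assoc k B B B).toLinearMap ∘ₗ L.opR M g ∘ₗ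
        (TensorProduct.assoc k V V V).toLinearMap := by
    refine TensorProduct.ext (TensorProduct.ext (LinearMap.ext fun w => ?_))
    refine L.toRightComodule.hom_ext fun m e u he i => L.toRightComodule.hom_ext
      fun n f x hf p => ?_
    have hfe : braidOp r M.coact (coactTensor L.coact L.coact) (opX M g r) (e i ⊗ₜ f p) = _ :=
      braidOp_family (he.tensor hf) r M.coact (opX M g r) (i, p)
    simp only [LinearMap.compr₂ₛₗ_apply, TensorProduct.mk_apply, LinearMap.comp_apply,
      LinearEquiv.coe_coe, TensorProduct.assoc_tmul, LinearMap.llcomp_apply',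
      LinearMap.lcomp_apply', opL_tmul, opR_tmul, hfe, L.opX_family hg he, L.opX_family hg hf,
      braidOp_family hf, coactBy_apply_tensor hr M M hf.toIsCorep, coactBy_mul_apply hr,
      Fintype.sum_prod_type, LinearMap.rTensor, linearMap_comp_sum, linearMap_sum_comp,
      map_sum_left, map_sum_right, ← TensorProduct.map_comp, LinearMap.id_comp,
      LinearMap.comp_assoc, TensorProduct.map_map_comp_assoc_eq]
    simp only [← Fintype.sum_prod_type']
    exact sum_reindex (fun z => ⟨z.2.2, z.2.1, z.1⟩) (fun z => ⟨z.2.2, z.2.1, z.1⟩)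
      (fun _ => rfl) (fun _ => rfl) fun _ => rfl
  exact LinearMap.congr_fun h t

/-- `D` on the left leg meets a product, treated by `hmul`, and a braiding operator, past which it
moves by colinearity of `D`. -/
theorem comul_opX_left (hmul : ∀ v b, D (g v * b) = opX M g r (L.comul v) (D b))
    (hD : IsComoduleMap M.coact (coactTensor M.coact M.coact) D) (y : V ⊗[k] V) :
    D.rTensor B ∘ₗ opX M g r y = L.opL M g (L.comul.rTensor V y) ∘ₗ D.rTensor B := by
  have h : LinearMap.llcomp k _ _ _ (D.rTensor B) ∘ₗ opX M g r =
      LinearMap.lcomp k _ (D.rTensor B) ∘ₗ L.opL M g ∘ₗ L.comul.rTensor V := by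
    refine TensorProduct.ext (LinearMap.ext fun w => L.toRightComodule.hom_ext
      fun m e u he i => ?_)
    have h1 : D ∘ₗ LinearMap.mul k B (g w) = opX M g r (L.comul w) ∘ₗ D :=
      LinearMap.ext fun b => hmul w b
    have h2 : ∀ φ, D ∘ₗ coactBy M.coact φ = coactBy (coactTensor M.coact M.coact) φ ∘ₗ D :=
      fun φ => LinearMap.ext fun b => hD.coactBy φ b
    simp only [LinearMap.compr₂ₛₗ_apply, TensorProduct.mk_apply, LinearMap.comp_apply,
      LinearMap.llcomp_apply', LinearMap.lcomp_apply', L.opX_family hg he, LinearMap.rTensor_tmul,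
      opL_tmul, braidOp_family he, linearMap_comp_sum, linearMap_sum_comp,
      LinearMap.rTensor_comp_map, LinearMap.map_comp_rTensor]
    refine Finset.sum_congr rfl fun j _ => ?_
    rw [← LinearMap.comp_assoc, h1, LinearMap.comp_assoc, h2, LinearMap.comp_assoc]
  exact LinearMap.congr_fun h y

/-- On the right leg it is the generator that gets split, and the braiding is carried along by
colinearity of the coproduct of `V`. -/
theorem comul_opX_right (hmul : ∀ v b, D (g v * b) = opX M g r (L.comul v) (D b))
    (y : V ⊗[k] V) :
    D.lTensor B ∘ₗ opX M g r y = L.opR M g (L.comul.lTensor V y) ∘ₗ D.lTensor B := by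
  have h : LinearMap.llcomp k _ _ _ (D.lTensor B) ∘ₗ opX M g r =
      LinearMap.lcomp k _ (D.lTensor B) ∘ₗ L.opR M g ∘ₗ L.comul.lTensor V := by
    refine TensorProduct.ext (LinearMap.ext fun w => L.toRightComodule.hom_ext
      fun m e u he i => ?_)
    have h1 : ∀ v, D ∘ₗ LinearMap.mul k B (g v) = opX M g r (L.comul v) ∘ₗ D :=
      fun v => LinearMap.ext fun b => hmul v b
    have h2 : IsComoduleMap L.coact (coactTensor L.coact L.coact) L.comul := L.comul_comodule
    simp only [LinearMap.compr₂ₛₗ_apply, TensorProduct.mk_apply, LinearMap.comp_apply,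
      LinearMap.llcomp_apply', LinearMap.lcomp_apply', L.opX_family hg he, LinearMap.lTensor_tmul,
      opR_tmul, h2.braidOp, braidOp_family he, linearMap_comp_sum, linearMap_sum_comp,
      LinearMap.rTensor_comp_map, LinearMap.map_comp_lTensor, LinearMap.lTensor_comp_map, h1]
  exact LinearMap.congr_fun h y

-- Products and braiding are colinear, so colinearity of `D` at `a` and at `b` propagates to `a *
-- b`. Its pointwise form serves as an induction step.
omit hg in
theorem coact_comul_mul (hm : IsComoduleMap (V := B ⊗[k] B) (coactTensor M.coact M.coact) M.coact
      (LinearMap.mul' k B)) (hr : IsCoquasitriangular r)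
    (hmul : ∀ a b, D (a * b) = opS r M (D a) (D b)) {a b : B}
    (ha : coactTensor M.coact M.coact (D a) = D.rTensor A (M.coact a))
    (hb : coactTensor M.coact M.coact (D b) = D.rTensor A (M.coact b)) :
    coactTensor M.coact M.coact (D (a * b)) = D.rTensor A (M.coact (a * b)) := by
  have h1 : D ∘ₗ LinearMap.mul' k B = TensorProduct.map (LinearMap.mul' k B)
      (LinearMap.mul' k B) ∘ₗ midMap (braiding r M.coact M.coact) ∘ₗ TensorProduct.map D D :=
    TensorProduct.ext' fun a b => by
      simp only [LinearMap.comp_apply, LinearMap.mul'_apply, hmul, opS_apply,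
        TensorProduct.map_tmul]
  have h2 := LinearMap.congr_fun ((hm.map hm).comp (IsComoduleMap.midMap (ρ₁ := M.coact)
    (ρ₄ := M.coact) (isComoduleMap_braiding hr M M))) (D a ⊗ₜ D b)
  have h3 := LinearMap.congr_fun hm (a ⊗ₜ b)
  simp only [LinearMap.comp_apply, LinearMap.mul'_apply] at h2 h3
  rw [hmul, opS_apply, h2, coactTensor_tmul_map ha hb, h3, ← LinearMap.rTensor_comp_apply,
    ← LinearMap.rTensor_comp_apply, h1, LinearMap.comp_assoc]

end Coalgebra

theorem comulB_comodule : IsComoduleMap (W := L.BraidedEnvelope ⊗[k] L.BraidedEnvelope) (L.comoduleB hr).coact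
    (coactTensor (L.comoduleB hr).coact (L.comoduleB hr).coact) (L.comulB hr) := by
  refine Envelope.linear_ext ?_ fun v x hx => ?_
  · simp only [LinearMap.comp_apply, comulB_one, comoduleB_one]
    rw [coactTensor, LinearMap.comp_apply, LinearMap.comp_apply, TensorProduct.map_tmul,
      comoduleB_one, LinearMap.rTensor_tmul, comulB_one]
    simp
  · have hv : coactTensor (L.comoduleB hr).coact (L.comoduleB hr).coact (L.comulB hr (L.gen v)) =
        (L.comulB hr).rTensor A ((L.comoduleB hr).coact (L.gen v)) := by
      have h1 := LinearMap.congr_fun ((L.isComoduleMap_gen hr).map (L.isComoduleMap_gen hr))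
        (L.comul v)
      have h2 := LinearMap.congr_fun L.comul_comodule v
      have h3 := LinearMap.congr_fun (L.isComoduleMap_gen hr) v
      have h4 : L.comulB hr ∘ₗ L.gen = TensorProduct.map L.gen L.gen ∘ₗ L.comul :=
        LinearMap.ext (L.comulB_gen hr)
      simp only [LinearMap.comp_apply] at h1 h2 h3
      rw [comulB_gen, h1, h2, h3, ← LinearMap.rTensor_comp_apply, ← LinearMap.rTensor_comp_apply,
        h4]
    exact coact_comul_mul (L.isComoduleMap_mul hr) hr (L.comulB_mul hr) hv hx

theorem counitB_comodule : (TensorProduct.lid k A).toLinearMap ∘ₗ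
    (L.counitB hr).toLinearMap.rTensor A ∘ₗ (L.comoduleB hr).coact =
      LinearMap.toSpanSingleton k A 1 ∘ₗ (L.counitB hr).toLinearMap := by
  have h : (Algebra.TensorProduct.lid k A).toAlgHom.comp
      ((Algebra.TensorProduct.map (L.counitB hr) (AlgHom.id k A)).comp (L.coactB hr)) =
      (Algebra.ofId k A).comp (L.counitB hr) := by
    refine Envelope.algHom_ext fun v => ?_
    change TensorProduct.lid k A ((L.counitB hr).toLinearMap.rTensor A
      (L.coactB hr (L.gen v))) = algebraMap k A (L.counitB hr (L.gen v))
    have h1 := LinearMap.congr_fun L.counit_comodule v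
    have h2 : (L.counitB hr).toLinearMap ∘ₗ L.gen = L.counit :=
      LinearMap.ext (L.counitB_gen hr)
    simp only [LinearMap.comp_apply, LinearEquiv.coe_coe, LinearMap.toSpanSingleton_apply] at h1
    rw [coactB_gen, ← LinearMap.rTensor_comp_apply, h2, h1, counitB_gen,
      Algebra.algebraMap_eq_smul_one]
  refine LinearMap.ext fun b => (DFunLike.congr_fun h b).trans ?_
  exact Algebra.algebraMap_eq_smul_one _

/-- `B(L)` is a bialgebra in the category of comodules. -/
def bialgebraB : BraidedBialgebra k A r L.BraidedEnvelope where
  toRightComodule := L.comoduleB hr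
  comul := L.comulB hr
  counit := L.counitB hr
  coact_one := L.comoduleB_one hr
  coact_mul := map_mul (L.coactB hr)
  coassoc := by
    refine Envelope.linear_ext ?_ fun v x hx => ?_
    · simp [comulB_one]
    -- Under both iterated coproducts, left multiplication by `gen v` becomes the operator of an
    -- iterated coproduct of `v`. Coassociativity in `L` and `assoc_opL` identify the two operators.
    · have h1 := L.comul_opX_left (L.isComoduleMap_gen hr) (L.comulB_gen_mul hr)
        (L.comulB_comodule hr) (L.comul v)
      have h2 := L.comul_opX_right (L.isComoduleMap_gen hr) (L.comulB_gen_mul hr) (L.comul v)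
      have h3 := L.assoc_opL (L.isComoduleMap_gen hr) hr (L.comul.rTensor V (L.comul v))
      have h4 := LinearMap.congr_fun L.coassoc v
      simp only [LinearMap.comp_apply, LinearEquiv.coe_coe] at h4 hx
      rw [h4] at h3
      have h5 : L.comulB hr (Envelope.gen L.canonicalBraiding 0 v * x) = _ :=
        L.comulB_gen_mul hr v x
      simp only [LinearMap.comp_apply, h5]
      have h1' := LinearMap.congr_fun h1 (L.comulB hr x)
      have h2' := LinearMap.congr_fun h2 (L.comulB hr x)
      have h3' := LinearMap.congr_fun h3 ((L.comulB hr).rTensor _ (L.comulB hr x))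
      simp only [LinearMap.comp_apply, LinearEquiv.coe_coe] at h1' h2' h3'
      rw [LinearEquiv.coe_coe, h1', h2', h3', hx]
  counit_left := by
    refine Envelope.linear_ext ?_ fun v x hx => ?_
    · simp [comulB_one]
    · have h := L.counit_left_opX (ε := (L.counitB hr).toLinearMap) (L.isComoduleMap_gen hr)
        (fun v b => by simp) (L.counitB_comodule hr) hr (L.comul v) (L.comulB hr x)
      have h5 : L.comulB hr (Envelope.gen L.canonicalBraiding 0 v * x) = _ :=
        L.comulB_gen_mul hr v x
      have h4 := LinearMap.congr_fun L.counit_left v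
      simp only [LinearMap.comp_apply, LinearEquiv.coe_coe] at h4 hx
      simp only [LinearMap.comp_apply, h5, LinearEquiv.coe_coe, h, h4, hx]
      rfl
  counit_right := by
    refine Envelope.linear_ext ?_ fun v x hx => ?_
    · simp [comulB_one]
    · have h := L.counit_right_opX (ε := (L.counitB hr).toLinearMap) (L.isComoduleMap_gen hr)
        (fun v b => by simp) hr (L.comul v) (L.comulB hr x)
      have h5 : L.comulB hr (Envelope.gen L.canonicalBraiding 0 v * x) = _ :=
        L.comulB_gen_mul hr v x
      have h4 := LinearMap.congr_fun L.counit_right v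
      simp only [LinearMap.comp_apply, LinearEquiv.coe_coe] at h4 hx
      simp only [LinearMap.comp_apply, h5, LinearEquiv.coe_coe, h, h4, hx]
      rfl
  comul_comodule := L.comulB_comodule hr
  counit_comodule := L.counitB_comodule hr
  comul_one := L.comulB_one hr
  comul_mul := TensorProduct.ext' fun a b => by
    simp only [LinearMap.comp_apply, LinearMap.mul'_apply, comulB_mul, opS_apply,
      TensorProduct.map_tmul]

theorem extends_bialgebraB : L.Extends (L.bialgebraB hr) where
  coact := L.coactB_gen hr
  comul := L.comulB_gen hr
  counit := L.counitB_gen hr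

end BraidedLieAlgebra

end

section

/-! ### Tensors over spaces of functionals. -/

section Tensor

variable {k : Type u} [Field k]

-- The additive monoid underneath is the one in which the structures on `T` are stated, so that
-- results about additive groups apply to them.
scoped instance {A : Type*} [AddCommGroup A] [Module k A] (T : Submodule k (Module.Dual k A)) :
    AddCommGroup T :=
  { T.addCommMonoid, T.addCommGroup with }

/-- In a basis of `W` the coefficients of a tensor are functionals on `A`, and a functional that
vanishes at every point is zero. Hence structure maps on `T` are determined by their values. -/
theorem tmul_eq_of_eval {A W : Type*} [AddCommGroup A] [Module k A] [AddCommGroup W] [Module k W]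
    {T : Submodule k (Module.Dual k A)} {s t : T ⊗[k] W}
    (h : ∀ a, TensorProduct.lid k W ((Module.Dual.eval k A a ∘ₗ T.subtype).rTensor W s) =
      TensorProduct.lid k W ((Module.Dual.eval k A a ∘ₗ T.subtype).rTensor W t)) : s = t := by
  classical
  rw [← sub_eq_zero]
  have h' : ∀ a, TensorProduct.lid k W ((Module.Dual.eval k A a ∘ₗ T.subtype).rTensor W
      (s - t)) = 0 := fun a => by rw [map_sub, map_sub, h, sub_self]
  generalize s - t = z at h'
  let b := Module.Basis.ofVectorSpace k W
  obtain ⟨c, rfl⟩ := TensorProduct.eq_repr_basis_right b z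
  have h2 : ∀ i, c i = 0 := by
    intro i
    refine Subtype.ext (LinearMap.ext fun a => ?_)
    have h3 := congrArg (fun w => b.repr w i) (h' a)
    simp only [Finsupp.sum, map_sum, LinearMap.rTensor_tmul, LinearMap.comp_apply,
      TensorProduct.lid_tmul, map_smul, Finsupp.coe_finsetSum, Finset.sum_apply,
      Finsupp.smul_apply, Module.Basis.repr_self, Submodule.subtype_apply, Module.Dual.eval_apply,
      map_zero, Finsupp.coe_zero, Pi.zero_apply, Finsupp.single_apply, smul_eq_mul, mul_ite,
      mul_one, mul_zero] at h3
    rw [Finset.sum_ite_eq'] at h3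
    split_ifs at h3 with hi
    · exact h3
    · rw [Finsupp.notMem_support_iff.1 hi]
  simp [Finsupp.sum, h2]

theorem midMap_map {V V' W W' X X' Y Y' : Type*} [AddCommMonoid V] [Module k V] [AddCommMonoid W]
    [Module k W] [AddCommMonoid V'] [Module k V'] [AddCommMonoid W'] [Module k W']
    [AddCommMonoid X] [Module k X] [AddCommMonoid Y] [Module k Y] [AddCommMonoid X'] [Module k X']
    [AddCommMonoid Y'] [Module k Y'] {Ψ : V' ⊗[k] W →ₗ[k] W ⊗[k] V'}
    {Ψ' : X' ⊗[k] Y →ₗ[k] Y ⊗[k] X'} (f₁ : V →ₗ[k] X) (f₂ : V' →ₗ[k] X') (f₃ : W →ₗ[k] Y)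
    (f₄ : W' →ₗ[k] Y') (h : Ψ' ∘ₗ TensorProduct.map f₂ f₃ = TensorProduct.map f₃ f₂ ∘ₗ Ψ) :
    midMap Ψ' ∘ₗ TensorProduct.map (TensorProduct.map f₁ f₂) (TensorProduct.map f₃ f₄) =
      TensorProduct.map (TensorProduct.map f₁ f₃) (TensorProduct.map f₂ f₄) ∘ₗ midMap Ψ := by
  refine TensorProduct.ext_fourfold' fun a b c d => ?_
  have h2 := LinearMap.congr_fun h (b ⊗ₜ c)
  simp only [LinearMap.comp_apply, TensorProduct.map_tmul] at h2
  simp only [LinearMap.comp_apply, TensorProduct.map_tmul, midMap_tmul, h2]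
  generalize Ψ (b ⊗ₜ c) = z
  induction z with
  | zero => simp
  | add a b ha hb => simp only [map_add, TensorProduct.add_tmul, TensorProduct.tmul_add, ha, hb]
  | tmul a b => simp

theorem upsilon_map {V W : Type*} [AddCommGroup V] [Module k V] [AddCommGroup W] [Module k W]
    {Ψ : V ⊗[k] V →ₗ[k] V ⊗[k] V} {Ψ' : W ⊗[k] W →ₗ[k] W ⊗[k] W} {Δ : V →ₗ[k] V ⊗[k] V}
    {Δ' : W →ₗ[k] W ⊗[k] W} {br : V ⊗[k] V →ₗ[k] V} {br' : W ⊗[k] W →ₗ[k] W} {j : V →ₗ[k] W}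
    (hΨ : Ψ' ∘ₗ TensorProduct.map j j = TensorProduct.map j j ∘ₗ Ψ)
    (hΔ : Δ' ∘ₗ j = TensorProduct.map j j ∘ₗ Δ) (hbr : br' ∘ₗ TensorProduct.map j j = j ∘ₗ br) :
    upsilon Ψ' Δ' br' ∘ₗ TensorProduct.map j j = TensorProduct.map j j ∘ₗ upsilon Ψ Δ br := by
  refine TensorProduct.ext' fun c d => ?_
  have hΔ' := LinearMap.congr_fun hΔ c
  simp only [LinearMap.comp_apply] at hΔ'
  simp only [upsilon, LinearMap.comp_apply, TensorProduct.map_tmul, LinearMap.rTensor_tmul, hΔ']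
  generalize Δ c = t
  induction t with
  | zero => simp
  | add a b ha hb => simp only [map_add, TensorProduct.add_tmul, ha, hb]
  | tmul a b =>
    have hΨ' := LinearMap.congr_fun hΨ (b ⊗ₜ d)
    simp only [LinearMap.comp_apply, TensorProduct.map_tmul] at hΨ'
    simp only [TensorProduct.map_tmul, LinearEquiv.coe_coe, TensorProduct.assoc_tmul,
      LinearMap.lTensor_tmul, hΨ']
    generalize Ψ (b ⊗ₜ d) = z
    induction z with
    | zero => simp
    | add a b ha hb => simp only [map_add, TensorProduct.tmul_add, ha, hb]
    | tmul x y =>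
      have h := LinearMap.congr_fun hbr (a ⊗ₜ x)
      simp only [LinearMap.comp_apply, TensorProduct.map_tmul] at h
      simp [h]

theorem map_left_inverse {V W V' W' : Type*} [AddCommMonoid V] [Module k V] [AddCommMonoid W]
    [Module k W] [AddCommMonoid V'] [Module k V'] [AddCommMonoid W'] [Module k W']
    {f : V →ₗ[k] W} {g : W →ₗ[k] V} {f' : V' →ₗ[k] W'} {g' : W' →ₗ[k] V'}
    (h : g ∘ₗ f = LinearMap.id) (h' : g' ∘ₗ f' = LinearMap.id) :
    TensorProduct.map g g' ∘ₗ TensorProduct.map f f' = LinearMap.id := by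
  rw [← TensorProduct.map_comp, h, h', TensorProduct.map_id]

theorem injective_of_comp_eq_id {V W : Type*} [AddCommMonoid V] [Module k V] [AddCommMonoid W]
    [Module k W] {f : V →ₗ[k] W} {g : W →ₗ[k] V} (h : g ∘ₗ f = LinearMap.id) :
    Function.Injective f :=
  Function.LeftInverse.injective (g := g) (LinearMap.congr_fun h)

theorem eq_of_comp_eq {V W Z : Type*} [AddCommMonoid V] [Module k V] [AddCommMonoid W]
    [Module k W] [AddCommMonoid Z] [Module k Z] {f : V →ₗ[k] W} {g : W →ₗ[k] V}
    (h : g ∘ₗ f = LinearMap.id) {F G : Z →ₗ[k] V} (hFG : f ∘ₗ F = f ∘ₗ G) : F = G := by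
  rw [← LinearMap.id_comp F, ← h, LinearMap.comp_assoc, hFG, ← LinearMap.comp_assoc, h,
    LinearMap.id_comp]

end Tensor

/-! ### Axioms pulled back along a split injection. -/

section Pull

variable {k : Type u} {A : Type v} [Field k] [Ring A] [HopfAlgebra k A]
  {V W : Type*} [AddCommGroup V] [Module k V] [AddCommGroup W] [Module k W]
  {f : V →ₗ[k] W} {g : W →ₗ[k] V} (hgf : g ∘ₗ f = LinearMap.id)
  {ρ : V →ₗ[k] V ⊗[k] A} {ρ' : W →ₗ[k] W ⊗[k] A} (hρ : ρ' ∘ₗ f = f.rTensor A ∘ₗ ρ)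
  {Δ : V →ₗ[k] V ⊗[k] V} {Δ' : W →ₗ[k] W ⊗[k] W} (hΔ : Δ' ∘ₗ f = TensorProduct.map f f ∘ₗ Δ)
  {ε : V →ₗ[k] k} {ε' : W →ₗ[k] k} (hε : ε = ε' ∘ₗ f)

include hρ hgf in
theorem coact_coassoc_of_comp
    (h : (TensorProduct.assoc k W A A).toLinearMap ∘ₗ ρ'.rTensor A ∘ₗ ρ' =
      (Coalgebra.comul (R := k) (A := A)).lTensor W ∘ₗ ρ') :
    (TensorProduct.assoc k V A A).toLinearMap ∘ₗ ρ.rTensor A ∘ₗ ρ =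
      (Coalgebra.comul (R := k) (A := A)).lTensor V ∘ₗ ρ := by
  refine eq_of_comp_eq (map_left_inverse hgf
    (LinearMap.id_comp (LinearMap.id : A ⊗[k] A →ₗ[k] A ⊗[k] A))) ?_
  have h1 : f.rTensor (A ⊗[k] A) ∘ₗ (TensorProduct.assoc k V A A).toLinearMap =
      (TensorProduct.assoc k W A A).toLinearMap ∘ₗ (f.rTensor A).rTensor A :=
    TensorProduct.ext_threefold fun _ _ _ => rfl
  have h2 : f.rTensor (A ⊗[k] A) ∘ₗ (Coalgebra.comul (R := k)).lTensor V =
      (Coalgebra.comul (R := k)).lTensor W ∘ₗ f.rTensor A := by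
    rw [LinearMap.rTensor_comp_lTensor, LinearMap.lTensor_comp_rTensor]
  have h3 : f.rTensor (A ⊗[k] A) ∘ₗ (TensorProduct.assoc k V A A).toLinearMap ∘ₗ
      ρ.rTensor A = (TensorProduct.assoc k W A A).toLinearMap ∘ₗ ρ'.rTensor A ∘ₗ
        f.rTensor A := by
    rw [← LinearMap.comp_assoc, h1, LinearMap.comp_assoc, ← LinearMap.rTensor_comp,
      ← LinearMap.rTensor_comp, hρ]
  refine (congrArg (fun f => f ∘ₗ ρ) h3).trans ?_
  refine (congrArg (fun f => ((TensorProduct.assoc k W A A).toLinearMap ∘ₗ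
    ρ'.rTensor A) ∘ₗ f) hρ.symm).trans ?_
  refine (congrArg (fun g => g ∘ₗ f) h).trans ?_
  refine (congrArg (fun f => (Coalgebra.comul (R := k)).lTensor W ∘ₗ f) hρ).trans ?_
  exact congrArg (fun f => f ∘ₗ ρ) h2.symm

include hρ hgf in
theorem coact_counit_of_comp (h : (TensorProduct.rid k W).toLinearMap ∘ₗ
      (Coalgebra.counit (R := k) (A := A)).lTensor W ∘ₗ ρ' = LinearMap.id) :
    (TensorProduct.rid k V).toLinearMap ∘ₗ
      (Coalgebra.counit (R := k) (A := A)).lTensor V ∘ₗ ρ = LinearMap.id := by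
  refine eq_of_comp_eq hgf ?_
  have h1 : f ∘ₗ (TensorProduct.rid k V).toLinearMap ∘ₗ
      (Coalgebra.counit (R := k) (A := A)).lTensor V =
      (TensorProduct.rid k W).toLinearMap ∘ₗ (Coalgebra.counit (R := k) (A := A)).lTensor W ∘ₗ
        f.rTensor A :=
    TensorProduct.ext' fun _ _ => by simp
  refine (congrArg (fun f => f ∘ₗ ρ) h1).trans ?_
  refine (congrArg (fun f => ((TensorProduct.rid k W).toLinearMap ∘ₗ
    (Coalgebra.counit (R := k) (A := A)).lTensor W) ∘ₗ f) hρ.symm).trans ?_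
  exact congrArg (fun g => g ∘ₗ f) h

include hΔ hgf in
theorem coassoc_of_comp
    (h : (TensorProduct.assoc k W W W).toLinearMap ∘ₗ Δ'.rTensor W ∘ₗ Δ' = Δ'.lTensor W ∘ₗ Δ') :
    (TensorProduct.assoc k V V V).toLinearMap ∘ₗ Δ.rTensor V ∘ₗ Δ = Δ.lTensor V ∘ₗ Δ := by
  refine eq_of_comp_eq (map_left_inverse hgf (map_left_inverse hgf hgf)) ?_
  have h1 : TensorProduct.map f (TensorProduct.map f f) ∘ₗ
      (TensorProduct.assoc k V V V).toLinearMap ∘ₗ Δ.rTensor V =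
      (TensorProduct.assoc k W W W).toLinearMap ∘ₗ Δ'.rTensor W ∘ₗ TensorProduct.map f f := by
    rw [← LinearMap.comp_assoc, TensorProduct.map_map_comp_assoc_eq, LinearMap.comp_assoc,
      LinearMap.map_comp_rTensor, LinearMap.rTensor_comp_map, hΔ]
  have h2 : TensorProduct.map f (TensorProduct.map f f) ∘ₗ Δ.lTensor V =
      Δ'.lTensor W ∘ₗ TensorProduct.map f f := by
    rw [LinearMap.map_comp_lTensor, LinearMap.lTensor_comp_map, hΔ]
  refine (congrArg (fun f => f ∘ₗ Δ) h1).trans ?_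
  refine (congrArg (fun f => ((TensorProduct.assoc k W W W).toLinearMap ∘ₗ
    Δ'.rTensor W) ∘ₗ f) hΔ.symm).trans ?_
  refine (congrArg (fun g => g ∘ₗ f) h).trans ?_
  refine (congrArg (fun f => Δ'.lTensor W ∘ₗ f) hΔ).trans ?_
  exact congrArg (fun f => f ∘ₗ Δ) h2.symm

include hΔ hgf hε in
theorem counit_left_of_comp
    (h : (TensorProduct.lid k W).toLinearMap ∘ₗ ε'.rTensor W ∘ₗ Δ' = LinearMap.id) :
    (TensorProduct.lid k V).toLinearMap ∘ₗ ε.rTensor V ∘ₗ Δ = LinearMap.id := by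
  refine eq_of_comp_eq hgf ?_
  have h1 : f ∘ₗ (TensorProduct.lid k V).toLinearMap ∘ₗ ε.rTensor V =
      (TensorProduct.lid k W).toLinearMap ∘ₗ ε'.rTensor W ∘ₗ TensorProduct.map f f :=
    TensorProduct.ext' fun _ _ => by simp [hε]
  refine (congrArg (fun f => f ∘ₗ Δ) h1).trans ?_
  refine (congrArg (fun f => ((TensorProduct.lid k W).toLinearMap ∘ₗ
    ε'.rTensor W) ∘ₗ f) hΔ.symm).trans ?_
  exact congrArg (fun g => g ∘ₗ f) h

include hΔ hgf hε in
theorem counit_right_of_comp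
    (h : (TensorProduct.rid k W).toLinearMap ∘ₗ ε'.lTensor W ∘ₗ Δ' = LinearMap.id) :
    (TensorProduct.rid k V).toLinearMap ∘ₗ ε.lTensor V ∘ₗ Δ = LinearMap.id := by
  refine eq_of_comp_eq hgf ?_
  have h1 : f ∘ₗ (TensorProduct.rid k V).toLinearMap ∘ₗ ε.lTensor V =
      (TensorProduct.rid k W).toLinearMap ∘ₗ ε'.lTensor W ∘ₗ TensorProduct.map f f :=
    TensorProduct.ext' fun _ _ => by simp [hε]
  refine (congrArg (fun f => f ∘ₗ Δ) h1).trans ?_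
  refine (congrArg (fun f => ((TensorProduct.rid k W).toLinearMap ∘ₗ
    ε'.lTensor W) ∘ₗ f) hΔ.symm).trans ?_
  exact congrArg (fun g => g ∘ₗ f) h

include hΔ hρ hgf in
theorem comul_comodule_of_comp (h : coactTensor ρ' ρ' ∘ₗ Δ' = Δ'.rTensor A ∘ₗ ρ') :
    coactTensor ρ ρ ∘ₗ Δ = Δ.rTensor A ∘ₗ ρ := by
  refine eq_of_comp_eq (map_left_inverse (map_left_inverse hgf hgf)
    (LinearMap.id_comp (LinearMap.id : A →ₗ[k] A))) ?_
  have h0 : IsComoduleMap ρ ρ' f := hρ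
  have h1 : coactTensor ρ' ρ' ∘ₗ TensorProduct.map f f =
      (TensorProduct.map f f).rTensor A ∘ₗ coactTensor ρ ρ := h0.map h0
  have h2 : (TensorProduct.map f f).rTensor A ∘ₗ Δ.rTensor A = Δ'.rTensor A ∘ₗ f.rTensor A := by
    rw [← LinearMap.rTensor_comp, ← LinearMap.rTensor_comp, hΔ]
  refine (congrArg (fun f => f ∘ₗ Δ) h1.symm).trans ?_
  refine (congrArg (fun f => coactTensor ρ' ρ' ∘ₗ f) hΔ.symm).trans ?_
  refine (congrArg (fun g => g ∘ₗ f) h).trans ?_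
  refine (congrArg (fun f => Δ'.rTensor A ∘ₗ f) hρ).trans ?_
  exact congrArg (fun f => f ∘ₗ ρ) h2.symm

include hρ hε in
theorem counit_comodule_of_comp (h : (TensorProduct.lid k A).toLinearMap ∘ₗ ε'.rTensor A ∘ₗ ρ' =
      LinearMap.toSpanSingleton k A 1 ∘ₗ ε') :
    (TensorProduct.lid k A).toLinearMap ∘ₗ ε.rTensor A ∘ₗ ρ =
      LinearMap.toSpanSingleton k A 1 ∘ₗ ε := by
  rw [hε, LinearMap.rTensor_comp]
  refine (congrArg (fun f => ((TensorProduct.lid k A).toLinearMap ∘ₗ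
    ε'.rTensor A) ∘ₗ f) hρ.symm).trans ?_
  exact congrArg (fun g => g ∘ₗ f) h

end Pull

/-! ### From subcoalgebras of `A` to braided Lie algebras of functionals. -/

section Transfer

variable {k : Type u} {A : Type v} [Field k] [Ring A] [HopfAlgebra k A]

/-- An identification of a subspace `T` of `A*` with a subcoalgebra of `A` through the map
`q : A → A*`, with a projection of `A` onto it. -/
structure KillingSection (q : A →ₗ[k] Module.Dual k A) (T : Submodule k (Module.Dual k A)) where
  j : T →ₗ[k] A
  π : A →ₗ[k] T
  π_comp_j : π ∘ₗ j = LinearMap.id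
  q_j : ∀ X, q (j X) = X
  subcoalgebra : IsSubcoalgebra (LinearMap.range j)

theorem KillingSection.exists_of_injOn {q : A →ₗ[k] Module.Dual k A} {D : Submodule k A}
    (hD : IsSubcoalgebra D) (hq : Set.InjOn q D) :
    ∃ K : KillingSection q (D.map q), LinearMap.range K.j = D := by
  let f : D →ₗ[k] D.map q := q.restrict fun x hx => Submodule.mem_map_of_mem hx
  have hf : Function.Bijective f := by
    refine ⟨fun x y h => Subtype.ext (hq x.2 y.2 (congrArg Subtype.val h)), ?_⟩
    rintro ⟨_, x, hx, rfl⟩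
    exact ⟨⟨x, hx⟩, rfl⟩
  let F := LinearEquiv.ofBijective f hf
  have hj : Function.Injective (D.subtype ∘ₗ F.symm.toLinearMap) :=
    D.subtype_injective.comp F.symm.injective
  obtain ⟨π, hπ⟩ := LinearMap.exists_leftInverse_of_injective _ (LinearMap.ker_eq_bot.2 hj)
  have hr : LinearMap.range (D.subtype ∘ₗ F.symm.toLinearMap) = D := by
    rw [LinearMap.range_comp, LinearEquiv.range, Submodule.map_top, Submodule.range_subtype]
  exact ⟨⟨_, π, hπ, fun X => congrArg Subtype.val (F.apply_symm_apply X), hr.symm ▸ hD⟩, hr⟩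

namespace KillingSection

variable {r s : A →ₗ[k] A →ₗ[k] k} {T : Submodule k (Module.Dual k A)}
  (K : KillingSection (quantumKilling r s) T)

/-- `π` is an arbitrary linear retraction, meaningful only on the subcoalgebra. The lemmas
`j_coact`, `j_comul` and `j_bracket` rest on the structure maps of `A` not leaving the subcoalgebra.
-/
theorem j_π {x : A} (h : x ∈ LinearMap.range K.j) : K.j (K.π x) = x := by
  obtain ⟨X, rfl⟩ := h
  exact congrArg K.j (LinearMap.congr_fun K.π_comp_j X)

theorem _root_.QLie.IsSubcoalgebra.adR_mem {D : Submodule k A} (hD : IsSubcoalgebra D) {c : A}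
    (hc : c ∈ D) : adR k A c ∈ LinearMap.range (D.subtype.rTensor A) := by
  obtain ⟨z, hz⟩ := hD c hc
  simp only [adR, LinearMap.comp_apply, ← hz]
  clear hz
  induction z with
  | zero => simp
  | add a b ha hb => simp only [map_add]; exact add_mem ha hb
  | tmul x y =>
    obtain ⟨z, hz⟩ := hD y y.2
    simp only [TensorProduct.map_tmul, LinearMap.lTensor_tmul, Submodule.subtype_apply, ← hz]
    clear hz
    induction z with
    | zero => simp
    | add a b ha hb => simp only [map_add, TensorProduct.tmul_add]; exact add_mem ha hb
    | tmul a b => exact ⟨a ⊗ₜ (HopfAlgebra.antipode k (x : A) * b), by simp⟩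

theorem _root_.QLie.IsSubcoalgebra.brA_mem {D : Submodule k A} (hD : IsSubcoalgebra D)
    (q : A →ₗ[k] Module.Dual k A) (c : A) {d : A} (hd : d ∈ D) : brA q (c ⊗ₜ d) ∈ D := by
  obtain ⟨z, hz⟩ := hD.adR_mem hd
  rw [brA_tmul, coactBy_apply, ← hz]
  clear hz
  induction z with
  | zero => simp
  | add a b ha hb => simp only [map_add]; exact add_mem ha hb
  | tmul a b => simpa using D.smul_mem _ a.2

/-- The coaction on `T`. -/
def coact : T →ₗ[k] T ⊗[k] A := K.π.rTensor A ∘ₗ adR k A ∘ₗ K.j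

/-- The coproduct on `T`. -/
def comul : T →ₗ[k] T ⊗[k] T := TensorProduct.map K.π K.π ∘ₗ Coalgebra.comul ∘ₗ K.j

/-- The bracket on `T`. -/
def bracket : T ⊗[k] T →ₗ[k] T :=
  K.π ∘ₗ brA (quantumKilling r s) ∘ₗ TensorProduct.map K.j K.j

/-- The counit on `T`. -/
def counit : T →ₗ[k] k := Module.Dual.eval k A 1 ∘ₗ T.subtype

theorem j_coact : adR k A ∘ₗ K.j = K.j.rTensor A ∘ₗ K.coact := by
  refine LinearMap.ext fun X => ?_
  obtain ⟨z, hz⟩ := K.subcoalgebra.adR_mem (LinearMap.mem_range_self K.j X)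
  simp only [coact, LinearMap.comp_apply, ← hz]
  clear hz
  induction z with
  | zero => simp
  | add a b ha hb => simp only [map_add, ← ha, ← hb]
  | tmul x y => simp [K.j_π x.2]

theorem isComoduleMap_j : IsComoduleMap K.coact (adR k A) K.j := K.j_coact

theorem j_comul : Coalgebra.comul ∘ₗ K.j = TensorProduct.map K.j K.j ∘ₗ K.comul := by
  refine LinearMap.ext fun X => ?_
  obtain ⟨z, hz⟩ := K.subcoalgebra _ (LinearMap.mem_range_self K.j X)
  simp only [comul, LinearMap.comp_apply, ← hz]
  clear hz
  induction z with
  | zero => simp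
  | add a b ha hb => simp only [map_add, ← ha, ← hb]
  | tmul x y => simp [K.j_π x.2, K.j_π y.2]

theorem j_bracket : brA (quantumKilling r s) ∘ₗ TensorProduct.map K.j K.j = K.j ∘ₗ K.bracket :=
  TensorProduct.ext' fun _ Y =>
    (K.j_π (K.subcoalgebra.brA_mem _ _ (LinearMap.mem_range_self K.j Y))).symm

theorem j_braiding : psiA r ∘ₗ TensorProduct.map K.j K.j =
    TensorProduct.map K.j K.j ∘ₗ braiding r K.coact K.coact :=
  TensorProduct.ext' fun X Y => K.isComoduleMap_j.braiding_map K.isComoduleMap_j r X Y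

theorem j_upsilon : upsA r s ∘ₗ TensorProduct.map K.j K.j =
    TensorProduct.map K.j K.j ∘ₗ upsilon (braiding r K.coact K.coact) K.comul K.bracket :=
  upsilon_map K.j_braiding K.j_comul K.j_bracket

theorem eval_comp_subtype (a : A) : Module.Dual.eval k A a ∘ₗ T.subtype =
    (quantumKilling r s).flip a ∘ₗ K.j :=
  LinearMap.ext fun X => by simp [K.q_j]

theorem counit_eq (hr : IsCoquasitriangular r) (hs : IsCoquasitriangular s) :
    counit (T := T) = Coalgebra.counit ∘ₗ K.j := by
  rw [counit, K.eval_comp_subtype]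
  exact LinearMap.ext fun X => quantumKilling_one_right hr hs (K.j X)

theorem eval_rTensor {W : Type*} [AddCommMonoid W] [Module k W] (a : A) (t : T ⊗[k] W) :
    (Module.Dual.eval k A a ∘ₗ T.subtype).rTensor W t =
      ((quantumKilling r s).flip a).rTensor W (K.j.rTensor W t) := by
  rw [K.eval_comp_subtype, LinearMap.rTensor_comp_apply]

theorem pairing_eq (t : T ⊗[k] T) (a b : A) : pairing T T t (a ⊗ₜ b) =
    LinearMap.mul' k k (TensorProduct.map ((quantumKilling r s).flip a)
      ((quantumKilling r s).flip b) (TensorProduct.map K.j K.j t)) := by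
  induction t with
  | zero => simp
  | add a b ha hb => simp only [map_add, LinearMap.add_apply, ha, hb]
  | tmul X Y => simp [pairing, K.q_j]

theorem jj : TensorProduct.map K.π K.π ∘ₗ TensorProduct.map K.j K.j = LinearMap.id :=
  map_left_inverse K.π_comp_j K.π_comp_j

theorem j_rTensor (W : Type*) [AddCommMonoid W] [Module k W] :
    K.π.rTensor W ∘ₗ K.j.rTensor W = LinearMap.id :=
  map_left_inverse K.π_comp_j (LinearMap.id_comp _)

theorem j_coactTensor : coactTensor (adR k A) (adR k A) ∘ₗ TensorProduct.map K.j K.j =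
    (TensorProduct.map K.j K.j).rTensor A ∘ₗ coactTensor K.coact K.coact :=
  K.isComoduleMap_j.map K.isComoduleMap_j

/-- `T` as a comodule. -/
def comodule : RightComodule k A T where
  coact := K.coact
  coact_coassoc := coact_coassoc_of_comp K.π_comp_j K.j_coact (adRComodule k A).coact_coassoc
  coact_counit := coact_counit_of_comp K.π_comp_j K.j_coact (adRComodule k A).coact_counit

variable (hr : IsCoquasitriangular r) (hs : IsCoquasitriangular s)
include hr hs

theorem bracket_comodule : K.coact ∘ₗ K.bracket =
    K.bracket.rTensor A ∘ₗ coactTensor K.coact K.coact := by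
  refine eq_of_comp_eq (K.j_rTensor A) ?_
  refine (congrArg (fun f => f ∘ₗ K.bracket) K.j_coact.symm).trans ?_
  refine (congrArg (fun f => adR k A ∘ₗ f) K.j_bracket.symm).trans ?_
  refine (congrArg (fun f => f ∘ₗ TensorProduct.map K.j K.j) (isComoduleMap_brA hr hs)).trans ?_
  refine (congrArg (fun f => (brA (quantumKilling r s)).rTensor A ∘ₗ f) K.j_coactTensor).trans ?_
  rw [← LinearMap.comp_assoc, ← LinearMap.rTensor_comp, j_bracket, LinearMap.rTensor_comp,
    LinearMap.comp_assoc]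

theorem jacobi : K.bracket ∘ₗ K.bracket.lTensor T =
    K.bracket ∘ₗ TensorProduct.map K.bracket K.bracket ∘ₗ midMap (braiding r K.coact K.coact) ∘ₗ
      K.comul.rTensor (T ⊗[k] T) := by
  refine eq_of_comp_eq K.π_comp_j ?_
  have h1 : TensorProduct.map K.j K.j ∘ₗ K.bracket.lTensor T =
      (brA (quantumKilling r s)).lTensor A ∘ₗ TensorProduct.map K.j (TensorProduct.map K.j K.j) :=
    by rw [LinearMap.map_comp_lTensor, LinearMap.lTensor_comp_map, j_bracket]
  have h2 : TensorProduct.map K.j K.j ∘ₗ TensorProduct.map K.bracket K.bracket =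
      TensorProduct.map (brA (quantumKilling r s)) (brA (quantumKilling r s)) ∘ₗ
        TensorProduct.map (TensorProduct.map K.j K.j) (TensorProduct.map K.j K.j) := by
    rw [← TensorProduct.map_comp, ← TensorProduct.map_comp, j_bracket]
  have h3 := midMap_map K.j K.j K.j K.j K.j_braiding
  have h4 : TensorProduct.map (TensorProduct.map K.j K.j) (TensorProduct.map K.j K.j) ∘ₗ
      K.comul.rTensor (T ⊗[k] T) = (Coalgebra.comul (R := k)).rTensor (A ⊗[k] A) ∘ₗ
        TensorProduct.map K.j (TensorProduct.map K.j K.j) := by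
    rw [LinearMap.map_comp_rTensor, LinearMap.rTensor_comp_map, j_comul]
  rw [← LinearMap.comp_assoc, ← LinearMap.comp_assoc, ← j_bracket, LinearMap.comp_assoc, h1,
    LinearMap.comp_assoc, ← LinearMap.comp_assoc _ (TensorProduct.map K.bracket K.bracket), h2,
    LinearMap.comp_assoc, ← LinearMap.comp_assoc _ (midMap _), ← h3, LinearMap.comp_assoc, h4]
  exact congrArg (fun f => f ∘ₗ TensorProduct.map K.j (TensorProduct.map K.j K.j))
    (jacobi_brA hr hs)

theorem comul_bracket : K.comul ∘ₗ K.bracket = TensorProduct.map K.bracket K.bracket ∘ₗ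
    midMap (braiding r K.coact K.coact) ∘ₗ TensorProduct.map K.comul K.comul := by
  refine eq_of_comp_eq K.jj ?_
  have h2 : TensorProduct.map K.j K.j ∘ₗ TensorProduct.map K.bracket K.bracket =
      TensorProduct.map (brA (quantumKilling r s)) (brA (quantumKilling r s)) ∘ₗ
        TensorProduct.map (TensorProduct.map K.j K.j) (TensorProduct.map K.j K.j) := by
    rw [← TensorProduct.map_comp, ← TensorProduct.map_comp, j_bracket]
  have h3 := midMap_map K.j K.j K.j K.j K.j_braiding
  have h4 : TensorProduct.map (TensorProduct.map K.j K.j) (TensorProduct.map K.j K.j) ∘ₗ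
      TensorProduct.map K.comul K.comul = TensorProduct.map (Coalgebra.comul (R := k))
        Coalgebra.comul ∘ₗ TensorProduct.map K.j K.j := by
    rw [← TensorProduct.map_comp, ← TensorProduct.map_comp, j_comul]
  rw [← LinearMap.comp_assoc, ← LinearMap.comp_assoc, h2, ← j_comul, LinearMap.comp_assoc,
    ← j_bracket, LinearMap.comp_assoc, ← LinearMap.comp_assoc _ (midMap _), ← h3,
    LinearMap.comp_assoc, h4]
  exact congrArg (fun f => f ∘ₗ TensorProduct.map K.j K.j) (comul_brA hr hs)

/-- On `A` the identity is known only under `q(-, b)` in the first leg. In `T` this is evaluation at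
`b`, and evaluations at all `b` separate tensors by `tmul_eq_of_eval`, so here the identity is
genuine. -/
theorem weak_cocomm : braiding r K.coact K.coact ∘ₗ upsilon (braiding r K.coact K.coact) K.comul
    K.bracket = K.bracket.lTensor T ∘ₗ (TensorProduct.assoc k T T T).toLinearMap ∘ₗ
      K.comul.rTensor T := by
  refine LinearMap.ext fun z => tmul_eq_of_eval fun b => ?_
  have h1 : ∀ t : T ⊗[k] T, K.j (TensorProduct.lid k T ((Module.Dual.eval k A b ∘ₗ
      T.subtype).rTensor T t)) = TensorProduct.lid k A (((quantumKilling r s).flip b).rTensor A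
        (TensorProduct.map K.j K.j t)) := by
    intro t
    induction t with
    | zero => simp
    | add a b ha hb => simp only [map_add, ha, hb]
    | tmul X Y => simp [K.q_j]
  refine injective_of_comp_eq_id K.π_comp_j ?_
  rw [h1, h1]
  have h2 : TensorProduct.map K.j K.j ∘ₗ braiding r K.coact K.coact ∘ₗ
      upsilon (braiding r K.coact K.coact) K.comul K.bracket =
      psiA r ∘ₗ upsA r s ∘ₗ TensorProduct.map K.j K.j := by
    rw [← LinearMap.comp_assoc, ← j_braiding, LinearMap.comp_assoc, j_upsilon]
  have h3 : TensorProduct.map K.j K.j ∘ₗ K.bracket.lTensor T ∘ₗ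
      (TensorProduct.assoc k T T T).toLinearMap ∘ₗ K.comul.rTensor T =
      (brA (quantumKilling r s)).lTensor A ∘ₗ (TensorProduct.assoc k A A A).toLinearMap ∘ₗ
        (Coalgebra.comul (R := k)).rTensor A ∘ₗ TensorProduct.map K.j K.j := by
    rw [LinearMap.rTensor_comp_map, j_comul, ← LinearMap.map_comp_rTensor,
      ← LinearMap.comp_assoc _ _ (TensorProduct.assoc k A A A).toLinearMap,
      ← TensorProduct.map_map_comp_assoc_eq, LinearMap.comp_assoc,
      ← LinearMap.comp_assoc _ (TensorProduct.map _ _), LinearMap.lTensor_comp_map, j_bracket,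
      ← LinearMap.map_comp_lTensor, LinearMap.comp_assoc]
  have h4 := LinearMap.congr_fun (weak_cocomm_brA hr hs b) (TensorProduct.map K.j K.j z)
  have h2' := LinearMap.congr_fun h2 z
  have h3' := LinearMap.congr_fun h3 z
  simp only [LinearMap.comp_apply, LinearEquiv.coe_coe] at h2' h3' h4 ⊢
  rw [h2', h3', h4]

/-- The braided Lie algebra structure on `T`. -/
def braidedLie : BraidedLieAlgebra k A r T where
  toRightComodule := K.comodule
  comul := K.comul
  counit := counit
  bracket := K.bracket
  coassoc := coassoc_of_comp K.π_comp_j K.j_comul Coalgebra.coassoc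
  counit_left := counit_left_of_comp K.π_comp_j K.j_comul (K.counit_eq hr hs)
    (LinearMap.ext fun X => by simp)
  counit_right := counit_right_of_comp K.π_comp_j K.j_comul (K.counit_eq hr hs)
    (LinearMap.ext fun X => by simp)
  comul_comodule := comul_comodule_of_comp K.π_comp_j K.j_coact K.j_comul adR_comul
  counit_comodule := counit_comodule_of_comp K.j_coact (K.counit_eq hr hs) adR_counit
  bracket_comodule := K.bracket_comodule hr hs
  jacobi := K.jacobi hr hs
  weak_cocomm := K.weak_cocomm hr hs
  comul_bracket := K.comul_bracket hr hs
  counit_bracket := by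
    rw [K.counit_eq hr hs, LinearMap.comp_assoc, ← j_bracket, TensorProduct.map_comp]
    exact congrArg (fun f => f ∘ₗ TensorProduct.map K.j K.j) (counit_brA hr hs)

/-- The braided Lie algebra structure on `T`, with its characterization by values. -/
def tangentBraidedLie : TangentBraidedLie r T where
  toBraidedLieAlgebra := K.braidedLie hr hs
  coact_spec X a := by
    change TensorProduct.lid k A (LinearMap.rTensor A _ (K.coact X)) = _
    have h := LinearMap.congr_fun K.j_coact X
    simp only [LinearMap.comp_apply] at h
    have h2 := quantumKilling_invariant hr hs (K.j X) a
    rw [K.eval_rTensor, ← h, ← K.q_j X, h2, adCoeff_apply]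
  comul_spec X a b := by
    change pairing T T (K.comul X) (a ⊗ₜ b) = _
    have h := LinearMap.congr_fun K.j_comul X
    simp only [LinearMap.comp_apply] at h
    rw [K.pairing_eq, ← h, ← quantumKilling_covMul hr hs, K.q_j]
  counit_spec X := rfl
  bracket_spec X Y := by
    change ((K.bracket (X ⊗ₜ Y) : T) : Module.Dual k A) = _
    refine LinearMap.ext fun a => ?_
    have h := LinearMap.congr_fun K.j_bracket (X ⊗ₜ Y)
    simp only [LinearMap.comp_apply, TensorProduct.map_tmul, brA_tmul] at h
    have h2 := apply_adCoeff ((quantumKilling r s).flip a) (quantumKilling r s (K.j X)) (K.j Y)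
    rw [← K.q_j (K.bracket _), ← h]
    refine h2.symm.trans ?_
    rw [← quantumKilling_invariant hr hs, K.q_j, K.q_j, adBracket, LinearMap.comp_apply]
    generalize adL k A a = t
    induction t with
    | zero => simp
    | add a b ha hb => simp only [map_add, ha, hb]
    | tmul X Y => simp [mul_comm]

/-- The values of the canonical braiding of `T`. -/
theorem pairing_upsilon (X Y : T) (a b : A) :
    pairing T T ((K.braidedLie hr hs).canonicalBraiding (X ⊗ₜ Y)) (a ⊗ₜ b) =
      TensorProduct.dualDistrib k A A (((X : Module.Dual k A) ∘ₗ LinearMap.mulRight k b) ⊗ₜ[k]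
        (Y : Module.Dual k A)) (adL k A a) := by
  have h := LinearMap.congr_fun K.j_upsilon (X ⊗ₜ Y)
  simp only [LinearMap.comp_apply, TensorProduct.map_tmul] at h
  rw [K.pairing_eq]
  refine (congrArg _ (congrArg _ h.symm)).trans ?_
  -- By the formula for `Υ` through `γ`, the pairing is `q(d⁽⁰⁾, a) q(c, d⁽¹⁾ b)`; invariance then
  -- moves the coaction from `d` to `a`.
  have h2 : LinearMap.mul' k k ∘ₗ TensorProduct.map ((quantumKilling r s).flip a)
      ((quantumKilling r s).flip b) ∘ₗ upsA r s ∘ₗ TensorProduct.mk k A A (K.j X) =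
      (quantumKilling r s (K.j X) ∘ₗ LinearMap.mulRight k b) ∘ₗ
        adCoeff ((quantumKilling r s).flip a) := by
    refine (adRComodule k A).hom_ext fun m e u he i => ?_
    simp only [LinearMap.comp_apply, TensorProduct.mk_apply, he.upsA_apply hr, map_sum,
      TensorProduct.map_tmul, LinearMap.mul'_apply, LinearMap.flip_apply,
      quantumKilling_gam hr hs, he.adCoeff_apply, map_smul, smul_eq_mul,
      LinearMap.mulRight_apply]
  refine (LinearMap.congr_fun h2 (K.j Y)).trans ?_
  change (quantumKilling r s (K.j X) ∘ₗ LinearMap.mulRight k b)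
    (adCoeff ((quantumKilling r s).flip a) (K.j Y)) = _
  rw [← quantumKilling_invariant hr hs, K.q_j, K.q_j]
  generalize adL k A a = t
  induction t with
  | zero => simp
  | add a b ha hb => simp only [map_add, ha, hb]
  | tmul X Y => simp [mul_comm]

end KillingSection

end Transfer

end

section

/-! ### Transport of a braided bialgebra along an algebra isomorphism. -/

section Pullback

variable {k : Type u} {A : Type v} [Field k] [Ring A] [HopfAlgebra k A]
  {B B' : Type*} [Ring B] [Algebra k B] [Ring B'] [Algebra k B'] {r : A →ₗ[k] A →ₗ[k] k}

theorem symm_comp_toLinearMap (φ : B ≃ₐ[k] B') :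
    φ.symm.toLinearMap ∘ₗ φ.toLinearMap = LinearMap.id :=
  LinearMap.ext fun x => φ.symm_apply_apply x

theorem comp_toLinearMap_symm (φ : B ≃ₐ[k] B') :
    φ.toLinearMap ∘ₗ φ.symm.toLinearMap = LinearMap.id :=
  LinearMap.ext fun x => φ.apply_symm_apply x

theorem map_comp_cancel {V W V' W' Z : Type*} [AddCommMonoid V] [Module k V] [AddCommMonoid W]
    [Module k W] [AddCommMonoid V'] [Module k V'] [AddCommMonoid W'] [Module k W']
    [AddCommMonoid Z] [Module k Z]
    {f : V →ₗ[k] W} {g : W →ₗ[k] V} {f' : V' →ₗ[k] W'} {g' : W' →ₗ[k] V'}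
    (h : f ∘ₗ g = LinearMap.id) (h' : f' ∘ₗ g' = LinearMap.id) (F : Z →ₗ[k] W ⊗[k] W') :
    TensorProduct.map f f' ∘ₗ TensorProduct.map g g' ∘ₗ F = F := by
  rw [← LinearMap.comp_assoc, map_left_inverse h h', LinearMap.id_comp]

namespace BraidedBialgebra

variable (S : BraidedBialgebra k A r B') (φ : B ≃ₐ[k] B')

/-- The coaction pulled back along an isomorphism. -/
def pullCoact : B →ₗ[k] B ⊗[k] A := φ.symm.toLinearMap.rTensor A ∘ₗ S.coact ∘ₗ φ.toLinearMap

/-- The coproduct pulled back along an isomorphism. -/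
def pullComul : B →ₗ[k] B ⊗[k] B :=
  TensorProduct.map φ.symm.toLinearMap φ.symm.toLinearMap ∘ₗ S.comul ∘ₗ φ.toLinearMap

theorem isComoduleMap_pull : S.coact ∘ₗ φ.toLinearMap =
    φ.toLinearMap.rTensor A ∘ₗ S.pullCoact φ :=
  (map_comp_cancel (comp_toLinearMap_symm φ) (LinearMap.id_comp _) _).symm

theorem comul_pull : S.comul ∘ₗ φ.toLinearMap =
    TensorProduct.map φ.toLinearMap φ.toLinearMap ∘ₗ S.pullComul φ :=
  (map_comp_cancel (comp_toLinearMap_symm φ) (comp_toLinearMap_symm φ) _).symm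

/-- The bialgebra structure pulled back along an isomorphism. -/
def pullback : BraidedBialgebra k A r B where
  coact := S.pullCoact φ
  comul := S.pullComul φ
  counit := S.counit.comp φ
  coact_coassoc := coact_coassoc_of_comp (symm_comp_toLinearMap φ)
    (S.isComoduleMap_pull φ) S.coact_coassoc
  coact_counit := coact_counit_of_comp (symm_comp_toLinearMap φ)
    (S.isComoduleMap_pull φ) S.coact_counit
  coact_one := by simp [pullCoact, S.coact_one]
  coact_mul x y := by
    have h : ∀ t, φ.symm.toLinearMap.rTensor A t =
        Algebra.TensorProduct.map φ.symm.toAlgHom (AlgHom.id k A) t := fun t => by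
      induction t with
      | zero => simp
      | add x y hx hy => simp only [map_add, hx, hy]
      | tmul x y => simp
    simp [pullCoact, S.coact_mul, h]
  coassoc := coassoc_of_comp (symm_comp_toLinearMap φ) (S.comul_pull φ) S.coassoc
  counit_left := counit_left_of_comp (symm_comp_toLinearMap φ) (S.comul_pull φ) rfl
    S.counit_left
  counit_right := counit_right_of_comp (symm_comp_toLinearMap φ) (S.comul_pull φ) rfl
    S.counit_right
  comul_comodule := comul_comodule_of_comp (symm_comp_toLinearMap φ)
    (S.isComoduleMap_pull φ) (S.comul_pull φ) S.comul_comodule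
  counit_comodule := counit_comodule_of_comp (S.isComoduleMap_pull φ) rfl S.counit_comodule
  comul_one := by simp [pullComul, S.comul_one]
  comul_mul := by
    have hf := symm_comp_toLinearMap φ
    refine eq_of_comp_eq (map_left_inverse hf hf) ?_
    have h1 : φ.toLinearMap ∘ₗ LinearMap.mul' k B =
        LinearMap.mul' k B' ∘ₗ TensorProduct.map φ.toLinearMap φ.toLinearMap :=
      TensorProduct.ext' fun x y => by simp
    have h2 : TensorProduct.map φ.toLinearMap φ.toLinearMap ∘ₗ
        TensorProduct.map (LinearMap.mul' k B) (LinearMap.mul' k B) =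
        TensorProduct.map (LinearMap.mul' k B') (LinearMap.mul' k B') ∘ₗ
          TensorProduct.map (TensorProduct.map φ.toLinearMap φ.toLinearMap)
            (TensorProduct.map φ.toLinearMap φ.toLinearMap) := by
      rw [← TensorProduct.map_comp, ← TensorProduct.map_comp, h1]
    have hφ : IsComoduleMap (S.pullCoact φ) S.coact φ.toLinearMap := S.isComoduleMap_pull φ
    have h3 := midMap_map φ.toLinearMap φ.toLinearMap φ.toLinearMap φ.toLinearMap
      (Ψ := braiding r (S.pullCoact φ) (S.pullCoact φ)) (Ψ' := braiding r S.coact S.coact)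
      (TensorProduct.ext' fun x y => hφ.braiding_map hφ r x y)
    have h4 : TensorProduct.map S.comul S.comul ∘ₗ
        TensorProduct.map φ.toLinearMap φ.toLinearMap =
        TensorProduct.map (TensorProduct.map φ.toLinearMap φ.toLinearMap)
            (TensorProduct.map φ.toLinearMap φ.toLinearMap) ∘ₗ
          TensorProduct.map (S.pullComul φ) (S.pullComul φ) := by
      rw [← TensorProduct.map_comp, ← TensorProduct.map_comp, S.comul_pull φ]
    rw [← LinearMap.comp_assoc, ← LinearMap.comp_assoc, h2, ← S.comul_pull φ,
      LinearMap.comp_assoc, h1, LinearMap.comp_assoc, ← LinearMap.comp_assoc _ (midMap _), ← h3,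
      LinearMap.comp_assoc, ← h4, ← LinearMap.comp_assoc, S.comul_mul]
    rfl

theorem isBialgebraIso_pullback : IsBialgebraIso (S.pullback φ) S φ where
  coact x := LinearMap.congr_fun (S.isComoduleMap_pull φ) x
  comul x := LinearMap.congr_fun (S.comul_pull φ) x
  counit _ := rfl

end BraidedBialgebra

end Pullback

end

/-! ### Braided Lie algebras with a unit vector. -/

section

variable {k : Type u} {A : Type v} [Field k] [Ring A] [HopfAlgebra k A]
  {r : A →ₗ[k] A →ₗ[k] k}

namespace BraidedLieAlgebra

variable {V : Type*} [AddCommGroup V] [Module k V] (L : BraidedLieAlgebra k A r V)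
  (hr : IsCoquasitriangular r)

include hr

/-- The counit on the braided leg is colinear, so it undoes the braiding and the coproduct. The
bracket is therefore the counit contraction of `Υ`, which yields the linear term in the relations of
`U(g)`. -/
theorem lTensor_counit_canonicalBraiding (t : V ⊗[k] V) :
    TensorProduct.rid k V (L.counit.lTensor V (L.canonicalBraiding t)) = L.bracket t := by
  have h : (TensorProduct.rid k V).toLinearMap ∘ₗ L.counit.lTensor V ∘ₗ L.canonicalBraiding =
      L.bracket := by
    refine TensorProduct.ext (LinearMap.ext fun c => L.toRightComodule.hom_ext
      fun m e u he i => ?_)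
    have h2 : ∀ a, L.counit ∘ₗ L.lam a = Coalgebra.counit (R := k) a • L.counit := fun a =>
      LinearMap.ext fun w => L.counit_lam hr a w
    have h3 := LinearMap.congr_fun L.counit_right c
    simp only [LinearMap.compr₂ₛₗ_apply, TensorProduct.mk_apply, LinearMap.comp_apply,
      L.canonicalBraiding_family he, map_sum, LinearMap.lTensor, TensorProduct.map_map, h2,
      he.counit, LinearMap.id_comp]
    rw [Finset.sum_eq_single i (fun l _ hl => by simp [hl]) (by simp)]
    have h4 : ∀ t : V ⊗[k] V, TensorProduct.rid k V (TensorProduct.map (L.brBy (e i)) L.counit t) =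
        L.brBy (e i) (TensorProduct.rid k V (L.counit.lTensor V t)) := fun t => by
      induction t with
      | zero => simp
      | add a b ha hb => simp only [map_add, ha, hb]
      | tmul a b => simp
    simp only [LinearMap.comp_apply, LinearEquiv.coe_coe, LinearMap.id_apply] at h3
    rw [if_pos rfl, one_smul, LinearEquiv.coe_coe, h4, h3]
    rfl
  exact LinearMap.congr_fun h t

/-- The counit of a bracket is the product of counits, and colinearity removes the braiding. On
tensors with second factor in `ker ε` this contraction is zero, so `Υ` has no component along `e` in
its left leg. -/
theorem rTensor_counit_canonicalBraiding (t : V ⊗[k] V) :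
    TensorProduct.lid k V (L.counit.rTensor V (L.canonicalBraiding t)) =
      TensorProduct.rid k V (L.counit.lTensor V t) := by
  have h : (TensorProduct.lid k V).toLinearMap ∘ₗ L.counit.rTensor V ∘ₗ L.canonicalBraiding =
      (TensorProduct.rid k V).toLinearMap ∘ₗ L.counit.lTensor V := by
    refine TensorProduct.ext (LinearMap.ext fun c => L.toRightComodule.hom_ext
      fun m e u he i => ?_)
    have h1 : ∀ v, L.counit ∘ₗ L.brBy v = L.counit v • L.counit := by
      intro v
      refine LinearMap.ext fun w => ?_
      have := LinearMap.congr_fun L.counit_bracket (w ⊗ₜ v)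
      simpa [brBy, mul_comm] using this
    have h3 : TensorProduct.lid k V (TensorProduct.map L.counit LinearMap.id (L.comul c)) = c :=
      LinearMap.congr_fun L.counit_left c
    have h4 : ∀ a (t : V ⊗[k] V), TensorProduct.lid k V
        (TensorProduct.map L.counit (L.lam a) t) =
        L.lam a (TensorProduct.lid k V (TensorProduct.map L.counit LinearMap.id t)) := fun a t => by
      induction t with
      | zero => simp
      | add a b ha hb => simp only [map_add, ha, hb]
      | tmul a b => simp
    have h5 := LinearMap.congr_fun L.counit_comodule (e i)
    simp only [LinearMap.comp_apply, LinearEquiv.coe_coe, he.coact, map_sum,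
      LinearMap.rTensor_tmul, TensorProduct.lid_tmul, LinearMap.toSpanSingleton_apply] at h5
    have h6 : L.lam 1 c = c := by
      have : r.flip 1 = Coalgebra.counit := LinearMap.ext fun a => hr.one_right a
      rw [lam, this, L.toRightComodule.coactBy_counit]
    have h7 : ∀ (x : k) a, x • L.lam a c = L.lam (x • a) c := fun x a => by
      simp [lam, coactBy_apply]
    have h8 : ∀ f : Fin m → A, ∑ i, L.lam (f i) c = L.lam (∑ i, f i) c := fun f => by
      simp [lam, coactBy_apply]
    simp only [LinearMap.compr₂ₛₗ_apply, TensorProduct.mk_apply, LinearMap.comp_apply,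
      L.canonicalBraiding_family he, map_sum, LinearMap.rTensor, TensorProduct.map_map, h1,
      TensorProduct.map_smul_left, LinearMap.smul_apply, map_smul, LinearMap.id_comp,
      LinearEquiv.coe_coe, h4, h3, h7, h8, h5]
    simp only [← h7, h6, LinearMap.lTensor_tmul, TensorProduct.rid_tmul]
  exact LinearMap.congr_fun h t

end BraidedLieAlgebra

/-- A braided Lie algebra `𝒯` with a group-like, coinvariant element `e` acting as the identity,
written as the sum of `k e` and of a subalgebra `ℒ`. -/
structure UnitalSplitting {V W : Type*} [AddCommGroup V] [Module k V] [AddCommGroup W] [Module k W]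
    (𝒯 : BraidedLieAlgebra k A r V) (ℒ : BraidedLieAlgebra k A r W) where
  e : V
  i : W →ₗ[k] V
  coeff : V →ₗ[k] k
  proj : V →ₗ[k] W
  decomp : ∀ v, v = coeff v • e + i (proj v)
  coeff_e : coeff e = 1
  proj_e : proj e = 0
  coeff_i : ∀ w, coeff (i w) = 0
  proj_i : ∀ w, proj (i w) = w
  counit_e : 𝒯.counit e = 1
  coact_e : 𝒯.coact e = e ⊗ₜ 1
  comul_e : 𝒯.comul e = e ⊗ₜ e
  bracket_left : ∀ v, 𝒯.bracket (e ⊗ₜ v) = v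
  bracket_right : ∀ v, 𝒯.bracket (v ⊗ₜ e) = 𝒯.counit v • e
  coact_i : 𝒯.coact ∘ₗ i = i.rTensor A ∘ₗ ℒ.coact
  comul_i : 𝒯.comul ∘ₗ i = TensorProduct.map i i ∘ₗ ℒ.comul
  counit_i : ∀ w, 𝒯.counit (i w) = ℒ.counit w
  bracket_i : 𝒯.bracket ∘ₗ TensorProduct.map i i = i ∘ₗ ℒ.bracket

namespace UnitalSplitting

variable {V : Type*} {W : Type w} [AddCommGroup V] [Module k V] [AddCommGroup W] [Module k W]
  {𝒯 : BraidedLieAlgebra k A r V} {ℒ : BraidedLieAlgebra k A r W} (E : UnitalSplitting 𝒯 ℒ)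

theorem isFamily_e : 𝒯.toRightComodule.IsFamily (fun _ : Unit => E.e) (fun _ _ => 1) where
  toIsCorep := isCorep_one
  coact _ := by simp [E.coact_e]

theorem canonicalBraiding_i : 𝒯.canonicalBraiding ∘ₗ TensorProduct.map E.i E.i =
    TensorProduct.map E.i E.i ∘ₗ ℒ.canonicalBraiding := by
  have h : IsComoduleMap ℒ.coact 𝒯.coact E.i := E.coact_i
  exact upsilon_map (TensorProduct.ext' fun x y => h.braiding_map h r x y) E.comul_i E.bracket_i

variable {R : Type*} [Ring R] [Algebra k R] {F : V →ₗ[k] R}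

theorem ext_of_e_i {Z : Type*} [AddCommMonoid Z] [Module k Z] {F G : V →ₗ[k] Z}
    (he : F E.e = G E.e) (hi : ∀ w, F (E.i w) = G (E.i w)) : F = G := by
  refine LinearMap.ext fun v => ?_
  rw [E.decomp v, map_add, map_add, map_smul, map_smul, he, hi]

/-- The extension to `𝒯` of a linear map on `ℒ` which sends `e` to `z`. -/
def extend {Z : Type*} [AddCommMonoid Z] [Module k Z] (z : Z) (F : W →ₗ[k] Z) : V →ₗ[k] Z :=
  E.coeff.smulRight z + F ∘ₗ E.proj

theorem extend_e {Z : Type*} [AddCommMonoid Z] [Module k Z] (z : Z) (F : W →ₗ[k] Z) :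
    E.extend z F E.e = z := by simp [extend, E.coeff_e, E.proj_e]

theorem extend_i {Z : Type*} [AddCommMonoid Z] [Module k Z] (z : Z) (F : W →ₗ[k] Z) (w : W) :
    E.extend z F (E.i w) = F w := by simp [extend, E.coeff_i, E.proj_i]

section

variable (hr : IsCoquasitriangular r)
include hr

/-- The vector `e` is coinvariant and group-like and acts as the identity, so `Υ` reduces to the
flip. With the lemma for the other side, the relations involving `e` say only that `e` is central,
and they become empty once `e` is sent to `1`. -/
theorem canonicalBraiding_e_left (v : V) :
    𝒯.canonicalBraiding (E.e ⊗ₜ v) = v ⊗ₜ E.e := by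
  have h1 : r 1 = Coalgebra.counit := LinearMap.ext hr.one_left
  have h2 : braiding r 𝒯.coact 𝒯.coact (E.e ⊗ₜ v) = v ⊗ₜ E.e :=
    (E.isFamily_e.braiding_left r 𝒯.coact v ()).trans
      (by simp [h1, 𝒯.toRightComodule.coactBy_counit])
  simp [BraidedLieAlgebra.canonicalBraiding, E.comul_e, h2, E.bracket_left]

/-- Coinvariance of `e` makes the braiding trivial, and `[v₍₁₎, e] = ε(v₍₁₎) e` is absorbed by the
counit axiom. -/
theorem canonicalBraiding_e_right (v : V) :
    𝒯.canonicalBraiding (v ⊗ₜ E.e) = E.e ⊗ₜ v := by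
  have h1 : 𝒯.lam 1 = LinearMap.id := by
    have : r.flip 1 = Coalgebra.counit := LinearMap.ext hr.one_right
    refine LinearMap.ext fun v => ?_
    rw [BraidedLieAlgebra.lam, this]
    exact 𝒯.toRightComodule.coactBy_counit v
  have h2 : 𝒯.brBy E.e = LinearMap.toSpanSingleton k V E.e ∘ₗ 𝒯.counit :=
    LinearMap.ext fun v => E.bracket_right v
  have h3 := LinearMap.congr_fun 𝒯.counit_left v
  have h4 : ∀ t : V ⊗[k] V, TensorProduct.map (LinearMap.toSpanSingleton k V E.e ∘ₗ 𝒯.counit)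
      LinearMap.id t = E.e ⊗ₜ TensorProduct.lid k V (𝒯.counit.rTensor V t) := fun t => by
    induction t with
    | zero => simp
    | add a b ha hb => simp only [map_add, ha, hb, TensorProduct.tmul_add]
    | tmul a b => simp [TensorProduct.smul_tmul]
  simp only [LinearMap.comp_apply, LinearEquiv.coe_coe, LinearMap.id_apply] at h3
  rw [𝒯.canonicalBraiding_family E.isFamily_e v ()]
  simp only [h1, h2, Finset.univ_unique, Finset.sum_const, Finset.card_singleton, one_smul, h4,
    h3]

/-- A map on `𝒯` sending `e` to `1` satisfies the quadratic relations of `B(𝒯)` if it satisfies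
those on a complement of `e`. -/
theorem mul_canonicalBraiding {g : Type*} [AddCommGroup g] [Module k g] {κ : g →ₗ[k] V}
    {c : V →ₗ[k] k} {p : V →ₗ[k] g} (hp : ∀ v, v = c v • E.e + κ (p v)) (hF : F E.e = 1)
    (h : ∀ t, LinearMap.mul' k R (TensorProduct.map F F (𝒯.canonicalBraiding
      (TensorProduct.map κ κ t))) = LinearMap.mul' k R (TensorProduct.map F F
        (TensorProduct.map κ κ t))) (t : V ⊗[k] V) :
    LinearMap.mul' k R (TensorProduct.map F F (𝒯.canonicalBraiding t)) =
      LinearMap.mul' k R (TensorProduct.map F F t) := by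
  induction t with
  | zero => simp
  | add a b ha hb => simp only [map_add, ha, hb]
  | tmul x y =>
    have h1 := h (p x ⊗ₜ p y)
    rw [TensorProduct.map_tmul] at h1
    rw [hp x, hp y]
    simp only [TensorProduct.add_tmul, TensorProduct.tmul_add, map_add, h1,
      ← TensorProduct.smul_tmul', TensorProduct.tmul_smul, map_smul,
      E.canonicalBraiding_e_left hr, E.canonicalBraiding_e_right hr, TensorProduct.map_tmul, hF,
      LinearMap.mul'_apply, one_mul, mul_one]

end

end UnitalSplitting

end

/-! ### The isomorphism of `U(g)` with `B(ℒ)`. -/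

section

variable {k : Type u} {A : Type v} [Field k] [Ring A] [HopfAlgebra k A]
  {r : A →ₗ[k] A →ₗ[k] k}

namespace UnitalSplitting

variable {V : Type*} {W : Type w} [AddCommGroup V] [Module k V] [AddCommGroup W] [Module k W]
  {𝒯 : BraidedLieAlgebra k A r V} {ℒ : BraidedLieAlgebra k A r W} (E : UnitalSplitting 𝒯 ℒ)

/-- The kernel of the counit, as the image of an injection with a given left inverse. -/
structure Augmentation (g : Type*) [AddCommGroup g] [Module k g] where
  κ : g →ₗ[k] V
  p : V →ₗ[k] g
  κ_p : ∀ v, κ (p v) = v - 𝒯.counit v • E.e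
  p_κ : ∀ x, p (κ x) = x

namespace Augmentation

variable {E} {g : Type*} [AddCommGroup g] [Module k g] (G : E.Augmentation g)

theorem counit_κ (x : g) : 𝒯.counit (G.κ x) = 0 := by
  have h := G.κ_p (G.κ x)
  rw [G.p_κ, eq_comm, sub_eq_self] at h
  simpa [E.counit_e] using congrArg 𝒯.counit h

theorem p_e : G.p E.e = 0 := by
  rw [← G.p_κ (G.p E.e), G.κ_p, E.counit_e, one_smul, sub_self, map_zero]

/-- The braiding on the kernel of the counit. -/
def sigma : g ⊗[k] g →ₗ[k] g ⊗[k] g :=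
  TensorProduct.map G.p G.p ∘ₗ 𝒯.canonicalBraiding ∘ₗ TensorProduct.map G.κ G.κ

/-- The bracket on the kernel of the counit. -/
def bracket : g ⊗[k] g →ₗ[k] g := G.p ∘ₗ 𝒯.bracket ∘ₗ TensorProduct.map G.κ G.κ

/-- The reduced coproduct on the kernel of the counit. -/
def delta : g →ₗ[k] g ⊗[k] g := TensorProduct.map G.p G.p ∘ₗ 𝒯.comul ∘ₗ G.κ

/-- The coaction on the kernel of the counit. -/
def coact : g →ₗ[k] g ⊗[k] A := G.p.rTensor A ∘ₗ 𝒯.coact ∘ₗ G.κ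

/-- `κ ∘ p` is `id - ε(-) e`. Its tensor square is grouped around the two counit contractions, which
are known both for `Υ` and for the coproduct. -/
theorem map_κ_p (z : V ⊗[k] V) : TensorProduct.map G.κ G.κ (TensorProduct.map G.p G.p z) =
    z - TensorProduct.rid k V (𝒯.counit.lTensor V z) ⊗ₜ E.e -
      E.e ⊗ₜ G.κ (G.p (TensorProduct.lid k V (𝒯.counit.rTensor V z))) := by
  induction z with
  | zero => simp
  | add a b ha hb =>
    simp only [map_add, ha, hb, TensorProduct.add_tmul, TensorProduct.tmul_add]
    abel
  | tmul a b =>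
    simp only [TensorProduct.map_tmul, LinearMap.lTensor_tmul, LinearMap.rTensor_tmul,
      TensorProduct.rid_tmul, TensorProduct.lid_tmul, map_smul, G.κ_p, TensorProduct.sub_tmul,
      TensorProduct.tmul_sub, TensorProduct.tmul_smul, TensorProduct.smul_tmul', smul_sub,
      smul_comm (𝒯.counit b)]
    abel

theorem κ_delta (x : g) : TensorProduct.map G.κ G.κ (G.delta x) =
    𝒯.comul (G.κ x) - G.κ x ⊗ₜ E.e - E.e ⊗ₜ G.κ x := by
  have h1 := LinearMap.congr_fun 𝒯.counit_left (G.κ x)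
  have h2 := LinearMap.congr_fun 𝒯.counit_right (G.κ x)
  simp only [LinearMap.comp_apply, LinearEquiv.coe_coe, LinearMap.id_apply] at h1 h2
  simp only [delta, LinearMap.comp_apply, map_κ_p, h1, h2, G.p_κ]

theorem κ_coact : 𝒯.coact ∘ₗ G.κ = G.κ.rTensor A ∘ₗ G.coact := by
  refine LinearMap.ext fun x => ?_
  have h1 := LinearMap.congr_fun 𝒯.counit_comodule (G.κ x)
  simp only [LinearMap.comp_apply, LinearEquiv.coe_coe, G.counit_κ, map_zero] at h1
  have h2 : ∀ z : V ⊗[k] A, G.κ.rTensor A (G.p.rTensor A z) =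
      z - E.e ⊗ₜ TensorProduct.lid k A (𝒯.counit.rTensor A z) := fun z => by
    induction z with
    | zero => simp
    | add a b ha hb =>
      simp only [map_add, ha, hb, TensorProduct.tmul_add]
      abel
    | tmul a b => simp [G.κ_p, TensorProduct.sub_tmul, TensorProduct.smul_tmul]
  simp [coact, h2, h1]

/-- The kernel of the counit as a comodule. -/
def comodule : RightComodule k A g where
  coact := G.coact
  coact_coassoc := coact_coassoc_of_comp (LinearMap.ext G.p_κ) G.κ_coact 𝒯.coact_coassoc
  coact_counit := coact_counit_of_comp (LinearMap.ext G.p_κ) G.κ_coact 𝒯.coact_counit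

theorem κ_bracket (t : g ⊗[k] g) :
    G.κ (G.bracket t) = 𝒯.bracket (TensorProduct.map G.κ G.κ t) := by
  have h : G.κ ∘ₗ G.bracket = 𝒯.bracket ∘ₗ TensorProduct.map G.κ G.κ :=
    TensorProduct.ext' fun x y => by
      have h := LinearMap.congr_fun 𝒯.counit_bracket (G.κ x ⊗ₜ G.κ y)
      simp only [LinearMap.comp_apply, TensorProduct.map_tmul, LinearMap.mul'_apply,
        G.counit_κ, mul_zero] at h
      simp [bracket, G.κ_p, h]
  exact LinearMap.congr_fun h t

variable (hr : IsCoquasitriangular r)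

-- Of the two contractions in `map_κ_p`, one is the bracket and the other vanishes on the kernel of
-- the counit. So `Υ = σ + [ , ] ⊗ e` there.
include hr in
theorem κ_sigma (t : g ⊗[k] g) : TensorProduct.map G.κ G.κ (G.sigma t) =
    𝒯.canonicalBraiding (TensorProduct.map G.κ G.κ t) - G.κ (G.bracket t) ⊗ₜ E.e := by
  have h : TensorProduct.rid k V (𝒯.counit.lTensor V (TensorProduct.map G.κ G.κ t)) = 0 := by
    induction t with
    | zero => simp
    | add a b ha hb => simp only [map_add, ha, hb, add_zero]
    | tmul x y => simp [G.counit_κ]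
  simp only [sigma, LinearMap.comp_apply, map_κ_p, 𝒯.lTensor_counit_canonicalBraiding hr,
    𝒯.rTensor_counit_canonicalBraiding hr, h, map_zero, TensorProduct.tmul_zero, sub_zero,
    κ_bracket]

/-- The algebra generated by the kernel of the counit, with its quadratic-linear relations. -/
abbrev Env : Type _ := Envelope G.sigma G.bracket

/-- The generators of `Env`. -/
abbrev gen : g →ₗ[k] G.Env := Envelope.gen G.sigma G.bracket

variable (E) in
/-- The map `𝒯 → B(ℒ)` that sends `e` to `1`. -/
def _root_.QLie.UnitalSplitting.genB : V →ₗ[k] ℒ.BraidedEnvelope := E.extend 1 ℒ.gen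

variable (E) in
theorem _root_.QLie.UnitalSplitting.genB_e : E.genB E.e = 1 := E.extend_e _ _

variable (E) in
theorem _root_.QLie.UnitalSplitting.genB_i (w : W) : E.genB (E.i w) = ℒ.gen w := E.extend_i _ _ _

variable (E) in
include hr in
theorem _root_.QLie.UnitalSplitting.mul_genB (t : V ⊗[k] V) :
    LinearMap.mul' k _ (TensorProduct.map E.genB E.genB (𝒯.canonicalBraiding t)) =
      LinearMap.mul' k _ (TensorProduct.map E.genB E.genB t) := by
  refine E.mul_canonicalBraiding hr E.decomp E.genB_e (fun t => ?_) t
  have h := LinearMap.congr_fun E.canonicalBraiding_i t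
  have h2 : E.genB ∘ₗ E.i = ℒ.gen := LinearMap.ext E.genB_i
  simp only [LinearMap.comp_apply] at h
  rw [h, TensorProduct.map_map, TensorProduct.map_map, h2]
  exact ℒ.mul_gen t

/-- The map `𝒯 → U(g)` that sends `e` to `1`. -/
def genU : V →ₗ[k] G.Env := G.gen ∘ₗ G.p + 𝒯.counit.smulRight 1

theorem genU_e : G.genU E.e = 1 := by simp [genU, G.p_e, E.counit_e]

theorem genU_κ (x : g) : G.genU (G.κ x) = G.gen x := by simp [genU, G.p_κ, G.counit_κ]

-- With `e` sent to `1`, the term `[x, y] ⊗ e` becomes linear: the quadratic relation for `Υ` turns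
-- into the quadratic-linear relation for `σ` and the bracket.
include hr in
theorem mul_κ_sigma {R : Type*} [Ring R] [Algebra k R] {F : V →ₗ[k] R} (hF : F E.e = 1)
    (t : g ⊗[k] g) : LinearMap.mul' k R (TensorProduct.map F F
      (𝒯.canonicalBraiding (TensorProduct.map G.κ G.κ t))) =
    LinearMap.mul' k R (TensorProduct.map (F ∘ₗ G.κ) (F ∘ₗ G.κ) (G.sigma t)) +
      F (G.κ (G.bracket t)) := by
  have h := congrArg (fun z => LinearMap.mul' k R (TensorProduct.map F F z)) (G.κ_sigma hr t)
  simp only [map_sub, TensorProduct.map_map, TensorProduct.map_tmul, hF, LinearMap.mul'_apply,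
    mul_one] at h
  rw [h, sub_add_cancel]

include hr in
theorem mul_genU (t : V ⊗[k] V) :
    LinearMap.mul' k _ (TensorProduct.map G.genU G.genU (𝒯.canonicalBraiding t)) =
      LinearMap.mul' k _ (TensorProduct.map G.genU G.genU t) := by
  refine E.mul_canonicalBraiding (κ := G.κ) (c := 𝒯.counit) (p := G.p) hr
    (fun v => by rw [G.κ_p, add_sub_cancel]) G.genU_e (fun t => ?_) t
  have h2 : G.genU ∘ₗ G.κ = G.gen := LinearMap.ext G.genU_κ
  rw [G.mul_κ_sigma hr G.genU_e, TensorProduct.map_map, h2, G.genU_κ]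
  exact (Envelope.mul_gen t).symm

/-- The algebra map `U(g) → B(ℒ)`. -/
def toB : G.Env →ₐ[k] ℒ.BraidedEnvelope :=
  Envelope.lift (E.genB ∘ₗ G.κ) fun t => by
    rw [← TensorProduct.map_map, ← E.mul_genB hr, G.mul_κ_sigma hr E.genB_e]
    rfl

theorem toB_gen (x : g) : G.toB hr (G.gen x) = E.genB (G.κ x) := Envelope.lift_gen _ _ _

/-- The algebra map `B(ℒ) → U(g)`. -/
def toU : ℒ.BraidedEnvelope →ₐ[k] G.Env :=
  ℒ.liftB (G.genU ∘ₗ E.i) fun t => by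
    have h := LinearMap.congr_fun E.canonicalBraiding_i t
    simp only [LinearMap.comp_apply] at h
    rw [← TensorProduct.map_map, ← h, G.mul_genU hr, TensorProduct.map_map]

theorem toU_genB (v : V) : G.toU hr (E.genB v) = G.genU v := by
  have h : (G.toU hr).toLinearMap ∘ₗ E.genB = G.genU := by
    refine E.ext_of_e_i ?_ fun w => ?_
    · simp [E.genB_e, G.genU_e]
    · rw [LinearMap.comp_apply, E.genB_i]
      exact ℒ.liftB_gen _ _ w
  exact LinearMap.congr_fun h v

theorem toB_genU (v : V) : G.toB hr (G.genU v) = E.genB v := by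
  rw [genU, LinearMap.add_apply, map_add, LinearMap.comp_apply, toB_gen, G.κ_p,
    LinearMap.smulRight_apply, map_smul, map_one, map_sub, map_smul, E.genB_e, sub_add_cancel]

/-- The isomorphism `U(g) ≃ B(ℒ)`. -/
def equivB : G.Env ≃ₐ[k] ℒ.BraidedEnvelope :=
  AlgEquiv.ofAlgHom (G.toB hr) (G.toU hr)
    (Envelope.algHom_ext fun w => by
      have h := G.toU_genB hr (E.i w)
      rw [E.genB_i] at h
      refine (congrArg (G.toB hr) h).trans ?_
      rw [toB_genU, E.genB_i]
      rfl)
    (Envelope.algHom_ext fun x => by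
      refine (congrArg (G.toU hr) (G.toB_gen hr x)).trans ?_
      rw [toU_genB, genU_κ]
      rfl)

theorem equivB_gen (x : g) : G.equivB hr (G.gen x) = E.genB (G.κ x) := G.toB_gen hr x

theorem equivB_gen_of_eq {x : g} {w : W} {c : k} (h : G.κ x = E.i w - c • E.e) :
    G.equivB hr (G.gen x) = ℒ.gen w - algebraMap k _ c := by
  rw [equivB_gen, h, map_sub, map_smul, E.genB_e, E.genB_i, Algebra.algebraMap_eq_smul_one]

theorem equivB_symm_genB (v : V) : (G.equivB hr).symm (E.genB v) = G.genU v := G.toU_genB hr v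

/-- The bialgebra structure on `U(g)`. -/
def bialgebraU : BraidedBialgebra k A r G.Env := (ℒ.bialgebraB hr).pullback (G.equivB hr)

theorem isBialgebraIso_equivB :
    IsBialgebraIso (G.bialgebraU hr) (ℒ.bialgebraB hr) (G.equivB hr) :=
  (ℒ.bialgebraB hr).isBialgebraIso_pullback _

variable (E) in
theorem _root_.QLie.UnitalSplitting.coact_genB : (ℒ.bialgebraB hr).coact ∘ₗ E.genB =
    E.genB.rTensor A ∘ₗ 𝒯.coact := by
  refine E.ext_of_e_i ?_ fun w => ?_
  · simp [E.genB_e, E.coact_e, (ℒ.bialgebraB hr).coact_one]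
  · have h := LinearMap.congr_fun E.coact_i w
    have h2 : E.genB ∘ₗ E.i = ℒ.gen := LinearMap.ext E.genB_i
    simp only [LinearMap.comp_apply] at h ⊢
    rw [h, E.genB_i, (ℒ.extends_bialgebraB hr).coact, ← h2, LinearMap.rTensor_comp_apply]

variable (E) in
theorem _root_.QLie.UnitalSplitting.comul_genB : (ℒ.bialgebraB hr).comul ∘ₗ E.genB =
    TensorProduct.map E.genB E.genB ∘ₗ 𝒯.comul := by
  refine E.ext_of_e_i ?_ fun w => ?_
  · simp [E.genB_e, E.comul_e, (ℒ.bialgebraB hr).comul_one]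
  · have h := LinearMap.congr_fun E.comul_i w
    have h2 : E.genB ∘ₗ E.i = ℒ.gen := LinearMap.ext E.genB_i
    simp only [LinearMap.comp_apply] at h ⊢
    rw [h, E.genB_i, (ℒ.extends_bialgebraB hr).comul, ← h2, TensorProduct.map_map]

variable (E) in
theorem _root_.QLie.UnitalSplitting.counit_genB (v : V) :
    (ℒ.bialgebraB hr).counit (E.genB v) = 𝒯.counit v := by
  have h : (ℒ.bialgebraB hr).counit.toLinearMap ∘ₗ E.genB = 𝒯.counit := by
    refine E.ext_of_e_i ?_ fun w => ?_
    · simp [E.genB_e, E.counit_e]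
    · simp [E.genB_i, (ℒ.extends_bialgebraB hr).counit, E.counit_i]
  exact LinearMap.congr_fun h v

theorem symm_comp_genB :
    (G.equivB hr).symm.toLinearMap ∘ₗ E.genB ∘ₗ G.κ = G.gen :=
  LinearMap.ext fun x => (G.equivB_symm_genB hr (G.κ x)).trans (G.genU_κ x)

theorem bialgebraU_coact (x : g) :
    (G.bialgebraU hr).coact (G.gen x) = G.gen.rTensor A (G.coact x) := by
  have h1 := LinearMap.congr_fun (E.coact_genB hr) (G.κ x)
  have h2 := LinearMap.congr_fun G.κ_coact x
  simp only [LinearMap.comp_apply] at h1 h2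
  change (G.equivB hr).symm.toLinearMap.rTensor A
    ((ℒ.bialgebraB hr).coact (G.equivB hr (G.gen x))) = _
  rw [equivB_gen, h1, h2, ← LinearMap.rTensor_comp_apply, ← LinearMap.rTensor_comp_apply,
    LinearMap.comp_assoc, symm_comp_genB]

theorem bialgebraU_comul (x : g) : (G.bialgebraU hr).comul (G.gen x) =
    G.gen x ⊗ₜ 1 + 1 ⊗ₜ G.gen x + TensorProduct.map G.gen G.gen (G.delta x) := by
  have h1 := LinearMap.congr_fun (E.comul_genB hr) (G.κ x)
  have h2 : 𝒯.comul (G.κ x) = G.κ x ⊗ₜ E.e + E.e ⊗ₜ G.κ x +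
      TensorProduct.map G.κ G.κ (G.delta x) := by rw [κ_delta]; abel
  simp only [LinearMap.comp_apply] at h1
  change TensorProduct.map (G.equivB hr).symm.toLinearMap (G.equivB hr).symm.toLinearMap
    ((ℒ.bialgebraB hr).comul (G.equivB hr (G.gen x))) = _
  have h3 : (G.equivB hr).symm.toLinearMap (E.genB (G.κ x)) = G.gen x :=
    LinearMap.congr_fun (G.symm_comp_genB hr) x
  rw [equivB_gen, h1, h2]
  simp only [map_add, TensorProduct.map_tmul, TensorProduct.map_map, symm_comp_genB,
    E.genB_e, h3]
  simp

theorem bialgebraU_counit (x : g) : (G.bialgebraU hr).counit (G.gen x) = 0 := by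
  refine (congrArg (ℒ.bialgebraB hr).counit (G.equivB_gen hr x)).trans ?_
  rw [E.counit_genB, G.counit_κ]

/-- The type `Envelope σ β` depends on the maps, so these enter as variables together with
equations; the result then applies to the fields of a `TangentQuantumLie` structure. -/
theorem exists_bialgebraIso {ρ : g →ₗ[k] g ⊗[k] A} {σ : g ⊗[k] g →ₗ[k] g ⊗[k] g}
    {β : g ⊗[k] g →ₗ[k] g} {δ : g →ₗ[k] g ⊗[k] g} (hρ : ρ = G.coact) (hσ : σ = G.sigma)
    (hβ : β = G.bracket) (hδ : δ = G.delta) :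
    ∃ (S : BraidedBialgebra k A r (Envelope σ β)) (φ : Envelope σ β ≃ₐ[k] ℒ.BraidedEnvelope),
      (∀ x, S.coact (Envelope.gen σ β x) = (Envelope.gen σ β).rTensor A (ρ x)) ∧
      (∀ x, S.comul (Envelope.gen σ β x) = Envelope.gen σ β x ⊗ₜ 1 + 1 ⊗ₜ Envelope.gen σ β x +
        TensorProduct.map (Envelope.gen σ β) (Envelope.gen σ β) (δ x)) ∧
      (∀ x, S.counit (Envelope.gen σ β x) = 0) ∧ IsBialgebraIso S (ℒ.bialgebraB hr) φ ∧
      ∀ x w c, G.κ x = E.i w - c • E.e →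
        φ (Envelope.gen σ β x) = ℒ.gen w - algebraMap k _ c := by
  subst hρ hσ hβ hδ
  exact ⟨G.bialgebraU hr, G.equivB hr, G.bialgebraU_coact hr, G.bialgebraU_comul hr,
    G.bialgebraU_counit hr, G.isBialgebraIso_equivB hr, fun _ _ _ => G.equivB_gen_of_eq hr⟩

end Augmentation

end UnitalSplitting

end

/-! ### Comparison of the structures on `T`, `L` and `g`, and their values on `A`. -/

section

variable {k : Type u} {A : Type v} [Field k] [Ring A] [HopfAlgebra k A]

namespace BraidedLieAlgebra

theorem isSubalgebra_submoduleOf {r : A →ₗ[k] A →ₗ[k] k} {T L : Submodule k (Module.Dual k A)}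
    {𝒯 : BraidedLieAlgebra k A r T} {ℒ : BraidedLieAlgebra k A r L} (hLT : L ≤ T)
    (coact : 𝒯.coact ∘ₗ Submodule.inclusion hLT =
      (Submodule.inclusion hLT).rTensor A ∘ₗ ℒ.coact)
    (comul : 𝒯.comul ∘ₗ Submodule.inclusion hLT =
      TensorProduct.map (Submodule.inclusion hLT) (Submodule.inclusion hLT) ∘ₗ ℒ.comul)
    (bracket : 𝒯.bracket ∘ₗ TensorProduct.map (Submodule.inclusion hLT)
      (Submodule.inclusion hLT) = Submodule.inclusion hLT ∘ₗ ℒ.bracket) :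
    𝒯.IsSubalgebra (L.submoduleOf T) := by
  have h1 : ∀ x : L, Submodule.inclusion hLT x ∈ L.submoduleOf T := fun x => x.2
  have h2 : (L.submoduleOf T).subtype ∘ₗ (Submodule.inclusion hLT).codRestrict _ h1 =
      Submodule.inclusion hLT := rfl
  refine ⟨?_, ?_, ?_⟩
  · rintro ⟨x, _⟩ hx
    have h := LinearMap.congr_fun coact ⟨x, hx⟩
    simp only [LinearMap.comp_apply] at h
    refine h ▸ ?_
    rw [← h2, LinearMap.rTensor_comp_apply]
    exact LinearMap.mem_range_self _ _
  · rintro ⟨x, _⟩ hx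
    have h := LinearMap.congr_fun comul ⟨x, hx⟩
    simp only [LinearMap.comp_apply] at h
    refine h ▸ ?_
    rw [← h2, TensorProduct.map_comp]
    exact LinearMap.mem_range_self _ _
  · rintro ⟨x, _⟩ hx ⟨y, _⟩ hy
    have h := LinearMap.congr_fun bracket (⟨x, hx⟩ ⊗ₜ ⟨y, hy⟩)
    simp only [LinearMap.comp_apply] at h
    exact h ▸ h1 _

end BraidedLieAlgebra

theorem adR_one : adR k A 1 = 1 ⊗ₜ 1 := by
  have h := (isCorep_one (k := k) (A := A)).adR_apply () ()
  simpa using h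

variable {r s : A →ₗ[k] A →ₗ[k] k} (hr : IsCoquasitriangular r) (hs : IsCoquasitriangular s)

section

include hr hs

theorem quantumKilling_one : quantumKilling r s 1 = dualOne k A :=
  LinearMap.ext fun a => quantumKilling_one_left hr hs a

theorem brA_one_left (c : A) : brA (quantumKilling r s) (1 ⊗ₜ c) = c := by
  rw [brA_tmul, quantumKilling_one hr hs]
  exact (adRComodule k A).coactBy_counit c

theorem brA_one_right (c : A) :
    brA (quantumKilling r s) (c ⊗ₜ 1) = Coalgebra.counit (R := k) c • (1 : A) := by
  rw [brA_tmul, coactBy_apply, adR_one]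
  simp [quantumKilling_one_right hr hs]

end

namespace KillingSection

variable {T L : Submodule k (Module.Dual k A)} (K : KillingSection (quantumKilling r s) T)
  (K' : KillingSection (quantumKilling r s) L)

/-- The element of `T` that corresponds to `1 ∈ A`. -/
def e : T := K.π 1

section

variable {K K'} {C₁ : Submodule k A} (hinj : Set.InjOn (quantumKilling r s) C₁)
  (hK : LinearMap.range K.j = C₁) (hK' : LinearMap.range K'.j ≤ C₁) (hLT : L ≤ T)

-- Both sides are the preimage in `C₁` of the same functional, and `q` is injective on `C₁`.
include hinj hK hK' in
theorem j_inclusion : K.j ∘ₗ Submodule.inclusion hLT = K'.j := by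
  refine LinearMap.ext fun x => hinj ?_ (hK' (LinearMap.mem_range_self _ x)) ?_
  · exact hK ▸ LinearMap.mem_range_self _ _
  · rw [LinearMap.comp_apply, K.q_j, K'.q_j]
    rfl

end

variable {K K'}

theorem coact_inclusion {i : L →ₗ[k] T} (hi : K.j ∘ₗ i = K'.j) :
    K.coact ∘ₗ i = i.rTensor A ∘ₗ K'.coact := by
  refine eq_of_comp_eq (K.j_rTensor A) ?_
  rw [← LinearMap.comp_assoc, ← LinearMap.comp_assoc, ← K.j_coact, LinearMap.comp_assoc,
    ← LinearMap.rTensor_comp, hi, K'.j_coact]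

theorem comul_inclusion {i : L →ₗ[k] T} (hi : K.j ∘ₗ i = K'.j) :
    K.comul ∘ₗ i = TensorProduct.map i i ∘ₗ K'.comul := by
  refine eq_of_comp_eq K.jj ?_
  rw [← LinearMap.comp_assoc, ← LinearMap.comp_assoc, ← K.j_comul, LinearMap.comp_assoc,
    ← TensorProduct.map_comp, hi, K'.j_comul]

theorem bracket_inclusion {i : L →ₗ[k] T} (hi : K.j ∘ₗ i = K'.j) :
    K.bracket ∘ₗ TensorProduct.map i i = i ∘ₗ K'.bracket := by
  refine eq_of_comp_eq K.π_comp_j ?_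
  rw [← LinearMap.comp_assoc, ← LinearMap.comp_assoc, ← K.j_bracket, LinearMap.comp_assoc,
    ← TensorProduct.map_comp, hi, K'.j_bracket]

/-- The splitting of `T` into the span of `1` and `L`. -/
def unitalSplitting {i : L →ₗ[k] T} (hi : K.j ∘ₗ i = K'.j) (h1 : (1 : A) ∈ LinearMap.range K.j)
    {coeff : T →ₗ[k] k} {proj : T →ₗ[k] L} (decomp : ∀ v, v = coeff v • K.e + i (proj v))
    (coeff_e : coeff K.e = 1) (proj_e : proj K.e = 0) (coeff_i : ∀ w, coeff (i w) = 0)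
    (proj_i : ∀ w, proj (i w) = w) :
    UnitalSplitting (K.braidedLie hr hs) (K'.braidedLie hr hs) where
  e := K.e
  i := i
  coeff := coeff
  proj := proj
  decomp := decomp
  coeff_e := coeff_e
  proj_e := proj_e
  coeff_i := coeff_i
  proj_i := proj_i
  counit_e := by
    change counit K.e = 1
    rw [K.counit_eq hr hs, LinearMap.comp_apply, e, K.j_π h1]
    simp
  coact_e := by
    change K.coact K.e = _
    simp only [coact, e, LinearMap.comp_apply, K.j_π h1, adR_one, LinearMap.rTensor_tmul]
  comul_e := by
    change K.comul K.e = _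
    simp only [comul, e, LinearMap.comp_apply, K.j_π h1, Bialgebra.comul_one,
      Algebra.TensorProduct.one_def, TensorProduct.map_tmul]
  bracket_left v := by
    change K.bracket (K.e ⊗ₜ v) = _
    simp only [bracket, e, LinearMap.comp_apply, K.j_π h1, TensorProduct.map_tmul,
      brA_one_left hr hs]
    exact LinearMap.congr_fun K.π_comp_j v
  bracket_right v := by
    change K.bracket (v ⊗ₜ K.e) = counit v • K.e
    simp only [bracket, e, LinearMap.comp_apply, K.j_π h1, TensorProduct.map_tmul,
      brA_one_right hr hs, map_smul, K.counit_eq hr hs]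
  coact_i := coact_inclusion hi
  comul_i := comul_inclusion hi
  counit_i w := by
    change counit (i w) = counit w
    rw [K.counit_eq hr hs, K'.counit_eq hr hs, LinearMap.comp_apply, LinearMap.comp_apply, ← hi,
      LinearMap.comp_apply]
  bracket_i := bracket_inclusion hi

theorem coe_e (hr : IsCoquasitriangular r) (hs : IsCoquasitriangular s)
    (h1 : (1 : A) ∈ LinearMap.range K.j) : (K.e : Module.Dual k A) = dualOne k A := by
  rw [← K.q_j, e, K.j_π h1, quantumKilling_one hr hs]

end KillingSection

theorem pairing_map_inclusion {g T : Submodule k (Module.Dual k A)} {κ : g →ₗ[k] T}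
    (hκ : T.subtype ∘ₗ κ = g.subtype) (t : g ⊗[k] g) :
    pairing T T (TensorProduct.map κ κ t) = pairing g g t := by
  simp only [pairing, LinearMap.comp_apply, TensorProduct.map_map, hκ]

theorem rTensor_eval_inclusion {g T : Submodule k (Module.Dual k A)} {κ : g →ₗ[k] T}
    (hκ : T.subtype ∘ₗ κ = g.subtype) (a : A) (t : g ⊗[k] A) :
    (Module.Dual.eval k A a ∘ₗ T.subtype).rTensor A (κ.rTensor A t) =
      (Module.Dual.eval k A a ∘ₗ g.subtype).rTensor A t := by
  rw [← LinearMap.rTensor_comp_apply, LinearMap.comp_assoc, hκ]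

section Quantum

theorem augPart_le (T : Submodule k (Module.Dual k A)) : augPart T ≤ T := inf_le_left

theorem coe_augPart_one {T : Submodule k (Module.Dual k A)} (x : augPart T) :
    (x : Module.Dual k A) 1 = 0 := x.2.2

variable {T L : Submodule k (Module.Dual k A)} {𝒯 : TangentBraidedLie r T}
  {ℒ : TangentBraidedLie r L}
  {E : UnitalSplitting 𝒯.toBraidedLieAlgebra ℒ.toBraidedLieAlgebra}

/-- The vanishing part of `T` as the kernel of the counit. -/
def augmentation (hE : (E.e : Module.Dual k A) = dualOne k A) : E.Augmentation (augPart T) where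
  κ := Submodule.inclusion (augPart_le T)
  p := (T.subtype - 𝒯.counit.smulRight (dualOne k A)).codRestrict (augPart T) fun v =>
    ⟨T.sub_mem v.2 (T.smul_mem _ (hE ▸ E.e.2)), by simp [𝒯.counit_spec, dualOne]⟩
  κ_p v := Subtype.ext (congrArg (fun z => (v : Module.Dual k A) - 𝒯.counit v • z) hE.symm)
  p_κ x := Subtype.ext <| by
    have h : 𝒯.counit (Submodule.inclusion (augPart_le T) x) = 0 :=
      (𝒯.counit_spec _).trans (coe_augPart_one x)
    change (x : Module.Dual k A) -
      𝒯.counit (Submodule.inclusion (augPart_le T) x) • dualOne k A = x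
    rw [h, zero_smul, sub_zero]

variable {g : Submodule k (Module.Dual k A)} (G : E.Augmentation g)
  (hκ : T.subtype ∘ₗ G.κ = g.subtype) (hE : (E.e : Module.Dual k A) = dualOne k A)
  (hΥ : ∀ (X Y : T) (a b : A), pairing T T (𝒯.canonicalBraiding (X ⊗ₜ Y)) (a ⊗ₜ b) =
    TensorProduct.dualDistrib k A A (((X : Module.Dual k A) ∘ₗ LinearMap.mulRight k b) ⊗ₜ[k]
      (Y : Module.Dual k A)) (adL k A a))

/-- The quantum Lie algebra structure on the kernel of the counit. -/
def tangentQuantumLie : TangentQuantumLie r g where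
  toRightComodule := G.comodule
  sigma := G.sigma
  bracket := G.bracket
  delta := G.delta
  coact_spec x a := by
    have h := LinearMap.congr_fun G.κ_coact x
    have h2 := 𝒯.coact_spec (G.κ x) a
    have h3 : (G.κ x : Module.Dual k A) = x := LinearMap.congr_fun hκ x
    change TensorProduct.lid k A (LinearMap.rTensor A _ (G.coact x)) = _
    rw [← rTensor_eval_inclusion hκ, ← h3]
    exact (congrArg _ (congrArg _ h.symm)).trans h2
  bracket_spec x y := by
    have h2 := 𝒯.bracket_spec (G.κ x) (G.κ y)
    have h3 : ∀ x, (G.κ x : Module.Dual k A) = x := LinearMap.congr_fun hκ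
    rw [← h3, ← h3 x, ← h3 y, ← h2, G.κ_bracket, TensorProduct.map_tmul]
  sigma_spec x y a b := by
    have h := G.κ_sigma hr (x ⊗ₜ y)
    have h2 := 𝒯.bracket_spec (G.κ x) (G.κ y)
    have h3 : ∀ x, (G.κ x : Module.Dual k A) = x := LinearMap.congr_fun hκ
    rw [← pairing_map_inclusion hκ, h, map_sub, LinearMap.sub_apply, G.κ_bracket,
      TensorProduct.map_tmul, hΥ, ← h3 x, ← h3 y, ← h2]
    -- What remains is the correction term `[x, y] ⊗ e` evaluated at `a ⊗ b`, where `e` is the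
    -- counit of `A`.
    congr 1
    simp only [pairing, LinearMap.comp_apply, TensorProduct.map_tmul,
      TensorProduct.dualDistrib_apply, Submodule.subtype_apply, hE]
  delta_spec x a b := by
    have h1 := 𝒯.comul_spec (G.κ x) a b
    have h3 : (G.κ x : Module.Dual k A) = x := LinearMap.congr_fun hκ x
    rw [← pairing_map_inclusion hκ, G.κ_delta, map_sub, map_sub, LinearMap.sub_apply,
      LinearMap.sub_apply, h1, ← h3]
    simp only [pairing, LinearMap.comp_apply, TensorProduct.map_tmul,
      TensorProduct.dualDistrib_apply, Submodule.subtype_apply, hE]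

set_option maxHeartbeats 1000000 in
include hE hr hΥ in
theorem exists_iso_of_splitting (hi : T.subtype ∘ₗ E.i = L.subtype) :
    ∃ (𝔤 : TangentQuantumLie r (augPart T)) (SB : BraidedBialgebra k A r ℒ.BraidedEnvelope)
      (SU : BraidedBialgebra k A r 𝔤.UniversalEnvelope)
      (φ : 𝔤.UniversalEnvelope ≃ₐ[k] ℒ.BraidedEnvelope),
      ℒ.Extends SB ∧ 𝔤.Extends SU ∧ IsBialgebraIso SU SB φ ∧
      ∀ (X : L) (x : augPart T),
        (x : Module.Dual k A) = X - (X : Module.Dual k A) 1 • dualOne k A →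
        φ (𝔤.gen x) = ℒ.gen X - algebraMap k _ ((X : Module.Dual k A) 1) := by
  obtain ⟨G, hκ⟩ : ∃ G : E.Augmentation (augPart T), T.subtype ∘ₗ G.κ = (augPart T).subtype :=
    ⟨augmentation hE, rfl⟩
  obtain ⟨𝔤, hρ, hσ, hβ, hδ⟩ : ∃ 𝔤 : TangentQuantumLie r (augPart T), 𝔤.coact = G.coact ∧
      𝔤.sigma = G.sigma ∧ 𝔤.bracket = G.bracket ∧ 𝔤.delta = G.delta :=
    ⟨tangentQuantumLie hr G hκ hE hΥ, rfl, rfl, rfl, rfl⟩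
  obtain ⟨SU, φ, h1, h2, h3, h4, h5⟩ := G.exists_bialgebraIso hr hρ hσ hβ hδ
  refine ⟨𝔤, ℒ.bialgebraB hr, SU, φ, ℒ.extends_bialgebraB hr, ⟨h1, h2, h3⟩, h4,
    fun X x hx => h5 x X _ (Subtype.ext ?_)⟩
  have h6 : (G.κ x : Module.Dual k A) = x := LinearMap.congr_fun hκ x
  have h7 : (E.i X : Module.Dual k A) = X := LinearMap.congr_fun hi X
  rw [h6, hx, Submodule.coe_sub, Submodule.coe_smul, h7, hE]

end Quantum

end

/-! ### The decomposition of the extended tangent space. -/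

section

variable {k : Type u} {A : Type v} [Field k] [Ring A] [HopfAlgebra k A]

section Subcoalgebra

theorem range_map_subtype_mono {D D' : Submodule k A} (h : D ≤ D') :
    LinearMap.range (TensorProduct.map D.subtype D.subtype) ≤
      LinearMap.range (TensorProduct.map D'.subtype D'.subtype) := by
  rw [← Submodule.subtype_comp_inclusion D D' h, TensorProduct.map_comp]
  exact LinearMap.range_comp_le_range _ _

theorem IsSubcoalgebra.sup {D D' : Submodule k A} (hD : IsSubcoalgebra D)
    (hD' : IsSubcoalgebra D') : IsSubcoalgebra (D ⊔ D') := by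
  intro c hc
  obtain ⟨a, ha, b, hb, rfl⟩ := Submodule.mem_sup.1 hc
  rw [map_add]
  exact add_mem (range_map_subtype_mono le_sup_left (hD a ha))
    (range_map_subtype_mono le_sup_right (hD' b hb))

theorem isSubcoalgebra_span_one : IsSubcoalgebra (Submodule.span k {(1 : A)}) := by
  intro c hc
  obtain ⟨x, rfl⟩ := Submodule.mem_span_singleton.1 hc
  refine ⟨x • ⟨1, Submodule.mem_span_singleton_self 1⟩ ⊗ₜ
    ⟨1, Submodule.mem_span_singleton_self 1⟩, ?_⟩
  simp [Algebra.TensorProduct.one_def]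

end Subcoalgebra

variable {r s : A →ₗ[k] A →ₗ[k] k} (hr : IsCoquasitriangular r) (hs : IsCoquasitriangular s)

section Split

theorem exists_splitting {V : Type*} [AddCommGroup V] [Module k V] {e : V}
    {L : Type*} [AddCommGroup L] [Module k L] {i : L →ₗ[k] V} (hi : Function.Injective i)
    (he : e ≠ 0) (hd : Disjoint (Submodule.span k {e}) (LinearMap.range i))
    (hs : Submodule.span k {e} ⊔ LinearMap.range i = ⊤) :
    ∃ (coeff : V →ₗ[k] k) (proj : V →ₗ[k] L), (∀ v, v = coeff v • e + i (proj v)) ∧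
      coeff e = 1 ∧ proj e = 0 ∧ (∀ w, coeff (i w) = 0) ∧ ∀ w, proj (i w) = w := by
  let f : k × L →ₗ[k] V := (LinearMap.toSpanSingleton k V e).coprod i
  have hf : Function.Bijective f := by
    constructor
    · rw [← LinearMap.ker_eq_bot, LinearMap.ker_coprod_of_disjoint_range,
        LinearMap.ker_eq_bot.2 hi, LinearMap.ker_toSpanSingleton k he, Submodule.prod_bot]
      rwa [LinearMap.range_toSpanSingleton]
    · rw [← LinearMap.range_eq_top, LinearMap.range_coprod, LinearMap.range_toSpanSingleton, hs]
  let F := LinearEquiv.ofBijective f hf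
  have h1 : F.symm e = (1, 0) := F.symm_apply_eq.2 (by simp [F, f])
  have h2 : ∀ w, F.symm (i w) = (0, w) := fun w => F.symm_apply_eq.2 (by simp [F, f])
  refine ⟨LinearMap.fst k k L ∘ₗ F.symm, LinearMap.snd k k L ∘ₗ F.symm, fun v => ?_, ?_, ?_,
    fun w => ?_, fun w => ?_⟩
  · conv_lhs => rw [← F.apply_symm_apply v]
    rfl
  all_goals simp [h1, h2]

end Split

include hr hs in
theorem exists_enveloping_iso {T L : Submodule k (Module.Dual k A)}
    {K : KillingSection (quantumKilling r s) T} {K' : KillingSection (quantumKilling r s) L}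
    (hLT : L ≤ T) (hi : K.j ∘ₗ Submodule.inclusion hLT = K'.j)
    (h1 : (1 : A) ∈ LinearMap.range K.j)
    (hT : T = Submodule.span k {dualOne k A} ⊔ L)
    (hd : Disjoint (Submodule.span k {dualOne k A}) L) :
    ∃ (𝒯 : TangentBraidedLie r T) (ℒ : TangentBraidedLie r L)
      (𝔤 : TangentQuantumLie r (augPart T))
      (SB : BraidedBialgebra k A r ℒ.BraidedEnvelope)
      (SU : BraidedBialgebra k A r 𝔤.UniversalEnvelope)
      (φ : 𝔤.UniversalEnvelope ≃ₐ[k] ℒ.BraidedEnvelope),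
      𝒯.IsSubalgebra (L.submoduleOf T) ∧ ℒ.Extends SB ∧ 𝔤.Extends SU ∧
      IsBialgebraIso SU SB φ ∧
      ∀ (X : L) (x : augPart T),
        (x : Module.Dual k A) = X - (X : Module.Dual k A) 1 • dualOne k A →
        φ (𝔤.gen x) = ℒ.gen X - algebraMap k _ ((X : Module.Dual k A) 1) := by
  have he : (K.e : Module.Dual k A) = dualOne k A := KillingSection.coe_e hr hs h1
  have hone : (dualOne k A : Module.Dual k A) 1 = 1 := Bialgebra.counit_one
  have hsp : (Submodule.span k {K.e}).map T.subtype = Submodule.span k {dualOne k A} := by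
    rw [Submodule.map_span, Set.image_singleton]
    exact congrArg (fun z => Submodule.span k {z}) he
  have hrg : (LinearMap.range (Submodule.inclusion hLT)).map T.subtype = L := by
    rw [← LinearMap.range_comp, Submodule.subtype_comp_inclusion, Submodule.range_subtype]
  obtain ⟨coeff, proj, h2, h3, h4, h5, h6⟩ := exists_splitting (e := K.e)
    (i := Submodule.inclusion hLT) (Submodule.inclusion_injective hLT)
    (fun h => by
      have := congrArg (fun X : T => (X : Module.Dual k A) 1) h
      simp [he, hone] at this)
    (by
      refine Submodule.disjoint_def.2 fun x hx hx' => Subtype.ext ?_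
      exact Submodule.disjoint_def.1 hd _ (hsp ▸ Submodule.mem_map_of_mem hx)
        (hrg.le (Submodule.mem_map_of_mem hx')))
    (by
      refine Submodule.map_injective_of_injective T.subtype_injective ?_
      rw [Submodule.map_sup, hsp, hrg, ← hT, Submodule.map_subtype_top])
  obtain ⟨𝔤, SB, SU, φ, hB, hU, hφ, hgen⟩ := exists_iso_of_splitting
    (𝒯 := K.tangentBraidedLie hr hs) (ℒ := K'.tangentBraidedLie hr hs)
    (E := KillingSection.unitalSplitting hr hs hi h1 h2 h3 h4 h5 h6) hr he
    (K.pairing_upsilon hr hs) rfl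
  exact ⟨K.tangentBraidedLie hr hs, K'.tangentBraidedLie hr hs, 𝔤, SB, SU, φ,
    BraidedLieAlgebra.isSubalgebra_submoduleOf (𝒯 := K.braidedLie hr hs)
      (ℒ := K'.braidedLie hr hs) hLT (KillingSection.coact_inclusion hi)
      (KillingSection.comul_inclusion hi) (KillingSection.bracket_inclusion hi),
    hB, hU, hφ, hgen⟩

section Decomposition

variable {C : Submodule k A} (hd : Disjoint (Submodule.span k {(1 : A)}) C)
  (hq : Set.InjOn (quantumKilling r s) (Submodule.span k {(1 : A)} ⊔ C : Submodule k A))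

include hr hs

theorem map_span_one_sup (C : Submodule k A) :
    (Submodule.span k {(1 : A)} ⊔ C).map (quantumKilling r s) =
      Submodule.span k {dualOne k A} ⊔ C.map (quantumKilling r s) := by
  rw [Submodule.map_sup, Submodule.map_span, Set.image_singleton, quantumKilling_one hr hs]

-- The sum in `A` is direct, `q` is injective on it, and `q` sends `1` to the unit of `A°`.
include hd hq in
theorem disjoint_span_dualOne :
    Disjoint (Submodule.span k {dualOne k A}) (C.map (quantumKilling r s)) := by
  rw [Submodule.disjoint_def]
  rintro x hx ⟨c, hc, rfl⟩
  obtain ⟨y, hy⟩ := Submodule.mem_span_singleton.1 hx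
  rw [← quantumKilling_one hr hs, ← map_smul] at hy
  have h1 : y • (1 : A) ∈ Submodule.span k {(1 : A)} :=
    Submodule.smul_mem _ _ (Submodule.mem_span_singleton_self 1)
  have h2 := hq (Submodule.mem_sup_left h1) (Submodule.mem_sup_right hc) hy
  rw [Submodule.disjoint_def.1 hd c (h2 ▸ h1) hc, map_zero]

omit hr hs in
theorem mem_augPart_sup_iff (L : Submodule k (Module.Dual k A)) (x : Module.Dual k A) :
    x ∈ augPart (Submodule.span k {dualOne k A} ⊔ L) ↔
      ∃ X ∈ L, x = X - X 1 • dualOne k A := by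
  have hone : (dualOne k A : Module.Dual k A) 1 = 1 := Bialgebra.counit_one
  constructor
  · rintro ⟨hx, hx1⟩
    obtain ⟨y, hy, X, hX, rfl⟩ := Submodule.mem_sup.1 hx
    obtain ⟨c, rfl⟩ := Submodule.mem_span_singleton.1 hy
    have h : c + X 1 = 0 := by simpa [hone] using hx1
    refine ⟨X, hX, ?_⟩
    rw [eq_neg_of_add_eq_zero_left h, neg_smul]
    abel
  · rintro ⟨X, hX, rfl⟩
    refine ⟨sub_mem (Submodule.mem_sup_right hX) (Submodule.smul_mem _ _
      (Submodule.mem_sup_left (Submodule.mem_span_singleton_self _))), ?_⟩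
    simp [hone]

end Decomposition

end

/-! ### Ideals of bicovariant calculi and their orthogonal subcoalgebras. -/

section

variable {k : Type u} {A : Type v} [Field k] [Ring A] [HopfAlgebra k A]

/-- A subspace of `A` that is a left ideal and is stable under the left adjoint coaction. -/
structure IsAdIdeal (I : Submodule k A) : Prop where
  mul_mem : ∀ a, ∀ b ∈ I, a * b ∈ I
  adL_mem : ∀ f : Module.Dual k A, ∀ b ∈ I, TensorProduct.lid k A (f.rTensor A (adL k A b)) ∈ I

namespace BicovariantFODC

variable (Γ : BicovariantFODC.{u, v, w} k A)
  {ι κ : Type*} [Fintype ι] [DecidableEq ι] [Fintype κ] [DecidableEq κ]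
  {u : ι → ι → A} {x : κ → κ → A}

theorem omegaR_corep (hx : IsCorep (k := k) x) (p q : κ) : Γ.omegaR (x p q) =
    ∑ l, Γ.hopf.rmul (Γ.d (x p l) ⊗ₜ HopfAlgebra.antipode k (x l q)) := by
  simp [omegaR, hx.comul]

/-- The antipode undoes convolution with the identity. With it, vanishing of all `ω(a₍₁₎ b) a₍₂₎`
gives vanishing of all `ω(ab)`. -/
theorem rmul_conv_antipode (hx : IsCorep (k := k) x) (F : κ → κ → Γ.carrier) (p q : κ) :
    ∑ l, Γ.hopf.rmul ((∑ m, Γ.hopf.rmul (F p m ⊗ₜ x m l)) ⊗ₜ HopfAlgebra.antipode k (x l q)) =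
      F p q := by
  simp only [TensorProduct.sum_tmul, map_sum, ← Γ.hopf.rmul_mul]
  rw [Finset.sum_comm]
  simp only [← map_sum, ← TensorProduct.tmul_sum, hx.sum_mul_antipode]
  rw [map_sum, Finset.sum_eq_single q (fun m _ hm => by simp [hm]) (by simp)]
  simp [Γ.hopf.rmul_one]

theorem d_corep (hx : IsCorep (k := k) x) (p q : κ) :
    Γ.d (x p q) = ∑ m, Γ.hopf.rmul (Γ.omegaR (x p m) ⊗ₜ x m q) := by
  simp only [Γ.omegaR_corep hx, TensorProduct.sum_tmul, map_sum, ← Γ.hopf.rmul_mul]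
  rw [Finset.sum_comm]
  simp only [← map_sum, ← TensorProduct.tmul_sum, hx.sum_antipode_mul]
  rw [map_sum, Finset.sum_eq_single q (fun m _ hm => by simp [hm]) (by simp)]
  simp [Γ.hopf.rmul_one]

/-- Since `S` reverses products, `ω(a₍₁₎ b) a₍₂₎ = d(a₍₁₎ b₍₁₎) S(b₍₂₎) S(a₍₂₎) a₍₃₎`. The last two
factors cancel, and the Leibniz rule splits the rest. -/
theorem lmul_omegaR_corep (hu : IsCorep (k := k) u) (hx : IsCorep (k := k) x) (i j : ι)
    (p q : κ) : ∑ m, Γ.hopf.rmul (Γ.omegaR (u i m * x p q) ⊗ₜ u m j) =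
      Γ.hopf.lmul (u i j ⊗ₜ Γ.omegaR (x p q)) +
        Coalgebra.counit (R := k) (x p q) • Γ.d (u i j) := by
  have h1 : ∀ m, Γ.omegaR (u i m * x p q) = ∑ l, ∑ t, Γ.hopf.rmul (Γ.d (u i l * x p t) ⊗ₜ
      (HopfAlgebra.antipode k (x t q) * HopfAlgebra.antipode k (u l m))) := fun m => by
    have h := Γ.omegaR_corep (hu.mul hx) (i, p) (m, q)
    rw [Fintype.sum_prod_type] at h
    simpa [HopfAlgebra.antipode_mul_antidistrib] using h
  simp only [h1, TensorProduct.sum_tmul, map_sum, ← Γ.hopf.rmul_mul, mul_assoc]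
  calc _ = ∑ l, ∑ t, Γ.hopf.rmul (Γ.d (u i l * x p t) ⊗ₜ (HopfAlgebra.antipode k (x t q) *
        ∑ m, HopfAlgebra.antipode k (u l m) * u m j)) := by
        simp only [Finset.mul_sum, TensorProduct.tmul_sum, map_sum]
        rw [Finset.sum_comm]
        exact Finset.sum_congr rfl fun l _ => Finset.sum_comm
    _ = ∑ t, Γ.hopf.rmul (Γ.d (u i j * x p t) ⊗ₜ HopfAlgebra.antipode k (x t q)) := by
        simp only [hu.sum_antipode_mul]
        rw [Finset.sum_eq_single j (fun l _ hl => by simp [hl]) (by simp)]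
        simp
    _ = Γ.hopf.rmul (Γ.d (u i j) ⊗ₜ ∑ t, x p t * HopfAlgebra.antipode k (x t q)) +
        Γ.hopf.lmul (u i j ⊗ₜ Γ.omegaR (x p q)) := by
        simp only [Γ.leibniz, TensorProduct.add_tmul, map_add, Finset.sum_add_distrib,
          Γ.omegaR_corep hx, TensorProduct.tmul_sum, map_sum, Γ.hopf.lmul_rmul, Γ.hopf.rmul_mul]
    _ = _ := by
        rw [hx.sum_mul_antipode, add_comm, hx.counit]
        split_ifs <;> simp [Γ.hopf.rmul_one]

theorem lmul_omegaR (hu : IsCorep (k := k) u) (i j : ι) (b : A) :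
    ∑ m, Γ.hopf.rmul (Γ.omegaR (u i m * b) ⊗ₜ u m j) =
      Γ.hopf.lmul (u i j ⊗ₜ Γ.omegaR b) + Coalgebra.counit (R := k) b • Γ.d (u i j) := by
  have h : ∑ m, Γ.hopf.rmul ∘ₗ (TensorProduct.mk k Γ.carrier A).flip (u m j) ∘ₗ Γ.omegaR ∘ₗ
      LinearMap.mulLeft k (u i m) = Γ.hopf.lmul ∘ₗ TensorProduct.mk k A Γ.carrier (u i j) ∘ₗ
        Γ.omegaR + (Coalgebra.counit (R := k) (A := A)).smulRight (Γ.d (u i j)) := by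
    refine hom_ext_corep fun n x hx p q => ?_
    simpa using Γ.lmul_omegaR_corep hu hx i j p q
  simpa using LinearMap.congr_fun h b

/-- Left colinearity of `d`, together with the reversal of the coproduct by `S`, produces the factor
`b₍₁₎ S(b₍₃₎)` of `ad_L`. -/
theorem coactL_omegaR (b : A) : Γ.hopf.coactL (Γ.omegaR b) = Γ.omegaR.lTensor A (adL k A b) := by
  have h : Γ.hopf.coactL ∘ₗ Γ.omegaR = Γ.omegaR.lTensor A ∘ₗ adL k A := by
    refine hom_ext_corep fun n x hx p q => ?_
    have h1 : ∀ η a, Γ.hopf.coactL (Γ.hopf.rmul (η ⊗ₜ a)) = _ := fun η a =>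
      LinearMap.congr_fun Γ.hopf.coactL_rmul (η ⊗ₜ a)
    have h2 : ∀ a, Γ.hopf.coactL (Γ.d a) = Γ.d.lTensor A (Coalgebra.comul a) :=
      LinearMap.congr_fun Γ.coactL_d
    simp only [LinearMap.comp_apply, Γ.omegaR_corep hx, hx.adL_apply, map_sum, h1,
      TensorProduct.map_tmul, h2, hx.comul, hx.comul_antipode, LinearMap.lTensor_tmul,
      TensorProduct.sum_tmul, TensorProduct.tmul_sum, LinearEquiv.coe_coe,
      TensorProduct.tensorTensorTensorComm_tmul, LinearMap.mul'_apply]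
    simp only [← Fintype.sum_prod_type']
    exact sum_reindex (fun z => ⟨z.2.2, z.2.1, z.1⟩) (fun z => ⟨z.2.2, z.2.1, z.1⟩)
      (fun _ => rfl) (fun _ => rfl) fun _ => rfl
  exact LinearMap.congr_fun h b

theorem omegaR_one : Γ.omegaR 1 = 0 := by
  have h := Γ.leibniz 1 1
  rw [mul_one, Γ.hopf.rmul_one, Γ.hopf.one_lmul, left_eq_add] at h
  simp [omegaR, Algebra.TensorProduct.one_def, h]

theorem _root_.QLie.lTensor_counit_adL (a : A) : TensorProduct.rid k A
    ((Coalgebra.counit (R := k) (A := A)).lTensor A (adL k A a)) =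
      Coalgebra.counit (R := k) a • (1 : A) := by
  have h : (TensorProduct.rid k A).toLinearMap ∘ₗ
      (Coalgebra.counit (R := k) (A := A)).lTensor A ∘ₗ adL k A =
        (Coalgebra.counit (R := k) (A := A)).smulRight 1 := by
    refine hom_ext_corep fun n x hx p q => ?_
    simp [hx.adL_apply, hx.counit, hx.sum_mul_antipode, ite_smul]
  exact LinearMap.congr_fun h a

/-- For `b` in the ideal, `ω(a₍₁₎ b) a₍₂₎ = a ω(b) + ε(b) da = 0`, and the antipode recovers `ω(ab)
= 0`. Stability under `ad_L` holds because `ω` intertwines `ad_L` with the left coaction and `ε` is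
ad-invariant. -/
theorem isAdIdeal : IsAdIdeal Γ.ideal where
  mul_mem a b := by
    rintro ⟨hb, hb'⟩
    rw [SetLike.mem_coe, LinearMap.mem_ker] at hb hb'
    refine ⟨?_, by simp [hb']⟩
    have h : Γ.omegaR ∘ₗ LinearMap.mulRight k b = 0 := by
      refine hom_ext_corep fun n x hx p q => ?_
      have h1 := Γ.rmul_conv_antipode hx (fun i j => Γ.omegaR (x i j * b)) p q
      simp only [Γ.lmul_omegaR hx, hb, hb', TensorProduct.tmul_zero, map_zero, zero_smul, add_zero,
        TensorProduct.zero_tmul, Finset.sum_const_zero] at h1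
      exact h1.symm
    exact LinearMap.congr_fun h a
  adL_mem f b := by
    rintro ⟨hb, hb'⟩
    rw [SetLike.mem_coe, LinearMap.mem_ker] at hb hb'
    have h1 : ∀ t : A ⊗[k] A, Γ.omegaR (TensorProduct.lid k A (f.rTensor A t)) =
        TensorProduct.lid k _ (f.rTensor _ (Γ.omegaR.lTensor A t)) := fun t => by
      induction t with
      | zero => simp
      | add a b ha hb => simp only [map_add, ha, hb]
      | tmul a b => simp
    have h2 : ∀ t : A ⊗[k] A, Coalgebra.counit (R := k) (TensorProduct.lid k A (f.rTensor A t)) =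
        f (TensorProduct.rid k A ((Coalgebra.counit (R := k) (A := A)).lTensor A t)) := fun t => by
      induction t with
      | zero => simp
      | add a b ha hb => simp only [map_add, ha, hb]
      | tmul a b => simp [mul_comm]
    refine ⟨?_, ?_⟩
    · rw [SetLike.mem_coe, LinearMap.mem_ker, h1, ← coactL_omegaR, hb]
      simp
    · rw [SetLike.mem_coe, LinearMap.mem_ker, h2, lTensor_counit_adL, hb']
      simp

end BicovariantFODC

section Perp

variable {r s : A →ₗ[k] A →ₗ[k] k} (hr : IsCoquasitriangular r) (hs : IsCoquasitriangular s)
  {I : Submodule k A} (hI : IsAdIdeal I)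

-- In `a ⬝ b` every term is a left multiple of an `ad_L`-coefficient of `b`.
include hI in
theorem IsAdIdeal.covMul_mem_right (a : A) {b : A} (hb : b ∈ I) : covMul r a b ∈ I := by
  rw [covMul]
  generalize Coalgebra.comul (R := k) a = t
  induction t with
  | zero => simp
  | add x y hx hy => rw [map_add]; exact add_mem hx hy
  | tmul x y => exact hI.mul_mem _ _ (hI.adL_mem _ _ hb)

-- The second form of the covariantised product exhibits left multiples of `ad_L`-coefficients of
-- the first factor. So `I` is a two-sided ideal for `⬝`.
include hI hr in
theorem IsAdIdeal.covMul_mem_left {ι : Type*} [Fintype ι] [DecidableEq ι] {u : ι → ι → A}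
    (hu : IsCorep (k := k) u) (i j : ι) {a : A} (ha : a ∈ I) : covMul r a (u i j) ∈ I := by
  rw [covMul_corep hr hu]
  exact sum_mem fun c _ => hI.mul_mem _ _ (hI.adL_mem _ _ ha)

-- The functionals in `S` cut out a subspace of `C`, so membership in `B ⊗ C` is tested
-- coefficientwise in a basis of `B`.
omit [Ring A] [HopfAlgebra k A] in
theorem mem_range_lTensor_of_forall {A B : Type*} [AddCommGroup A] [Module k A] [AddCommGroup B]
    [Module k B] {C : Submodule k A} {S : Set (Module.Dual k A)} (hS : ∀ c, (∀ f ∈ S, f c = 0) → c ∈ C)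
    {z : B ⊗[k] A} (hz : ∀ f ∈ S, TensorProduct.rid k B (f.lTensor B z) = 0) :
    z ∈ LinearMap.range (C.subtype.lTensor B) := by
  classical
  let b := Module.Basis.ofVectorSpace k B
  obtain ⟨c, rfl⟩ := TensorProduct.eq_repr_basis_left b z
  have h2 : ∀ i, c i ∈ C := by
    intro i
    refine hS _ fun f hf => ?_
    have h3 := congrArg (fun w => b.repr w i) (hz f hf)
    simp only [Finsupp.sum, map_sum, LinearMap.lTensor_tmul, TensorProduct.rid_tmul, map_smul,
      Finsupp.coe_finsetSum, Finset.sum_apply, Finsupp.smul_apply, Module.Basis.repr_self,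
      map_zero, Finsupp.coe_zero, Pi.zero_apply, Finsupp.single_apply, smul_eq_mul, mul_ite,
      mul_one, mul_zero] at h3
    rw [Finset.sum_ite_eq'] at h3
    split_ifs at h3 with hi
    · exact h3
    · rw [Finsupp.notMem_support_iff.1 hi, map_zero]
  exact sum_mem fun i _ => ⟨b i ⊗ₜ ⟨c i, h2 i⟩, rfl⟩

/-- Over a field `(A ⊗ C) ∩ (C ⊗ A) = C ⊗ C`: a retraction onto `C`, applied in both legs, fixes the
tensor. -/
theorem mem_range_map_subtype {C : Submodule k A} {z : A ⊗[k] A}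
    (h : z ∈ LinearMap.range (C.subtype.lTensor A)) (h' : z ∈ LinearMap.range (C.subtype.rTensor A)) :
    z ∈ LinearMap.range (TensorProduct.map C.subtype C.subtype) := by
  obtain ⟨p, hp⟩ := C.subtype.exists_leftInverse_of_injective C.ker_subtype
  have h1 : (C.subtype ∘ₗ p).lTensor A z = z := by
    obtain ⟨w, rfl⟩ := h
    rw [← LinearMap.lTensor_comp_apply, LinearMap.comp_assoc, hp, LinearMap.comp_id]
  have h2 : (C.subtype ∘ₗ p).rTensor A z = z := by
    obtain ⟨w, rfl⟩ := h'
    rw [← LinearMap.rTensor_comp_apply, LinearMap.comp_assoc, hp, LinearMap.comp_id]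
  refine ⟨TensorProduct.map p p z, ?_⟩
  rw [TensorProduct.map_map]
  conv_rhs => rw [← h1, ← h2]
  rw [← LinearMap.comp_apply, LinearMap.lTensor_comp_rTensor]

theorem mem_killingPerp {q : A →ₗ[k] Module.Dual k A} {c : A} :
    c ∈ killingPerp q I ↔ ∀ a ∈ I, q c a = 0 := by
  simp [killingPerp, Submodule.mem_dualAnnihilator]

-- For `b` in `I` and all `a`, `q(c₍₁₎, a) q(c₍₂₎, b) = q(c, a ⬝ b) = 0`. Injectivity of `q` frees
-- the first leg, so the second leg of `Δ c` lies in the orthogonal; the other leg is symmetric.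
include hr hs hI in
theorem isSubcoalgebra_killingPerp (hq : Function.Injective (quantumKilling r s)) :
    IsSubcoalgebra (killingPerp (quantumKilling r s) I) := by
  intro c hc
  rw [mem_killingPerp] at hc
  have key : ∀ a b (t : A ⊗[k] A), LinearMap.mul' k k (TensorProduct.map
      ((quantumKilling r s).flip a) ((quantumKilling r s).flip b) t) =
      quantumKilling r s (TensorProduct.lid k A (((quantumKilling r s).flip a).rTensor A t)) b ∧
      LinearMap.mul' k k (TensorProduct.map
        ((quantumKilling r s).flip a) ((quantumKilling r s).flip b) t) =
      quantumKilling r s (TensorProduct.rid k A (((quantumKilling r s).flip b).lTensor A t)) a := by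
    intro a b t
    induction t with
    | zero => simp
    | add x y hx hy =>
      simp only [map_add, LinearMap.add_apply]
      exact ⟨by rw [hx.1, hy.1], by rw [hx.2, hy.2]⟩
    | tmul x y => simp [mul_comm]
  let S : Set (Module.Dual k A) := (quantumKilling r s).flip '' I
  have hS : ∀ c, (∀ f ∈ S, f c = 0) → c ∈ killingPerp (quantumKilling r s) I := fun c h =>
    mem_killingPerp.2 fun a ha => h _ ⟨a, ha, rfl⟩
  refine mem_range_map_subtype (mem_range_lTensor_of_forall hS ?_) ?_
  · rintro _ ⟨b, hb, rfl⟩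
    refine hq ?_
    rw [map_zero]
    refine LinearMap.ext fun a => ?_
    rw [← (key a b _).2, ← quantumKilling_covMul hr hs, hc _ (hI.covMul_mem_right a hb)]
    rfl
  · have h := mem_range_lTensor_of_forall (z := TensorProduct.comm k A A (Coalgebra.comul c)) hS ?_
    · obtain ⟨w, hw⟩ := h
      refine ⟨TensorProduct.comm k _ _ w, ?_⟩
      rw [← LinearMap.comm_comp_lTensor_comp_comm_eq]
      simp [hw]
    · rintro _ ⟨a, ha, rfl⟩
      have h1 : TensorProduct.rid k A (((quantumKilling r s).flip a).lTensor A
          (TensorProduct.comm k A A (Coalgebra.comul c))) = TensorProduct.lid k A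
            (((quantumKilling r s).flip a).rTensor A (Coalgebra.comul c)) := by
        generalize Coalgebra.comul (R := k) c = t
        induction t with
        | zero => simp
        | add x y hx hy => simp only [map_add, hx, hy]
        | tmul x y => simp
      refine hq ?_
      rw [map_zero, h1]
      refine hom_ext_corep fun n u hu i j => ?_
      rw [← (key a _ _).1, ← quantumKilling_covMul hr hs, hc _ (hI.covMul_mem_left hr hu i j ha)]
      rfl

end Perp

end

/-! ### Tangent spaces from subcoalgebras, and inner calculi. -/

section

variable {k : Type u} {A : Type v} [Field k] [Ring A] [HopfAlgebra k A]

theorem IsCorep.conv_dual {ι : Type*} [Fintype ι] [DecidableEq ι] {u : ι → ι → A}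
    (hu : IsCorep (k := k) u) (f g : Module.Dual k A) (i j : ι) :
    conv f g (u i j) = ∑ l, f (u i l) * g (u l j) := by
  simp [conv, hu.comul]

theorem IsSubcoalgebra.conv_congr {C : Submodule k A} (hC : IsSubcoalgebra C)
    {f f' g g' : Module.Dual k A} (hf : ∀ c ∈ C, f c = f' c) (hg : ∀ c ∈ C, g c = g' c) {c : A}
    (hc : c ∈ C) : conv f g c = conv f' g' c := by
  obtain ⟨w, hw⟩ := hC c hc
  simp only [conv, LinearMap.comp_apply, ← hw]
  clear hw
  induction w with
  | zero => simp
  | add a b ha hb => simp only [map_add, ha, hb]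
  | tmul a b => simp [hf a a.2, hg b b.2]

theorem IsSubcoalgebra.comul_comul_mem {C : Submodule k A} (hC : IsSubcoalgebra C) {c : A}
    (hc : c ∈ C) : (Coalgebra.comul (R := k)).lTensor A (Coalgebra.comul (R := k) c) ∈
      LinearMap.range (TensorProduct.map C.subtype (TensorProduct.map C.subtype C.subtype)) := by
  obtain ⟨w, hw⟩ := hC c hc
  rw [← hw]
  clear hw
  induction w with
  | zero => simp
  | add a b ha hb => simp only [map_add]; exact add_mem ha hb
  | tmul a b =>
    obtain ⟨w, hw⟩ := hC b b.2
    exact ⟨a ⊗ₜ w, by simp [hw]⟩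

section Killing

variable {r s : A →ₗ[k] A →ₗ[k] k} (hr : IsCoquasitriangular r) (hs : IsCoquasitriangular s)

section

variable {ι κ : Type*} [Fintype ι] [DecidableEq ι] [Fintype κ] [DecidableEq κ]
  {u : ι → ι → A} {x : κ → κ → A}

include hr hs

theorem quantumKilling_mul_corep (hu : IsCorep (k := k) u) (hx : IsCorep (k := k) x) (i j : ι)
    (p q : κ) (b : A) : quantumKilling r s (u i j) (x p q * b) =
      ∑ l, ∑ n, ∑ m, s (x p m) (u i l) * r (u n j) (x m q) * quantumKilling r s (u l n) b := by
  have h : quantumKilling r s (u i j) ∘ₗ LinearMap.mulLeft k (x p q) =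
      ∑ l, ∑ n, ∑ m, (s (x p m) (u i l) * r (u n j) (x m q)) • quantumKilling r s (u l n) := by
    refine hom_ext_corep fun N y hy a b => ?_
    have h1 := hu.quantumKilling_apply r s (hx.mul hy) i j (p, a) (q, b)
    simp only [LinearMap.comp_apply, LinearMap.mulLeft_apply, h1, hs.mul_left_corep hu,
      hr.mul_right_corep hu, LinearMap.sum_apply, LinearMap.smul_apply, smul_eq_mul,
      hu.quantumKilling_apply r s hy, Finset.mul_sum, Finset.sum_mul, Fintype.sum_prod_type]
    simp only [← Fintype.sum_prod_type']
    exact sum_reindex (fun z => ⟨z.2.2.2.2, z.2.2.2.1, z.2.1, z.1, z.2.2.1⟩)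
      (fun z => ⟨z.2.2.2.1, z.2.2.1, z.2.2.2.2, z.2.1, z.1⟩) (fun _ => rfl) (fun _ => rfl)
      fun _ => by ring
  simpa using LinearMap.congr_fun h b

/-- `q(c, ab) = s(a₍₁₎, c₍₁₎) q(c₍₂₎, b) r(c₍₃₎, a₍₂₎)`. -/
theorem quantumKilling_flip_mul (hx : IsCorep (k := k) x) (p q : κ) (b : A) :
    (quantumKilling r s).flip (x p q * b) = ∑ m, conv (conv (s (x p m))
      ((quantumKilling r s).flip b)) (r.flip (x m q)) := by
  refine hom_ext_corep fun n u hu i j => ?_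
  simp only [LinearMap.sum_apply, hu.conv_dual, LinearMap.flip_apply, Finset.sum_mul,
    quantumKilling_mul_corep hr hs hu hx]
  simp only [← Fintype.sum_prod_type']
  exact sum_reindex (fun z => ⟨z.2.2, z.2.1, z.1⟩) (fun z => ⟨z.2.2, z.2.1, z.1⟩)
    (fun _ => rfl) (fun _ => rfl) fun _ => by ring

end

theorem mem_killingIdeal {q : A →ₗ[k] Module.Dual k A} {C : Submodule k A} {a : A} :
    a ∈ killingIdeal q C ↔ ∀ c ∈ C, q c a = 0 := by
  simp [killingIdeal, Submodule.mem_dualCoannihilator]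

include hr hs in
theorem apply_adL_killing (f : Module.Dual k A) (c b : A) :
    quantumKilling r s c (TensorProduct.lid k A (f.rTensor A (adL k A b))) =
      quantumKilling r s (coactBy (adR k A) f c) b := by
  have h := apply_adCoeff ((quantumKilling r s).flip b) f c
  rw [← quantumKilling_invariant hr hs] at h
  refine Eq.trans ?_ h
  generalize adL k A b = t
  induction t with
  | zero => simp
  | add a b ha hb => simp only [map_add, ha, hb]
  | tmul a b => simp [mul_comm]

theorem IsSubcoalgebra.coactBy_mem {C : Submodule k A} (hC : IsSubcoalgebra C)
    (f : Module.Dual k A) {c : A} (hc : c ∈ C) : coactBy (adR k A) f c ∈ C := by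
  obtain ⟨w, hw⟩ := hC.adR_mem hc
  rw [coactBy_apply, ← hw]
  clear hw
  induction w with
  | zero => simp
  | add a b ha hb => simp only [map_add]; exact add_mem ha hb
  | tmul a b => simpa using C.smul_mem _ a.2

-- In `q(c, ab) = s(a₍₁₎, c₍₁₎) q(c₍₂₎, b) r(c₍₃₎, a₍₂₎)` the middle leg of `c` stays in `C`, where
-- `q(-, b)` vanishes. Invariance trades `ad_L` on `b` for `adR` on `c`, which also stays in `C`.
include hr hs in
theorem isAdIdeal_killingIdeal {C : Submodule k A} (hC : IsSubcoalgebra C) :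
    IsAdIdeal (killingIdeal (quantumKilling r s) C) where
  mul_mem a b hb := by
    rw [mem_killingIdeal] at hb ⊢
    intro c hc
    have h : (quantumKilling r s c) ∘ₗ LinearMap.mulRight k b = 0 := by
      refine hom_ext_corep fun n x hx p q => ?_
      have h1 := LinearMap.congr_fun (quantumKilling_flip_mul hr hs hx p q b) c
      rw [LinearMap.flip_apply] at h1
      simp only [LinearMap.comp_apply, LinearMap.mulRight_apply, h1, LinearMap.sum_apply]
      refine Finset.sum_eq_zero fun m _ => ?_
      rw [hC.conv_congr (f' := 0) (g' := r.flip (x m q)) (fun c hc => ?_) (fun _ _ => rfl) hc]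
      · simp [conv]
      · rw [hC.conv_congr (f' := s (x p m)) (g' := 0) (fun _ _ => rfl) hb hc]
        simp [conv]
    exact LinearMap.congr_fun h a
  adL_mem f b hb := by
    rw [mem_killingIdeal] at hb ⊢
    intro c hc
    rw [apply_adL_killing hr hs, hb _ (hC.coactBy_mem f hc)]

include hr hs in
theorem counit_eq_zero_of_mem_killingIdeal {C : Submodule k A} (h1 : (1 : A) ∈ C) {a : A}
    (ha : a ∈ killingIdeal (quantumKilling r s) C) : Coalgebra.counit (R := k) a = 0 := by
  rw [← quantumKilling_one_left hr hs, mem_killingIdeal.1 ha 1 h1]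

/-- `(c, d) ↦ s(-, c) * r(d, -)`. -/
def convPair (r s : A →ₗ[k] A →ₗ[k] k) : A →ₗ[k] A →ₗ[k] Module.Dual k A :=
  LinearMap.mk₂ k (fun c d => conv (s.flip c) (r d))
    (fun _ _ _ => by
      simp [conv, TensorProduct.map_add_left, LinearMap.add_comp, LinearMap.comp_add])
    (fun _ _ _ => by simp [conv, TensorProduct.map_smul_left, LinearMap.smul_comp, LinearMap.comp_smul])
    (fun _ _ _ => by
      simp [conv, TensorProduct.map_add_right, LinearMap.add_comp, LinearMap.comp_add])
    (fun _ _ _ => by simp [conv, TensorProduct.map_smul_right, LinearMap.smul_comp, LinearMap.comp_smul])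

theorem convPair_apply (c d : A) : convPair r s c d = conv (s.flip c) (r d) := rfl

include hr hs in
theorem convPair_mem_hopfDual (c d : A) : convPair r s c d ∈ hopfDual k A := by
  rw [hopfDual, Submodule.mem_comap]
  -- Membership in the range is vanishing in the quotient, a condition bilinear in `c` and `d` that
  -- can be tested on matrix entries.
  have h : (convPair r s).compr₂ ((Submodule.mkQ (LinearMap.range
      (TensorProduct.dualDistrib k A A))) ∘ₗ (LinearMap.mul' k A).dualMap) = 0 := by
    refine bilin_ext_corep fun m n u y hu hy i l a j => ?_
    refine (Submodule.Quotient.mk_eq_zero _).2 ⟨∑ t, ∑ v,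
      convPair r s (u i t) (y v j) ⊗ₜ convPair r s (u t l) (y a v), ?_⟩
    refine hom_ext_corep₂ fun m n x z hx hz p q b e => ?_
    have h1 := (hx.mul hz).conv_dual (s.flip (u i l)) (r (y a j)) (p, b) (q, e)
    simp only [convPair_apply, map_sum, LinearMap.sum_apply, TensorProduct.dualDistrib_apply,
      hx.conv_dual, hz.conv_dual, LinearMap.dualMap_apply, LinearMap.mul'_apply, h1,
      LinearMap.flip_apply, hs.mul_left_corep hu, hr.mul_right_corep hy, Finset.sum_mul_sum,
      Fintype.sum_prod_type]
    simp only [← Fintype.sum_prod_type']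
    exact sum_reindex (fun z => ⟨z.2.2.1, z.2.2.2, z.1, z.2.1⟩)
      (fun z => ⟨z.2.2.1, z.2.2.2, z.1, z.2.1⟩) (fun _ => rfl) (fun _ => rfl) fun _ => by ring
  exact (Submodule.Quotient.mk_eq_zero _).1 (LinearMap.congr_fun (LinearMap.congr_fun h c) d)

/-- `c ⊗ d ⊗ e ↦ (s(-, c) * r(e, -)) ⊗ q(d, -)`. -/
def killingComul (r s : A →ₗ[k] A →ₗ[k] k) :
    A ⊗[k] (A ⊗[k] A) →ₗ[k] Module.Dual k A ⊗[k] Module.Dual k A :=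
  TensorProduct.map (TensorProduct.lift (convPair r s)) (quantumKilling r s) ∘ₗ
    (TensorProduct.assoc k A A A).symm.toLinearMap ∘ₗ
    (TensorProduct.comm k A A).toLinearMap.lTensor A

-- The coproduct of `q(c, -)` is `(s(-, c₍₁₎) * r(c₍₃₎, -)) ⊗ q(c₍₂₎, -)`. Its right factor comes
-- again from the subcoalgebra, whence the left coideal property.
include hr hs in
theorem quantumKilling_comp_mul (c : A) : quantumKilling r s c ∘ₗ LinearMap.mul' k A =
    TensorProduct.dualDistrib k A A (killingComul r s
      ((Coalgebra.comul (R := k)).lTensor A (Coalgebra.comul (R := k) c))) := by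
  have h : (LinearMap.mul' k A).dualMap ∘ₗ quantumKilling r s = TensorProduct.dualDistrib k A A ∘ₗ
      killingComul r s ∘ₗ (Coalgebra.comul (R := k)).lTensor A ∘ₗ Coalgebra.comul := by
    refine hom_ext_corep fun n u hu i j => ?_
    refine TensorProduct.ext (hom_ext_corep fun N x hx p q => LinearMap.ext fun b => ?_)
    simp only [LinearMap.compr₂ₛₗ_apply, TensorProduct.mk_apply, LinearMap.comp_apply,
      LinearMap.dualMap_apply, LinearMap.mul'_apply, quantumKilling_mul_corep hr hs hu hx,
      killingComul, hu.comul, map_sum, LinearMap.lTensor_tmul, TensorProduct.tmul_sum,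
      LinearEquiv.coe_coe, TensorProduct.comm_tmul, TensorProduct.assoc_symm_tmul,
      TensorProduct.map_tmul, TensorProduct.lift.tmul, convPair_apply, LinearMap.sum_apply,
      TensorProduct.dualDistrib_apply, hx.conv_dual, LinearMap.flip_apply, Finset.sum_mul]
  exact LinearMap.congr_fun h c

include hr hs in
theorem isTangentSubspace_map {C : Submodule k A} (hC : IsSubcoalgebra C) (h1 : (1 : A) ∈ C) :
    IsTangentSubspace (C.map (quantumKilling r s)) where
  le_hopfDual := by
    rintro _ ⟨c, -, rfl⟩
    exact ⟨_, (quantumKilling_comp_mul hr hs c).symm⟩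
  one_mem := ⟨1, h1, quantumKilling_one hr hs⟩
  comul_mem := by
    rintro _ ⟨c, hc, rfl⟩
    rw [quantumKilling_comp_mul hr hs]
    obtain ⟨w, hw⟩ := hC.comul_comul_mem hc
    rw [← hw]
    clear hw
    induction w with
    | zero => simp
    | add a b ha hb => simp only [map_add]; exact add_mem ha hb
    | tmul a z =>
      induction z with
      | zero => simp
      | add x y hx hy => simp only [TensorProduct.tmul_add, map_add]; exact add_mem hx hy
      | tmul b d =>
        exact ⟨⟨_, convPair_mem_hopfDual hr hs (a : A) (d : A)⟩ ⊗ₜ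
          ⟨_, Submodule.mem_map_of_mem b.2⟩, rfl⟩
  ad_mem := by
    rintro h - _ ⟨c, hc, rfl⟩
    -- By invariance `[h, q(c)]` is `q` of `c⁽⁰⁾ h(c⁽¹⁾)`, and a subcoalgebra is stable under `adR`.
    refine ⟨coactBy (adR k A) h c, hC.coactBy_mem h hc, LinearMap.ext fun a => ?_⟩
    rw [← apply_adL_killing hr hs, adBracket, LinearMap.comp_apply]
    generalize adL k A a = t
    induction t with
    | zero => simp
    | add a b ha hb => simp only [map_add, ha, hb]
    | tmul a b => simp

end Killing

section Inner

variable {r s : A →ₗ[k] A →ₗ[k] k} (hr : IsCoquasitriangular r) (hs : IsCoquasitriangular s)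
  {C : Submodule k A} (hC : IsSubcoalgebra C)

-- As far as `q` on `C` can see, `a₀` is the unit, so `q(c, a a₀) = q(c, a)` there; against `1 ∈ A`
-- only counits remain, and they cancel since `ε(a₀) = 0`.
include hr hs hC in
theorem mul_sub_mem_killingIdeal {a₀ : A} (h0 : Coalgebra.counit (R := k) a₀ = 0)
    (hq : ∀ c ∈ C, quantumKilling r s c a₀ = Coalgebra.counit (R := k) c) (a : A) :
    a * a₀ - Coalgebra.counit (R := k) a • a₀ - a + Coalgebra.counit (R := k) a • 1 ∈
      killingIdeal (quantumKilling r s) (Submodule.span k {(1 : A)} ⊔ C) := by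
  rw [mem_killingIdeal]
  intro z hz
  obtain ⟨y, hy, c, hc, rfl⟩ := Submodule.mem_sup.1 hz
  obtain ⟨t, rfl⟩ := Submodule.mem_span_singleton.1 hy
  have h1 : quantumKilling r s c (a * a₀) = quantumKilling r s c a := by
    have h : (quantumKilling r s c) ∘ₗ LinearMap.mulRight k a₀ = quantumKilling r s c := by
      refine hom_ext_corep fun n x hx p q => ?_
      have h1 := LinearMap.congr_fun (quantumKilling_flip_mul hr hs hx p q a₀) c
      -- The same expansion with `1` in place of `a₀`; the middle factors `q(-, a₀)` and `q(-, 1)`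
      -- agree on `C`.
      have h2 := LinearMap.congr_fun (quantumKilling_flip_mul hr hs hx p q 1) c
      rw [LinearMap.flip_apply] at h1 h2
      rw [mul_one] at h2
      simp only [LinearMap.comp_apply, LinearMap.mulRight_apply, h1, h2, LinearMap.sum_apply]
      refine Finset.sum_congr rfl fun m _ => ?_
      refine hC.conv_congr (fun c hc => ?_) (fun _ _ => rfl) hc
      refine hC.conv_congr (fun _ _ => rfl) (fun c hc => ?_) hc
      rw [LinearMap.flip_apply, LinearMap.flip_apply, hq c hc, quantumKilling_one_right hr hs]
    exact LinearMap.congr_fun h a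
  simp only [map_add, map_sub, map_smul, LinearMap.add_apply, LinearMap.smul_apply, h1, hq c hc,
    quantumKilling_one_left hr hs, quantumKilling_one_right hr hs, Bialgebra.counit_mul, h0,
    Bialgebra.counit_one, smul_eq_mul]
  ring

/-- With `θ = ω(a₀)` the hypothesis reads `ω(a) = ω(a a₀) - ε(a) θ`. Therefore `da = ω(a₍₁₎) a₍₂₎ =
ω(a₍₁₎ a₀) a₍₂₎ - θ a = a θ - θ a`. -/
theorem BicovariantFODC.isInner_of_mem_ideal (Γ : BicovariantFODC.{u, v, w} k A) {a₀ : A}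
    (h0 : Coalgebra.counit (R := k) a₀ = 0) (h : ∀ a : A, a * a₀ - Coalgebra.counit (R := k) a • a₀
      - a + Coalgebra.counit (R := k) a • 1 ∈ Γ.ideal) : Γ.IsInner := by
  refine ⟨Γ.omegaR a₀, fun a => ?_⟩
  have hω : ∀ a, Γ.omegaR a = Γ.omegaR (a * a₀) - Coalgebra.counit (R := k) a • Γ.omegaR a₀ :=
    fun a => by
      have h1 : Γ.omegaR _ = 0 := (h a).1
      simp only [map_add, map_sub, map_smul, Γ.omegaR_one, smul_zero, add_zero] at h1
      exact (sub_eq_zero.1 h1).symm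
  have h2 : Γ.d = Γ.hopf.lmul ∘ₗ (TensorProduct.mk k A Γ.carrier).flip (Γ.omegaR a₀) -
      Γ.hopf.rmul ∘ₗ TensorProduct.mk k Γ.carrier A (Γ.omegaR a₀) := by
    refine hom_ext_corep fun n x hx p q => ?_
    have h3 := Γ.lmul_omegaR hx p q a₀
    rw [h0, zero_smul, add_zero] at h3
    have h4 : ∀ i j, Γ.omegaR (x i j) = Γ.omegaR (x i j * a₀) -
        (if i = j then (1 : k) else 0) • Γ.omegaR a₀ := fun i j => by rw [hω, hx.counit]
    simp only [LinearMap.sub_apply, LinearMap.comp_apply, TensorProduct.mk_apply,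
      LinearMap.flip_apply, ← h3, Γ.d_corep hx]
    conv_lhs => simp only [h4 p, TensorProduct.sub_tmul, map_sub, Finset.sum_sub_distrib]
    congr 1
    rw [Finset.sum_eq_single p (fun m _ hm => by simp [hm.symm]) (by simp)]
    simp
  exact LinearMap.congr_fun h2 a

end Inner

/-- For finite-dimensional `T` the inclusion into `A*` transposes to a surjection of `A` onto `T*`.
-/
theorem exists_eval_eq {T : Submodule k (Module.Dual k A)} [FiniteDimensional k T]
    (f : Module.Dual k T) : ∃ a : A, ∀ X : T, (X : Module.Dual k A) a = f X := by
  have h : Function.Surjective T.subtype.flip :=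
    LinearMap.flip_surjective_iff₁.2 T.subtype_injective
  obtain ⟨a, ha⟩ := h f
  exact ⟨a, fun X => LinearMap.congr_fun ha X⟩

end

/-! ### The calculus attached to an ideal: its bimodule of forms. -/

section

theorem eq_zero_of_forall_rTensor {k A W : Type*} [Field k] [AddCommGroup A] [Module k A]
    [AddCommGroup W] [Module k W] {w : A ⊗[k] W}
    (h : ∀ f : Module.Dual k A, TensorProduct.lid k W (f.rTensor W w) = 0) : w = 0 := by
  classical
  let b := Module.Basis.ofVectorSpace k A
  obtain ⟨c, rfl⟩ := TensorProduct.eq_repr_basis_left b w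
  have h2 : ∀ i, c i = 0 := by
    intro i
    have h3 := h (b.coord i)
    simp only [Finsupp.sum, map_sum, LinearMap.rTensor_tmul, TensorProduct.lid_tmul,
      Module.Basis.coord_apply, Module.Basis.repr_self, Finsupp.single_apply, ite_smul, one_smul,
      zero_smul] at h3
    rw [Finset.sum_ite_eq'] at h3
    split_ifs at h3 with hi
    · exact h3
    · rw [Finsupp.notMem_support_iff.1 hi]
  simp [Finsupp.sum, h2]

namespace IsAdIdeal

variable {k : Type u} {A : Type v} [Field k] [Ring A] [HopfAlgebra k A] {I : Submodule k A}

/-- The right-invariant forms `A / (I + k 1)`. -/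
abbrev Forms (I : Submodule k A) : Type v := A ⧸ (I ⊔ Submodule.span k {(1 : A)})

/-- The projection `A → A / (I + k 1)`. -/
def form (I : Submodule k A) : A →ₗ[k] Forms I := Submodule.mkQ _

theorem form_one : form I 1 = 0 :=
  (Submodule.Quotient.mk_eq_zero _).2
    (Submodule.mem_sup_right (Submodule.mem_span_singleton_self 1))

theorem form_eq_zero {a : A} (h : a ∈ I) : form I a = 0 :=
  (Submodule.Quotient.mk_eq_zero _).2 (Submodule.mem_sup_left h)

theorem forms_ext {W : Type*} [AddCommMonoid W] [Module k W] {F G : Forms I ⊗[k] A →ₗ[k] W}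
    (h : ∀ (m n : ℕ) (y : Fin m → Fin m → A) (x : Fin n → Fin n → A), IsCorep (k := k) y →
      IsCorep (k := k) x → ∀ p q a b, F (form I (y p q) ⊗ₜ x a b) = G (form I (y p q) ⊗ₜ x a b)) :
    F = G := by
  have h2 : (TensorProduct.mk k (Forms I) A).compr₂ F ∘ₗ form I =
      (TensorProduct.mk k (Forms I) A).compr₂ G ∘ₗ form I :=
    bilin_ext_corep fun m n y x hy hx p q a b => h m n y x hy hx p q a b
  refine TensorProduct.ext' fun v a => ?_
  obtain ⟨b, rfl⟩ := Submodule.mkQ_surjective _ v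
  exact LinearMap.congr_fun (LinearMap.congr_fun h2 b) a

theorem forms_ext_left {W : Type*} [AddCommMonoid W] [Module k W]
    {F G : A ⊗[k] (Forms I ⊗[k] A) →ₗ[k] W}
    (h : ∀ (l m n : ℕ) (u : Fin l → Fin l → A) (y : Fin m → Fin m → A) (x : Fin n → Fin n → A),
      IsCorep (k := k) u → IsCorep (k := k) y → IsCorep (k := k) x → ∀ i j p q a b,
        F (u i j ⊗ₜ (form I (y p q) ⊗ₜ x a b)) = G (u i j ⊗ₜ (form I (y p q) ⊗ₜ x a b))) :
    F = G :=
  TensorProduct.ext <| hom_ext_corep fun l u hu i j => forms_ext fun m n y x hy hx p q a b =>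
    h l m n u y x hu hy hx i j p q a b

theorem forms_ext_right {W : Type*} [AddCommMonoid W] [Module k W]
    {F G : (Forms I ⊗[k] A) ⊗[k] A →ₗ[k] W}
    (h : ∀ (l m n : ℕ) (u : Fin l → Fin l → A) (y : Fin m → Fin m → A) (x : Fin n → Fin n → A),
      IsCorep (k := k) u → IsCorep (k := k) y → IsCorep (k := k) x → ∀ i j p q a b,
        F ((form I (y p q) ⊗ₜ x a b) ⊗ₜ u i j) = G ((form I (y p q) ⊗ₜ x a b) ⊗ₜ u i j)) :
    F = G :=
  TensorProduct.ext <| forms_ext fun m n y x hy hx p q a b => hom_ext_corep fun l u hu i j =>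
    h l m n u y x hu hy hx i j p q a b

variable (hI : IsAdIdeal I) (hε : ∀ a ∈ I, Coalgebra.counit (R := k) a = 0)

/-- The map `b ↦ a ↦ [ab] - ε(b) [a]`. -/
def preAct (I : Submodule k A) : A →ₗ[k] A →ₗ[k] Forms I :=
  LinearMap.mk₂ k (fun b a => form I (a * b) - Coalgebra.counit (R := k) b • form I a)
    (fun _ _ _ => by simp only [mul_add, map_add, add_smul]; abel)
    (fun _ _ _ => by simp [mul_smul, smul_sub])
    (fun _ _ _ => by simp only [add_mul, map_add, smul_add]; abel)
    (fun c m n => by simp [smul_sub, smul_comm c])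

/-- The action `a ▹ [b] = [ab] - ε(b) [a]`. -/
def act : A →ₗ[k] Forms I →ₗ[k] Forms I :=
  -- The formula is dictated by `ω(ab) = a ▹ ω(b) + ε(b) ω(a)`. It descends in `b` because `I` is a
  -- left ideal killed by `ε` and because it gives zero at `b = 1`.
  (Submodule.liftQ _ (preAct I) (sup_le
    (fun b hb => LinearMap.ext fun a => by
      simp [preAct, hε b hb, form_eq_zero (hI.mul_mem a b hb)])
    ((Submodule.span_singleton_le_iff_mem _ _).2 (LinearMap.ext fun a => by simp [preAct])))).flip

theorem act_form (a b : A) : act hI hε a (form I b) =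
    form I (a * b) - Coalgebra.counit (R := k) b • form I a := rfl

theorem act_one (v : Forms I) : act hI hε 1 v = v := by
  obtain ⟨b, rfl⟩ := Submodule.mkQ_surjective _ v
  change act hI hε 1 (form I b) = form I b
  rw [act_form, one_mul, form_one, smul_zero, sub_zero]

theorem act_mul (a a' : A) (v : Forms I) :
    act hI hε (a * a') v = act hI hε a (act hI hε a' v) := by
  obtain ⟨b, rfl⟩ := Submodule.mkQ_surjective _ v
  change act hI hε (a * a') (form I b) = act hI hε a (act hI hε a' (form I b))
  simp only [act_form, map_sub, map_smul, Bialgebra.counit_mul, mul_assoc, smul_sub, mul_smul,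
    smul_comm (Coalgebra.counit (R := k) b) (Coalgebra.counit (R := k) a')]
  abel

/-- The coaction `[b] ↦ b₍₁₎ S(b₍₃₎) ⊗ [b₍₂₎]`. -/
def coact : Forms I →ₗ[k] A ⊗[k] Forms I :=
  Submodule.liftQ _ ((form I).lTensor A ∘ₗ adL k A) (sup_le
    (fun b hb => eq_zero_of_forall_rTensor fun f => by
      have h : ∀ t : A ⊗[k] A, TensorProduct.lid k _ (f.rTensor _ ((form I).lTensor A t)) =
          form I (TensorProduct.lid k A (f.rTensor A t)) := fun t => by
        induction t with
        | zero => simp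
        | add a b ha hb => simp only [map_add, ha, hb]
        | tmul a b => simp
      rw [LinearMap.comp_apply, h, form_eq_zero (hI.adL_mem f b hb)])
    ((Submodule.span_singleton_le_iff_mem _ _).2 (by
      have h := (isCorep_one (k := k) (A := A)).adL_apply () ()
      rw [LinearMap.mem_ker, LinearMap.comp_apply, h]
      simp [form_one])))

/-- The bimodule of forms. -/
abbrev Bimod (I : Submodule k A) : Type v := Forms I ⊗[k] A

/-- `a (v ⊗ b) = a₍₁₎ ▹ v ⊗ a₍₂₎ b`. -/
def lmul : A ⊗[k] Bimod I →ₗ[k] Bimod I :=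
  TensorProduct.map (TensorProduct.lift (act hI hε)) (LinearMap.mul' k A) ∘ₗ
    (TensorProduct.tensorTensorTensorComm k A A (Forms I) A).toLinearMap ∘ₗ
    (Coalgebra.comul (R := k)).rTensor (Bimod I)

/-- `(v ⊗ a) b = v ⊗ ab`. -/
def rmul (I : Submodule k A) : Bimod I ⊗[k] A →ₗ[k] Bimod I :=
  (LinearMap.mul' k A).lTensor (Forms I) ∘ₗ (TensorProduct.assoc k (Forms I) A A).toLinearMap

/-- `v ⊗ b ↦ v⁽⁻¹⁾ b₍₁₎ ⊗ (v⁽⁰⁾ ⊗ b₍₂₎)`. -/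
def coactL : Bimod I →ₗ[k] A ⊗[k] Bimod I :=
  (LinearMap.mul' k A).rTensor (Bimod I) ∘ₗ
    (TensorProduct.tensorTensorTensorComm k A (Forms I) A A).toLinearMap ∘ₗ
    TensorProduct.map (coact hI) Coalgebra.comul

/-- `v ⊗ b ↦ (v ⊗ b₍₁₎) ⊗ b₍₂₎`. -/
def coactR (I : Submodule k A) : Bimod I →ₗ[k] Bimod I ⊗[k] A :=
  (TensorProduct.assoc k (Forms I) A A).symm.toLinearMap ∘ₗ
    (Coalgebra.comul (R := k)).lTensor (Forms I)

/-- `a ↦ [a₍₁₎] ⊗ a₍₂₎`. -/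
def diff (I : Submodule k A) : A →ₗ[k] Bimod I :=
  (form I).rTensor A ∘ₗ Coalgebra.comul

section Corep

variable {ι κ μ : Type*} [Fintype ι] [DecidableEq ι] [Fintype κ] [DecidableEq κ] [Fintype μ]
  [DecidableEq μ] {u : ι → ι → A} {y : κ → κ → A} {x : μ → μ → A}

theorem lmul_tmul (hu : IsCorep (k := k) u) (i j : ι) (v : Forms I) (c : A) :
    lmul hI hε (u i j ⊗ₜ (v ⊗ₜ c)) = ∑ l, act hI hε (u i l) v ⊗ₜ (u l j * c) := by
  simp [lmul, hu.comul, TensorProduct.sum_tmul]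

theorem rmul_tmul (v : Forms I) (a b : A) :
    rmul I ((v ⊗ₜ a) ⊗ₜ b) = v ⊗ₜ (a * b) := rfl

theorem coact_form (hy : IsCorep (k := k) y) (p q : κ) : coact hI (form I (y p q)) =
    ∑ l, ∑ m, (y p l * HopfAlgebra.antipode k (y m q)) ⊗ₜ form I (y l m) := by
  change (form I).lTensor A (adL k A (y p q)) = _
  simp [hy.adL_apply]

theorem coactL_tmul (hy : IsCorep (k := k) y) (hx : IsCorep (k := k) x) (p q : κ) (a b : μ) :
    coactL hI (form I (y p q) ⊗ₜ x a b) = ∑ l, ∑ m, ∑ c,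
      (y p l * HopfAlgebra.antipode k (y m q) * x a c) ⊗ₜ (form I (y l m) ⊗ₜ x c b) := by
  simp only [coactL, LinearMap.comp_apply, TensorProduct.map_tmul, coact_form hI hy, hx.comul,
    TensorProduct.sum_tmul, TensorProduct.tmul_sum, map_sum, LinearEquiv.coe_coe,
    TensorProduct.tensorTensorTensorComm_tmul, LinearMap.rTensor_tmul, LinearMap.mul'_apply]
  simp only [← Fintype.sum_prod_type']
  exact sum_reindex (fun z => ⟨z.2.1, z.2.2, z.1⟩) (fun z => ⟨z.2.2, z.1, z.2.1⟩)
    (fun _ => rfl) (fun _ => rfl) fun _ => rfl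

theorem coactR_tmul (hx : IsCorep (k := k) x) (v : Forms I) (a b : μ) :
    coactR I (v ⊗ₜ x a b) = ∑ c, (v ⊗ₜ x a c) ⊗ₜ x c b := by
  simp [coactR, hx.comul, TensorProduct.tmul_sum]

theorem diff_corep (hx : IsCorep (k := k) x) (a b : μ) :
    diff I (x a b) = ∑ c, form I (x a c) ⊗ₜ x c b := by
  simp [diff, hx.comul]

/-- The common core of `coactL_lmul`, applied there to `y` and to the `1 × 1` matrix `1`, one for
each term of the action. The antipode from the left coaction cancels against the second leg of `u`.
-/
theorem sum_coactL_mul (hu : IsCorep (k := k) u) (hy : IsCorep (k := k) y)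
    (hx : IsCorep (k := k) x) (i j : ι) (p q : κ) (a b : μ) :
    ∑ l, coactL hI (form I (u i l * y p q) ⊗ₜ (u l j * x a b)) =
      ∑ α, ∑ β, ∑ γ, ∑ δ, ∑ c, (u i α * (y p β * HopfAlgebra.antipode k (y δ q) * x a c)) ⊗ₜ
        (form I (u α γ * y β δ) ⊗ₜ (u γ j * x c b)) := by
  have h1 : ∀ l, coactL hI (form I (u i l * y p q) ⊗ₜ (u l j * x a b)) = _ := fun l =>
    coactL_tmul hI (hu.mul hy) (hu.mul hx) (i, p) (l, q) (l, a) (j, b)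
  simp only [h1, Fintype.sum_prod_type, HopfAlgebra.antipode_mul_antidistrib]
  calc _ = ∑ α, ∑ β, ∑ γ, ∑ δ, ∑ ε, ∑ c, (u i α * y p β * HopfAlgebra.antipode k (y δ q) *
          (∑ l, HopfAlgebra.antipode k (u γ l) * u l ε) * x a c) ⊗ₜ
        (form I (u α γ * y β δ) ⊗ₜ (u ε j * x c b)) := by
        simp only [Finset.mul_sum, Finset.sum_mul, TensorProduct.sum_tmul]
        simp only [← Fintype.sum_prod_type']
        exact sum_reindex
          (fun z => ⟨z.2.1, z.2.2.1, z.2.2.2.1, z.2.2.2.2.1, z.2.2.2.2.2.1, z.2.2.2.2.2.2, z.1⟩)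
          (fun z => ⟨z.2.2.2.2.2.2, z.1, z.2.1, z.2.2.1, z.2.2.2.1, z.2.2.2.2.1, z.2.2.2.2.2.1⟩)
          (fun _ => rfl) (fun _ => rfl) fun _ => by simp only [mul_assoc]
    _ = _ := by
        refine Finset.sum_congr rfl fun α _ => Finset.sum_congr rfl fun β _ =>
          Finset.sum_congr rfl fun γ _ => Finset.sum_congr rfl fun δ _ => ?_
        simp only [hu.sum_antipode_mul]
        rw [Finset.sum_eq_single γ (fun ε _ hh => by simp [hh.symm]) (by simp)]
        simp only [if_true, mul_one, mul_assoc]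

end Corep

end IsAdIdeal

end

/-! ### The Hopf bimodule axioms, the differential and the recovery of the ideal. -/

section

namespace IsAdIdeal

variable {k : Type u} {A : Type v} [Field k] [Ring A] [HopfAlgebra k A] {I : Submodule k A}
  (hI : IsAdIdeal I) (hε : ∀ a ∈ I, Coalgebra.counit (R := k) a = 0)

theorem one_lmul (η : Bimod I) : lmul hI hε (1 ⊗ₜ η) = η := by
  have h : lmul hI hε ∘ₗ TensorProduct.mk k A _ 1 = LinearMap.id :=
    forms_ext fun m n y x hy hx p q a b => by
      simpa [act_one] using lmul_tmul hI hε isCorep_one () () (form I (y p q)) (x a b)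
  exact LinearMap.congr_fun h η

theorem mul_lmul (a b : A) (η : Bimod I) :
    lmul hI hε ((a * b) ⊗ₜ η) = lmul hI hε (a ⊗ₜ lmul hI hε (b ⊗ₜ η)) := by
  have h : (LinearMap.mul k A).compr₂ ((TensorProduct.mk k A (Bimod I)).compr₂ (lmul hI hε)) =
      (LinearMap.llcomp k (Bimod I) (Bimod I) (Bimod I)).compl₁₂
        ((TensorProduct.mk k A (Bimod I)).compr₂ (lmul hI hε))
        ((TensorProduct.mk k A (Bimod I)).compr₂ (lmul hI hε)) := by
    refine bilin_ext_corep fun M N u z hu hz i j c d => ?_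
    refine TensorProduct.ext' fun v x => ?_
    have h1 := lmul_tmul hI hε (hu.mul hz) (i, c) (j, d) v x
    simp only [LinearMap.compr₂_apply, LinearMap.mul_apply', TensorProduct.mk_apply,
      LinearMap.compl₁₂_apply, LinearMap.llcomp_apply, h1, lmul_tmul hI hε hz, map_sum,
      lmul_tmul hI hε hu, Fintype.sum_prod_type, act_mul, mul_assoc]
    exact Finset.sum_comm
  exact LinearMap.congr_fun (LinearMap.congr_fun (LinearMap.congr_fun h a) b) η

theorem coactL_coassoc : (TensorProduct.assoc k A A (Bimod I)).toLinearMap ∘ₗ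
    (Coalgebra.comul (R := k) (A := A)).rTensor (Bimod I) ∘ₗ coactL hI =
      (coactL hI).lTensor A ∘ₗ coactL hI := by
  refine forms_ext fun m n y x hy hx p q a b => ?_
  simp only [LinearMap.comp_apply, coactL_tmul hI hy hx, map_sum, LinearMap.rTensor_tmul,
    LinearMap.lTensor_tmul, Bialgebra.comul_mul, hy.comul, hx.comul, hy.comul_antipode,
    Finset.sum_mul, Finset.mul_sum, Algebra.TensorProduct.tmul_mul_tmul,
    TensorProduct.sum_tmul, TensorProduct.tmul_sum, LinearEquiv.coe_coe, TensorProduct.assoc_tmul]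
  simp only [← Fintype.sum_prod_type']
  exact sum_reindex
    (fun z => ⟨z.2.2.2.2.2, z.2.2.2.2.1, z.2.2.2.1, z.1, z.2.1, z.2.2.1⟩)
    (fun z => ⟨z.2.2.2.1, z.2.2.2.2.1, z.2.2.2.2.2, z.2.2.1, z.2.1, z.1⟩)
    (fun _ => rfl) (fun _ => rfl) fun _ => rfl

theorem coactL_counit : (TensorProduct.lid k (Bimod I)).toLinearMap ∘ₗ
    (Coalgebra.counit (R := k) (A := A)).rTensor (Bimod I) ∘ₗ coactL hI = LinearMap.id := by
  refine forms_ext fun m n y x hy hx p q a b => ?_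
  simp [coactL_tmul hI hy hx, hy.counit, hx.counit, ite_smul]

theorem coactR_coassoc : (TensorProduct.assoc k (Bimod I) A A).toLinearMap ∘ₗ
    (coactR I).rTensor A ∘ₗ coactR I =
      (Coalgebra.comul (R := k) (A := A)).lTensor (Bimod I) ∘ₗ coactR I := by
  refine forms_ext fun m n y x hy hx p q a b => ?_
  simp only [LinearMap.comp_apply, coactR_tmul hx, map_sum, LinearMap.rTensor_tmul,
    LinearMap.lTensor_tmul, hx.comul, TensorProduct.sum_tmul, TensorProduct.tmul_sum,
    LinearEquiv.coe_coe, TensorProduct.assoc_tmul]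
  exact Finset.sum_comm

theorem coactR_counit : (TensorProduct.rid k (Bimod I)).toLinearMap ∘ₗ
    (Coalgebra.counit (R := k) (A := A)).lTensor (Bimod I) ∘ₗ coactR I = LinearMap.id := by
  refine forms_ext fun m n y x hy hx p q a b => ?_
  simp [coactR_tmul hx, hx.counit, ite_smul]

theorem coact_comm : (TensorProduct.assoc k A (Bimod I) A).toLinearMap ∘ₗ
    (coactL hI).rTensor A ∘ₗ coactR I = (coactR I).lTensor A ∘ₗ coactL hI := by
  refine forms_ext fun m n y x hy hx p q a b => ?_
  simp only [LinearMap.comp_apply, coactR_tmul hx, coactL_tmul hI hy hx, map_sum,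
    LinearMap.rTensor_tmul, LinearMap.lTensor_tmul, TensorProduct.sum_tmul,
    TensorProduct.tmul_sum, LinearEquiv.coe_coe, TensorProduct.assoc_tmul]
  simp only [← Fintype.sum_prod_type']
  exact sum_reindex (fun z => ⟨z.2.1, z.2.2.1, z.2.2.2, z.1⟩)
    (fun z => ⟨z.2.2.2, z.1, z.2.1, z.2.2.1⟩) (fun _ => rfl) (fun _ => rfl) fun _ => rfl

theorem coactL_lmul : coactL hI ∘ₗ lmul hI hε =
    TensorProduct.map (LinearMap.mul' k A) (lmul hI hε) ∘ₗ
      (TensorProduct.tensorTensorTensorComm k A A A (Bimod I)).toLinearMap ∘ₗ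
      TensorProduct.map Coalgebra.comul (coactL hI) := by
  refine forms_ext_left fun l m n u y x hu hy hx i j p q a b => ?_
  have h1 := sum_coactL_mul hI hu hy hx i j p q a b
  have h2 := sum_coactL_mul hI hu (isCorep_one (k := k) (A := A)) hx i j () () a b
  simp only [mul_one, one_mul, HopfAlgebra.antipode_one, Finset.univ_unique,
    Finset.sum_singleton] at h2
  simp only [LinearMap.comp_apply, lmul_tmul hI hε hu, act_form, TensorProduct.sub_tmul,
    ← TensorProduct.smul_tmul', map_sum, map_sub, map_smul, Finset.sum_sub_distrib,
    ← Finset.smul_sum, h1, h2, TensorProduct.map_tmul, hu.comul, coactL_tmul hI hy hx,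
    TensorProduct.sum_tmul, TensorProduct.tmul_sum, LinearEquiv.coe_coe,
    TensorProduct.tensorTensorTensorComm_tmul, LinearMap.mul'_apply, TensorProduct.tmul_sub,
    TensorProduct.tmul_smul]
  congr 1
  · simp only [← Fintype.sum_prod_type']
    exact sum_reindex (fun z => ⟨z.2.1, z.2.2.2.1, z.2.2.2.2, z.1, z.2.2.1⟩)
      (fun z => ⟨z.2.2.2.1, z.1, z.2.2.2.2, z.2.1, z.2.2.1⟩) (fun _ => rfl) (fun _ => rfl)
      fun _ => rfl
  -- The term coming from `ε(b) [a]` carries no inner `y`-indices; the identity `∑ y S(y) = ε(y)`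
  -- reintroduces them so that the two sides match.
  · have h3 : ∀ α c γ, (if p = q then (1 : k) else 0) • (u i α * x a c) ⊗ₜ
        (form I (u α γ) ⊗ₜ (u γ j * x c b)) =
        ∑ l, ∑ m, (if l = m then (1 : k) else 0) • (u i α *
          (y p l * HopfAlgebra.antipode k (y m q) * x a c)) ⊗ₜ[k]
            (form I (u α γ) ⊗ₜ[k] (u γ j * x c b)) := fun α c γ => by
      simp only [ite_smul, one_smul, zero_smul, Finset.sum_ite_eq, Finset.mem_univ, if_true,
        ← TensorProduct.sum_tmul, ← Finset.mul_sum, ← Finset.sum_mul, hy.sum_mul_antipode]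
      split_ifs <;> simp
    simp only [hy.counit, Finset.smul_sum, h3]
    simp only [← Fintype.sum_prod_type']
    exact sum_reindex (fun z => ⟨z.2.2.2.1, z.2.2.2.2, z.2.2.1, z.1, z.2.1⟩)
      (fun z => ⟨z.2.2.2.1, z.2.2.2.2, z.2.2.1, z.1, z.2.1⟩) (fun _ => rfl) (fun _ => rfl)
      fun _ => rfl

theorem coactL_rmul : coactL hI ∘ₗ rmul I = TensorProduct.map (LinearMap.mul' k A) (rmul I) ∘ₗ
    (TensorProduct.tensorTensorTensorComm k A (Bimod I) A A).toLinearMap ∘ₗ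
    TensorProduct.map (coactL hI) Coalgebra.comul := by
  refine forms_ext_right fun l m n u y x hu hy hx i j p q a b => ?_
  have h1 := coactL_tmul hI hy (hx.mul hu) p q (a, i) (b, j)
  simp only [LinearMap.comp_apply, rmul_tmul, h1, Fintype.sum_prod_type, TensorProduct.map_tmul,
    hu.comul, coactL_tmul hI hy hx, TensorProduct.sum_tmul, TensorProduct.tmul_sum, map_sum,
    LinearEquiv.coe_coe, TensorProduct.tensorTensorTensorComm_tmul, LinearMap.mul'_apply,
    mul_assoc]
  simp only [← Fintype.sum_prod_type']
  exact sum_reindex (fun z => ⟨z.2.2.2, z.1, z.2.1, z.2.2.1⟩)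
    (fun z => ⟨z.2.1, z.2.2.1, z.2.2.2, z.1⟩) (fun _ => rfl) (fun _ => rfl) fun _ => rfl

theorem coactR_lmul : coactR I ∘ₗ lmul hI hε =
    TensorProduct.map (lmul hI hε) (LinearMap.mul' k A) ∘ₗ
      (TensorProduct.tensorTensorTensorComm k A A (Bimod I) A).toLinearMap ∘ₗ
      TensorProduct.map Coalgebra.comul (coactR I) := by
  refine forms_ext_left fun l m n u y x hu hy hx i j p q a b => ?_
  have h1 : ∀ (v : Forms I) t, coactR I (v ⊗ₜ (u t j * x a b)) = _ := fun v t =>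
    coactR_tmul (hu.mul hx) v (t, a) (j, b)
  simp only [LinearMap.comp_apply, lmul_tmul hI hε hu, h1, Fintype.sum_prod_type,
    TensorProduct.map_tmul, hu.comul, coactR_tmul hx, TensorProduct.sum_tmul,
    TensorProduct.tmul_sum, map_sum, LinearEquiv.coe_coe,
    TensorProduct.tensorTensorTensorComm_tmul, LinearMap.mul'_apply]
  simp only [← Fintype.sum_prod_type']
  exact sum_reindex (fun z => ⟨z.2.2, z.2.1, z.1⟩)
    (fun z => ⟨z.2.2, z.2.1, z.1⟩) (fun _ => rfl) (fun _ => rfl) fun _ => rfl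

theorem coactR_rmul : coactR I ∘ₗ rmul I = TensorProduct.map (rmul I) (LinearMap.mul' k A) ∘ₗ
    (TensorProduct.tensorTensorTensorComm k (Bimod I) A A A).toLinearMap ∘ₗ
    TensorProduct.map (coactR I) Coalgebra.comul := by
  refine forms_ext_right fun l m n u y x hu hy hx i j p q a b => ?_
  have h1 := coactR_tmul (hx.mul hu) (form I (y p q)) (a, i) (b, j)
  simp only [LinearMap.comp_apply, rmul_tmul, h1, Fintype.sum_prod_type, TensorProduct.map_tmul,
    hu.comul, coactR_tmul hx, TensorProduct.sum_tmul, TensorProduct.tmul_sum, map_sum,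
    LinearEquiv.coe_coe, TensorProduct.tensorTensorTensorComm_tmul, LinearMap.mul'_apply]
  exact Finset.sum_comm

/-- The Hopf bimodule of forms. -/
def hopfBimodule : HopfBimodule k A (Bimod I) where
  lmul := lmul hI hε
  rmul := rmul I
  one_lmul := one_lmul hI hε
  mul_lmul := mul_lmul hI hε
  rmul_one η := by
    induction η using TensorProduct.induction_on with
    | zero => simp
    | add a b ha hb => rw [TensorProduct.add_tmul, map_add, ha, hb]
    | tmul v a => rw [rmul_tmul, mul_one]
  rmul_mul η a b := by
    induction η using TensorProduct.induction_on with
    | zero => simp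
    | add x y hx hy => simp only [TensorProduct.add_tmul, map_add, hx, hy]
    | tmul v c => simp only [rmul_tmul, mul_assoc]
  lmul_rmul a η b := by
    have h : rmul I ∘ₗ (TensorProduct.mk k (Bimod I) A).flip b ∘ₗ lmul hI hε =
        lmul hI hε ∘ₗ (rmul I ∘ₗ (TensorProduct.mk k (Bimod I) A).flip b).lTensor A := by
      refine forms_ext_left fun l m n u y x hu hy hx i j p q c d => ?_
      simp only [LinearMap.comp_apply, lmul_tmul hI hε hu, map_sum, LinearMap.flip_apply,
        TensorProduct.mk_apply, LinearMap.lTensor_tmul, rmul_tmul, mul_assoc]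
    exact LinearMap.congr_fun h (a ⊗ₜ η)
  coactL := coactL hI
  coactR := coactR I
  coactL_coassoc := coactL_coassoc hI
  coactL_counit := coactL_counit hI
  coactR_coassoc := coactR_coassoc
  coactR_counit := coactR_counit
  coact_comm := coact_comm hI
  coactL_lmul := coactL_lmul hI hε
  coactL_rmul := coactL_rmul hI
  coactR_lmul := coactR_lmul hI hε
  coactR_rmul := coactR_rmul

/-- In `a · db` the correction in the action contributes `-[a₍₁₎] ⊗ a₍₂₎ b`, which is `-(da) b`; the
other term is `d(ab)`. -/
theorem leibniz (a b : A) : diff I (a * b) =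
    rmul I (diff I a ⊗ₜ b) + lmul hI hε (a ⊗ₜ diff I b) := by
  have h : (LinearMap.mul k A).compr₂ (diff I) =
      (TensorProduct.mk k (Bimod I) A).compr₂ (rmul I) ∘ₗ diff I +
        ((TensorProduct.mk k A (Bimod I)).compr₂ (lmul hI hε)).compl₂ (diff I) := by
    refine bilin_ext_corep fun M N u z hu hz i j c d => ?_
    have h1 := diff_corep (I := I) (hu.mul hz) (i, c) (j, d)
    simp only [LinearMap.compr₂_apply, LinearMap.mul_apply', h1, LinearMap.add_apply,
      LinearMap.comp_apply, LinearMap.compl₂_apply, TensorProduct.mk_apply, diff_corep hu,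
      diff_corep hz, map_sum, LinearMap.sum_apply,
      lmul_tmul hI hε hu, act_form, hz.counit, TensorProduct.sub_tmul, Finset.sum_sub_distrib,
      Fintype.sum_prod_type, ite_smul, one_smul, zero_smul, ite_tmul',
      Finset.sum_ite_irrel, Finset.sum_const_zero, Finset.sum_ite_eq, Finset.mem_univ, if_true]
    exact Finset.sum_comm.trans (add_sub_cancel _ _).symm
  exact LinearMap.congr_fun (LinearMap.congr_fun h a) b

theorem coactL_diff : coactL hI ∘ₗ diff I = (diff I).lTensor A ∘ₗ Coalgebra.comul := by
  refine hom_ext_corep fun n x hx a b => ?_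
  simp only [LinearMap.comp_apply, diff_corep hx, map_sum, coactL_tmul hI hx hx, hx.comul,
    LinearMap.lTensor_tmul, TensorProduct.tmul_sum]
  calc _ = ∑ l, ∑ m, ∑ c, (x a l * ∑ t, HopfAlgebra.antipode k (x m t) * x t c) ⊗ₜ
          (form I (x l m) ⊗ₜ x c b) := by
        simp only [Finset.mul_sum, TensorProduct.sum_tmul, ← mul_assoc]
        simp only [← Fintype.sum_prod_type']
        exact sum_reindex (fun z => ⟨z.2.1, z.2.2.1, z.2.2.2, z.1⟩)
          (fun z => ⟨z.2.2.2, z.1, z.2.1, z.2.2.1⟩) (fun _ => rfl) (fun _ => rfl) fun _ => rfl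
    _ = _ := by
        refine Finset.sum_congr rfl fun l _ => Finset.sum_congr rfl fun m _ => ?_
        simp only [hx.sum_antipode_mul]
        rw [Finset.sum_eq_single m (fun c _ hc => by simp [hc.symm]) (by simp)]
        simp

theorem coactR_diff : coactR I ∘ₗ diff I = (diff I).rTensor A ∘ₗ Coalgebra.comul := by
  refine hom_ext_corep fun n x hx a b => ?_
  simp only [LinearMap.comp_apply, diff_corep hx, map_sum, coactR_tmul hx, hx.comul,
    LinearMap.rTensor_tmul, TensorProduct.sum_tmul]
  exact Finset.sum_comm

theorem rmul_diff_antipode {κ : Type*} [Fintype κ] [DecidableEq κ] {x : κ → κ → A}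
    (hx : IsCorep (k := k) x) (p q : κ) : ∑ l, rmul I (diff I (x p l) ⊗ₜ
      HopfAlgebra.antipode k (x l q)) = form I (x p q) ⊗ₜ 1 := by
  simp only [diff_corep hx, TensorProduct.sum_tmul, map_sum, rmul_tmul]
  rw [Finset.sum_comm]
  simp only [← TensorProduct.tmul_sum, hx.sum_mul_antipode]
  rw [Finset.sum_eq_single q (fun m _ hm => by simp [hm]) (by simp)]
  simp

/-- The form `[y] ⊗ x` equals `d(y₍₁₎) S(y₍₂₎) x`, and the Leibniz rule rewrites each `(da) b` as
`d(ab) - a db`. -/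
theorem lmul_diff_surjective : Function.Surjective (lmul hI hε ∘ₗ (diff I).lTensor A) := by
  have h : (LinearMap.range (lmul hI hε ∘ₗ (diff I).lTensor A)).mkQ = 0 := ?_
  · rw [← LinearMap.range_eq_top, ← Submodule.ker_mkQ (LinearMap.range _), h, LinearMap.ker_zero]
  refine forms_ext fun m n y x hy hx p q a b => (Submodule.Quotient.mk_eq_zero _).2 ⟨∑ l, (1 ⊗ₜ (y p l * (HopfAlgebra.antipode k (y l q) *
    x a b)) - y p l ⊗ₜ (HopfAlgebra.antipode k (y l q) * x a b)), ?_⟩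
  have h1 := rmul_diff_antipode (I := I) hy p q
  have h2 : ∀ η : Bimod I, ∀ a b, rmul I (η ⊗ₜ (a * b)) = rmul I (rmul I (η ⊗ₜ a) ⊗ₜ b) :=
    (hopfBimodule hI hε).rmul_mul
  simp only [map_sum, map_sub, LinearMap.comp_apply, LinearMap.lTensor_tmul, one_lmul,
    leibniz hI hε, add_sub_cancel_right, h2]
  rw [← map_sum, ← TensorProduct.sum_tmul, h1, rmul_tmul, one_mul]

/-- The bicovariant calculus defined by `I`. -/
def calculus : BicovariantFODC.{u, v, v} k A where
  carrier := Bimod I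
  hopf := hopfBimodule hI hε
  d := diff I
  leibniz := leibniz hI hε
  coactL_d := coactL_diff hI
  coactR_d := coactR_diff
  surj := lmul_diff_surjective hI hε

theorem omegaR_calculus (a : A) : (calculus hI hε).omegaR a = form I a ⊗ₜ 1 := by
  have h : (calculus hI hε).omegaR = (TensorProduct.mk k (Forms I) A).flip 1 ∘ₗ form I := by
    refine hom_ext_corep fun n x hx p q => ?_
    rw [BicovariantFODC.omegaR_corep _ hx]
    exact rmul_diff_antipode hx p q
  exact LinearMap.congr_fun h a

/-- Since `ω(a) = [a] ⊗ 1`, the kernel of `ω` is `I + k 1`; as `ε` vanishes on `I` and not at `1`,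
the condition `ε(a) = 0` leaves `I`. -/
theorem ideal_calculus : (calculus hI hε).ideal = I := by
  ext a
  constructor
  · rintro ⟨h, h'⟩
    have h1 : form I a ⊗ₜ[k] (1 : A) = 0 := (omegaR_calculus hI hε a).symm.trans h
    have h2 := congrArg (TensorProduct.rid k (Forms I))
      (congrArg ((Coalgebra.counit (R := k) (A := A)).lTensor (Forms I)) h1)
    have h3 : form I a = 0 := by simpa using h2
    obtain ⟨b, hb, c, hc, rfl⟩ := Submodule.mem_sup.1 ((Submodule.Quotient.mk_eq_zero _).1 h3)
    obtain ⟨t, rfl⟩ := Submodule.mem_span_singleton.1 hc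
    have h4 : t = 0 := by simpa [hε b hb] using h'
    rwa [h4, zero_smul, add_zero]
  · intro h
    exact ⟨(omegaR_calculus hI hε a).trans (by rw [form_eq_zero h, TensorProduct.zero_tmul]; rfl),
      hε a h⟩

end IsAdIdeal

end

/-! ### Assembly of the three parts. -/

section

theorem exists_eval_eq_counit {k : Type u} {A : Type v} [Field k] [Ring A] [HopfAlgebra k A]
    {r s : A →ₗ[k] A →ₗ[k] k} (hr : IsCoquasitriangular r) (hs : IsCoquasitriangular s)
    {C : Submodule k A} [FiniteDimensional k C] (hC : IsSubcoalgebra C)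
    (hd : Disjoint (Submodule.span k {(1 : A)}) C)
    (hq : Set.InjOn (quantumKilling r s) (Submodule.span k {(1 : A)} ⊔ C : Submodule k A)) :
    ∃ a₀ : A, Coalgebra.counit (R := k) a₀ = 0 ∧
      ∀ c ∈ C, quantumKilling r s c a₀ = Coalgebra.counit (R := k) c := by
  obtain ⟨K, hK⟩ := KillingSection.exists_of_injOn (isSubcoalgebra_span_one.sup hC) hq
  have hj : ∀ (c : A) (hc : c ∈ (Submodule.span k {(1 : A)} ⊔ C : Submodule k A)),
      K.j ⟨quantumKilling r s c, Submodule.mem_map_of_mem hc⟩ = c := fun c hc =>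
    hq (hK.le (LinearMap.mem_range_self _ _)) hc (K.q_j _)
  have hone : (1 : A) ∈ (Submodule.span k {(1 : A)} ⊔ C : Submodule k A) :=
    Submodule.mem_sup_left (Submodule.mem_span_singleton_self 1)
  have h1 : (1 : A) ∉ C := fun h => by
    have h2 : (1 : A) = 0 :=
      Submodule.disjoint_def.1 hd 1 (Submodule.mem_span_singleton_self 1) h
    simpa using congrArg (Coalgebra.counit (R := k)) h2
  obtain ⟨f, hf1, hfC⟩ := Submodule.exists_le_ker_of_notMem h1
  -- As `f` vanishes on `C` but not at `1`, the functional `ε - f / f(1)` is `ε` on `C` and zero at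
  -- `1`; by finite dimension it is evaluation at some `a₀`.
  obtain ⟨a₀, ha₀⟩ := exists_eval_eq
    ((Coalgebra.counit (R := k) - (f 1)⁻¹ • f) ∘ₗ K.j)
  refine ⟨a₀, ?_, fun c hc => ?_⟩
  · have h2 := ha₀ ⟨_, Submodule.mem_map_of_mem hone⟩
    rw [LinearMap.comp_apply, hj 1 hone] at h2
    rw [← quantumKilling_one_left hr hs]
    simpa [hf1] using h2
  · have hc' : c ∈ (Submodule.span k {(1 : A)} ⊔ C : Submodule k A) := Submodule.mem_sup_right hc
    have h2 := ha₀ ⟨_, Submodule.mem_map_of_mem hc'⟩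
    rw [LinearMap.comp_apply, hj c hc'] at h2
    simpa [LinearMap.mem_ker.1 (hfC hc)] using h2

theorem exists_calculus_killingIdeal {k : Type u} {A : Type v} [Field k] [Ring A]
    [HopfAlgebra k A] {r s : A →ₗ[k] A →ₗ[k] k} (hr : IsCoquasitriangular r)
    (hs : IsCoquasitriangular s) {C : Submodule k A} (hC : IsSubcoalgebra C) (h1 : (1 : A) ∈ C) :
    ∃ Γ : BicovariantFODC.{u, v, v} k A, Γ.ideal = killingIdeal (quantumKilling r s) C ∧
      C.map (quantumKilling r s) ≤ Γ.extTangent ∧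
      (FiniteDimensional k (C.map (quantumKilling r s)) →
        Γ.extTangent = C.map (quantumKilling r s)) := by
  have hI := isAdIdeal_killingIdeal hr hs hC
  have hε : ∀ a ∈ killingIdeal (quantumKilling r s) C, Coalgebra.counit (R := k) a = 0 :=
    fun a ha => counit_eq_zero_of_mem_killingIdeal hr hs h1 ha
  have h := hI.ideal_calculus hε
  refine ⟨hI.calculus hε, h, ?_, fun _ => ?_⟩
  · rw [BicovariantFODC.extTangent, h]
    exact Submodule.le_dualCoannihilator_dualAnnihilator _
  · rw [BicovariantFODC.extTangent, h]
    exact Subspace.dualCoannihilator_dualAnnihilator_eq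

theorem exists_enveloping_iso_of_injOn {k : Type u} {A : Type v} [Field k] [Ring A]
    [HopfAlgebra k A] {r s : A →ₗ[k] A →ₗ[k] k} (hr : IsCoquasitriangular r)
    (hs : IsCoquasitriangular s) {C : Submodule k A} (hC : IsSubcoalgebra C)
    (hd : Disjoint (Submodule.span k {(1 : A)}) C)
    (hq : Set.InjOn (quantumKilling r s) (Submodule.span k {(1 : A)} ⊔ C : Submodule k A))
    {T L : Submodule k (Module.Dual k A)}
    (hT : T = (Submodule.span k {(1 : A)} ⊔ C).map (quantumKilling r s))
    (hL : L = C.map (quantumKilling r s)) :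
    ∃ (𝒯 : TangentBraidedLie r T) (ℒ : TangentBraidedLie r L)
      (𝔤 : TangentQuantumLie r (augPart T))
      (SB : BraidedBialgebra k A r ℒ.BraidedEnvelope)
      (SU : BraidedBialgebra k A r 𝔤.UniversalEnvelope)
      (φ : 𝔤.UniversalEnvelope ≃ₐ[k] ℒ.BraidedEnvelope),
      𝒯.IsSubalgebra (L.submoduleOf T) ∧ ℒ.Extends SB ∧ 𝔤.Extends SU ∧
      IsBialgebraIso SU SB φ ∧
      ∀ (X : L) (x : augPart T),
        (x : Module.Dual k A) = X - (X : Module.Dual k A) 1 • dualOne k A →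
        φ (𝔤.gen x) = ℒ.gen X - algebraMap k _ ((X : Module.Dual k A) 1) := by
  have hle : C ≤ Submodule.span k {(1 : A)} ⊔ C := le_sup_right
  have hqC : Set.InjOn (quantumKilling r s) C := fun x hx y hy => @hq x (hle hx) y (hle hy)
  obtain ⟨K, hK⟩ : ∃ K : KillingSection (quantumKilling r s) T,
      LinearMap.range K.j = Submodule.span k {(1 : A)} ⊔ C := by
    rw [hT]
    exact KillingSection.exists_of_injOn (isSubcoalgebra_span_one.sup hC) hq
  obtain ⟨K', hK'⟩ : ∃ K' : KillingSection (quantumKilling r s) L, LinearMap.range K'.j = C := by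
    rw [hL]
    exact KillingSection.exists_of_injOn hC hqC
  have hLT : L ≤ T := by
    rw [hT, hL]
    exact Submodule.map_mono hle
  have hone : (1 : A) ∈ LinearMap.range K.j :=
    hK.ge (Submodule.mem_sup_left (Submodule.mem_span_singleton_self 1))
  have hTL : T = Submodule.span k {dualOne k A} ⊔ L := by
    rw [hT, hL, map_span_one_sup hr hs C]
  have hd' : Disjoint (Submodule.span k {dualOne k A}) L := by
    rw [hL]
    exact disjoint_span_dualOne hr hs hd hq
  have hi := KillingSection.j_inclusion hq hK (hK'.le.trans hle) hLT
  exact exists_enveloping_iso hr hs hLT hi hone hTL hd'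

end

end QLie

end

theorem mainTheorem6 {k : Type u} {A : Type v} [Field k] [Ring A] [HopfAlgebra k A]
    (r s : A →ₗ[k] A →ₗ[k] k) (hr : QLie.IsCoquasitriangular r)
    (hs : QLie.IsCoquasitriangular s) :
    -- (i)
    (∀ C₁ : Submodule k A, QLie.IsSubcoalgebra C₁ → (1 : A) ∈ C₁ →
      QLie.IsTangentSubspace (C₁.map (QLie.quantumKilling r s)) ∧
      LinearMap.ker (QLie.quantumKilling r s).flip ≤
        QLie.killingIdeal (QLie.quantumKilling r s) C₁ ∧
      ∃ Γ : QLie.BicovariantFODC.{u, v, v} k A,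
        Γ.ideal = QLie.killingIdeal (QLie.quantumKilling r s) C₁ ∧
        C₁.map (QLie.quantumKilling r s) ≤ Γ.extTangent ∧
        (FiniteDimensional k (C₁.map (QLie.quantumKilling r s)) →
          Γ.extTangent = C₁.map (QLie.quantumKilling r s))) ∧
    -- (ii)
    (∀ Γ : QLie.BicovariantFODC.{u, v, w} k A,
      Function.Injective (QLie.quantumKilling r s) →
      QLie.IsSubcoalgebra (QLie.killingPerp (QLie.quantumKilling r s) Γ.ideal) ∧
      (1 : A) ∈ QLie.killingPerp (QLie.quantumKilling r s) Γ.ideal ∧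
      (Γ.extTangent ≤ LinearMap.range (QLie.quantumKilling r s) →
        Γ.extTangent =
          (QLie.killingPerp (QLie.quantumKilling r s) Γ.ideal).map (QLie.quantumKilling r s))) ∧
    -- (iii)
    (∀ C₁ C : Submodule k A, QLie.IsSubcoalgebra C →
      C₁ = Submodule.span k {(1 : A)} ⊔ C → Disjoint (Submodule.span k {(1 : A)}) C →
      Set.InjOn (QLie.quantumKilling r s) C₁ →
      ∀ T L : Submodule k (Module.Dual k A),
      T = C₁.map (QLie.quantumKilling r s) → L = C.map (QLie.quantumKilling r s) →
      -- the decomposition of the extended tangent space, and the tangent space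
      T = Submodule.span k {QLie.dualOne k A} ⊔ L ∧
      Disjoint (Submodule.span k {QLie.dualOne k A}) L ∧
      (∀ x : Module.Dual k A,
        x ∈ QLie.augPart T ↔ ∃ X ∈ L, x = X - X 1 • QLie.dualOne k A) ∧
      -- the braided Lie algebra, its subalgebra, and the two enveloping bialgebras
      (∃ (𝒯 : QLie.TangentBraidedLie r T) (ℒ : QLie.TangentBraidedLie r L)
        (𝔤 : QLie.TangentQuantumLie r (QLie.augPart T))
        (SB : QLie.BraidedBialgebra k A r ℒ.BraidedEnvelope)
        (SU : QLie.BraidedBialgebra k A r 𝔤.UniversalEnvelope)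
        (φ : 𝔤.UniversalEnvelope ≃ₐ[k] ℒ.BraidedEnvelope),
        𝒯.IsSubalgebra (L.submoduleOf T) ∧ ℒ.Extends SB ∧ 𝔤.Extends SU ∧
        QLie.IsBialgebraIso SU SB φ ∧
        ∀ (X : L) (x : QLie.augPart T),
          (x : Module.Dual k A) = X - (X : Module.Dual k A) 1 • QLie.dualOne k A →
          φ (𝔤.gen x) = ℒ.gen X - algebraMap k _ ((X : Module.Dual k A) 1)) ∧
      -- the calculus
      (FiniteDimensional k C → ∀ Γ : QLie.BicovariantFODC.{u, v, w} k A,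
        Γ.ideal = QLie.killingIdeal (QLie.quantumKilling r s) C₁ →
        Γ.extTangent = T ∧ Γ.tangent = QLie.augPart T ∧ Γ.IsInner)) := by
  refine ⟨fun C₁ hC h1 => ⟨QLie.isTangentSubspace_map hr hs hC h1,
      fun a ha => QLie.mem_killingIdeal.2 fun c _ => LinearMap.congr_fun (LinearMap.mem_ker.1 ha) c,
      QLie.exists_calculus_killingIdeal hr hs hC h1⟩,
    fun Γ hq => ⟨QLie.isSubcoalgebra_killingPerp hr hs Γ.isAdIdeal hq,
      QLie.mem_killingPerp.2 fun a ha => (QLie.quantumKilling_one_left hr hs a).trans ha.2,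
      -- The orthogonal is the preimage under `q` of the extended tangent space, so its image is the
      -- intersection of that space with the range of `q`.
      fun h => ((Submodule.map_comap_eq _ _).trans (inf_eq_right.2 h)).symm⟩,
    fun C₁ C hC hC₁ hd hq T L hT hL => ?_⟩
  subst hC₁
  have hTL : T = Submodule.span k {QLie.dualOne k A} ⊔ L := by
    rw [hT, hL, QLie.map_span_one_sup hr hs C]
  refine ⟨hTL, hL ▸ QLie.disjoint_span_dualOne hr hs hd hq, fun x => ?_,
    QLie.exists_enveloping_iso_of_injOn hr hs hC hd hq hT hL, fun _ Γ hΓ => ?_⟩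
  · rw [hTL]
    exact QLie.mem_augPart_sup_iff _ x
  · have hΓT : Γ.extTangent = T := by
      rw [QLie.BicovariantFODC.extTangent, hΓ, hT]
      -- `q(C₁)` is finite-dimensional because `C` is, so it equals its double annihilator.
      exact Subspace.dualCoannihilator_dualAnnihilator_eq
    obtain ⟨a₀, h0, ha₀⟩ := QLie.exists_eval_eq_counit hr hs hC hd hq
    exact ⟨hΓT, congrArg QLie.augPart hΓT, Γ.isInner_of_mem_ideal h0 fun a =>
      hΓ.ge (QLie.mul_sub_mem_killingIdeal hr hs hC h0 ha₀ a)⟩
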